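/- **Setting.** Let $n\ge 3$, and write $\mathbf C^{n+1}=\mathbf C^n\times\mathbf C\ni(z,w)$, $w=u+iv$, $r=|z|$, $\rho=|(z,w)|$. Let $C=\{t\sigma: t>0,\ \sigma\in\Sigma\}\subset\mathbf C^n$ be a special Lagrangian cone (without its vertex), whose link $\Sigma\subset S^{2n-1}$ is a compact embedded smooth $(n-1)$-dimensional submanifold, not necessarily connected, with components $\Sigma_m$. Fix a dilation-equivariant Lagrangian neighbourhood of $C$: a symplectic embedding $\Phi_C$ into $\mathbf C^n$ of an open dilation-invariant neighbourhood of the zero section of $T^*C$, which is the identity on the zero section and satisfies $\Phi_C\circ t=t\,\Phi_C$ for all $t>0$, where $t$ acts on $T^*C$ by covering $x\mapsto tx$ so that the canonical symplectic form is multiplied by $t^2$. On $C\times\mathbf R$ (with $\mathbf R=\{v=0\}\subset\mathbf C$) use the product neighbourhood $\Phi_C\times\big((u,\eta)\mapsto u+i\eta\big)$. For a $1$-form $\alpha$, $\operatorname{graph}(\alpha)$ is the image of $\alpha$ under this map. Let $L\subset\mathbf C^n$ be a closed connected smooth special Lagrangian submanifold with $0\notin L$ which is exact, that is, $d\beta=\lambda|_L$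 for some smooth $\beta:L\to\mathbf R$, where $\lambda=\tfrac12\sum_j(x_j\,dy_j-y_j\,dx_j)$. Let $L$ be asymptotic to $C$ with rate $\mu<0$: for some $\Lambda_0>0$ there is a smooth function $g$ on $C\cap\{r>\Lambda_0\}$ with $|\nabla^kg|\le C_kr^{\mu-k}$ for all $k\ge0$, such that $\operatorname{graph}(dg)$ is defined and contained in $L$, and for every $R\ge\Lambda_0$ the part of $L$ outside the graph of $dg$ over $C\cap\{r>R\}$ is compact. Then $\beta$ has a limit $c_{\infty,m}$ along the end of $L$ asymptotic to $\operatorname{Cone}(\Sigma_m)$. Let $a>1$ be an integer, $1<b<a$ a real number, and $\chi:\mathbf R\to\mathbf R$ a smooth function with $\chi(t)=1$ for $t\le1$ and $\chi(t)=0$ for $t\ge2$. On $\operatorname{Cone}(\Sigma_m)\times\mathbf R$ put $$\varphi_a=-\Big(u^{2a}+\sum_{j=1}^a a_ju^{2a-2j}r^{2j}\Big)c_{\infty,m},\qquad G=-u^{2a}c_{\infty,m}+u^{2a}g(|u|^{-a}x)\quad(u\ne0),$$ where the $a_j$ are the coefficients for which $u^{2a}+\sum_j a_ju^{2a-2j}r^{2j}$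 is harmonic on $C\times\mathbf R$, and put $$I=\chi\big(r/|u|^b\big)G+\big(1-\chi(r/|u|^b)\big)\varphi_a\quad(u\neq0),\qquad I=\varphi_a\quad(u=0).$$ For $A_1>0$ let $X$ (the approximate solution) be the union of * the graph of $dI$ over $(C\times\mathbf R)\cap\{r\ge|u|^b,\ \rho<A_1^{-1}\}$ (so the graph of $d\varphi_a$ where $r\ge 2|u|^b$), and * the points $\big(|u|^ay,\ u-2ia\,u^{2a-1}\beta(y)\big)$ with $0<|u|<A_1^{-1}$ and $y\in L$ not on the graph of $dg$ over $C\cap\{r>\max(\Lambda_0,|u|^{b-a})\}$. For $\Lambda,A>0$ and $0<u_0<1$ put $S_0=u_0^aL\times\mathbf R$ and $$\mathcal U=\{r>\Lambda|u|^a\},\qquad \mathcal V_{u_0}=\{r<2\Lambda|u|^a,\ ||u|-u_0|\le u_0^a\},\qquad \rho^{-1}(0,A^{-1})=\{0<\rho<A^{-1}\}.$$ **Proposition.** Let $K\ge 0$ be an integer. For all sufficiently large $A_1$ the graph of $dI$ in the definition of $X$ is well defined, and for every $\epsilon>0$ there is $A_0\geq A_1$ such that for every $A\ge A_0$ there exists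 $\Lambda>0$ for which the following hold. 1. In $(C\times\mathbf R)\cap\mathcal U\cap\rho^{-1}(0,A^{-1})$ the nearest-point projection $\mathcal G:C\times\mathbf R\to X$ is well defined and smooth, and for all $k\le K$ $$|\nabla^k(\mathcal G^*g_X-g_{C\times\mathbf R})|\le\epsilon\, r^{-k}.$$ 2. For every $0<u_0<1$, in $S_0\cap\mathcal V_{u_0}\cap\rho^{-1}(0,A^{-1})$ the nearest-point projection $\mathcal F:S_0\to X$ is well defined and smooth, and for all $k\le K$ $$|\nabla^k(\mathcal F^*g_X-g_{S_0})|\le\epsilon\, r^{-k}.$$ Here $g_N$ denotes the metric induced on $N$ from $\mathbf C^{n+1}$, and $\nabla$ and $|\cdot|$ are taken with respect to $g_{C\times\mathbf R}$ in (1) and $g_{S_0}$ in (2). Moreover, for every $A\ge A_0$, $X\cap\rho^{-1}(0,A^{-1})$ has $r^{-1}$-bounded $C^K$-geometry: there are $\delta,B>0$ such that for all $R,S>0$ and every point $q\in X\cap\rho^{-1}(0,A^{-1})$ with $r(q)\in(R,2R)$ and $\rho(q)\in(S,2S)$ there is a smooth chart of $X$ centred at $q$, defined on the ball of radius $\delta$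 in $\mathbf R^{n+1}$, in which $R^{-2}g_X$ lies between $B^{-1}$ and $B$ times the Euclidean metric and the derivatives of order $\le K$ of its components are bounded by $B$. -/

import Mathlib

open Set Filter Topology Metric
open scoped ContDiff RealInnerProductSpace

noncomputable section

/-! ## Submanifolds of Euclidean spaces, their metrics and covariant derivatives -/

namespace SLGeom

section Submanifold

variable {E : Type*} [NormedAddCommGroup E] [InnerProductSpace ℝ E] [FiniteDimensional ℝ E]

/-- `N` is a smooth embedded `m`-dimensional submanifold (without boundary) of `E`: near each of its
points it is the image of a smooth parametrization `ψ` that has a smooth left inverse `π` defined on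
an open subset of `E`. -/
def IsSmoothSubmanifold (m : ℕ) (N : Set E) : Prop :=
  ∀ x ∈ N, ∃ (V : Set (EuclideanSpace ℝ (Fin m))) (W : Set E)
    (ψ : EuclideanSpace ℝ (Fin m) → E) (π : E → EuclideanSpace ℝ (Fin m)),
    IsOpen V ∧ IsOpen W ∧ x ∈ W ∧ ContDiffOn ℝ ∞ ψ V ∧ ContDiffOn ℝ ∞ π W ∧
      ψ '' V = N ∩ W ∧ ∀ q ∈ V, π (ψ q) = q

/-- The tangent space `T_p N` of a submanifold `N ⊆ E`, as a linear subspace of `E`. -/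
def tangentSpaceOf (N : Set E) (p : E) : Submodule ℝ E :=
  Submodule.span ℝ (tangentConeAt ℝ N p)

/-- The orthogonal projection of `E` onto `T_p N`. -/
def tangentProj (N : Set E) (p : E) : E →L[ℝ] E :=
  (tangentSpaceOf N p).starProjection

/-- The gradient at `p` of a function on `N` for the induced metric, i.e. the vector `(df)^♯ ∈ T_p N`
dual to `df`. -/
def tangentialGrad (N : Set E) (f : E → ℝ) (p : E) : E :=
  tangentProj N p ((InnerProductSpace.toDual ℝ E).symm (fderivWithin ℝ f N p))

/-- The Levi-Civita covariant derivative of a covariant tensor field on `N` (metric induced from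
`E`). A tensor on `T_p N` is represented by the multilinear form on `E` obtained by first projecting
all arguments to `T_p N`. For tangent vectors,
`(∇T)_p (v₀; v₁, …, v_j) = (D_{v₀} T)_p (v₁, …, v_j)`, because the Levi-Civita connection of a
submanifold is the tangential part of the flat derivative. -/
def covDeriv (N : Set E) {j : ℕ} (T : E → E [×j]→L[ℝ] ℝ) : E → E [×(j + 1)]→L[ℝ] ℝ :=
  fun p => (fderivWithin ℝ T N p).uncurryLeft.compContinuousLinearMap fun _ => tangentProj N p

/-- The `k`-th iterated covariant derivative `∇^k T` on `N`. -/
def iterCovDeriv (N : Set E) {j : ℕ} (T : E → E [×j]→L[ℝ] ℝ) :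
    (k : ℕ) → E → E [×(j + k)]→L[ℝ] ℝ
  | 0 => T
  | k + 1 => covDeriv N (iterCovDeriv N T k)

/-- A function, seen as a covariant tensor field of rank `0`. -/
def scalarTensor (f : E → ℝ) : E → E [×0]→L[ℝ] ℝ :=
  fun p => ContinuousMultilinearMap.constOfIsEmpty ℝ (fun _ : Fin 0 => E) (f p)

variable (E) in
/-- The Euclidean inner product as a covariant tensor of rank `2`. -/
def euclidTensor : E [×2]→L[ℝ] ℝ :=
  ((continuousMultilinearCurryFin1 ℝ E ℝ).symm.toContinuousLinearEquiv.toContinuousLinearMap ∘L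
    innerSL ℝ (E := E)).uncurryLeft

theorem euclidTensor_apply (v w : E) : euclidTensor E ![v, w] = ⟪v, w⟫ := by
  simp [euclidTensor, ContinuousLinearMap.uncurryLeft_apply]
  rfl

/-- The metric `g_N` induced on `N`. -/
def inducedMetric (N : Set E) : E → E [×2]→L[ℝ] ℝ :=
  fun p => (euclidTensor E).compContinuousLinearMap fun _ => tangentProj N p

/-- The pullback to `N` by a map `f : N → X ⊆ E` of the metric induced on `X`:
`(f^* g_X)_p (v, w) = ⟪df_p v, df_p w⟫` for `v, w ∈ T_p N`. -/
def pullbackMetric (N : Set E) (f : E → E) : E → E [×2]→L[ℝ] ℝ :=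
  fun p => (euclidTensor E).compContinuousLinearMap fun _ => fderivWithin ℝ f N p ∘L tangentProj N p

/-- `q` is the unique point of `X` nearest to `p`. -/
def IsNearestPoint (X : Set E) (p q : E) : Prop :=
  q ∈ X ∧ ∀ q' ∈ X, q' ≠ q → dist p q < dist p q'

/-- On the part `D` of the submanifold `N`, the nearest-point projection `f` from `N` to `X` is
well defined and smooth (in a neighbourhood of `D` in `N`), and
`|∇^k (f^* g_X - g_N)| ≤ ε r^{-k}` for all `k ≤ K`, with `∇` and the norm those of `g_N`
(the norm of a tensor is its largest absolute value on unit vectors). -/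
def MetricCloseOn (r : E → ℝ) (N X D : Set E) (K : ℕ) (ε : ℝ) : Prop :=
  ∃ (O : Set E) (f : E → E), IsOpen O ∧ D ⊆ N ∩ O ∧ (∀ p ∈ N ∩ O, IsNearestPoint X p (f p)) ∧
    ContDiffOn ℝ ∞ f (N ∩ O) ∧
    ∀ k ≤ K, ∀ p ∈ D,
      ‖iterCovDeriv N (fun q => pullbackMetric N f q - inducedMetric N q) k p‖ ≤ ε / r p ^ k

/-- There is a chart `ψ` of the `m`-dimensional `X ⊆ E` around `q`, defined on the ball of radius
`δ`, in which the rescaled induced metric `R⁻² g_X` is comparable to the Euclidean metric and has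
all its components bounded in `C^K`, with constant `B`. -/
def HasBoundedChartAt (m K : ℕ) (X : Set E) (R δ B : ℝ) (q : E) : Prop :=
  ∃ (ψ : EuclideanSpace ℝ (Fin m) → E) (π : E → EuclideanSpace ℝ (Fin m)),
    ContDiffOn ℝ ∞ ψ (ball 0 δ) ∧ ContinuousOn π (ψ '' ball 0 δ) ∧
    (∀ y ∈ ball 0 δ, π (ψ y) = y) ∧ ψ 0 = q ∧
    (∃ O : Set E, IsOpen O ∧ ψ '' ball 0 δ = X ∩ O) ∧
    (∀ y ∈ ball 0 δ, ∀ v : EuclideanSpace ℝ (Fin m),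
      B⁻¹ * ‖v‖ ^ 2 ≤ R⁻¹ ^ 2 * ‖fderiv ℝ ψ y v‖ ^ 2 ∧
      R⁻¹ ^ 2 * ‖fderiv ℝ ψ y v‖ ^ 2 ≤ B * ‖v‖ ^ 2) ∧
    ∀ k ≤ K, ∀ i j : Fin m, ∀ y ∈ ball 0 δ,
      ‖iteratedFDeriv ℝ k (fun y' => R⁻¹ ^ 2 *
        ⟪fderiv ℝ ψ y' (EuclideanSpace.single i 1),
          fderiv ℝ ψ y' (EuclideanSpace.single j 1)⟫) y‖ ≤ B

/-- `r^{-1}`-bounded `C^K`-geometry of the `m`-dimensional `X` on its part `X ∩ D`: the metrics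
`R⁻² g_X` are bounded in `C^K` in charts of a uniform size, uniformly on
`Ω_{R,S} = {R < r < 2R, S < ρ < 2S}` for all `R, S > 0`. -/
def HasBoundedGeometryOn (r ρ : E → ℝ) (m K : ℕ) (X D : Set E) : Prop :=
  ∃ δ > (0 : ℝ), ∃ B > (0 : ℝ), ∀ R > (0 : ℝ), ∀ S > (0 : ℝ), ∀ q ∈ X ∩ D,
    R < r q → r q < 2 * R → S < ρ q → ρ q < 2 * S → HasBoundedChartAt m K X R δ B q

end Submanifold

/-! ## Special Lagrangian cones and their smoothings in `ℂⁿ` -/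

/-- `ℂⁿ` -/
abbrev Cn (n : ℕ) := EuclideanSpace ℂ (Fin n)

/-- `ℂⁿ⁺¹ = ℂⁿ × ℂ`, with points `(z, w)`. -/
abbrev CnC (n : ℕ) := WithLp 2 (Cn n × ℂ)

section Cn

variable {n : ℕ}

/-- The symplectic form `∑ dx_j ∧ dy_j` of `ℂⁿ`. -/
def omega (v w : Cn n) : ℝ := ∑ j, ((v j).re * (w j).im - (v j).im * (w j).re)

/-- The `n`-dimensional submanifold `N` of `ℂⁿ` is special Lagrangian: `ω` and `Im Ω` vanish on `N`,
where `Ω = dz₁ ∧ … ∧ dz_n`. -/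
def IsSpecialLagrangian (N : Set (Cn n)) : Prop :=
  IsSmoothSubmanifold n N ∧
  (∀ p ∈ N, ∀ v ∈ tangentSpaceOf N p, ∀ w ∈ tangentSpaceOf N p, omega v w = 0) ∧
  ∀ p ∈ N, ∀ v : Fin n → Cn n, (∀ i, v i ∈ tangentSpaceOf N p) →
    (Matrix.det (Matrix.of fun i j => v j i)).im = 0

/-- The cone over `S` without its vertex. -/
def puncturedCone (S : Set (Cn n)) : Set (Cn n) :=
  {x | ∃ t : ℝ, 0 < t ∧ ∃ σ ∈ S, x = t • σ}

/-- `S` is a compact smooth `(n-1)`-dimensional submanifold of the unit sphere whose cone is special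
Lagrangian. -/
structure IsSpecialLagrangianLink (S : Set (Cn n)) : Prop where
  isCompact : IsCompact S
  subset_sphere : S ⊆ sphere 0 1
  smooth : IsSmoothSubmanifold (n - 1) S
  cone_sl : IsSpecialLagrangian (puncturedCone S)

/-- The cotangent bundle of a submanifold `N ⊆ ℂⁿ`: `(x, ξ)` stands for the covector `⟪ξ, ·⟫` on
`T_x N`, with `ξ ∈ T_x N`. -/
def cotangentBundle (N : Set (Cn n)) : Set (Cn n × Cn n) :=
  {p | p.1 ∈ N ∧ p.2 ∈ tangentSpaceOf N p.1}

/-- A dilation-equivariant Lagrangian neighbourhood of the cone `C` (without vertex): an open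
neighbourhood `dom` of the zero section of `T^*C` and a smooth embedding `toFun` of it in `ℂⁿ` which
is the identity on the zero section, symplectic, and equivariant for the dilations `x ↦ t x` and the
induced action on `T^*C` for which the canonical symplectic form is homogeneous of degree `2`.
For covectors written as `(x, ξ)`, the canonical symplectic form `∑ dqⁱ ∧ dpᵢ` of `T^*C` is
`((x', ξ'), (x'', ξ'')) ↦ ⟪x', ξ''⟫ - ⟪x'', ξ'⟫`, and the action is `t · (x, ξ) = (t x, t ξ)`. -/
structure ConeLagrangianNbhd (C : Set (Cn n)) where
  dom : Set (Cn n × Cn n)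
  toFun : Cn n × Cn n → Cn n
  isOpen_dom : ∃ O : Set (Cn n × Cn n), IsOpen O ∧ dom = cotangentBundle C ∩ O
  zero_mem : ∀ x ∈ C, (x, 0) ∈ dom
  map_zero : ∀ x ∈ C, toFun (x, 0) = x
  smooth : ContDiffOn ℝ ∞ toFun dom
  injOn : InjOn toFun dom
  symplectic : ∀ p ∈ dom, ∀ X ∈ tangentConeAt ℝ dom p, ∀ Y ∈ tangentConeAt ℝ dom p,
    omega (fderivWithin ℝ toFun dom p X) (fderivWithin ℝ toFun dom p Y) =
      ⟪X.1, Y.2⟫ - ⟪Y.1, X.2⟫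
  smul_mem : ∀ t : ℝ, 0 < t → ∀ x ξ, (x, ξ) ∈ dom → (t • x, t • ξ) ∈ dom
  map_smul : ∀ t : ℝ, 0 < t → ∀ x ξ, (x, ξ) ∈ dom → toFun (t • x, t • ξ) = t • toFun (x, ξ)

/-- The point of `graph_C(dg)` over `x ∈ C`. -/
def coneGraphPoint {C : Set (Cn n)} (Φ : ConeLagrangianNbhd C) (g : Cn n → ℝ) (x : Cn n) : Cn n :=
  Φ.toFun (x, tangentialGrad C g x)

/-- The part of `graph_C(dg)` over `C ∩ {r > R}`. -/
def coneGraph {C : Set (Cn n)} (Φ : ConeLagrangianNbhd C) (g : Cn n → ℝ) (R : ℝ) : Set (Cn n) :=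
  coneGraphPoint Φ g '' {x | x ∈ C ∧ R < ‖x‖}

/-- `L` is asymptotic to the cone `C` with rate `μ`: outside compact sets it is the graph over the
end `{r > R}` of `C` (for all `R ≥ Λ₀`) of the exact form `dg`, where `|∇^k g| ≤ C_k r^{μ-k}`. -/
structure IsAsymptoticTo {C : Set (Cn n)} (Φ : ConeLagrangianNbhd C) (L : Set (Cn n))
    (Λ₀ μ : ℝ) (g : Cn n → ℝ) : Prop where
  smooth : ContDiffOn ℝ ∞ g {x | x ∈ C ∧ Λ₀ < ‖x‖}
  mem_dom : ∀ x ∈ C, Λ₀ < ‖x‖ → (x, tangentialGrad C g x) ∈ Φ.dom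
  graph_subset : coneGraph Φ g Λ₀ ⊆ L
  isCompact_diff : ∀ R, Λ₀ ≤ R → IsCompact (L \ coneGraph Φ g R)
  decay : ∀ k : ℕ, ∃ Ck : ℝ, ∀ x ∈ C, Λ₀ < ‖x‖ →
    ‖iterCovDeriv C (scalarTensor g) k x‖ ≤ Ck * ‖x‖ ^ (μ - k)

/-- `β` is a Liouville potential of `L`: `dβ = λ|_L` for the Liouville form
`λ = ½ ∑ (x_j dy_j - y_j dx_j)`, that is `λ_x(v) = ½ ω(x, v)`. -/
def IsLiouvillePotential (L : Set (Cn n)) (β : Cn n → ℝ) : Prop :=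
  ContDiffOn ℝ ∞ β L ∧
  ∀ x ∈ L, ∀ v ∈ tangentSpaceOf L x, fderivWithin ℝ β L x v = (1 / 2) * omega x v

/-- The limit of the Liouville potential along the end of `L` that is asymptotic to the component of
the cone containing `x`; this is the constant `c_{∞,m}` for `x ∈ Cone(Σ_m)`. -/
def endConst {C : Set (Cn n)} (Φ : ConeLagrangianNbhd C) (g β : Cn n → ℝ) (x : Cn n) : ℝ :=
  limUnder atTop fun t : ℝ => β (coneGraphPoint Φ g (t • x))

/-! ## The approximate solution in `ℂⁿ⁺¹` -/

/-- The radial function `r = |z|`. -/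
def rad (p : CnC n) : ℝ := ‖p.fst‖

/-- The coordinate `u = Re w`. -/
def uCoord (p : CnC n) : ℝ := p.snd.re

/-- The cylinder `N × ℝ ⊆ ℂⁿ × ℂ`, with the `ℝ`-factor on `{v = 0}`. -/
def cylinder (N : Set (Cn n)) : Set (CnC n) := {p | p.fst ∈ N ∧ p.snd.im = 0}

/-- The coefficients `a_j` (`a_0 = 1`) for which `∑_{j ≤ a} a_j u^{2a-2j} r^{2j}` is harmonic on
`C × ℝ`, where `Δ = ∂_u² + ∂_r² + (n-1) r⁻¹ ∂_r` on functions of `(u, r)`. -/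
def harmonicCoeff (n a : ℕ) : ℕ → ℝ
  | 0 => 1
  | j + 1 => -harmonicCoeff n a j * ((2 * a - 2 * j) * (2 * a - 2 * j - 1)) /
      ((2 * j + 2) * (2 * j + n))

section Solution

variable {C : Set (Cn n)} (Φ : ConeLagrangianNbhd C) (L : Set (Cn n)) (Λ₀ : ℝ) (g β : Cn n → ℝ)
  (a : ℕ) (b : ℝ) (χ : ℝ → ℝ)

/-- The homogeneous harmonic function
`φ_a = -(u^{2a} + ∑_{j=1}^a a_j u^{2a-2j} r^{2j}) c_{∞,m}` on `C × ℝ`. -/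
def phiA (p : CnC n) : ℝ :=
  -(∑ j ∈ Finset.range (a + 1),
      harmonicCoeff n a j * uCoord p ^ (2 * a - 2 * j) * rad p ^ (2 * j)) * endConst Φ g β p.fst

/-- The potential `G = -u^{2a} c_{∞,m} + u^{2a} g(|u|^{-a} x)` for `u ≠ 0`, `G = 0` for `u = 0`. -/
def potG (p : CnC n) : ℝ :=
  if uCoord p = 0 then 0 else
    -uCoord p ^ (2 * a) * endConst Φ g β p.fst +
      uCoord p ^ (2 * a) * g ((|uCoord p| ^ a)⁻¹ • p.fst)

/-- The interpolation `I = χ(r/|u|^b) G + (1 - χ(r/|u|^b)) φ_a`, equal to `φ_a` for `u = 0`. It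
equals `φ_a` where `r ≥ 2|u|^b` and `G` where `r ≤ |u|^b`, `u ≠ 0`. -/
def potI (p : CnC n) : ℝ :=
  if uCoord p = 0 then phiA Φ g β a p else
    χ (rad p / |uCoord p| ^ b) * potG Φ g β a p +
      (1 - χ (rad p / |uCoord p| ^ b)) * phiA Φ g β a p

/-- The point over `p ∈ C × ℝ` of the graph of the covector `⟪ξ, ·⟫` in the Lagrangian neighbourhood
`Φ × (u, η) ↦ u + iη` of `C × ℝ`. -/
def cylGraphMap (p ξ : CnC n) : CnC n :=
  WithLp.toLp 2 (Φ.toFun (p.fst, ξ.fst), p.snd + Complex.I * ξ.snd)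

/-- The part of `C × ℝ` over which the approximate solution is the graph of `dI`:
`{r ≥ |u|^b, ρ < 1/A}`. -/
def graphRegion (C : Set (Cn n)) (b A : ℝ) : Set (CnC n) :=
  {p | p ∈ cylinder C ∧ |uCoord p| ^ b ≤ rad p ∧ ‖p‖ < A⁻¹}

/-- The graph of `dI` over `{r ≥ |u|^b, ρ < 1/A} ⊆ C × ℝ` is well defined. -/
def GraphWellDefined (A : ℝ) : Prop :=
  ∀ p ∈ graphRegion C b A,
    (p.fst, (tangentialGrad (cylinder C) (potI Φ g β a b χ) p).fst) ∈ Φ.dom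

/-- The Lagrangian embedding `(y, u) ↦ (|u|^a y, u - 2 i a u^{2a-1} β(y))` of `L × (ℝ ∖ 0)`. -/
def embX2 (y : Cn n) (u : ℝ) : CnC n :=
  WithLp.toLp 2 ((|u| ^ a : ℝ) • y,
    (u : ℂ) + Complex.I * ((-2 * a * u ^ (2 * a - 1) * β y : ℝ) : ℂ))

/-- The approximate solution `X` near the origin. Where `r ≥ |u|^b` it is the graph over `C × ℝ` of
`dI` (hence of `dφ_a` where `r ≥ 2|u|^b`). The rest is the part `r ≤ |u|^b` of the image of
`L × (ℝ ∖ 0)` under `embX2`; here `r` is the radius in the cone, so that the points of `L` which are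
left out for a given `u` are those of the graph of `dg` over `{r > |u|^{b-a}}`. -/
def approxSol (A : ℝ) : Set (CnC n) :=
  {q | ∃ p ∈ graphRegion C b A,
      q = cylGraphMap Φ p (tangentialGrad (cylinder C) (potI Φ g β a b χ) p)} ∪
  {q | ∃ y u, u ≠ 0 ∧ |u| < A⁻¹ ∧ y ∈ L \ coneGraph Φ g (max Λ₀ (|u| ^ (b - a))) ∧
      q = embX2 β a y u}

end Solution

/-- The part `{r > Λ|u|^a, 0 < ρ < 1/A}` of `C × ℝ`. -/
def regionU (C : Set (Cn n)) (a : ℕ) (Λ A : ℝ) : Set (CnC n) :=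
  {p | p ∈ cylinder C ∧ Λ * |uCoord p| ^ a < rad p ∧ ‖p‖ ∈ Ioo 0 A⁻¹}

/-- `u₀^a L × ℝ`. -/
def modelS (L : Set (Cn n)) (a : ℕ) (u₀ : ℝ) : Set (CnC n) :=
  cylinder ((fun y : Cn n => (u₀ ^ a : ℝ) • y) '' L)

/-- The part `{r < 2Λ|u|^a, ||u| - u₀| ≤ u₀^a, 0 < ρ < 1/A}` of `u₀^a L × ℝ`. -/
def regionV (L : Set (Cn n)) (a : ℕ) (u₀ Λ A : ℝ) : Set (CnC n) :=
  {p | p ∈ modelS L a u₀ ∧ rad p < 2 * Λ * |uCoord p| ^ a ∧ |(|uCoord p| - u₀)| ≤ u₀ ^ a ∧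
    ‖p‖ ∈ Ioo 0 A⁻¹}

end Cn

end SLGeom

end

/-! All the claims are local and behave well under similarities, so X is examined through the maps q
↦ s q + (0, u) as the scale s tends to zero. Two limits occur. If u and s tend to zero with |u|^a /
s → 0, the rescaled X converges smoothly to C × ℝ near Σ × {0} (`ConicalScale.smoothlyConverges`).
If s = u₀^a, ||u| - u₀| ≤ u₀^a and u₀ → 0, it converges smoothly to L × ℝ near the points of L × {0}
(`smoothlyConverges_neck`).

Convergence means that parametrizations converge with all derivatives and account for every nearby
point of X (`SmoothlyConverges`). It implies everything that is wanted near a point. The inverse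
function theorem with parameters solves the equation for the critical points of the distance and
gives a smooth nearest-point projection (`SmoothlyConverges.exists_nearest`). In the limit this
projection is the identity of the model, so the difference of the metrics tends to zero with its
covariant derivatives (`SmoothlyConverges.nearGood`). The parametrizations also provide charts of
uniform size (`SmoothlyConverges.exists_boundedChart`). As Σ and the bounded parts of L are compact,
the pointwise statements yield uniform thresholds (`eventually_forall_of_isCompact`), and undoing
the similarity produces the factors r^{-k} (`NearGood.similarity`).

For the conical limit, X is there the graph of dI, and the rescaled potential is s⁻² I(s · + (0,
u)). Up to additive constants it tends to zero (`ConicalScale.st_rescaledPot`). The linear term of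
u^{2a} becomes u^{2a-1}/s = u^{a-1} (u^a/s), the other terms of φ_a carry positive powers of u or s,
and the contribution of g is (|u|^a/s)² g((s/|u|^a) x) up to harmless factors, which decays because
g does. The cut-off function matters only where s is at most a multiple of |u|^b. There s/u → 0
because b > 1, so the cut-off factor has smooth limits along ultrafilters.

The two descriptions of X agree where r ≤ |u|^b. On the ends of L one has β = c_∞ + ½⟨∇g, y⟩ - g
(`liouville_coneGraphPoint`), because Φ is symplectic and equivariant. This identity turns the
u-derivative of G into -2a u^{2a-1} β, so that the graph of dG is the image of the end of L under
`embX2` (`cylGraphMap_eq_embX2`). For the neck limit, `embX2` rescaled by u₀^a is one fixed smooth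
map of two coefficients, and these converge to (1, 0) (`tendsto_neckParam`). The assumption b < a
makes the graph region r ≥ |u|^b part of the conical regime and pushes the removed part of L to
infinity. -/

set_option linter.unusedSectionVars false

noncomputable section

namespace SLGeom

/-! ## Smoothly convergent families of maps -/

section Families

variable {ι : Type} {E F G H : Type} [NormedAddCommGroup E] [NormedSpace ℝ E]
  [NormedAddCommGroup F] [NormedSpace ℝ F] [NormedAddCommGroup G] [NormedSpace ℝ G]
  [NormedAddCommGroup H] [NormedSpace ℝ H]

/-- `f` is smooth on a neighbourhood of `x₀`. -/
def SmoothNear (f : E → F) (x₀ : E) : Prop := ∀ᶠ x in 𝓝 x₀, ContDiffAt ℝ ∞ f x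

/-- The members of the family `f` are eventually smooth on a fixed neighbourhood of `x₀`. -/
def FamSmooth (l : Filter ι) (f : ι → E → F) (x₀ : E) : Prop :=
  ∀ᶠ p in l ×ˢ 𝓝 x₀, ContDiffAt ℝ ∞ (f p.1) p.2

/-- The derivatives of order at most `k` of `f i` at `x` tend to those of `f₀` at `x₀`. -/
def CT (l : Filter ι) (x₀ : E) : ℕ → {F : Type} → [NormedAddCommGroup F] → [NormedSpace ℝ F] →
    (ι → E → F) → (E → F) → Prop
  | 0, _, _, _, f, f₀ => Tendsto (fun p : ι × E => f p.1 p.2) (l ×ˢ 𝓝 x₀) (𝓝 (f₀ x₀))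
  | k + 1, _, _, _, f, f₀ => Tendsto (fun p : ι × E => f p.1 p.2) (l ×ˢ 𝓝 x₀) (𝓝 (f₀ x₀)) ∧
      CT l x₀ k (fun i => fderiv ℝ (f i)) (fderiv ℝ f₀)

/-- Convergence of a family of smooth maps in `C^k` near `x₀`. -/
structure STk (l : Filter ι) (x₀ : E) (k : ℕ) (f : ι → E → F) (f₀ : E → F) : Prop where
  fam : FamSmooth l f x₀
  lim : SmoothNear f₀ x₀
  tends : CT l x₀ k f f₀

/-- Convergence of a family of smooth maps in `C^∞` near `x₀`. -/
def ST (l : Filter ι) (x₀ : E) (f : ι → E → F) (f₀ : E → F) : Prop := ∀ k, STk l x₀ k f f₀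

variable {l : Filter ι} {x₀ : E} {k : ℕ} {f f' : ι → E → F} {f₀ f₀' : E → F}

theorem eventually_prod_nhds {P : ι × E → Prop} (h : ∀ᶠ p in l ×ˢ 𝓝 x₀, P p) :
    ∀ᶠ p in l ×ˢ 𝓝 x₀, ∀ᶠ y in 𝓝 p.2, P (p.1, y) := by
  obtain ⟨pa, ha, pb, hb, hab⟩ := eventually_prod_iff.1 h
  refine eventually_prod_iff.2 ⟨pa, ha, _, hb.eventually_nhds, ?_⟩
  intro i hi x hx
  filter_upwards [hx] with y hy using hab hi hy

theorem eventually_prod_diag {P : ι × E → Prop} (h : ∀ᶠ p in l ×ˢ 𝓝 x₀, P p) :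
    ∀ᶠ i in l, P (i, x₀) := by
  obtain ⟨pa, ha, pb, hb, hab⟩ := eventually_prod_iff.1 h
  filter_upwards [ha] with i hi using hab hi hb.self_of_nhds

theorem eventually_prod_uniform {P : ι × E → Prop} (h : ∀ᶠ p in l ×ˢ 𝓝 x₀, P p) :
    ∃ ρ > 0, ∀ᶠ i in l, ∀ x ∈ ball x₀ ρ, P (i, x) := by
  obtain ⟨pa, ha, pb, hb, hab⟩ := eventually_prod_iff.1 h
  obtain ⟨ρ, hρ, hb⟩ := Metric.eventually_nhds_iff_ball.1 hb
  exact ⟨ρ, hρ, by filter_upwards [ha] with i hi x hx using hab hi (hb x hx)⟩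

theorem SmoothNear.fderiv (h : SmoothNear f₀ x₀) : SmoothNear (fderiv ℝ f₀) x₀ :=
  Eventually.mono h fun _ hx => hx.fderiv_right (by simp)

theorem FamSmooth.fderiv (h : FamSmooth l f x₀) : FamSmooth l (fun i => fderiv ℝ (f i)) x₀ :=
  Eventually.mono h fun _ hx => hx.fderiv_right (by simp)

theorem SmoothNear.self (h : SmoothNear f₀ x₀) : ContDiffAt ℝ ∞ f₀ x₀ := h.self_of_nhds

theorem SmoothNear.famSmooth (h : SmoothNear f₀ x₀) : FamSmooth l (fun _ => f₀) x₀ :=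
  tendsto_snd.eventually h

theorem _root_.ContDiffOn.smoothNear {s : Set E} (h : ContDiffOn ℝ ∞ f₀ s) (hs : IsOpen s)
    (hx : x₀ ∈ s) : SmoothNear f₀ x₀ := by
  filter_upwards [hs.mem_nhds hx] with x hx using h.contDiffAt (hs.mem_nhds hx)

theorem _root_.ContDiff.smoothNear (h : ContDiff ℝ ∞ f₀) : SmoothNear f₀ x₀ :=
  Eventually.of_forall fun _ => h.contDiffAt

theorem CT.zero (h : CT l x₀ k f f₀) :
    Tendsto (fun p : ι × E => f p.1 p.2) (l ×ˢ 𝓝 x₀) (𝓝 (f₀ x₀)) := by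
  cases k with
  | zero => exact h
  | succ k => exact h.1

theorem STk.tendsto (h : STk l x₀ k f f₀) :
    Tendsto (fun p : ι × E => f p.1 p.2) (l ×ˢ 𝓝 x₀) (𝓝 (f₀ x₀)) := h.tends.zero

theorem ST.tendsto (h : ST l x₀ f f₀) :
    Tendsto (fun p : ι × E => f p.1 p.2) (l ×ˢ 𝓝 x₀) (𝓝 (f₀ x₀)) := (h 0).tendsto

theorem STk.fderiv (h : STk l x₀ (k + 1) f f₀) :
    STk l x₀ k (fun i => fderiv ℝ (f i)) (fderiv ℝ f₀) :=
  ⟨h.fam.fderiv, h.lim.fderiv, h.tends.2⟩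

theorem ST.fderiv (h : ST l x₀ f f₀) : ST l x₀ (fun i => fderiv ℝ (f i)) (fderiv ℝ f₀) :=
  fun k => (h (k + 1)).fderiv

theorem STk.succ (h : STk l x₀ 0 f f₀) (h' : STk l x₀ k (fun i => _root_.fderiv ℝ (f i))
    (_root_.fderiv ℝ f₀)) : STk l x₀ (k + 1) f f₀ :=
  ⟨h.fam, h.lim, h.tends, h'.tends⟩

theorem STk.zero (h : STk l x₀ k f f₀) : STk l x₀ 0 f f₀ := ⟨h.fam, h.lim, h.tends.zero⟩

theorem STk.pred {F : Type} [NormedAddCommGroup F] [NormedSpace ℝ F] {f : ι → E → F} {f₀ : E → F}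
    (h : STk l x₀ (k + 1) f f₀) : STk l x₀ k f f₀ := by
  induction k generalizing F with
  | zero => exact h.zero
  | succ k ih => exact STk.succ h.zero (ih h.fderiv)

theorem STk.congr {F : Type} [NormedAddCommGroup F] [NormedSpace ℝ F] {f f' : ι → E → F}
    {f₀ f₀' : E → F} (h : STk l x₀ k f f₀) (hf : ∀ᶠ p in l ×ˢ 𝓝 x₀, f' p.1 p.2 = f p.1 p.2)
    (hf₀ : f₀' =ᶠ[𝓝 x₀] f₀) : STk l x₀ k f' f₀' := by
  have key : ∀ {F : Type} [NormedAddCommGroup F] [NormedSpace ℝ F] {f f' : ι → E → F}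
      {f₀ f₀' : E → F}, FamSmooth l f x₀ → SmoothNear f₀ x₀ →
      (∀ᶠ p in l ×ˢ 𝓝 x₀, f' p.1 p.2 = f p.1 p.2) → f₀' =ᶠ[𝓝 x₀] f₀ →
      FamSmooth l f' x₀ ∧ SmoothNear f₀' x₀ := by
    intro F _ _ f f' f₀ f₀' h1 h2 h3 h4
    refine ⟨?_, ?_⟩
    · filter_upwards [h1, eventually_prod_nhds h3] with p hp hp' using hp.congr_of_eventuallyEq hp'
    · filter_upwards [h2, h4.eventuallyEq_nhds] with p hp hp' using hp.congr_of_eventuallyEq hp'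
  induction k generalizing F with
  | zero =>
    refine ⟨(key h.fam h.lim hf hf₀).1, (key h.fam h.lim hf hf₀).2, ?_⟩
    have := h.tendsto
    simp only [CT]
    rw [hf₀.self_of_nhds]
    exact this.congr' (by filter_upwards [hf] with p hp using hp.symm)
  | succ k ih =>
    refine ⟨(key h.fam h.lim hf hf₀).1, (key h.fam h.lim hf hf₀).2, ?_, ?_⟩
    · rw [hf₀.self_of_nhds]
      exact h.tendsto.congr' (by filter_upwards [hf] with p hp using hp.symm)
    · refine (ih h.fderiv ?_ hf₀.fderiv).tends
      filter_upwards [eventually_prod_nhds hf] with p hp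
      exact Filter.EventuallyEq.fderiv_eq hp

theorem ST.congr (h : ST l x₀ f f₀) (hf : ∀ᶠ p in l ×ˢ 𝓝 x₀, f' p.1 p.2 = f p.1 p.2)
    (hf₀ : f₀' =ᶠ[𝓝 x₀] f₀) : ST l x₀ f' f₀' := fun k => (h k).congr hf hf₀

theorem SmoothNear.STk {F : Type} [NormedAddCommGroup F] [NormedSpace ℝ F] {f₀ : E → F}
    (h : SmoothNear f₀ x₀) : STk l x₀ k (fun _ => f₀) f₀ := by
  induction k generalizing F with
  | zero => exact ⟨h.famSmooth, h, h.self.continuousAt.tendsto.comp tendsto_snd⟩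
  | succ k ih => exact ⟨h.famSmooth, h, h.self.continuousAt.tendsto.comp tendsto_snd,
      (ih h.fderiv).tends⟩

theorem SmoothNear.ST (h : SmoothNear f₀ x₀) : ST l x₀ (fun _ => f₀) f₀ := fun _ => h.STk

/-- The derivative of x ↦ A(f x) is a fixed linear map applied to Df, so the claim reproduces itself
one order lower in other target spaces. This is why the induction generalizes over the spaces; the
other closure properties follow the same pattern. -/
theorem STk.clm {F G : Type} [NormedAddCommGroup F] [NormedSpace ℝ F] [NormedAddCommGroup G]
    [NormedSpace ℝ G] {f : ι → E → F} {f₀ : E → F} (A : F →L[ℝ] G) (h : STk l x₀ k f f₀) :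
    STk l x₀ k (fun i x => A (f i x)) (fun x => A (f₀ x)) := by
  have key : ∀ {k} {F G : Type} [NormedAddCommGroup F] [NormedSpace ℝ F] [NormedAddCommGroup G]
      [NormedSpace ℝ G] {f : ι → E → F} {f₀ : E → F} (A : F →L[ℝ] G), STk l x₀ k f f₀ →
      STk l x₀ 0 (fun i x => A (f i x)) (fun x => A (f₀ x)) := by
    intro k F G _ _ _ _ f f₀ A h
    refine ⟨Eventually.mono h.fam fun _ hx => A.contDiff.contDiffAt.comp _ hx,
      Eventually.mono h.lim fun _ hx => A.contDiff.contDiffAt.comp _ hx,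
      (A.continuous.tendsto _).comp h.tendsto⟩
  induction k generalizing F G with
  | zero => exact key A h
  | succ k ih =>
    refine STk.succ (key A h) ((ih (ContinuousLinearMap.compL ℝ E F G A) h.fderiv).congr ?_ ?_)
    · filter_upwards [h.fam] with p hp
      exact (A.hasFDerivAt.comp p.2 (hp.differentiableAt (by simp)).hasFDerivAt).fderiv
    · filter_upwards [h.lim] with x hx
      exact (A.hasFDerivAt.comp x (hx.differentiableAt (by simp)).hasFDerivAt).fderiv

theorem STk.prodMk {F G : Type} [NormedAddCommGroup F] [NormedSpace ℝ F] [NormedAddCommGroup G]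
    [NormedSpace ℝ G] {f : ι → E → F} {f₀ : E → F} {g : ι → E → G} {g₀ : E → G}
    (hf : STk l x₀ k f f₀) (hg : STk l x₀ k g g₀) :
    STk l x₀ k (fun i x => (f i x, g i x)) (fun x => (f₀ x, g₀ x)) := by
  have key : ∀ {k} {F G : Type} [NormedAddCommGroup F] [NormedSpace ℝ F] [NormedAddCommGroup G]
      [NormedSpace ℝ G] {f : ι → E → F} {f₀ : E → F} {g : ι → E → G} {g₀ : E → G},
      STk l x₀ k f f₀ → STk l x₀ k g g₀ →
      STk l x₀ 0 (fun i x => (f i x, g i x)) (fun x => (f₀ x, g₀ x)) := by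
    intro k F G _ _ _ _ f f₀ g g₀ hf hg
    exact ⟨hf.fam.mp (hg.fam.mono fun _ h h' => h'.prodMk h),
      hf.lim.mp (hg.lim.mono fun _ h h' => h'.prodMk h), hf.tendsto.prodMk_nhds hg.tendsto⟩
  induction k generalizing F G with
  | zero => exact key hf hg
  | succ k ih =>
    refine STk.succ (key hf hg) (((ih hf.fderiv hg.fderiv).clm
      ((ContinuousLinearMap.prodₗᵢ ℝ : ((E →L[ℝ] F) × (E →L[ℝ] G)) ≃ₗᵢ[ℝ]
        (E →L[ℝ] F × G)).toContinuousLinearEquiv.toContinuousLinearMap)).congr ?_ ?_)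
    · filter_upwards [hf.fam, hg.fam] with p h h'
      exact ((h.differentiableAt (by simp)).hasFDerivAt.prodMk
        (h'.differentiableAt (by simp)).hasFDerivAt).fderiv
    · filter_upwards [hf.lim, hg.lim] with p h h'
      exact ((h.differentiableAt (by simp)).hasFDerivAt.prodMk
        (h'.differentiableAt (by simp)).hasFDerivAt).fderiv

theorem STk.add {g : ι → E → F} {g₀ : E → F} (hf : STk l x₀ k f f₀) (hg : STk l x₀ k g g₀) :
    STk l x₀ k (fun i x => f i x + g i x) (fun x => f₀ x + g₀ x) :=
  (hf.prodMk hg).clm (ContinuousLinearMap.fst ℝ F F + ContinuousLinearMap.snd ℝ F F)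

/-- Leibniz rule: each of the two terms of the derivative is again bilinear in convergent families,
one differentiated and one merely lowered in order by `STk.pred`. -/
theorem STk.bilin {F G H : Type} [NormedAddCommGroup F] [NormedSpace ℝ F] [NormedAddCommGroup G]
    [NormedSpace ℝ G] [NormedAddCommGroup H] [NormedSpace ℝ H]
    {f : ι → E → F} {f₀ : E → F} {g : ι → E → G} {g₀ : E → G} (B : F →L[ℝ] G →L[ℝ] H)
    (hf : STk l x₀ k f f₀) (hg : STk l x₀ k g g₀) :
    STk l x₀ k (fun i x => B (f i x) (g i x)) (fun x => B (f₀ x) (g₀ x)) := by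
  have key : ∀ {k} {F G H : Type} [NormedAddCommGroup F] [NormedSpace ℝ F] [NormedAddCommGroup G]
      [NormedSpace ℝ G] [NormedAddCommGroup H] [NormedSpace ℝ H]
      {f : ι → E → F} {f₀ : E → F} {g : ι → E → G} {g₀ : E → G} (B : F →L[ℝ] G →L[ℝ] H),
      STk l x₀ k f f₀ → STk l x₀ k g g₀ →
      STk l x₀ 0 (fun i x => B (f i x) (g i x)) (fun x => B (f₀ x) (g₀ x)) := by
    intro k F G H _ _ _ _ _ _ f f₀ g g₀ B hf hg
    have hB : ContDiff ℝ ∞ (fun p : F × G => B p.1 p.2) := B.isBoundedBilinearMap.contDiff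
    refine ⟨hf.fam.mp (hg.fam.mono fun _ h h' => hB.contDiffAt.comp _ (h'.prodMk h)),
      hf.lim.mp (hg.lim.mono fun _ h h' => hB.contDiffAt.comp _ (h'.prodMk h)),
      (hB.continuous.tendsto _).comp (hf.tendsto.prodMk_nhds hg.tendsto)⟩
  induction k generalizing F G H with
  | zero => exact key B hf hg
  | succ k ih =>
    refine STk.succ (key B hf hg) (((ih (B.precompR E) hf.pred hg.fderiv).add
      (ih (B.precompL E) hf.fderiv hg.pred)).congr ?_ ?_)
    · filter_upwards [hf.fam, hg.fam] with p h h'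
      exact B.fderiv_of_bilinear (h.differentiableAt (by simp)) (h'.differentiableAt (by simp))
    · filter_upwards [hf.lim, hg.lim] with p h h'
      exact B.fderiv_of_bilinear (h.differentiableAt (by simp)) (h'.differentiableAt (by simp))

/-- Chain rule. Convergence of h is only needed near f₀ x₀, since f i x tends to that point as i and
x vary jointly. -/
theorem STk.comp {F G : Type} [NormedAddCommGroup F] [NormedSpace ℝ F] [NormedAddCommGroup G]
    [NormedSpace ℝ G] {f : ι → E → F} {f₀ : E → F} {h : ι → F → G} {h₀ : F → G}
    (hh : STk l (f₀ x₀) k h h₀) (hf : STk l x₀ k f f₀) :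
    STk l x₀ k (fun i x => h i (f i x)) (fun x => h₀ (f₀ x)) := by
  have key : ∀ {k} {F G : Type} [NormedAddCommGroup F] [NormedSpace ℝ F] [NormedAddCommGroup G]
      [NormedSpace ℝ G] {f : ι → E → F} {f₀ : E → F} {h : ι → F → G} {h₀ : F → G},
      STk l (f₀ x₀) k h h₀ → STk l x₀ k f f₀ →
      STk l x₀ 0 (fun i x => h i (f i x)) (fun x => h₀ (f₀ x)) ∧
      (∀ᶠ p in l ×ˢ 𝓝 x₀, ContDiffAt ℝ ∞ (h p.1) (f p.1 p.2)) ∧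
      ∀ᶠ x in 𝓝 x₀, ContDiffAt ℝ ∞ h₀ (f₀ x) := by
    intro k F G _ _ _ _ f f₀ h h₀ hh hf
    have ht : Tendsto (fun p : ι × E => (p.1, f p.1 p.2)) (l ×ˢ 𝓝 x₀) (l ×ˢ 𝓝 (f₀ x₀)) :=
      tendsto_fst.prodMk hf.tendsto
    have h1 := ht.eventually hh.fam
    have h2 := hf.lim.self.continuousAt.tendsto.eventually hh.lim
    refine ⟨⟨?_, ?_, hh.tendsto.comp ht⟩, h1, h2⟩
    · filter_upwards [h1, hf.fam] with p hp hp' using ContDiffAt.comp p.2 hp hp'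
    · filter_upwards [h2, hf.lim] with p hp hp' using ContDiffAt.comp p hp hp'
  induction k generalizing F G with
  | zero => exact (key hh hf).1
  | succ k ih =>
    obtain ⟨h0, h1, h2⟩ := key hh hf
    refine STk.succ h0 (((ih hh.fderiv hf.pred).bilin (ContinuousLinearMap.compL ℝ E F G)
      hf.fderiv).congr ?_ ?_)
    · filter_upwards [h1, hf.fam] with p h h'
      exact fderiv_comp p.2 (h.differentiableAt (by simp)) (h'.differentiableAt (by simp))
    · filter_upwards [h2, hf.lim] with p h h'
      exact fderiv_comp p (h.differentiableAt (by simp)) (h'.differentiableAt (by simp))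

theorem ST.comp {h : ι → F → G} {h₀ : F → G} (hh : ST l (f₀ x₀) h h₀) (hf : ST l x₀ f f₀) :
    ST l x₀ (fun i x => h i (f i x)) (fun x => h₀ (f₀ x)) := fun k => (hh k).comp (hf k)

theorem STk.map {h₀ : F → G} (hh : SmoothNear h₀ (f₀ x₀)) (hf : STk l x₀ k f f₀) :
    STk l x₀ k (fun i x => h₀ (f i x)) (fun x => h₀ (f₀ x)) := STk.comp hh.STk hf

theorem ST.map {h₀ : F → G} (hh : SmoothNear h₀ (f₀ x₀)) (hf : ST l x₀ f f₀) :
    ST l x₀ (fun i x => h₀ (f i x)) (fun x => h₀ (f₀ x)) := fun k => (hf k).map hh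

theorem ST.prodMk {g : ι → E → G} {g₀ : E → G} (hf : ST l x₀ f f₀) (hg : ST l x₀ g g₀) :
    ST l x₀ (fun i x => (f i x, g i x)) (fun x => (f₀ x, g₀ x)) := fun k => (hf k).prodMk (hg k)

theorem ST.add {g : ι → E → F} {g₀ : E → F} (hf : ST l x₀ f f₀) (hg : ST l x₀ g g₀) :
    ST l x₀ (fun i x => f i x + g i x) (fun x => f₀ x + g₀ x) := fun k => (hf k).add (hg k)

theorem ST.clm (A : F →L[ℝ] G) (hf : ST l x₀ f f₀) :
    ST l x₀ (fun i x => A (f i x)) (fun x => A (f₀ x)) := fun k => (hf k).clm A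

theorem ST.bilin {g : ι → E → G} {g₀ : E → G} (B : F →L[ℝ] G →L[ℝ] H)
    (hf : ST l x₀ f f₀) (hg : ST l x₀ g g₀) :
    ST l x₀ (fun i x => B (f i x) (g i x)) (fun x => B (f₀ x) (g₀ x)) :=
  fun k => (hf k).bilin B (hg k)

theorem ST.mul {f g : ι → E → ℝ} {f₀ g₀ : E → ℝ} (hf : ST l x₀ f f₀) (hg : ST l x₀ g g₀) :
    ST l x₀ (fun i x => f i x * g i x) (fun x => f₀ x * g₀ x) :=
  hf.bilin (ContinuousLinearMap.mul ℝ ℝ) hg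

/-- A convergent family of constants. -/
theorem ST.const {c : ι → F} {c₀ : F} (hc : Tendsto c l (𝓝 c₀)) :
    ST l x₀ (fun i _ => c i) (fun _ => c₀) := by
  intro k
  have h0 : STk l x₀ 0 (fun i _ => c i) (fun _ => c₀) :=
    ⟨Eventually.of_forall fun _ => contDiffAt_const, Eventually.of_forall fun _ => contDiffAt_const,
      hc.comp tendsto_fst⟩
  cases k with
  | zero => exact h0
  | succ k =>
    refine h0.succ ((SmoothNear.STk (f₀ := fun _ => (0 : E →L[ℝ] F))
      (Eventually.of_forall fun _ => contDiffAt_const)).congr ?_ ?_)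
    · exact Eventually.of_forall fun _ => by simp
    · exact Eventually.of_forall fun _ => by simp

/-- A jointly smooth map with a convergent family of parameters. -/
theorem ST.param {Ψ : F × E → G} {c : ι → F} {c₀ : F} (hc : Tendsto c l (𝓝 c₀))
    (hΨ : SmoothNear Ψ (c₀, x₀)) : ST l x₀ (fun i x => Ψ (c i, x)) (fun x => Ψ (c₀, x)) :=
  ST.map (f := fun i x => (c i, x)) (f₀ := fun x => (c₀, x)) hΨ
    ((ST.const hc).prodMk (SmoothNear.ST (f₀ := fun x => x) contDiff_id.smoothNear))

/-- Along an ultrafilter every case distinction is decided and every bounded parameter converges.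
This is how the different positions of the cut-off relative to the scale are handled. -/
theorem ST.of_ultrafilter (h : ∀ U : Ultrafilter ι, ↑U ≤ l → ST (U : Filter ι) x₀ f f₀)
    (h₀ : SmoothNear f₀ x₀) : ST l x₀ f f₀ := by
  -- An ultrafilter on pairs lies below the product of its first projection with the neighbourhoods
  -- of x₀, so it suffices to know convergence along that projection.
  have hU : ∀ V : Ultrafilter (ι × E), ↑V ≤ l ×ˢ 𝓝 x₀ →
      (↑(V.map Prod.fst) : Filter ι) ≤ l ∧
      (V : Filter (ι × E)) ≤ (↑(V.map Prod.fst) : Filter ι) ×ˢ 𝓝 x₀ := by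
    intro V hV
    refine ⟨(map_mono hV).trans tendsto_fst, ?_⟩
    have h2 : Tendsto Prod.snd (V : Filter (ι × E)) (𝓝 x₀) := tendsto_snd.mono_left hV
    have h1 : Tendsto Prod.fst (V : Filter (ι × E)) (↑(V.map Prod.fst) : Filter ι) := by
      simp [Tendsto]
    exact tendsto_id'.1 (h1.prodMk h2)
  have key : ∀ {F : Type} [NormedAddCommGroup F] [NormedSpace ℝ F] {f : ι → E → F} {f₀ : E → F},
      (∀ U : Ultrafilter ι, ↑U ≤ l → ST (U : Filter ι) x₀ f f₀) → SmoothNear f₀ x₀ →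
      STk l x₀ 0 f f₀ := by
    intro F _ _ f f₀ h h₀
    refine ⟨?_, h₀, ?_⟩
    · refine mem_iff_ultrafilter.2 fun V hV => ?_
      exact (hU V hV).2 (h _ (hU V hV).1 0).fam
    · refine (tendsto_iff_ultrafilter _ _ _).2 fun V hV => ?_
      exact (h _ (hU V hV).1).tendsto.mono_left (hU V hV).2
  intro k
  induction k generalizing F with
  | zero => exact key h h₀
  | succ k ih => exact (key h h₀).succ (ih (fun U hU => (h U hU).fderiv) h₀.fderiv)

/-- Only norms are compared: the norm of the derivative of order k + 1 of f is that of the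
derivative of order k of Df, so multilinear and iterated linear maps need not be identified. -/
theorem ST.tendsto_iteratedFDeriv (h : ST l x₀ f f₀) (k : ℕ) :
    Tendsto (fun p : ι × E => ‖iteratedFDeriv ℝ k (f p.1) p.2‖) (l ×ˢ 𝓝 x₀)
      (𝓝 ‖iteratedFDeriv ℝ k f₀ x₀‖) := by
  induction k generalizing F with
  | zero => simpa only [norm_iteratedFDeriv_zero] using h.tendsto.norm
  | succ k ih => simpa only [norm_iteratedFDeriv_fderiv] using ih h.fderiv

end Families

end SLGeom

end

noncomputable section

namespace SLGeom

/-! ## The inverse function theorem for convergent families -/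

section Inverse

variable {ι : Type} {E F G : Type} [NormedAddCommGroup E] [NormedSpace ℝ E]
  [NormedAddCommGroup F] [NormedSpace ℝ F] [NormedAddCommGroup G] [NormedSpace ℝ G]
variable {l : Filter ι} {x₀ : E} {H : ι → E → F} {H₀ : E → F}

/-- On one ball all derivatives of the H i stay within c of the invertible map e, so H i - e is
c-Lipschitz with c‖e⁻¹‖ ≤ 1/2. This gives injectivity with a constant independent of i and
surjectivity onto balls of a fixed radius η, hence local inverses on a common domain. -/
theorem exists_local_inverses [CompleteSpace E] (hH : ST l x₀ H H₀) (e : E ≃L[ℝ] F)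
    (he : fderiv ℝ H₀ x₀ = e) :
    ∃ G : ι → F → E, Tendsto (fun p : ι × F => G p.1 p.2) (l ×ˢ 𝓝 (H₀ x₀)) (𝓝 x₀) ∧
      (∀ᶠ p in l ×ˢ 𝓝 x₀, G p.1 (H p.1 p.2) = p.2) ∧
      (∀ᶠ p in l ×ˢ 𝓝 (H₀ x₀), H p.1 (G p.1 p.2) = p.2) ∧
      FamSmooth l G (H₀ x₀) := by
  set N : NNReal := ‖(e.symm : F →L[ℝ] E)‖₊ with hN
  -- Besides N c ≤ 1/2 this leaves (N + 1)⁻¹ - c > 0. Adding 1 covers the trivial space, where N =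
  -- 0.
  set c : NNReal := (N + 1)⁻¹ / 2 with hc
  have hN1 : (0 : ℝ) < (N : ℝ) + 1 := by positivity
  have hcpos : (0 : ℝ) < c := by simp only [hc]; positivity
  have hNc : (N : ℝ) * c ≤ 1 / 2 := by
    have : ((c : NNReal) : ℝ) = ((N : ℝ) + 1)⁻¹ / 2 := by simp [hc]
    rw [this, div_eq_mul_inv, ← mul_assoc]
    have : (N : ℝ) * ((N : ℝ) + 1)⁻¹ ≤ 1 := by
      rw [← div_eq_mul_inv, div_le_one hN1]; linarith
    linarith
  have h1 : ∀ᶠ p in l ×ˢ 𝓝 x₀, ‖fderiv ℝ (H p.1) p.2 - e‖ ≤ c := by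
    have := hH.fderiv.tendsto
    rw [he] at this
    filter_upwards [this (Metric.closedBall_mem_nhds _ hcpos)] with p hp
    simpa [dist_eq_norm] using hp
  have h2 : ∀ᶠ p in l ×ˢ 𝓝 x₀, ∃ e' : E ≃L[ℝ] F, fderiv ℝ (H p.1) p.2 = e' := by
    have := hH.fderiv.tendsto
    rw [he] at this
    filter_upwards [this (ContinuousLinearEquiv.nhds e)] with p hp
    obtain ⟨e', he'⟩ := hp
    exact ⟨e', he'.symm⟩
  obtain ⟨ρ, hρ, hev⟩ := eventually_prod_uniform (((hH 0).fam.and h1).and h2)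
  have hlip : ∀ᶠ i in l, ∀ x ∈ ball x₀ ρ, ∀ y ∈ ball x₀ ρ,
      ‖H i x - H i y - e (x - y)‖ ≤ c * ‖x - y‖ := by
    filter_upwards [hev] with i hi x hx y hy
    exact (convex_ball x₀ ρ).norm_image_sub_le_of_norm_fderiv_le'
      (fun z hz => (hi z hz).1.1.differentiableAt (by simp)) (fun z hz => (hi z hz).1.2) hy hx
  have hanti : ∀ᶠ i in l, ∀ x ∈ ball x₀ ρ, ∀ y ∈ ball x₀ ρ,
      ‖x - y‖ ≤ 2 * N * ‖H i x - H i y‖ := by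
    filter_upwards [hlip] with i hi x hx y hy
    have a1 := hi x hx y hy
    have a2 : ‖x - y‖ ≤ N * ‖e (x - y)‖ := by
      have := (e.symm : F →L[ℝ] E).le_opNorm (e (x - y))
      simpa [hN] using this
    have a3 : ‖e (x - y)‖ ≤ ‖H i x - H i y‖ + ‖H i x - H i y - e (x - y)‖ := by
      have := norm_sub_le (H i x - H i y) (H i x - H i y - e (x - y))
      simpa using this
    have a4 : ‖x - y‖ ≤ N * (‖H i x - H i y‖ + c * ‖x - y‖) :=
      a2.trans (mul_le_mul_of_nonneg_left (by linarith) N.2)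
    have a5 := mul_le_mul_of_nonneg_right hNc (norm_nonneg (x - y))
    nlinarith
  let G : ι → F → E := fun i => Function.invFunOn (H i) (ball x₀ ρ)
  have hleft : ∀ᶠ i in l, ∀ x ∈ ball x₀ ρ, G i (H i x) = x := by
    filter_upwards [hanti] with i hi
    have hinj : InjOn (H i) (ball x₀ ρ) := by
      intro x hx y hy hxy
      have := hi x hx y hy
      rw [hxy, sub_self, norm_zero, mul_zero] at this
      exact sub_eq_zero.1 (norm_le_zero_iff.1 this)
    exact hinj.leftInvOn_invFunOn
  -- The inverse of e with the weaker bound N + 1, which has a positive inverse; the radius η below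
  -- is computed from it.
  let R : (e : E →L[ℝ] F).NonlinearRightInverse :=
    { toFun := e.symm
      nnnorm := N + 1
      bound' := fun y => by
        have := (e.symm : F →L[ℝ] E).le_opNorm y
        refine this.trans (mul_le_mul_of_nonneg_right ?_ (norm_nonneg _))
        simp [hN]
      right_inv' := fun y => by simp }
  have hRc : (0 : ℝ) < ((R.nnnorm : ℝ))⁻¹ - c := by
    have : ((R.nnnorm : ℝ))⁻¹ - c = ((N : ℝ) + 1)⁻¹ / 2 := by
      simp only [R, hc]; push_cast; ring
    rw [this]; positivity
  set η : ℝ := (((R.nnnorm : ℝ))⁻¹ - c) * (ρ / 2) with hη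
  have hηpos : 0 < η := by positivity
  have hsurj : ∀ᶠ i in l, ∀ y ∈ closedBall (H i x₀) η, G i y ∈ ball x₀ ρ ∧ H i (G i y) = y := by
    filter_upwards [hlip] with i hi y hy
    have happ : ApproximatesLinearOn (H i) (e : E →L[ℝ] F) (ball x₀ ρ) c :=
      fun x hx y hy => hi x hx y hy
    obtain ⟨x, hx, hxy⟩ := happ.surjOn_closedBall_of_nonlinearRightInverse R (by positivity)
      (closedBall_subset_ball (by linarith)) hy
    have hx' : x ∈ ball x₀ ρ := closedBall_subset_ball (by linarith : ρ / 2 < ρ) hx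
    exact ⟨Function.invFunOn_mem ⟨x, hx', hxy⟩, Function.invFunOn_eq ⟨x, hx', hxy⟩⟩
  have hHx : Tendsto (fun p : ι × F => p.2 - H p.1 x₀) (l ×ˢ 𝓝 (H₀ x₀)) (𝓝 0) := by
    have a : Tendsto (fun i => H i x₀) l (𝓝 (H₀ x₀)) :=
      hH.tendsto.comp (tendsto_id.prodMk tendsto_const_nhds)
    simpa using (tendsto_snd (f := l) (g := 𝓝 (H₀ x₀))).sub (a.comp tendsto_fst)
  have hnear : ∀ᶠ p in l ×ˢ 𝓝 (H₀ x₀), p.2 ∈ ball (H p.1 x₀) η := by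
    filter_upwards [hHx (Metric.ball_mem_nhds _ hηpos)] with p hp
    simpa [dist_eq_norm] using hp
  have hmem : ∀ᶠ p in l ×ˢ 𝓝 (H₀ x₀), G p.1 p.2 ∈ ball x₀ ρ ∧ H p.1 (G p.1 p.2) = p.2 := by
    filter_upwards [hnear, tendsto_fst.eventually hsurj] with p hp hp'
    exact hp' p.2 (ball_subset_closedBall hp)
  refine ⟨G, ?_, ?_, hmem.mono fun _ h => h.2, ?_⟩
  · rw [tendsto_iff_norm_sub_tendsto_zero]
    refine squeeze_zero' (Eventually.of_forall fun _ => norm_nonneg _) ?_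
      (g := fun p : ι × F => 2 * (N : ℝ) * ‖p.2 - H p.1 x₀‖) ?_
    · filter_upwards [hmem, tendsto_fst.eventually hanti] with p hp hp'
      have := hp' _ hp.1 x₀ (mem_ball_self hρ)
      rwa [hp.2] at this
    · simpa using hHx.norm.const_mul (2 * (N : ℝ))
  · filter_upwards [tendsto_fst.eventually hleft, tendsto_snd.eventually (ball_mem_nhds x₀ hρ)]
      with p hp hp' using hp _ hp'
  · filter_upwards [hmem, tendsto_fst.eventually hev, tendsto_fst.eventually hleft]
      with ⟨i, y⟩ hp hi hl
    obtain ⟨hG, hHG⟩ := hp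
    obtain ⟨⟨hsm, -⟩, e', he'⟩ := hi _ hG
    have hder : HasFDerivAt (H i) (e' : E →L[ℝ] F) (G i y) := by
      rw [← he']; exact (hsm.differentiableAt (by simp)).hasFDerivAt
    have hloc := hsm.to_localInverse hder (by simp)
    have hst := hsm.hasStrictFDerivAt' hder (by simp)
    simp only at hHG hloc ⊢
    rw [hHG] at hloc
    -- The chosen inverse is smooth because it agrees with the smooth local inverse at G i y: the
    -- latter stays in the ball, where H i is injective.
    refine hloc.congr_of_eventuallyEq ?_
    have ev1 := hst.eventually_right_inverse
    have ev2 := hst.localInverse_continuousAt.tendsto.eventually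
      (isOpen_ball.mem_nhds (by rw [hst.localInverse_apply_image]; exact hG) :
        ∀ᶠ z in 𝓝 _, z ∈ ball x₀ ρ)
    rw [hHG] at ev1 ev2
    filter_upwards [ev1, ev2] with z hz hz'
    have := hl _ hz'
    rw [hz] at this
    exact this

theorem inverse_eq_of_comp_eq_id {A : E →L[ℝ] F} {B : F →L[ℝ] E} (e : E ≃L[ℝ] F) (hA : A = e)
    (h : A.comp B = ContinuousLinearMap.id ℝ F) : B = A.inverse := by
  subst hA
  rw [ContinuousLinearMap.inverse_equiv]
  ext y
  have := DFunLike.congr_fun h y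
  simp at this
  exact (e.symm_apply_eq.2 this.symm).symm

/-- Bootstrapping with DG = (DH ∘ G)⁻¹: convergence of G in C^k gives convergence of the right-hand
side in C^k, as inversion is smooth at invertible operators, and therefore convergence of G in
C^{k+1}. -/
theorem smoothTendsto_of_inverse [CompleteSpace E] (hH : ST l x₀ H H₀) (e : E ≃L[ℝ] F)
    (he : fderiv ℝ H₀ x₀ = e) {G : ι → F → E} {G₀ : F → E}
    (hG : Tendsto (fun p : ι × F => G p.1 p.2) (l ×ˢ 𝓝 (H₀ x₀)) (𝓝 x₀))
    (hGs : FamSmooth l G (H₀ x₀)) (hHG : ∀ᶠ p in l ×ˢ 𝓝 (H₀ x₀), H p.1 (G p.1 p.2) = p.2)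
    (hG₀ : G₀ (H₀ x₀) = x₀) (hG₀s : SmoothNear G₀ (H₀ x₀))
    (hHG₀ : ∀ᶠ y in 𝓝 (H₀ x₀), H₀ (G₀ y) = y) : ST l (H₀ x₀) G G₀ := by
  have h0 : STk l (H₀ x₀) 0 G G₀ := ⟨hGs, hG₀s, by simp only [CT]; rwa [hG₀]⟩
  have hD : ∀ᶠ p in l ×ˢ 𝓝 (H₀ x₀), fderiv ℝ (G p.1) p.2 =
      (fderiv ℝ (H p.1) (G p.1 p.2)).inverse := by
    have ht : Tendsto (fun p : ι × F => (p.1, G p.1 p.2)) (l ×ˢ 𝓝 (H₀ x₀)) (l ×ˢ 𝓝 x₀) :=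
      tendsto_fst.prodMk hG
    have h2 : ∀ᶠ p in l ×ˢ 𝓝 x₀, ∃ e' : E ≃L[ℝ] F, fderiv ℝ (H p.1) p.2 = e' := by
      have := hH.fderiv.tendsto
      rw [he] at this
      filter_upwards [this (ContinuousLinearEquiv.nhds e)] with p hp
      obtain ⟨e', he'⟩ := hp
      exact ⟨e', he'.symm⟩
    filter_upwards [ht.eventually h2, ht.eventually (hH 0).fam, hGs, eventually_prod_nhds hHG]
      with p ⟨e', h1⟩ h2 h3 h4
    refine inverse_eq_of_comp_eq_id e' h1 ?_
    rw [← fderiv_comp p.2 (h2.differentiableAt (by simp)) (h3.differentiableAt (by simp))]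
    have h4' : (H p.1 ∘ G p.1) =ᶠ[𝓝 p.2] id := h4
    rw [h4'.fderiv_eq, fderiv_id]
  have hD₀ : ∀ᶠ y in 𝓝 (H₀ x₀), fderiv ℝ G₀ y = (fderiv ℝ H₀ (G₀ y)).inverse := by
    have ht : Tendsto G₀ (𝓝 (H₀ x₀)) (𝓝 x₀) := by
      have := hG₀s.self.continuousAt.tendsto
      rwa [hG₀] at this
    have h2 : ∀ᶠ x in 𝓝 x₀, ∃ e' : E ≃L[ℝ] F, fderiv ℝ H₀ x = e' := by
      have := (hH 0).lim.fderiv.self.continuousAt.tendsto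
      rw [he] at this
      filter_upwards [this (ContinuousLinearEquiv.nhds e)] with p hp
      obtain ⟨e', he'⟩ := hp
      exact ⟨e', he'.symm⟩
    filter_upwards [ht.eventually h2, ht.eventually (hH 0).lim, hG₀s, eventually_eventually_nhds.2 hHG₀]
      with p ⟨e', h1⟩ h2 h3 h4
    refine inverse_eq_of_comp_eq_id e' h1 ?_
    rw [← fderiv_comp p (h2.differentiableAt (by simp)) (h3.differentiableAt (by simp))]
    have h4' : (H₀ ∘ G₀) =ᶠ[𝓝 p] id := h4
    rw [h4'.fderiv_eq, fderiv_id]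
  have hinv : SmoothNear (ContinuousLinearMap.inverse : (E →L[ℝ] F) → F →L[ℝ] E)
      (fderiv ℝ H₀ (G₀ (H₀ x₀))) := by
    rw [hG₀, he]
    filter_upwards [ContinuousLinearEquiv.nhds e] with A hA
    obtain ⟨e', rfl⟩ := hA
    exact contDiffAt_map_inverse e'
  intro k
  induction k with
  | zero => exact h0
  | succ k ih =>
    refine h0.succ ?_
    have h1 : STk l (G₀ (H₀ x₀)) k (fun i => fderiv ℝ (H i)) (fderiv ℝ H₀) := by
      rw [hG₀]; exact hH.fderiv k
    have h2 : STk l (H₀ x₀) k (fun i y => fderiv ℝ (H i) (G i y)) (fun y => fderiv ℝ H₀ (G₀ y)) :=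
      h1.comp ih
    exact (STk.map (f₀ := fun y => fderiv ℝ H₀ (G₀ y)) hinv h2).congr hD hD₀

/-- Inverse function theorem: a convergent family whose limit has an invertible derivative at `x₀`
has a convergent family of local inverses. -/
theorem exists_inverse_family [CompleteSpace E] (hH : ST l x₀ H H₀) (e : E ≃L[ℝ] F)
    (he : fderiv ℝ H₀ x₀ = e) :
    ∃ (G : ι → F → E) (G₀ : F → E), ST l (H₀ x₀) G G₀ ∧ G₀ (H₀ x₀) = x₀ ∧
      (∀ᶠ p in l ×ˢ 𝓝 x₀, G p.1 (H p.1 p.2) = p.2) ∧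
      (∀ᶠ p in l ×ˢ 𝓝 (H₀ x₀), H p.1 (G p.1 p.2) = p.2) ∧
      (∀ᶠ x in 𝓝 x₀, G₀ (H₀ x) = x) ∧ (∀ᶠ y in 𝓝 (H₀ x₀), H₀ (G₀ y) = y) := by
  obtain ⟨G, h1, h2, h3, h4⟩ := exists_local_inverses hH e he
  -- The inverse of the limit map comes from the same statement for the constant family over a
  -- one-point index set.
  obtain ⟨G', -, h2', h3', h4'⟩ := exists_local_inverses (l := (pure () : Filter Unit))
    (hH 0).lim.ST e he
  have k2 := h2'.curry
  have k3 := h3'.curry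
  have k4 := Eventually.curry h4'
  simp only [eventually_pure] at k2 k3 k4
  exact ⟨G, G' (), smoothTendsto_of_inverse hH e he h1 h4 h3 k2.self_of_nhds k4 k3, k2.self_of_nhds,
    h2, h3, k2, k3⟩

end Inverse

end SLGeom

end

noncomputable section

namespace SLGeom

/-! ## Germs of charts, tangent spaces and covariant derivatives -/

section Charts

variable {ι : Type} {E F P : Type} [NormedAddCommGroup E] [InnerProductSpace ℝ E]
  [FiniteDimensional ℝ E] [NormedAddCommGroup F] [NormedSpace ℝ F]
  [NormedAddCommGroup P] [NormedSpace ℝ P] [FiniteDimensional ℝ P]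
variable {N X : Set E} {ψ : P → E} {π : E → P} {v₀ : P}

/-- The germ at `v₀` of a parametrization `ψ` of `N` with a smooth left inverse `π`. -/
structure ChartGerm (N : Set E) (ψ : P → E) (π : E → P) (v₀ : P) : Prop where
  smooth : SmoothNear ψ v₀
  smooth_inv : SmoothNear π (ψ v₀)
  left_inv : ∀ᶠ v in 𝓝 v₀, π (ψ v) = v
  mem : ∀ᶠ v in 𝓝 v₀, ψ v ∈ N
  right_inv : ∀ᶠ x in 𝓝 (ψ v₀), x ∈ N → ψ (π x) = x

theorem IsSmoothSubmanifold.exists_chartGerm {m : ℕ} (hN : IsSmoothSubmanifold m N) {x : E}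
    (hx : x ∈ N) : ∃ (ψ : EuclideanSpace ℝ (Fin m) → E) (π : E → EuclideanSpace ℝ (Fin m))
      (v₀ : EuclideanSpace ℝ (Fin m)), ChartGerm N ψ π v₀ ∧ ψ v₀ = x := by
  obtain ⟨V, W, ψ, π, hV, hW, hxW, hψ, hπ, himg, hinv⟩ := hN x hx
  obtain ⟨v₀, hv₀, rfl⟩ : x ∈ ψ '' V := himg ▸ ⟨hx, hxW⟩
  refine ⟨ψ, π, v₀, ⟨hψ.smoothNear hV hv₀, hπ.smoothNear hW hxW, ?_, ?_, ?_⟩, rfl⟩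
  · filter_upwards [hV.mem_nhds hv₀] with v hv using hinv v hv
  · filter_upwards [hV.mem_nhds hv₀] with v hv
    exact (himg.subset ⟨v, hv, rfl⟩).1
  · filter_upwards [hW.mem_nhds hxW] with y hy hyN
    obtain ⟨v, hv, rfl⟩ : y ∈ ψ '' V := himg ▸ ⟨hyN, hy⟩
    rw [hinv v hv]

theorem ChartGerm.eventually (h : ChartGerm N ψ π v₀) : ∀ᶠ v in 𝓝 v₀, ChartGerm N ψ π v := by
  have hc := h.smooth.self.continuousAt.tendsto
  filter_upwards [eventually_eventually_nhds.2 h.smooth, hc.eventually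
    (eventually_eventually_nhds.2 h.smooth_inv), eventually_eventually_nhds.2 h.left_inv,
    eventually_eventually_nhds.2 h.mem, hc.eventually (eventually_eventually_nhds.2 h.right_inv)]
    with v h1 h2 h3 h4 h5
  exact ⟨h1, h2, h3, h4, h5⟩

theorem ChartGerm.inv_apply (h : ChartGerm N ψ π v₀) : π (ψ v₀) = v₀ := h.left_inv.self_of_nhds

theorem ChartGerm.mem_self (h : ChartGerm N ψ π v₀) : ψ v₀ ∈ N := h.mem.self_of_nhds

theorem ChartGerm.differentiableAt (h : ChartGerm N ψ π v₀) : DifferentiableAt ℝ ψ v₀ :=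
  h.smooth.self.differentiableAt (by simp)

theorem ChartGerm.fderiv_comp_fderiv (h : ChartGerm N ψ π v₀) :
    (fderiv ℝ π (ψ v₀)).comp (fderiv ℝ ψ v₀) = ContinuousLinearMap.id ℝ P := by
  rw [← fderiv_comp v₀ (h.smooth_inv.self.differentiableAt (by simp)) h.differentiableAt]
  have h4' : (π ∘ ψ) =ᶠ[𝓝 v₀] id := h.left_inv
  rw [h4'.fderiv_eq, fderiv_id]

theorem ChartGerm.injective (h : ChartGerm N ψ π v₀) : Function.Injective (fderiv ℝ ψ v₀) :=
  Function.LeftInverse.injective (g := fderiv ℝ π (ψ v₀))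
    fun w => DFunLike.congr_fun h.fderiv_comp_fderiv w

/-- A derivative within N is determined only on the span of the tangent cone. The value chosen by
`fderivWithin` is therefore meaningful on tangent vectors only, and all arguments are projected
there first. -/
theorem eqOn_tangentSpaceOf {f : E → F} {f' f'' : E →L[ℝ] F} {x : E}
    (h' : HasFDerivWithinAt f f' N x) (h'' : HasFDerivWithinAt f f'' N x) {w : E}
    (hw : w ∈ tangentSpaceOf N x) : f' w = f'' w := by
  have : EqOn (f' : E →ₗ[ℝ] F) (f'' : E →ₗ[ℝ] F) (Submodule.span ℝ (tangentConeAt ℝ N x)) :=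
    LinearMap.eqOn_span (h'.unique_on h'')
  exact this hw

theorem fderivWithin_apply_of_hasFDerivWithinAt {f : E → F} {f' : E →L[ℝ] F} {x : E}
    (h : HasFDerivWithinAt f f' N x) {w : E} (hw : w ∈ tangentSpaceOf N x) :
    fderivWithin ℝ f N x w = f' w :=
  eqOn_tangentSpaceOf h.differentiableWithinAt.hasFDerivWithinAt h hw

theorem fderivWithin_apply_of_eqOn {f f' : E → F} {x : E} (hx : x ∈ N)
    (h : ∀ᶠ y in 𝓝 x, y ∈ N → f y = f' y) (hf' : DifferentiableAt ℝ f' x) {w : E}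
    (hw : w ∈ tangentSpaceOf N x) : fderivWithin ℝ f N x w = fderiv ℝ f' x w := by
  refine fderivWithin_apply_of_hasFDerivWithinAt ?_ hw
  refine hf'.hasFDerivAt.hasFDerivWithinAt.congr_of_eventuallyEq ?_ (h.self_of_nhds hx)
  exact eventually_nhdsWithin_iff.2 h

/-- On N the identity is ψ ∘ π, so its derivative on tangent vectors factors through Dψ. Conversely
a differentiable map into N sends directions into the tangent cone. -/
theorem ChartGerm.tangentSpaceOf_eq (h : ChartGerm N ψ π v₀) :
    tangentSpaceOf N (ψ v₀) = LinearMap.range (fderiv ℝ ψ v₀ : P →ₗ[ℝ] E) := by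
  apply le_antisymm
  · refine Submodule.span_le.2 fun w hw => ?_
    have hd : DifferentiableAt ℝ (fun x => ψ (π x)) (ψ v₀) := by
      refine DifferentiableAt.comp (ψ v₀) ?_ (h.smooth_inv.self.differentiableAt (by simp))
      rw [h.inv_apply]; exact h.differentiableAt
    have h1 : fderivWithin ℝ (fun x => x) N (ψ v₀) w = fderiv ℝ (fun x => ψ (π x)) (ψ v₀) w :=
      fderivWithin_apply_of_eqOn h.mem_self (h.right_inv.mono fun x hx hxN => (hx hxN).symm) hd
        (Submodule.subset_span hw)
    have h2 : fderivWithin ℝ (fun x => x) N (ψ v₀) w = w :=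
      fderivWithin_apply_of_hasFDerivWithinAt (hasFDerivWithinAt_id _ _) (Submodule.subset_span hw)
    have h3 : fderiv ℝ (fun x => ψ (π x)) (ψ v₀) =
        (fderiv ℝ ψ v₀).comp (fderiv ℝ π (ψ v₀)) := by
      have := fderiv_comp (ψ v₀) (g := ψ) (f := π) (by rw [h.inv_apply]; exact h.differentiableAt)
        (h.smooth_inv.self.differentiableAt (by simp))
      rw [h.inv_apply] at this
      exact this
    rw [h2, h3] at h1
    exact ⟨_, h1.symm⟩
  · rintro _ ⟨w, rfl⟩
    refine Submodule.subset_span ?_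
    have h1 : HasFDerivWithinAt ψ (fderiv ℝ ψ v₀) {v | ψ v ∈ N} v₀ :=
      h.differentiableAt.hasFDerivAt.hasFDerivWithinAt
    have h2 := h1.mapsTo_tangent_cone
    rw [tangentConeAt_of_mem_nhds h.mem] at h2
    exact tangentConeAt_mono (by rintro _ ⟨v, hv, rfl⟩; exact hv) (h2 (mem_univ w))

theorem ChartGerm.fderiv_mem (h : ChartGerm N ψ π v₀) (w : P) :
    fderiv ℝ ψ v₀ w ∈ tangentSpaceOf N (ψ v₀) := by
  rw [h.tangentSpaceOf_eq]; exact ⟨w, rfl⟩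

/-- The pairing `x ↦ ⟪x, A ·⟫`. -/
def dualOf (A : P →L[ℝ] E) : E →L[ℝ] (P →L[ℝ] ℝ) :=
  ((ContinuousLinearMap.compL ℝ P E ℝ).flip A).comp (innerSL ℝ)

/-- The Gram form `⟪A ·, A ·⟫`. -/
def gramOf (A : P →L[ℝ] E) : P →L[ℝ] (P →L[ℝ] ℝ) := (dualOf A).comp A

/-- The orthogonal projection onto the range of `A`, if `A` is injective. -/
def projOf (A : P →L[ℝ] E) : E →L[ℝ] E := A.comp ((gramOf A).inverse.comp (dualOf A))

@[simp] theorem dualOf_apply (A : P →L[ℝ] E) (x : E) (w : P) : dualOf A x w = ⟪x, A w⟫ := rfl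

@[simp] theorem gramOf_apply (A : P →L[ℝ] E) (w' w : P) : gramOf A w' w = ⟪A w', A w⟫ := rfl

theorem contDiff_dualOf : ContDiff ℝ ∞ (dualOf : (P →L[ℝ] E) → _) := by
  unfold dualOf; fun_prop

theorem contDiff_gramOf : ContDiff ℝ ∞ (gramOf : (P →L[ℝ] E) → _) :=
  contDiff_dualOf.clm_comp contDiff_id

theorem exists_gramOf_equiv {A : P →L[ℝ] E} (hA : Function.Injective A) :
    ∃ e : P ≃L[ℝ] (P →L[ℝ] ℝ), gramOf A = e := by
  have hinj : Function.Injective (gramOf A : P →ₗ[ℝ] (P →L[ℝ] ℝ)) := by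
    rw [← LinearMap.ker_eq_bot, LinearMap.ker_eq_bot']
    intro w hw
    have : gramOf A w w = 0 := by rw [show gramOf A w = 0 from hw]; rfl
    rw [gramOf_apply, inner_self_eq_zero] at this
    exact hA (by rw [this, map_zero])
  have hfin : Module.finrank ℝ P = Module.finrank ℝ (P →L[ℝ] ℝ) := by
    rw [← (LinearMap.toContinuousLinearMap (𝕜 := ℝ) (E := P) (F' := ℝ)).finrank_eq]
    exact (Subspace.dual_finrank_eq (K := ℝ) (V := P)).symm
  refine ⟨(LinearEquiv.ofInjectiveOfFinrankEq _ hinj hfin).toContinuousLinearEquiv, ?_⟩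
  ext w
  rfl

theorem gramOf_inverse_apply {A : P →L[ℝ] E} (hA : Function.Injective A) (ξ : P →L[ℝ] ℝ) :
    gramOf A ((gramOf A).inverse ξ) = ξ := by
  obtain ⟨e, he⟩ := exists_gramOf_equiv hA
  rw [he, ContinuousLinearMap.inverse_equiv]; simp

theorem starProjection_congr {K K' : Submodule ℝ E} (h : K = K') :
    K.starProjection = K'.starProjection := by
  subst h; rfl

/-- `projOf` solves the normal equations. Being an explicit formula in A, it shows that tangential
projections vary smoothly with a chart and extend smoothly to the ambient space. -/
theorem projOf_eq {A : P →L[ℝ] E} (hA : Function.Injective A) :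
    projOf A = (LinearMap.range (A : P →ₗ[ℝ] E)).starProjection := by
  ext x
  symm
  refine Submodule.eq_starProjection_of_mem_of_inner_eq_zero ⟨_, rfl⟩ ?_
  rintro _ ⟨w, rfl⟩
  have := DFunLike.congr_fun (gramOf_inverse_apply hA (dualOf A x)) w
  simp only [gramOf_apply, dualOf_apply] at this
  rw [inner_sub_left]
  simp only [ContinuousLinearMap.coe_coe]
  rw [show projOf A x = A ((gramOf A).inverse (dualOf A x)) from rfl, this, sub_self]

theorem smoothNear_gramOf_inverse {A : P →L[ℝ] E} (hA : Function.Injective A) :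
    SmoothNear (fun A : P →L[ℝ] E => (gramOf A).inverse) A := by
  obtain ⟨e, he⟩ := exists_gramOf_equiv hA
  have := contDiff_gramOf.continuous.tendsto A
  rw [he] at this
  filter_upwards [this (ContinuousLinearEquiv.nhds e)] with B hB
  obtain ⟨e', he'⟩ := hB
  have h1 := contDiffAt_map_inverse (n := ∞) e'
  rw [he'] at h1
  exact ContDiffAt.comp B h1 contDiff_gramOf.contDiffAt

theorem smoothNear_projOf {A : P →L[ℝ] E} (hA : Function.Injective A) :
    SmoothNear (projOf : (P →L[ℝ] E) → _) A := by
  filter_upwards [smoothNear_gramOf_inverse hA] with B hB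
  exact contDiffAt_id.clm_comp (hB.clm_comp contDiff_dualOf.contDiffAt)

theorem ChartGerm.tangentProj_eq (h : ChartGerm N ψ π v₀) :
    tangentProj N (ψ v₀) = projOf (fderiv ℝ ψ v₀) := by
  rw [projOf_eq h.injective, tangentProj, starProjection_congr h.tangentSpaceOf_eq]

/-- The smooth extension of the projections to the tangent spaces given by a chart. -/
def projExt (ψ : P → E) (π : E → P) (x : E) : E →L[ℝ] E := projOf (fderiv ℝ ψ (π x))

theorem ChartGerm.smoothNear_projExt (h : ChartGerm N ψ π v₀) :
    SmoothNear (projExt ψ π) (ψ v₀) := by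
  have h1 : Tendsto π (𝓝 (ψ v₀)) (𝓝 v₀) := by
    have := h.smooth_inv.self.continuousAt.tendsto
    rwa [h.inv_apply] at this
  have h2 := h.smooth.fderiv.self.continuousAt.tendsto.eventually (smoothNear_projOf h.injective)
  filter_upwards [h.smooth_inv, h1.eventually h.smooth.fderiv, h1.eventually h2]
    with x a1 a2 a3
  exact ContDiffAt.comp x a3 (ContDiffAt.comp x a2 a1)

theorem ChartGerm.inv_tendsto (h : ChartGerm N ψ π v₀) : Tendsto π (𝓝 (ψ v₀)) (𝓝 v₀) := by
  have := h.smooth_inv.self.continuousAt.tendsto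
  rwa [h.inv_apply] at this

theorem ChartGerm.eventually_chartGerm_inv (h : ChartGerm N ψ π v₀) :
    ∀ᶠ x in 𝓝 (ψ v₀), x ∈ N → ChartGerm N ψ π (π x) ∧ ψ (π x) = x := by
  filter_upwards [h.inv_tendsto.eventually h.eventually, h.right_inv] with x h1 h2 hx
  exact ⟨h1, h2 hx⟩

theorem ChartGerm.tangentProj_eq_projExt (h : ChartGerm N ψ π v₀) :
    ∀ᶠ x in 𝓝 (ψ v₀), x ∈ N → tangentProj N x = projExt ψ π x := by
  filter_upwards [h.eventually_chartGerm_inv] with x h1 hx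
  obtain ⟨h1, h2⟩ := h1 hx
  rw [projExt, ← h1.tangentProj_eq, h2]

theorem tangentProj_mem (x w : E) : tangentProj N x w ∈ tangentSpaceOf N x :=
  Submodule.starProjection_apply_mem _ _

theorem tangentProj_of_mem {x w : E} (hw : w ∈ tangentSpaceOf N x) : tangentProj N x w = w :=
  Submodule.starProjection_eq_self_iff.2 hw

/-- The covariant derivative of an ambient extension of a tensor field, where `Q` extends the
tangential projections. -/
def covExt (Q : E → E →L[ℝ] E) {j : ℕ} (T : E → E [×j]→L[ℝ] ℝ) : E → E [×(j + 1)]→L[ℝ] ℝ :=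
  fun p => (fderiv ℝ T p).uncurryLeft.compContinuousLinearMap fun _ => Q p

/-- Iterated version of `covExt`. -/
def iterCovExt (Q : E → E →L[ℝ] E) {j : ℕ} (T : E → E [×j]→L[ℝ] ℝ) :
    (k : ℕ) → E → E [×(j + k)]→L[ℝ] ℝ
  | 0 => T
  | k + 1 => covExt Q (iterCovExt Q T k)

/-- Trades the derivative within N for an ordinary derivative of an ambient extension, to which the
calculus of convergent families applies. -/
theorem covDeriv_eq_covExt {Q : E → E →L[ℝ] E} {j : ℕ} {T T' : E → E [×j]→L[ℝ] ℝ} {x : E}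
    (hx : x ∈ N) (hT : ∀ᶠ y in 𝓝 x, y ∈ N → T y = T' y) (hT' : DifferentiableAt ℝ T' x)
    (hQ : tangentProj N x = Q x) : covDeriv N T x = covExt Q T' x := by
  ext m
  simp only [covDeriv, covExt, ContinuousMultilinearMap.compContinuousLinearMap_apply,
    ContinuousLinearMap.uncurryLeft_apply]
  rw [fderivWithin_apply_of_eqOn hx hT hT' (tangentProj_mem _ _), hQ]

/-- Composition of all the arguments of a tensor with a linear map, after uncurrying. -/
def uncurryComp (j : ℕ) (A : (E →L[ℝ] E [×j]→L[ℝ] ℝ) × (E →L[ℝ] E)) : E [×(j + 1)]→L[ℝ] ℝ :=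
  A.1.uncurryLeft.compContinuousLinearMap fun _ => A.2

theorem contDiff_compCLM {F : Type} [NormedAddCommGroup F] [NormedSpace ℝ F] (j : ℕ) :
    ContDiff ℝ ∞ fun A : (F [×j]→L[ℝ] ℝ) × (E →L[ℝ] F) =>
      A.1.compContinuousLinearMap fun _ => A.2 := by
  have h1 : ContDiff ℝ ∞ fun A : (F [×j]→L[ℝ] ℝ) × (E →L[ℝ] F) =>
      ContinuousMultilinearMap.compContinuousLinearMapContinuousMultilinear ℝ
        (fun _ : Fin j => E) (fun _ : Fin j => F) ℝ (fun _ => A.2) :=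
    (ContinuousMultilinearMap.contDiff _).comp (contDiff_pi.2 fun _ => contDiff_snd)
  exact h1.clm_apply contDiff_fst

theorem contDiff_uncurryComp (j : ℕ) : ContDiff ℝ ∞ (uncurryComp (E := E) j) := by
  have h0 : ContDiff ℝ ∞ (fun A : E →L[ℝ] E [×j]→L[ℝ] ℝ =>
      ContinuousLinearMap.uncurryLeft (Ei := fun _ : Fin (j + 1) => E) A) := by
    refine IsBoundedLinearMap.contDiff (IsLinearMap.with_bound
      ⟨fun _ _ => ?_, fun _ _ => ?_⟩ 1 fun A => ?_)
    · ext m; simp [ContinuousLinearMap.uncurryLeft_apply]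
    · ext m; simp [ContinuousLinearMap.uncurryLeft_apply]
    · rw [one_mul]
      refine ContinuousMultilinearMap.opNorm_le_bound (norm_nonneg A) fun m => ?_
      rw [ContinuousLinearMap.uncurryLeft_apply]
      exact ContinuousLinearMap.norm_map_tail_le (Ei := fun _ : Fin (j + 1) => E) A m
  have h1 : ContDiff ℝ ∞ fun A : (E →L[ℝ] E [×j]→L[ℝ] ℝ) × (E →L[ℝ] E) =>
      ContinuousLinearMap.uncurryLeft (Ei := fun _ : Fin (j + 1) => E) A.1 := h0.comp contDiff_fst
  exact (contDiff_compCLM (j + 1)).comp (h1.prodMk contDiff_snd)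

theorem ST.covExt {l : Filter ι} {Q : E → E →L[ℝ] E} {j : ℕ} {x₀ : E}
    {T : ι → E → E [×j]→L[ℝ] ℝ} {T₀ : E → E [×j]→L[ℝ] ℝ} (hT : ST l x₀ T T₀)
    (hQ : SmoothNear Q x₀) : ST l x₀ (fun i => covExt Q (T i)) (covExt Q T₀) :=
  ST.map (f := fun i x => (_root_.fderiv ℝ (T i) x, Q x)) (f₀ := fun x => (_root_.fderiv ℝ T₀ x, Q x))
    (contDiff_uncurryComp j).smoothNear (hT.fderiv.prodMk hQ.ST)

theorem ST.iterCovExt {l : Filter ι} {Q : E → E →L[ℝ] E} {j : ℕ} {x₀ : E}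
    {T : ι → E → E [×j]→L[ℝ] ℝ} {T₀ : E → E [×j]→L[ℝ] ℝ} (hT : ST l x₀ T T₀)
    (hQ : SmoothNear Q x₀) (k : ℕ) :
    ST l x₀ (fun i => iterCovExt Q (T i) k) (iterCovExt Q T₀ k) := by
  induction k with
  | zero => exact hT
  | succ k ih => exact ih.covExt hQ

theorem iterCovDeriv_eventually_eq {l : Filter ι} {Q : E → E →L[ℝ] E} {j : ℕ} {x₀ : E}
    {T' : ι → E → E [×j]→L[ℝ] ℝ} {T₀ : E → E [×j]→L[ℝ] ℝ} (hT : ST l x₀ T' T₀)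
    (hQ : SmoothNear Q x₀) (hQN : ∀ᶠ x in 𝓝 x₀, x ∈ N → tangentProj N x = Q x)
    {T : ι → E → E [×j]→L[ℝ] ℝ} (h : ∀ᶠ p in l ×ˢ 𝓝 x₀, p.2 ∈ N → T p.1 p.2 = T' p.1 p.2) (k : ℕ) :
    ∀ᶠ p in l ×ˢ 𝓝 x₀, p.2 ∈ N → iterCovDeriv N (T p.1) k p.2 = iterCovExt Q (T' p.1) k p.2 := by
  induction k with
  | zero => exact h
  | succ k ih =>
    filter_upwards [eventually_prod_nhds ih, ((hT.iterCovExt hQ k) 0).fam,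
      tendsto_snd.eventually hQN] with p h1 h2 h3 hp
    exact covDeriv_eq_covExt hp h1 (h2.differentiableAt (by simp)) (h3 hp)

theorem iterCovDeriv_zero {j : ℕ} (k : ℕ) (x : E) :
    iterCovDeriv N (fun _ => (0 : E [×j]→L[ℝ] ℝ)) k x = 0 := by
  induction k generalizing x with
  | zero => rfl
  | succ k ih =>
    have : iterCovDeriv N (fun _ => (0 : E [×j]→L[ℝ] ℝ)) k = fun _ => 0 := funext ih
    simp only [iterCovDeriv, this, covDeriv]
    ext m
    simp [ContinuousLinearMap.uncurryLeft_apply]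

/-- If the ambient extensions `T'` of the tensor fields `T` on `N` converge to a tensor field that
vanishes on `N`, then the covariant derivatives of `T` tend to zero. -/
theorem tendsto_iterCovDeriv {l : Filter ι} (hψ : ChartGerm N ψ π v₀) {j : ℕ}
    {T' : ι → E → E [×j]→L[ℝ] ℝ} {T₀ : E → E [×j]→L[ℝ] ℝ} (hT : ST l (ψ v₀) T' T₀)
    {T : ι → E → E [×j]→L[ℝ] ℝ}
    (h : ∀ᶠ p in l ×ˢ 𝓝 (ψ v₀), p.2 ∈ N → T p.1 p.2 = T' p.1 p.2)
    (h₀ : ∀ᶠ x in 𝓝 (ψ v₀), x ∈ N → T₀ x = 0) (k : ℕ) {ε : ℝ} (hε : 0 < ε) :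
    ∀ᶠ p in l ×ˢ 𝓝 (ψ v₀), p.2 ∈ N → ‖iterCovDeriv N (T p.1) k p.2‖ ≤ ε := by
  have h1 := ((hT.iterCovExt hψ.smoothNear_projExt k)).tendsto
  -- The limit extension vanishes on N only, not nearby in the ambient space. Its iterated
  -- derivative at the point still agrees with the intrinsic one, which is that of the zero tensor.
  have h2 : iterCovExt (projExt ψ π) T₀ k (ψ v₀) = 0 := by
    have := iterCovDeriv_eventually_eq (l := (pure () : Filter Unit)) (N := N)
      (hT 0).lim.ST hψ.smoothNear_projExt hψ.tangentProj_eq_projExt (T := fun _ _ => 0)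
      (tendsto_snd.eventually (h₀.mono fun x hx hxN => (hx hxN).symm)) k
    have := (eventually_prod_diag this)
    simp only [eventually_pure] at this
    rw [← this hψ.mem_self, iterCovDeriv_zero]
  rw [h2] at h1
  have h3 := h1.norm
  rw [norm_zero] at h3
  filter_upwards [h3.eventually (gt_mem_nhds hε), iterCovDeriv_eventually_eq hT
    hψ.smoothNear_projExt hψ.tangentProj_eq_projExt h k] with p hp hp' hpN
  rw [hp' hpN]
  exact hp.le

/-! ### Similarities -/

theorem tangentSpaceOf_preimage_similarity {s : ℝ} (hs : s ≠ 0) (b x : E) :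
    tangentSpaceOf ((fun y => s • y + b) ⁻¹' N) x = tangentSpaceOf N (s • x + b) := by
  apply le_antisymm
  · refine Submodule.span_le.2 fun w hw => ?_
    have h1 : HasFDerivWithinAt (fun y : E => s • y + b) (s • ContinuousLinearMap.id ℝ E)
        ((fun y => s • y + b) ⁻¹' N) x :=
      (((hasFDerivAt_id x).const_smul s).add_const b).hasFDerivWithinAt
    have h2 := tangentConeAt_mono (image_preimage_subset _ _) (h1.mapsTo_tangent_cone hw)
    have h3 : s • w ∈ tangentSpaceOf N (s • x + b) := Submodule.subset_span h2
    have := Submodule.smul_mem _ s⁻¹ h3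
    rwa [smul_smul, inv_mul_cancel₀ hs, one_smul] at this
  · refine Submodule.span_le.2 fun w hw => ?_
    have h1 : HasFDerivWithinAt (fun y : E => s⁻¹ • (y - b)) (s⁻¹ • ContinuousLinearMap.id ℝ E)
        N (s • x + b) :=
      (((hasFDerivAt_id _).sub_const b).const_smul s⁻¹).hasFDerivWithinAt
    have h2 := h1.mapsTo_tangent_cone hw
    have h4 : s⁻¹ • (s • x + b - b) = x := by
      rw [add_sub_cancel_right, smul_smul, inv_mul_cancel₀ hs, one_smul]
    rw [h4] at h2
    have h5 : (fun y : E => s⁻¹ • (y - b)) '' N ⊆ (fun y => s • y + b) ⁻¹' N := by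
      rintro _ ⟨y, hy, rfl⟩
      simpa [smul_smul, mul_inv_cancel₀ hs] using hy
    have h3 : s⁻¹ • w ∈ tangentSpaceOf ((fun y => s • y + b) ⁻¹' N) x :=
      Submodule.subset_span (tangentConeAt_mono h5 h2)
    have := Submodule.smul_mem _ s h3
    rwa [smul_smul, mul_inv_cancel₀ hs, one_smul] at this

theorem fderivWithin_comp_similarity {s : ℝ} (hs : s ≠ 0) (b x : E) {c : ℝ} (hc : c ≠ 0)
    (f : E → F) {w : E} (hw : w ∈ tangentSpaceOf N (s • x + b)) :
    fderivWithin ℝ (fun y => c • f (s • y + b)) ((fun y => s • y + b) ⁻¹' N) x w =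
      (c * s) • fderivWithin ℝ f N (s • x + b) w := by
  by_cases hf : DifferentiableWithinAt ℝ f N (s • x + b)
  · have h1 : HasFDerivWithinAt (fun y : E => s • y + b) (s • ContinuousLinearMap.id ℝ E)
        ((fun y => s • y + b) ⁻¹' N) x :=
      (((hasFDerivAt_id x).const_smul s).add_const b).hasFDerivWithinAt
    have h2 := (hf.hasFDerivWithinAt.comp x h1 (mapsTo_preimage _ _)).const_smul c
    rw [← tangentSpaceOf_preimage_similarity hs] at hw
    refine (fderivWithin_apply_of_hasFDerivWithinAt h2 hw).trans ?_
    simp [smul_smul]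
  -- Without differentiability both sides are the default value 0; the inverse similarity carries
  -- differentiability back.
  · have : ¬ DifferentiableWithinAt ℝ (fun y => c • f (s • y + b))
        ((fun y => s • y + b) ⁻¹' N) x := by
      intro h
      apply hf
      have h1 : HasFDerivWithinAt (fun y : E => s⁻¹ • (y - b)) (s⁻¹ • ContinuousLinearMap.id ℝ E)
          N (s • x + b) :=
        (((hasFDerivAt_id _).sub_const b).const_smul s⁻¹).hasFDerivWithinAt
      have h4 : s⁻¹ • (s • x + b - b) = x := by
        rw [add_sub_cancel_right, smul_smul, inv_mul_cancel₀ hs, one_smul]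
      have h5 : MapsTo (fun y : E => s⁻¹ • (y - b)) N ((fun y => s • y + b) ⁻¹' N) := by
        intro y hy
        simpa [smul_smul, mul_inv_cancel₀ hs] using hy
      rw [← h4] at h
      have h6 := (h.comp (s • x + b) h1.differentiableWithinAt h5).const_smul c⁻¹
      refine h6.congr (fun y _ => ?_) ?_ <;>
        simp [smul_smul, inv_mul_cancel₀ hc, mul_inv_cancel₀ hs, inv_mul_cancel₀ hs]
    rw [fderivWithin_zero_of_not_differentiableWithinAt hf,
      fderivWithin_zero_of_not_differentiableWithinAt this]
    simp

/-- A similarity does not change the tangential projections, and each derivative contributes one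
factor s. This is the source of the powers of r in the estimates. -/
theorem iterCovDeriv_comp_similarity {s : ℝ} (hs : s ≠ 0) (b x : E) {j : ℕ}
    (T : E → E [×j]→L[ℝ] ℝ) (k : ℕ) :
    iterCovDeriv ((fun y => s • y + b) ⁻¹' N) (fun y => T (s • y + b)) k x =
      s ^ k • iterCovDeriv N T k (s • x + b) := by
  induction k generalizing x with
  | zero => simp [iterCovDeriv]
  | succ k ih =>
    have h1 : iterCovDeriv ((fun y => s • y + b) ⁻¹' N) (fun y => T (s • y + b)) k =
        fun y => s ^ k • iterCovDeriv N T k (s • y + b) := funext ih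
    have h2 : tangentProj ((fun y => s • y + b) ⁻¹' N) x = tangentProj N (s • x + b) := by
      unfold tangentProj
      rw [starProjection_congr (tangentSpaceOf_preimage_similarity hs b x)]
    simp only [iterCovDeriv, h1]
    ext m
    simp only [covDeriv, ContinuousMultilinearMap.compContinuousLinearMap_apply,
      ContinuousLinearMap.uncurryLeft_apply, smul_apply]
    rw [h2, fderivWithin_comp_similarity hs b x (pow_ne_zero k hs) (iterCovDeriv N T k)
      (tangentProj_mem _ _), pow_succ]
    rfl

end Charts

end SLGeom

end

noncomputable section

namespace SLGeom

/-! ## Families of submanifolds converging smoothly near a point -/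

section Convergence

variable {ι : Type} {E P : Type} [NormedAddCommGroup E] [InnerProductSpace ℝ E]
  [FiniteDimensional ℝ E] [NormedAddCommGroup P] [NormedSpace ℝ P] [FiniteDimensional ℝ P]
variable {l : Filter ι} {N : Set E} {X : ι → Set E} {ψ : P → E} {π : E → P} {v₀ : P}
  {ψi : ι → P → E}

/-- Near `ψ v₀` the sets `X i` converge to `N`: they have parametrizations `ψi i` which converge
smoothly to the parametrization `ψ` of `N` and cover all points of `X i` near `ψ v₀`. -/
structure SmoothlyConverges (l : Filter ι) (X : ι → Set E) (N : Set E) (ψ : P → E) (π : E → P)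
    (v₀ : P) (ψi : ι → P → E) : Prop where
  chart : ChartGerm N ψ π v₀
  st : ST l v₀ ψi ψ
  mem : ∀ᶠ p in l ×ˢ 𝓝 v₀, ψi p.1 p.2 ∈ X p.1
  cover : ∀ V ∈ 𝓝 v₀, ∀ᶠ p in l ×ˢ 𝓝 (ψ v₀), p.2 ∈ X p.1 → ∃ v ∈ V, ψi p.1 v = p.2

/-- The nearest-point projection from `N` to `X` exists and is smooth near `p`, and the covariant
derivatives at `p` of the difference of the metrics are bounded by `ε`. -/
def NearGood (N X : Set E) (K : ℕ) (ε : ℕ → ℝ) (p : E) : Prop :=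
  ∃ (O : Set E) (f : E → E), IsOpen O ∧ p ∈ O ∧ (∀ q ∈ N ∩ O, IsNearestPoint X q (f q)) ∧
    ContDiffOn ℝ ∞ f (N ∩ O) ∧
    ∀ k ≤ K, ‖iterCovDeriv N (fun q => pullbackMetric N f q - inducedMetric N q) k p‖ ≤ ε k

/-- The map whose zeros `(v, w)` are the critical points `ψ' v` of the distance from `ψ w`,
together with `w`. -/
def critMap (ψ ψ' : P → E) (p : P × P) : (P →L[ℝ] ℝ) × P :=
  (dualOf (fderiv ℝ ψ' p.1) (ψ' p.1 - ψ p.2), p.2)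

theorem ST.comp_fst {F Q : Type} [NormedAddCommGroup F] [NormedSpace ℝ F] [NormedAddCommGroup Q]
    [NormedSpace ℝ Q] {f : ι → P → F} {f₀ : P → F} {q₀ : Q}
    (hf : ST l v₀ f f₀) : ST l (v₀, q₀) (fun i p => f i p.1) (fun p => f₀ p.1) :=
  ST.comp (f := fun _ p => p.1) (f₀ := fun p : P × Q => p.1) hf
    (SmoothNear.ST contDiff_fst.smoothNear)

theorem ST.comp_snd {F Q : Type} [NormedAddCommGroup F] [NormedSpace ℝ F] [NormedAddCommGroup Q]
    [NormedSpace ℝ Q] {f : ι → P → F} {f₀ : P → F} {q₀ : Q}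
    (hf : ST l v₀ f f₀) : ST l (q₀, v₀) (fun i p => f i p.2) (fun p => f₀ p.2) :=
  ST.comp (f := fun _ p => p.2) (f₀ := fun p : Q × P => p.2) hf
    (SmoothNear.ST contDiff_snd.smoothNear)

theorem SmoothlyConverges.critMap_st (h : SmoothlyConverges l X N ψ π v₀ ψi) :
    ST l (v₀, v₀) (fun i => critMap ψ (ψi i)) (critMap ψ ψ) := by
  have h1 := (h.st.fderiv.comp_fst (q₀ := v₀)).prodMk
    ((h.st.comp_fst (q₀ := v₀)).prodMk ((h.chart.smooth.ST (l := l)).comp_snd (q₀ := v₀)))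
  have h2 := h1.prodMk (SmoothNear.ST (l := l) (x₀ := (v₀, v₀)) (f₀ := fun p : P × P => p.2)
    contDiff_snd.smoothNear)
  have hΨ : ContDiff ℝ ∞ (fun q : ((P →L[ℝ] E) × E × E) × P =>
      (dualOf q.1.1 (q.1.2.1 - q.1.2.2), q.2)) := by
    refine ContDiff.prodMk (ContDiff.clm_apply (contDiff_dualOf.comp ?_) ?_) contDiff_snd <;>
      fun_prop
  exact h2.map hΨ.smoothNear

theorem critMap_self (w : P) : critMap ψ ψ (w, w) = (0, w) := by simp [critMap]

/-- On the diagonal ψ v - ψ w vanishes, so the derivative of the factor `dualOf` drops out. What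
remains is (p, q) ↦ (M(p - q), q) with M the invertible Gram form. -/
theorem ChartGerm.exists_fderiv_critMap (h : ChartGerm N ψ π v₀) :
    ∃ e : (P × P) ≃L[ℝ] ((P →L[ℝ] ℝ) × P), fderiv ℝ (critMap ψ ψ) (v₀, v₀) = e := by
  obtain ⟨M, hM⟩ := exists_gramOf_equiv h.injective
  set A := fderiv ℝ ψ v₀ with hA
  have hψ : HasFDerivAt ψ A v₀ := h.differentiableAt.hasFDerivAt
  have h1 : HasFDerivAt (fun p : P × P => ψ p.1 - ψ p.2)
      (A.comp (ContinuousLinearMap.fst ℝ P P) - A.comp (ContinuousLinearMap.snd ℝ P P))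
      (v₀, v₀) :=
    (HasFDerivAt.comp (v₀, v₀) (g := ψ) hψ hasFDerivAt_fst).sub
      (HasFDerivAt.comp (v₀, v₀) (g := ψ) hψ hasFDerivAt_snd)
  have h2 : DifferentiableAt ℝ (fun p : P × P => dualOf (fderiv ℝ ψ p.1)) (v₀, v₀) := by
    have a : DifferentiableAt ℝ (fderiv ℝ ψ) v₀ := h.smooth.fderiv.self.differentiableAt (by simp)
    have b : DifferentiableAt ℝ (fun p : P × P => fderiv ℝ ψ p.1) (v₀, v₀) :=
      DifferentiableAt.comp (v₀, v₀) (g := fderiv ℝ ψ) a differentiableAt_fst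
    exact DifferentiableAt.comp (v₀, v₀) (contDiff_dualOf.differentiable (by simp) _) b
  have h3 := (h2.hasFDerivAt.clm_apply h1).prodMk (hasFDerivAt_snd (p := (v₀, v₀)) (𝕜 := ℝ))
  let e : (P × P) ≃L[ℝ] ((P →L[ℝ] ℝ) × P) := ContinuousLinearEquiv.equivOfInverse
    (((M : P →L[ℝ] (P →L[ℝ] ℝ)).comp (ContinuousLinearMap.fst ℝ P P -
      ContinuousLinearMap.snd ℝ P P)).prod (ContinuousLinearMap.snd ℝ P P))
    (((M.symm : (P →L[ℝ] ℝ) →L[ℝ] P).comp (ContinuousLinearMap.fst ℝ (P →L[ℝ] ℝ) P) +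
      ContinuousLinearMap.snd ℝ (P →L[ℝ] ℝ) P).prod (ContinuousLinearMap.snd ℝ (P →L[ℝ] ℝ) P))
    (fun p => by simp) (fun p => by simp)
  refine ⟨e, ?_⟩
  refine (HasFDerivAt.fderiv h3).trans ?_
  refine ContinuousLinearMap.ext fun p => Prod.ext ?_ rfl
  have : dualOf A (A p.1 - A p.2) = M (p.1 - p.2) := by
    rw [← map_sub]
    exact DFunLike.congr_fun hM (p.1 - p.2)
  simpa [e] using this

theorem fderiv_dist_eq_zero {ψ' : P → E} {v : P} {x : E} {s : Set P} (hs : s ∈ 𝓝 v)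
    (hψ : DifferentiableAt ℝ ψ' v) (hmin : ∀ v' ∈ s, dist x (ψ' v) ≤ dist x (ψ' v')) :
    dualOf (fderiv ℝ ψ' v) (ψ' v - x) = 0 := by
  have h1 : IsLocalMin (fun v' => ‖ψ' v' - x‖ ^ 2) v := by
    filter_upwards [hs] with v' hv'
    have := hmin v' hv'
    rw [dist_comm, dist_comm x, dist_eq_norm, dist_eq_norm] at this
    gcongr
  have h2 := (hψ.hasFDerivAt.sub_const x).norm_sq.fderiv
  rw [h1.fderiv_eq_zero] at h2
  ext w
  have := DFunLike.congr_fun h2 w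
  simp at this
  rw [dualOf_apply, inner_sub_left]
  exact this

/-- The inverse of `critMap` at (0, w) gives the only critical point of the distance near v₀. A
minimizer exists on a closed ball of parameters, and by the covering condition every point of X i
that is at least as close is such a critical point. Existence, uniqueness and smoothness follow
together. -/
theorem SmoothlyConverges.exists_nearest (h : SmoothlyConverges l X N ψ π v₀ ψi) :
    ∃ (f : ι → E → E) (f₀ : E → E), ST l (ψ v₀) f f₀ ∧ (∀ᶠ x in 𝓝 (ψ v₀), f₀ x = ψ (π x)) ∧
      ∀ᶠ p in l ×ˢ 𝓝 (ψ v₀), p.2 ∈ N → IsNearestPoint (X p.1) p.2 (f p.1 p.2) := by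
  obtain ⟨e, he⟩ := h.chart.exists_fderiv_critMap
  obtain ⟨G, G₀, hG, hG₀, hl, -, hl₀, -⟩ := exists_inverse_family h.critMap_st e he
  rw [critMap_self] at hG
  have hvi : ST l v₀ (fun i w => (G i (0, w)).1) (fun w => (G₀ (0, w)).1) := by
    refine ST.clm (ContinuousLinearMap.fst ℝ P P) (f := fun i w => G i (0, w))
      (f₀ := fun w => G₀ (0, w)) ?_
    refine ST.comp (f := fun _ w => ((0 : P →L[ℝ] ℝ), w)) (f₀ := fun w => ((0 : P →L[ℝ] ℝ), w)) hG
      (SmoothNear.ST (ContDiff.smoothNear ?_))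
    fun_prop
  have hv₀ : ∀ᶠ w in 𝓝 v₀, (G₀ (0, w)).1 = w := by
    have : Tendsto (fun w : P => (w, w)) (𝓝 v₀) (𝓝 (v₀, v₀)) :=
      (continuous_id.prodMk continuous_id).tendsto v₀
    filter_upwards [this.eventually hl₀] with w hw
    rw [critMap_self] at hw
    rw [hw]
  have hv₀' := hv₀.self_of_nhds
  have hπ : ST l (ψ v₀) (fun _ => π) π := h.chart.smooth_inv.ST
  have hvπ : ST l (ψ v₀) (fun i x => (G i (0, π x)).1) (fun x => (G₀ (0, π x)).1) := by
    refine ST.comp (h := fun i w => (G i (0, w)).1) (h₀ := fun w => (G₀ (0, w)).1) ?_ hπ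
    rw [h.chart.inv_apply]; exact hvi
  refine ⟨fun i x => ψi i (G i (0, π x)).1, fun x => ψ (G₀ (0, π x)).1, ?_, ?_, ?_⟩
  · refine ST.comp (f₀ := fun x => (G₀ (0, π x)).1) ?_ hvπ
    rw [h.chart.inv_apply, hv₀']; exact h.st
  · filter_upwards [h.chart.inv_tendsto.eventually hv₀] with x hx
    rw [hx]
  obtain ⟨ρ, hρ, hl⟩ := eventually_prod_uniform hl
  obtain ⟨ρ', hρ', hm⟩ := eventually_prod_uniform (h.mem.and (h.st 0).fam)
  set η := min ρ ρ' / 2 with hη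
  have hηpos : 0 < η := by positivity
  have hηρ : η < ρ := by have := min_le_left ρ ρ'; have : 0 < min ρ ρ' := by positivity
                         linarith
  have hηρ' : η < ρ' := by have := min_le_right ρ ρ'; have : 0 < min ρ ρ' := by positivity
                           linarith
  obtain ⟨ρ₂, hρ₂, hc⟩ := eventually_prod_uniform (h.cover (ball v₀ η) (ball_mem_nhds _ hηpos))
  have hdist : ∀ᶠ p in l ×ˢ 𝓝 (ψ v₀), dist p.2 (ψi p.1 v₀) < ρ₂ / 2 := by
    have a : Tendsto (fun i => ψi i v₀) l (𝓝 (ψ v₀)) :=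
      h.st.tendsto.comp (tendsto_id.prodMk tendsto_const_nhds)
    have b := (tendsto_snd (f := l) (g := 𝓝 (ψ v₀))).dist (a.comp tendsto_fst)
    rw [dist_self] at b
    exact b.eventually (gt_mem_nhds (by positivity))
  filter_upwards [hdist, tendsto_snd.eventually (ball_mem_nhds (ψ v₀) (half_pos hρ₂)),
    tendsto_fst.eventually hl, tendsto_fst.eventually hm, tendsto_fst.eventually hc,
    tendsto_snd.eventually h.chart.right_inv,
    tendsto_snd.eventually (h.chart.inv_tendsto.eventually (ball_mem_nhds v₀ hρ))]
    with ⟨i, x⟩ h1 h2 h3 h4 h5 h6 h7 hx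
  simp only at h1 h2 h3 h4 h5 h6 h7 hx ⊢
  have hψx := h6 hx
  have hcont : ContinuousOn (fun v => dist x (ψi i v)) (closedBall v₀ η) := by
    intro v hv
    exact ContinuousAt.continuousWithinAt (tendsto_const_nhds.dist
      (h4 v (closedBall_subset_ball hηρ' hv)).2.continuousAt.tendsto)
  obtain ⟨vs, hvs, hmin⟩ := (isCompact_closedBall v₀ η).exists_isMinOn
    ⟨v₀, mem_closedBall_self hηpos.le⟩ hcont
  have hmin' : ∀ v' ∈ closedBall v₀ η, dist x (ψi i vs) ≤ dist x (ψi i v') := fun v' hv' => hmin hv'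
  -- Competitors lie near ψ v₀, so they have parameters in the open ball of radius η, where
  -- minimality forces criticality. Applied to the minimizer itself, this also disposes of
  -- minimizers on the boundary of the closed ball.
  have huniq : ∀ q ∈ X i, dist x q ≤ dist x (ψi i vs) → q = ψi i (G i (0, π x)).1 := by
    intro q hq hle
    have hqy : q ∈ ball (ψ v₀) ρ₂ := by
      have a1 := hmin' v₀ (mem_closedBall_self hηpos.le)
      have a2 := dist_triangle q x (ψ v₀)
      rw [dist_comm q x] at a2
      rw [mem_ball]
      linarith
    obtain ⟨v, hv, rfl⟩ := h5 q hqy hq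
    have hv' : v ∈ ball v₀ ρ := ball_subset_ball hηρ.le hv
    have hcrit := fderiv_dist_eq_zero (isOpen_ball.mem_nhds hv)
      ((h4 v (ball_subset_ball hηρ'.le hv)).2.differentiableAt (by simp))
      (x := x) (fun v' hv' => hle.trans (hmin' v' (ball_subset_closedBall hv')))
    have := h3 (v, π x) (by
      rw [← ball_prod_same]; exact ⟨hv', h7⟩)
    simp only [critMap] at this
    rw [hψx, hcrit] at this
    rw [this]
  have hvs' : ψi i vs = ψi i (G i (0, π x)).1 :=
    huniq _ (h4 vs (closedBall_subset_ball hηρ' hvs)).1 le_rfl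
  refine ⟨hvs' ▸ (h4 vs (closedBall_subset_ball hηρ' hvs)).1, fun q hq hne => ?_⟩
  by_contra hcon
  refine hne (huniq q hq ?_)
  rw [hvs']
  exact not_lt.1 hcon

/-- The limit projection is ψ ∘ π, the identity on N. Hence the ambient extensions of the metric
differences converge to a tensor field that vanishes on N. -/
theorem SmoothlyConverges.nearGood (h : SmoothlyConverges l X N ψ π v₀ ψi) (K : ℕ) {ε : ℝ}
    (hε : 0 < ε) :
    ∀ᶠ p in l ×ˢ 𝓝 (ψ v₀), p.2 ∈ N → NearGood N (X p.1) K (fun _ => ε) p.2 := by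
  obtain ⟨f, f₀, hf, hf₀, hnear⟩ := h.exists_nearest
  set Q := projExt ψ π
  let Θ : (E →L[ℝ] E) → E [×2]→L[ℝ] ℝ := fun A => (euclidTensor E).compContinuousLinearMap fun _ => A
  have hΘ : ContDiff ℝ ∞ Θ := (contDiff_compCLM (E := E) 2).comp (contDiff_const.prodMk contDiff_id)
  have hQ : SmoothNear Q (ψ v₀) := h.chart.smoothNear_projExt
  have hQN := h.chart.tangentProj_eq_projExt
  have hT : ST l (ψ v₀) (fun i x => Θ ((fderiv ℝ (f i) x).comp (Q x)) - Θ (Q x))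
      (fun x => Θ ((fderiv ℝ f₀ x).comp (Q x)) - Θ (Q x)) := by
    have h1 : ContDiff ℝ ∞ (fun q : (E →L[ℝ] E) × (E →L[ℝ] E) => Θ (q.1.comp q.2) - Θ q.2) := by
      refine ContDiff.sub (hΘ.comp (contDiff_fst.clm_comp contDiff_snd)) (hΘ.comp contDiff_snd)
    exact ST.map (f := fun i x => (fderiv ℝ (f i) x, Q x)) (f₀ := fun x => (fderiv ℝ f₀ x, Q x))
      h1.smoothNear (hf.fderiv.prodMk hQ.ST)
  have hTN : ∀ᶠ p in l ×ˢ 𝓝 (ψ v₀), p.2 ∈ N →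
      pullbackMetric N (f p.1) p.2 - inducedMetric N p.2 =
        Θ ((fderiv ℝ (f p.1) p.2).comp (Q p.2)) - Θ (Q p.2) := by
    filter_upwards [(hf 0).fam, tendsto_snd.eventually hQN] with p h1 h2 hp
    have h3 : (fderivWithin ℝ (f p.1) N p.2).comp (tangentProj N p.2) =
        (fderiv ℝ (f p.1) p.2).comp (tangentProj N p.2) := by
      ext w
      exact fderivWithin_apply_of_hasFDerivWithinAt
        (h1.differentiableAt (by simp)).hasFDerivAt.hasFDerivWithinAt (tangentProj_mem _ _)
    simp only [pullbackMetric, inducedMetric, Θ]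
    rw [h3, h2 hp]
  have hT₀ : ∀ᶠ x in 𝓝 (ψ v₀), x ∈ N → Θ ((fderiv ℝ f₀ x).comp (Q x)) - Θ (Q x) = 0 := by
    filter_upwards [(hf 0).lim, hQN, eventually_eventually_nhds.2 hf₀,
      eventually_eventually_nhds.2 h.chart.right_inv] with x h1 h2 h3 h4 hx
    have h5 : (fderiv ℝ f₀ x).comp (Q x) = Q x := by
      ext w
      have hw : Q x w ∈ tangentSpaceOf N x := by
        have := tangentProj_mem (N := N) x w
        rwa [h2 hx] at this
      have a1 := fderivWithin_apply_of_eqOn (f := fun y => y) (f' := f₀) hx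
        (by filter_upwards [h3, h4] with y h3 h4 hy; rw [h3, h4 hy])
        (h1.differentiableAt (by simp)) hw
      rw [ContinuousLinearMap.comp_apply, ← a1]
      exact fderivWithin_apply_of_hasFDerivWithinAt (hasFDerivWithinAt_id _ _) hw
    rw [h5, sub_self]
  have hder : ∀ᶠ p in l ×ˢ 𝓝 (ψ v₀), p.2 ∈ N → ∀ k ≤ K, ‖iterCovDeriv N
      (fun q => pullbackMetric N (f p.1) q - inducedMetric N q) k p.2‖ ≤ ε := by
    have : ∀ k ∈ Finset.range (K + 1), ∀ᶠ p in l ×ˢ 𝓝 (ψ v₀), p.2 ∈ N → ‖iterCovDeriv N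
      (fun q => pullbackMetric N (f p.1) q - inducedMetric N q) k p.2‖ ≤ ε := fun k _ =>
        tendsto_iterCovDeriv h.chart hT (T := fun i q => pullbackMetric N (f i) q -
          inducedMetric N q) hTN hT₀ k hε
    have h2 := (Filter.eventually_all_finset _).2 this
    filter_upwards [h2] with p hp hpN k hk
    exact hp k (Finset.mem_range.2 (by omega)) hpN
  filter_upwards [hder, eventually_prod_nhds (hnear.and (hf 0).fam)] with p h1 h2 hp
  obtain ⟨O, hO, hOo, hpO⟩ := _root_.eventually_nhds_iff.1 h2
  exact ⟨O, f p.1, hOo, hpO, fun q hq => (hO q hq.2).1 hq.1,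
    fun q hq => (hO q hq.2).2.contDiffWithinAt, h1 hp⟩

end Convergence

end SLGeom

end

noncomputable section

namespace SLGeom

/-! ## Gluing, rescaling and bounded charts -/

section Scaling

variable {ι : Type} {E P : Type} [NormedAddCommGroup E] [InnerProductSpace ℝ E]
  [FiniteDimensional ℝ E] [NormedAddCommGroup P] [NormedSpace ℝ P] [FiniteDimensional ℝ P]
variable {l : Filter ι} {N : Set E} {X : Set E} {K : ℕ}

theorem IsNearestPoint.unique {p q q' : E} (h : IsNearestPoint X p q) (h' : IsNearestPoint X p q') :
    q = q' := by
  by_contra hne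
  exact lt_asymm (h.2 q' h'.1 (Ne.symm hne)) (h'.2 q h.1 hne)

theorem iterCovDeriv_congr {j : ℕ} {T T' : E → E [×j]→L[ℝ] ℝ} {O : Set E} (hO : IsOpen O)
    (h : ∀ x ∈ N ∩ O, T x = T' x) (k : ℕ) :
    ∀ x ∈ N ∩ O, iterCovDeriv N T k x = iterCovDeriv N T' k x := by
  induction k with
  | zero => exact h
  | succ k ih =>
    intro x hx
    have : fderivWithin ℝ (iterCovDeriv N T k) N x = fderivWithin ℝ (iterCovDeriv N T' k) N x := by
      refine Filter.EventuallyEq.fderivWithin_eq ?_ (ih x hx)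
      refine eventually_nhdsWithin_iff.2 ?_
      filter_upwards [hO.mem_nhds hx.2] with y hy hyN using ih y ⟨hyN, hy⟩
    simp only [iterCovDeriv, covDeriv, this]

-- Nearest points are unique, so the local projections agree on overlaps and glue to one map, chosen
-- pointwise wherever a nearest point exists.
open Classical in
theorem metricCloseOn_of_nearGood {r : E → ℝ} {D : Set E} {ε : ℝ}
    (h : ∀ p ∈ D, p ∈ N ∧ NearGood N X K (fun k => ε / r p ^ k) p) :
    MetricCloseOn r N X D K ε := by
  choose! h1 O f hO hpO hnear hsm hb using h
  let F : E → E := fun q => if hq : ∃ y, IsNearestPoint X q y then hq.choose else q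
  have hF : ∀ p ∈ D, ∀ q ∈ N ∩ O p, F q = f p q := by
    intro p hp q hq
    have hex : ∃ y, IsNearestPoint X q y := ⟨_, hnear p hp q hq⟩
    have : F q = hex.choose := dif_pos hex
    rw [this]
    exact hex.choose_spec.unique (hnear p hp q hq)
  refine ⟨⋃ p ∈ D, O p, F, isOpen_biUnion hO, fun p hp => ⟨h1 p hp, mem_biUnion hp (hpO p hp)⟩,
    ?_, ?_, ?_⟩
  · rintro q ⟨hqN, hq⟩
    obtain ⟨p, hp, hq⟩ := mem_iUnion₂.1 hq
    rw [hF p hp q ⟨hqN, hq⟩]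
    exact hnear p hp q ⟨hqN, hq⟩
  · rintro q ⟨hqN, hq⟩
    obtain ⟨p, hp, hq⟩ := mem_iUnion₂.1 hq
    have a1 := (hsm p hp).congr (hF p hp) q ⟨hqN, hq⟩
    refine a1.mono_of_mem_nhdsWithin ?_
    refine mem_of_superset (inter_mem_nhdsWithin _ ((hO p hp).mem_nhds hq)) ?_
    rintro y ⟨⟨hyN, -⟩, hy⟩
    exact ⟨hyN, hy⟩
  · intro k hk p hp
    have key : ∀ q ∈ N ∩ O p, pullbackMetric N F q - inducedMetric N q =
        pullbackMetric N (f p) q - inducedMetric N q := by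
      intro q hq
      have : fderivWithin ℝ F N q = fderivWithin ℝ (f p) N q := by
        refine Filter.EventuallyEq.fderivWithin_eq ?_ (hF p hp q hq)
        refine eventually_nhdsWithin_iff.2 ?_
        filter_upwards [(hO p hp).mem_nhds hq.2] with y hy hyN using hF p hp y ⟨hyN, hy⟩
      simp only [pullbackMetric, this]
    rw [iterCovDeriv_congr (hO p hp) key k p ⟨h1 p hp, hpO p hp⟩]
    exact hb p hp k hk

/-- Conjugating the projection by the similarity leaves its derivative unchanged, so the metric
difference as a tensor is merely transported. Only the k covariant derivatives cost a factor s^{-k}.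
-/
theorem NearGood.similarity {s : ℝ} (hs : 0 < s) {b p : E} {ε : ℕ → ℝ}
    (h : NearGood ((fun y => s • y + b) ⁻¹' N) ((fun y => s • y + b) ⁻¹' X) K ε p) :
    NearGood N X K (fun k => ε k / s ^ k) (s • p + b) := by
  obtain ⟨O, f, hO, hpO, hnear, hsm, hb⟩ := h
  set σ : E → E := fun y => s • y + b with hσ
  set τ : E → E := fun y => s⁻¹ • (y - b) with hτ
  have hs' := hs.ne'
  have hστ : ∀ y, σ (τ y) = y := fun y => by simp [hσ, hτ, smul_smul, mul_inv_cancel₀ hs']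
  have hτσ : ∀ y, τ (σ y) = y := fun y => by simp [hσ, hτ, smul_smul, inv_mul_cancel₀ hs']
  have hτc : ContDiff ℝ ∞ τ := by unfold τ; fun_prop
  have hσc : ContDiff ℝ ∞ σ := by unfold σ; fun_prop
  have hdist : ∀ x y, dist (σ x) (σ y) = s * dist x y := by
    intro x y
    simp [hσ, dist_smul₀, abs_of_pos hs]
  refine ⟨τ ⁻¹' O, fun y => σ (f (τ y)), hO.preimage hτc.continuous, ?_, ?_, ?_, ?_⟩
  · change τ (σ p) ∈ O
    rwa [hτσ]
  · rintro q ⟨hqN, hqO⟩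
    have h1 := hnear (τ q) ⟨by change σ (τ q) ∈ N; rwa [hστ], hqO⟩
    refine ⟨h1.1, fun q' hq' hne => ?_⟩
    have h2 := h1.2 (τ q') (by change σ (τ q') ∈ X; rwa [hστ]) (fun h => hne (by
      simp only [← h, hστ]))
    have h3 := mul_lt_mul_of_pos_left h2 hs
    rwa [← hdist, ← hdist, hστ, hστ] at h3
  · refine hσc.comp_contDiffOn (hsm.comp hτc.contDiffOn ?_)
    rintro q ⟨hqN, hqO⟩
    exact ⟨by change σ (τ q) ∈ N; rwa [hστ], hqO⟩
  · intro k hk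
    have key : (fun q => pullbackMetric (σ ⁻¹' N) f q - inducedMetric (σ ⁻¹' N) q) =
        fun q => (fun q => pullbackMetric N (fun y => σ (f (τ y))) q - inducedMetric N q)
          (s • q + b) := by
      funext q
      have e1 : tangentProj (σ ⁻¹' N) q = tangentProj N (s • q + b) := by
        unfold tangentProj
        rw [starProjection_congr (tangentSpaceOf_preimage_similarity hs' b q)]
      have e2 : (fderivWithin ℝ f (σ ⁻¹' N) q).comp (tangentProj N (s • q + b)) =
          (fderivWithin ℝ (fun y => σ (f (τ y))) N (s • q + b)).comp
            (tangentProj N (s • q + b)) := by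
        ext w
        have hw := tangentProj_mem (N := N) (s • q + b) w
        have a1 := fderivWithin_comp_similarity (N := N) hs' b q (inv_ne_zero hs')
          (fun y => σ (f (τ y)) - b) hw
        have a2 : (fun y => s⁻¹ • (σ (f (τ (s • y + b))) - b)) = f := by
          funext y
          change τ (σ (f (τ (σ y)))) = f y
          rw [hτσ, hτσ]
        rw [a2] at a1
        rw [inv_mul_cancel₀ hs', one_smul, fderivWithin_sub_const] at a1
        exact a1
      simp only [pullbackMetric, inducedMetric]
      rw [e1, e2]
    have h1 := hb k hk
    rw [key] at h1
    rw [iterCovDeriv_comp_similarity hs' b p (N := N)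
      (fun q => pullbackMetric N (fun y => σ (f (τ y))) q - inducedMetric N q) k, norm_smul,
      norm_pow, Real.norm_of_nonneg hs.le] at h1
    rw [le_div_iff₀ (by positivity), mul_comm]
    exact h1

theorem NearGood.mono {ε ε' : ℕ → ℝ} {p : E} (h : NearGood N X K ε p) (hε : ∀ k ≤ K, ε k ≤ ε' k) :
    NearGood N X K ε' p := by
  obtain ⟨O, f, hO, hpO, hnear, hsm, hb⟩ := h
  exact ⟨O, f, hO, hpO, hnear, hsm, fun k hk => (hb k hk).trans (hε k hk)⟩

variable {m : ℕ}

/-- The image of the smaller ball remains relatively open because the inverse of the chart is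
continuous on the image. -/
theorem HasBoundedChartAt.mono {R δ δ' B B' : ℝ} {q : E} (h : HasBoundedChartAt m K X R δ B q)
    (hδ : δ' ≤ δ) (hB : 0 < B) (hBB' : B ≤ B') :
    HasBoundedChartAt m K X R δ' B' q := by
  obtain ⟨ψ, π, h1, h2, h3, h4, ⟨O, hO, hO'⟩, h6, h7⟩ := h
  have hsub : ball (0 : EuclideanSpace ℝ (Fin m)) δ' ⊆ ball 0 δ := ball_subset_ball hδ
  refine ⟨ψ, π, h1.mono hsub, h2.mono (image_mono hsub), fun y hy => h3 y (hsub hy), h4, ?_, ?_,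
    fun k hk i j y hy => (h7 k hk i j y (hsub hy)).trans hBB'⟩
  · rw [hO'] at h2
    obtain ⟨W, hW, hW'⟩ := (_root_.continuousOn_iff'.1 h2) (ball 0 δ') isOpen_ball
    refine ⟨O ∩ W, hO.inter hW, ?_⟩
    ext x
    constructor
    · rintro ⟨y, hy, rfl⟩
      have hx : ψ y ∈ X ∩ O := hO' ▸ ⟨y, hsub hy, rfl⟩
      have : ψ y ∈ π ⁻¹' ball 0 δ' ∩ (X ∩ O) := ⟨by rw [mem_preimage, h3 y (hsub hy)]; exact hy, hx⟩
      rw [hW'] at this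
      exact ⟨hx.1, hx.2, this.1⟩
    · rintro ⟨hxX, hxO, hxW⟩
      have : x ∈ π ⁻¹' ball 0 δ' ∩ (X ∩ O) := by rw [hW']; exact ⟨hxW, hxX, hxO⟩
      obtain ⟨y, hy, rfl⟩ : x ∈ ψ '' ball 0 δ := hO' ▸ ⟨hxX, hxO⟩
      refine ⟨y, ?_, rfl⟩
      have := this.1
      rwa [mem_preimage, h3 y hy] at this
  · intro y hy v
    obtain ⟨a1, a2⟩ := h6 y (hsub hy) v
    refine ⟨le_trans ?_ a1, a2.trans (by gcongr)⟩
    gcongr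

/-- Bounds for the rescaled set are obtained at R = 1. Measured with R, the Gram matrix of the
dilated chart acquires the factor (s/R)², and M controls the ratio of the two scales. -/
theorem HasBoundedChartAt.similarity {s R M δ B : ℝ} (hs : 0 < s) (hR : 0 < R) (hM : 0 < M)
    (h1M : M⁻¹ ≤ (s / R) ^ 2) (h2M : (s / R) ^ 2 ≤ M) {b q : E}
    (h : HasBoundedChartAt m K ((fun y => s • y + b) ⁻¹' X) 1 δ B q) (hB : 0 < B) :
    HasBoundedChartAt m K X R δ (M * B) (s • q + b) := by
  obtain ⟨ψ, π, h1, h2, h3, h4, ⟨O, hO, hO'⟩, h6, h7⟩ := h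
  have hs' := hs.ne'
  set τ : E → E := fun y => s⁻¹ • (y - b) with hτ
  have hτσ : ∀ y, τ (s • y + b) = y := fun y => by simp [hτ, smul_smul, inv_mul_cancel₀ hs']
  have hστ : ∀ y, s • τ y + b = y := fun y => by simp [hτ, smul_smul, mul_inv_cancel₀ hs']
  have hτc : Continuous τ := by unfold τ; fun_prop
  have hfd : ∀ y, fderiv ℝ (fun y => s • ψ y + b) y = s • fderiv ℝ ψ y := by
    intro y
    rw [fderiv_add_const]
    exact congrFun (fderiv_const_smul_field (𝕜 := ℝ) (f := ψ) s) y
  have hsq : ∀ c : ℝ, R⁻¹ ^ 2 * (s ^ 2 * c) = (s / R) ^ 2 * (1⁻¹ ^ 2 * c) := by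
    intro c; field_simp
  refine ⟨fun y => s • ψ y + b, fun x => π (τ x), ?_, ?_, ?_, by simp only [h4], ?_, ?_, ?_⟩
  · exact (h1.const_smul s).add contDiffOn_const
  · refine h2.comp hτc.continuousOn ?_
    rintro _ ⟨y, hy, rfl⟩
    simp only [hτσ]
    exact ⟨y, hy, rfl⟩
  · intro y hy
    simp only [hτσ]
    exact h3 y hy
  · refine ⟨τ ⁻¹' O, hO.preimage hτc, ?_⟩
    ext x
    constructor
    · rintro ⟨y, hy, rfl⟩
      have : ψ y ∈ (fun y => s • y + b) ⁻¹' X ∩ O := hO' ▸ ⟨y, hy, rfl⟩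
      exact ⟨this.1, by simp only [mem_preimage, hτσ]; exact this.2⟩
    · rintro ⟨hxX, hxO⟩
      have : τ x ∈ (fun y => s • y + b) ⁻¹' X ∩ O := ⟨by simp only [mem_preimage, hστ]; exact hxX, hxO⟩
      rw [← hO'] at this
      obtain ⟨y, hy, hyx⟩ := this
      exact ⟨y, hy, by simp only [hyx, hστ]⟩
  · intro y hy v
    obtain ⟨a1, a2⟩ := h6 y hy v
    rw [hfd]
    have e : R⁻¹ ^ 2 * ‖(s • fderiv ℝ ψ y) v‖ ^ 2 = (s / R) ^ 2 * (1⁻¹ ^ 2 * ‖fderiv ℝ ψ y v‖ ^ 2) := by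
      rw [← hsq, smul_apply, norm_smul, mul_pow, Real.norm_of_nonneg hs.le]
    rw [e]
    constructor
    · rw [mul_inv, mul_assoc]
      gcongr
    · rw [mul_assoc]
      gcongr
  · intro k hk i j y hy
    have e : (fun y' => R⁻¹ ^ 2 *
        ⟪fderiv ℝ (fun y => s • ψ y + b) y' (EuclideanSpace.single i 1),
          fderiv ℝ (fun y => s • ψ y + b) y' (EuclideanSpace.single j 1)⟫) =
        (s / R) ^ 2 • (fun y' => 1⁻¹ ^ 2 * ⟪fderiv ℝ ψ y' (EuclideanSpace.single i 1),
          fderiv ℝ ψ y' (EuclideanSpace.single j 1)⟫) := by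
      funext y'
      simp only [hfd, smul_apply, Pi.smul_apply, smul_eq_mul]
      rw [← hsq, inner_smul_left, inner_smul_right]
      simp only [conj_trivial]
      rw [← mul_assoc s s, ← pow_two]
    have hsm : ContDiffAt ℝ k (fun y' => (1 : ℝ)⁻¹ ^ 2 * ⟪fderiv ℝ ψ y' (EuclideanSpace.single i 1),
          fderiv ℝ ψ y' (EuclideanSpace.single j 1)⟫) y := by
      have a0 : ContDiffAt ℝ k (fderiv ℝ ψ) y :=
        (h1.contDiffAt (isOpen_ball.mem_nhds hy)).fderiv_right (m := k) (by exact_mod_cast le_top)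
      exact contDiffAt_const.mul ((a0.clm_apply contDiffAt_const).inner ℝ
        (a0.clm_apply contDiffAt_const))
    rw [e, iteratedFDeriv_const_smul_apply hsm, norm_smul, Real.norm_of_nonneg (by positivity)]
    have := h7 k hk i j y hy
    gcongr

end Scaling

/-! ### Charts of uniform size from smooth convergence -/

section BoundedCharts

variable {ι : Type} {E : Type} [NormedAddCommGroup E] [InnerProductSpace ℝ E]
  [FiniteDimensional ℝ E]
variable {l : Filter ι} {N : Set E} {X : ι → Set E} {K : ℕ}

theorem SmoothlyConverges.reparam {P Q : Type} [NormedAddCommGroup P] [NormedSpace ℝ P]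
    [FiniteDimensional ℝ P] [NormedAddCommGroup Q] [NormedSpace ℝ Q] [FiniteDimensional ℝ Q]
    {ψ : P → E} {π : E → P} {v₀ : P} {ψi : ι → P → E} (L : Q ≃L[ℝ] P)
    (h : SmoothlyConverges l X N ψ π v₀ ψi) :
    SmoothlyConverges l X N (fun v => ψ (L v)) (fun x => L.symm (π x)) (L.symm v₀)
      (fun i v => ψi i (L v)) := by
  have hL : Tendsto L (𝓝 (L.symm v₀)) (𝓝 v₀) := by
    have := L.continuous.tendsto (L.symm v₀)
    rwa [L.apply_symm_apply] at this
  have hLs : SmoothNear (L : Q → P) (L.symm v₀) := L.contDiff.smoothNear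
  refine ⟨⟨?_, ?_, ?_, ?_, ?_⟩, ?_, ?_, ?_⟩
  · filter_upwards [hL.eventually h.chart.smooth] with v hv
    exact ContDiffAt.comp v hv L.contDiff.contDiffAt
  · rw [L.apply_symm_apply]
    filter_upwards [h.chart.smooth_inv] with x hx
    exact L.symm.contDiff.contDiffAt.comp x hx
  · filter_upwards [hL.eventually h.chart.left_inv] with v hv
    rw [hv, L.symm_apply_apply]
  · exact hL.eventually h.chart.mem
  · rw [L.apply_symm_apply]
    simpa using h.chart.right_inv
  · refine ST.comp (f := fun _ v => L v) (f₀ := fun v => L v) ?_ hLs.ST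
    rw [L.apply_symm_apply]; exact h.st
  · exact (tendsto_fst.prodMk (hL.comp tendsto_snd)).eventually h.mem
  · intro V hV
    rw [L.apply_symm_apply]
    have hV' : L.symm ⁻¹' V ∈ 𝓝 v₀ := L.symm.continuous.continuousAt hV
    filter_upwards [h.cover _ hV'] with p hp hpX
    obtain ⟨v, hv, hvp⟩ := hp hpX
    exact ⟨L.symm v, hv, by simpa using hvp⟩

variable {m : ℕ} {ψ : EuclideanSpace ℝ (Fin m) → E} {π : E → EuclideanSpace ℝ (Fin m)}
  {v₀ : EuclideanSpace ℝ (Fin m)} {ψi : ι → EuclideanSpace ℝ (Fin m) → E}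

theorem exists_bound_fderiv (h : SmoothlyConverges l X N ψ π v₀ ψi) :
    ∃ B > 0, ∀ᶠ p in l ×ˢ 𝓝 v₀, ∀ w, B⁻¹ * ‖w‖ ^ 2 ≤ ‖fderiv ℝ (ψi p.1) p.2 w‖ ^ 2 ∧
      ‖fderiv ℝ (ψi p.1) p.2 w‖ ^ 2 ≤ B * ‖w‖ ^ 2 := by
  obtain ⟨c, hc, hanti⟩ := LinearMap.exists_antilipschitzWith
    (fderiv ℝ ψ v₀ : EuclideanSpace ℝ (Fin m) →ₗ[ℝ] E)
    (LinearMap.ker_eq_bot.2 h.chart.injective)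
  have hlow : ∀ w, ‖w‖ ≤ c * ‖fderiv ℝ ψ v₀ w‖ := fun w => by
    simpa using hanti.le_mul_dist w 0
  have hc' : (0 : ℝ) < c := hc
  have h1 := h.st.fderiv.tendsto
  have h2 : ∀ᶠ p in l ×ˢ 𝓝 v₀, ‖fderiv ℝ (ψi p.1) p.2 - fderiv ℝ ψ v₀‖ < (2 * c : ℝ)⁻¹ := by
    filter_upwards [h1 (ball_mem_nhds _ (inv_pos.2 (by positivity : (0 : ℝ) < 2 * c)))] with p hp
    simpa [dist_eq_norm] using hp
  set A : ℝ := ‖fderiv ℝ ψ v₀‖ + (2 * c : ℝ)⁻¹ with hA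
  have hApos : 0 < A := by positivity
  -- Dψ expands lengths by at least 1/c, and nearby members keep half of that, 1/(2c). A bounds
  -- their norms, and the sum of squares serves on both sides.
  refine ⟨(2 * c) ^ 2 + A ^ 2, by positivity, ?_⟩
  filter_upwards [h2] with p hp w
  set D := fderiv ℝ (ψi p.1) p.2
  have a1 : ‖(D - fderiv ℝ ψ v₀) w‖ ≤ (2 * c : ℝ)⁻¹ * ‖w‖ :=
    ((D - fderiv ℝ ψ v₀).le_opNorm w).trans (by gcongr)
  rw [sub_apply] at a1
  have a2 : ‖D w‖ ≤ A * ‖w‖ := by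
    have b1 := norm_add_le (fderiv ℝ ψ v₀ w) (D w - fderiv ℝ ψ v₀ w)
    rw [add_sub_cancel] at b1
    have b2 := (fderiv ℝ ψ v₀).le_opNorm w
    rw [hA, add_mul]; linarith
  have a3 : (2 * c : ℝ)⁻¹ * ‖w‖ ≤ ‖D w‖ := by
    have b1 := norm_sub_norm_le (fderiv ℝ ψ v₀ w) (fderiv ℝ ψ v₀ w - D w)
    rw [sub_sub_cancel, norm_sub_rev (fderiv ℝ ψ v₀ w) (D w)] at b1
    have b2 : (c : ℝ)⁻¹ * ‖w‖ ≤ ‖fderiv ℝ ψ v₀ w‖ := by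
      rw [inv_mul_le_iff₀ hc']; exact hlow w
    have b3 : (c : ℝ)⁻¹ * ‖w‖ = (2 * c : ℝ)⁻¹ * ‖w‖ + (2 * c : ℝ)⁻¹ * ‖w‖ := by
      field_simp; ring
    linarith
  constructor
  · have b1 : ((2 * c : ℝ)⁻¹ * ‖w‖) ^ 2 ≤ ‖D w‖ ^ 2 := by gcongr
    have b2 : ((2 * c : ℝ) ^ 2 + A ^ 2)⁻¹ ≤ ((2 * c : ℝ) ^ 2)⁻¹ := by
      gcongr; nlinarith
    calc ((2 * c : ℝ) ^ 2 + A ^ 2)⁻¹ * ‖w‖ ^ 2 ≤ ((2 * c : ℝ) ^ 2)⁻¹ * ‖w‖ ^ 2 := by gcongr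
      _ = ((2 * c : ℝ)⁻¹ * ‖w‖) ^ 2 := by rw [mul_pow _ ‖w‖, inv_pow]
      _ ≤ _ := b1
  · have b1 : ‖D w‖ ^ 2 ≤ (A * ‖w‖) ^ 2 := by gcongr
    rw [mul_pow] at b1
    nlinarith [sq_nonneg (2 * c * ‖w‖ : ℝ)]

theorem exists_bound_gram (h : SmoothlyConverges l X N ψ π v₀ ψi) (K : ℕ) :
    ∃ B > 0, ∀ᶠ p in l ×ˢ 𝓝 v₀, ∀ k ≤ K, ∀ i j : Fin m,
      ‖iteratedFDeriv ℝ k (fun y => (1 : ℝ)⁻¹ ^ 2 *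
        ⟪fderiv ℝ (ψi p.1) y (EuclideanSpace.single i 1),
          fderiv ℝ (ψi p.1) y (EuclideanSpace.single j 1)⟫) p.2‖ ≤ B := by
  let g : (EuclideanSpace ℝ (Fin m) →L[ℝ] E) → Fin m → Fin m → ℝ := fun A i j =>
    (1 : ℝ)⁻¹ ^ 2 * ⟪A (EuclideanSpace.single i 1), A (EuclideanSpace.single j 1)⟫
  have hg : ∀ i j, ContDiff ℝ ∞ (fun A => g A i j) := by
    intro i j
    refine contDiff_const.mul (ContDiff.inner ℝ ?_ ?_) <;>
      exact contDiff_id.clm_apply contDiff_const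
  have hst : ∀ i j, ST l v₀ (fun a y => g (fderiv ℝ (ψi a) y) i j)
      (fun y => g (fderiv ℝ ψ y) i j) := fun i j =>
    ST.map (h₀ := fun A => g A i j) (f₀ := fderiv ℝ ψ) (hg i j).smoothNear h.st.fderiv
  let b : ℕ → Fin m → Fin m → ℝ := fun k i j =>
    ‖iteratedFDeriv ℝ k (fun y => g (fderiv ℝ ψ y) i j) v₀‖ + 1
  have hb : ∀ k i j, 0 ≤ b k i j := fun k i j => by positivity
  let B : ℝ := ∑ k ∈ Finset.range (K + 1), ∑ i, ∑ j, b k i j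
  have hle : ∀ k ≤ K, ∀ i j, b k i j ≤ B := by
    intro k hk i j
    have c1 : b k i j ≤ ∑ j, b k i j :=
      Finset.single_le_sum (f := fun j => b k i j) (fun j _ => hb k i j) (Finset.mem_univ j)
    have c2 : ∑ j, b k i j ≤ ∑ i, ∑ j, b k i j :=
      Finset.single_le_sum (f := fun i => ∑ j, b k i j)
        (fun i _ => Finset.sum_nonneg fun j _ => hb k i j) (Finset.mem_univ i)
    have c3 : ∑ i, ∑ j, b k i j ≤ B :=
      Finset.single_le_sum (f := fun k => ∑ i, ∑ j, b k i j)
        (fun k _ => Finset.sum_nonneg fun i _ => Finset.sum_nonneg fun j _ => hb k i j)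
        (Finset.mem_range.2 (by omega))
    exact c1.trans (c2.trans c3)
  have hB : 0 ≤ B := Finset.sum_nonneg fun k _ => Finset.sum_nonneg fun i _ =>
    Finset.sum_nonneg fun j _ => hb k i j
  refine ⟨B + 1, by positivity, ?_⟩
  have hev : ∀ k ∈ Finset.range (K + 1), ∀ᶠ p in l ×ˢ 𝓝 v₀, ∀ i j : Fin m,
      ‖iteratedFDeriv ℝ k (fun y => g (fderiv ℝ (ψi p.1) y) i j) p.2‖ ≤ b k i j := by
    intro k _
    refine eventually_all.2 fun i => eventually_all.2 fun j => ?_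
    filter_upwards [((hst i j).tendsto_iteratedFDeriv k).eventually
      (gt_mem_nhds (lt_add_one _))] with p hp using hp.le
  filter_upwards [(Filter.eventually_all_finset _).2 hev] with p hp k hk i j
  exact (hp k (Finset.mem_range.2 (by omega)) i j).trans ((hle k hk i j).trans (by linarith))

/-- Smoothly converging families have charts of a uniform size with uniform bounds. -/
theorem SmoothlyConverges.exists_boundedChart (h : SmoothlyConverges l X N ψ π v₀ ψi) (K : ℕ) :
    ∃ δ > 0, ∃ B > 0, ∀ᶠ p in l ×ˢ 𝓝 (ψ v₀), p.2 ∈ X p.1 →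
      HasBoundedChartAt m K (X p.1) 1 δ B p.2 := by
  obtain ⟨B₁, hB₁, hb₁⟩ := exists_bound_fderiv h
  obtain ⟨B₂, hB₂, hb₂⟩ := exists_bound_gram h K
  -- The maps π ∘ ψi converge to the identity. Composing their local inverses with π gives left
  -- inverses of the ψi i on a neighbourhood independent of i.
  have hθ : ST l v₀ (fun i v => π (ψi i v)) (fun v => π (ψ v)) :=
    ST.map (f₀ := ψ) h.chart.smooth_inv h.st
  have hid : (fun v => π (ψ v)) =ᶠ[𝓝 v₀] id := h.chart.left_inv
  obtain ⟨G, G₀, hG, hG₀, hl, -, -, -⟩ := exists_inverse_family hθ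
    (ContinuousLinearEquiv.refl ℝ (EuclideanSpace ℝ (Fin m))) (by
      rw [hid.fderiv_eq, fderiv_id]; rfl)
  rw [h.chart.inv_apply] at hG
  obtain ⟨ρ₁, hρ₁, e1⟩ := eventually_prod_uniform (hG 0).fam
  obtain ⟨ρ₂, hρ₂, hπ⟩ := Metric.eventually_nhds_iff_ball.1
    (h.chart.smooth_inv.and (h.chart.inv_tendsto.eventually (ball_mem_nhds v₀ hρ₁)))
  have hnear : ∀ᶠ p in l ×ˢ 𝓝 v₀, ψi p.1 p.2 ∈ ball (ψ v₀) ρ₂ :=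
    h.st.tendsto (ball_mem_nhds _ hρ₂)
  obtain ⟨ρ, hρ, e2⟩ := eventually_prod_uniform
    (((((h.mem.and (h.st 0).fam).and hl).and hnear).and hb₁).and hb₂)
  obtain ⟨ρ₃, hρ₃, e3⟩ := eventually_prod_uniform
    (h.cover (ball v₀ (ρ / 2)) (ball_mem_nhds _ (half_pos hρ)))
  obtain ⟨ρ₄, hρ₄, e4⟩ := eventually_prod_uniform
    (((h.st.tendsto (ball_mem_nhds _ hρ₃) : ∀ᶠ p in l ×ˢ 𝓝 v₀, ψi p.1 p.2 ∈ ball (ψ v₀) ρ₃)))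
  -- The chart is recentred at a parameter vq within δ of v₀, so its ball lies in the ball of radius
  -- 2δ about v₀; hence the halves.
  set δ := min (ρ / 2) (ρ₄ / 2) with hδ
  have hδpos : 0 < δ := by positivity
  have hδρ : δ ≤ ρ / 2 := min_le_left _ _
  have hδρ₄ : δ ≤ ρ₄ / 2 := min_le_right _ _
  refine ⟨δ, hδpos, B₁ + B₂, by positivity, ?_⟩
  filter_upwards [h.cover (ball v₀ δ) (ball_mem_nhds _ hδpos), tendsto_fst.eventually e1,
    tendsto_fst.eventually e2, tendsto_fst.eventually e3, tendsto_fst.eventually e4]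
    with ⟨i, q⟩ h1 h2 h3 h4 h5 hq
  simp only at h1 h2 h3 h4 h5 hq ⊢
  obtain ⟨vq, hvq, rfl⟩ := h1 hq
  have hsub : ∀ y ∈ ball (0 : EuclideanSpace ℝ (Fin m)) δ, vq + y ∈ ball v₀ (2 * δ) := by
    intro y hy
    rw [mem_ball, dist_eq_norm] at hvq ⊢
    rw [mem_ball_zero_iff] at hy
    have := norm_add_le (vq - v₀) y
    rw [show vq + y - v₀ = vq - v₀ + y by abel]
    linarith
  have hsubρ : ∀ y ∈ ball (0 : EuclideanSpace ℝ (Fin m)) δ, vq + y ∈ ball v₀ ρ := fun y hy =>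
    ball_subset_ball (by linarith) (hsub y hy)
  have hsubρ₄ : ∀ y ∈ ball (0 : EuclideanSpace ℝ (Fin m)) δ, vq + y ∈ ball v₀ ρ₄ := fun y hy =>
    ball_subset_ball (by linarith) (hsub y hy)
  have hfd : ∀ y, fderiv ℝ (fun y => ψi i (vq + y)) y = fderiv ℝ (ψi i) (vq + y) := fun y =>
    fderiv_comp_add_left vq
  have hπc : ContinuousOn π (ball (ψ v₀) ρ₂) := fun x hx =>
    (hπ x hx).1.continuousAt.continuousWithinAt
  have hGc : ContinuousOn (fun x => G i (π x)) (ball (ψ v₀) ρ₂) := fun x hx =>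
    (ContinuousAt.comp (g := G i) (h2 (π x) (hπ x hx).2).continuousAt
      (hπ x hx).1.continuousAt).continuousWithinAt
  refine ⟨fun y => ψi i (vq + y), fun x => G i (π x) - vq, ?_, ?_, ?_, by simp, ?_, ?_, ?_⟩
  · intro y hy
    have := (h3 _ (hsubρ y hy)).1.1.1.1.2
    exact (ContDiffAt.comp y this (contDiffAt_const.add contDiffAt_id)).contDiffWithinAt
  · refine (hGc.sub continuousOn_const).mono ?_
    rintro _ ⟨y, hy, rfl⟩
    exact (h3 _ (hsubρ y hy)).1.1.2
  · intro y hy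
    have := (h3 _ (hsubρ y hy)).1.1.1.2
    simp only at this ⊢
    rw [this, add_sub_cancel_left]
  -- The first ball is where the inverse is continuous, the preimage confines its parameter to the
  -- domain, and the last ball ensures that points of X i have parameters at all.
  · refine ⟨(ball (ψ v₀) ρ₂ ∩ (fun x => G i (π x)) ⁻¹' ball vq δ) ∩ ball (ψ v₀) ρ₃,
      (hGc.isOpen_inter_preimage isOpen_ball isOpen_ball).inter isOpen_ball, ?_⟩
    ext x
    constructor
    · rintro ⟨y, hy, rfl⟩
      have := h3 _ (hsubρ y hy)
      have hGv := this.1.1.1.2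
      refine ⟨this.1.1.1.1.1, ⟨this.1.1.2, ?_⟩, h5 _ (hsubρ₄ y hy)⟩
      simp only [mem_preimage] at hGv ⊢
      rw [hGv, mem_ball, dist_eq_norm, add_sub_cancel_left]
      exact mem_ball_zero_iff.1 hy
    · rintro ⟨hxX, ⟨hx2, hxG⟩, hx3⟩
      obtain ⟨v, hv, rfl⟩ := h4 x hx3 hxX
      have hGv := (h3 v (ball_subset_ball (by linarith) hv)).1.1.1.2
      simp only [mem_preimage] at hGv hxG
      rw [hGv] at hxG
      refine ⟨v - vq, ?_, by simp⟩
      rw [mem_ball_zero_iff, ← dist_eq_norm]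
      exact hxG
  · intro y hy w
    obtain ⟨a1, a2⟩ := (h3 _ (hsubρ y hy)).1.2 w
    rw [hfd]
    simp only [inv_one, one_pow, one_mul] at a1 a2 ⊢
    refine ⟨le_trans ?_ a1, a2.trans ?_⟩
    · gcongr; linarith
    · gcongr; linarith
  · intro k hk a b y hy
    have := (h3 _ (hsubρ y hy)).2 k hk a b
    simp only [hfd]
    rw [iteratedFDeriv_comp_add_left (f := fun y => (1 : ℝ)⁻¹ ^ 2 *
        ⟪fderiv ℝ (ψi i) y (EuclideanSpace.single a 1),
          fderiv ℝ (ψi i) y (EuclideanSpace.single b 1)⟫)]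
    exact this.trans (by linarith)

end BoundedCharts

end SLGeom

end

noncomputable section

namespace SLGeom

/-! ## Gradients in charts, cylinders and graphs -/

section Gradients

variable {ι : Type} {E P : Type} [NormedAddCommGroup E] [InnerProductSpace ℝ E]
  [FiniteDimensional ℝ E] [NormedAddCommGroup P] [NormedSpace ℝ P] [FiniteDimensional ℝ P]
variable {l : Filter ι} {N : Set E} {ψ : P → E} {π : E → P} {v₀ : P}

/-- The coordinates of the gradient of the function with coordinate expression `h`. -/
def gradCoord (ψ : P → E) (h : P → ℝ) (v : P) : P :=
  (gramOf (fderiv ℝ ψ v)).inverse (fderiv ℝ h v)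

theorem inner_tangentialGrad (f : E → ℝ) (p w : E) :
    ⟪tangentialGrad N f p, w⟫ = fderivWithin ℝ f N p (tangentProj N p w) := by
  rw [tangentialGrad, tangentProj, Submodule.inner_starProjection_left_eq_right,
    InnerProductSpace.toDual_symm_apply]

theorem tangentialGrad_mem (f : E → ℝ) (p : E) : tangentialGrad N f p ∈ tangentSpaceOf N p :=
  tangentProj_mem _ _

theorem tangentialGrad_unique {f : E → ℝ} {p ξ : E} (hξ : ξ ∈ tangentSpaceOf N p)
    (h : ∀ w ∈ tangentSpaceOf N p, ⟪ξ, w⟫ = fderivWithin ℝ f N p w) :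
    tangentialGrad N f p = ξ := by
  refine ext_inner_right ℝ fun w => ?_
  rw [inner_tangentialGrad, ← h _ (tangentProj_mem _ _), tangentProj,
    ← Submodule.inner_starProjection_left_eq_right]
  congr 1
  exact tangentProj_of_mem hξ

theorem ChartGerm.fderivWithin_apply (h : ChartGerm N ψ π v₀) {F : Type} [NormedAddCommGroup F]
    [NormedSpace ℝ F] {f : E → F}
    (hf : DifferentiableAt ℝ (fun v => f (ψ v)) v₀) (w : P) :
    fderivWithin ℝ f N (ψ v₀) (fderiv ℝ ψ v₀ w) = fderiv ℝ (fun v => f (ψ v)) v₀ w := by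
  have h1 : HasFDerivAt π (fderiv ℝ π (ψ v₀)) (ψ v₀) :=
    (h.smooth_inv.self.differentiableAt (by simp)).hasFDerivAt
  have h2 : HasFDerivAt (fun v => f (ψ v)) (fderiv ℝ (fun v => f (ψ v)) v₀) (π (ψ v₀)) := by
    rw [h.inv_apply]; exact hf.hasFDerivAt
  have h3 := HasFDerivAt.comp (ψ v₀) h2 h1
  rw [fderivWithin_apply_of_eqOn (f' := (fun v => f (ψ v)) ∘ π) h.mem_self ?_
    h3.differentiableAt (h.fderiv_mem w), h3.fderiv]
  · have := DFunLike.congr_fun h.fderiv_comp_fderiv w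
    simp only [ContinuousLinearMap.comp_apply] at this ⊢
    rw [this]; rfl
  · filter_upwards [h.right_inv] with x hx hxN
    simp only [Function.comp]
    rw [hx hxN]

theorem ChartGerm.tangentialGrad_eq (h : ChartGerm N ψ π v₀) {f : E → ℝ}
    (hf : DifferentiableAt ℝ (fun v => f (ψ v)) v₀) :
    tangentialGrad N f (ψ v₀) = fderiv ℝ ψ v₀ (gradCoord ψ (fun v => f (ψ v)) v₀) := by
  refine tangentialGrad_unique (h.fderiv_mem _) fun w hw => ?_
  rw [h.tangentSpaceOf_eq] at hw
  obtain ⟨a, rfl⟩ := hw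
  change _ = fderivWithin ℝ f N (ψ v₀) (fderiv ℝ ψ v₀ a)
  rw [h.fderivWithin_apply hf]
  exact DFunLike.congr_fun (gramOf_inverse_apply h.injective _) a

theorem ChartGerm.tangentialGrad_unique (h : ChartGerm N ψ π v₀) {f : E → ℝ}
    (hf : DifferentiableAt ℝ (fun v => f (ψ v)) v₀) {ξ : E} (hξ : ξ ∈ tangentSpaceOf N (ψ v₀))
    (hi : ∀ a, ⟪ξ, fderiv ℝ ψ v₀ a⟫ = fderiv ℝ (fun v => f (ψ v)) v₀ a) :
    tangentialGrad N f (ψ v₀) = ξ := by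
  refine SLGeom.tangentialGrad_unique hξ fun w hw => ?_
  rw [h.tangentSpaceOf_eq] at hw
  obtain ⟨a, rfl⟩ := hw
  change ⟪ξ, fderiv ℝ ψ v₀ a⟫ = fderivWithin ℝ f N (ψ v₀) (fderiv ℝ ψ v₀ a)
  rw [h.fderivWithin_apply hf, hi]

theorem ChartGerm.inner_tangentialGrad (h : ChartGerm N ψ π v₀) {f : E → ℝ}
    (hf : DifferentiableAt ℝ (fun v => f (ψ v)) v₀) (a : P) :
    ⟪tangentialGrad N f (ψ v₀), fderiv ℝ ψ v₀ a⟫ = fderiv ℝ (fun v => f (ψ v)) v₀ a := by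
  rw [SLGeom.inner_tangentialGrad, tangentProj_of_mem (h.fderiv_mem a), h.fderivWithin_apply hf]

theorem tangentialGrad_comp_similarity {s : ℝ} (hs : s ≠ 0) (b x : E) {c : ℝ} (hc : c ≠ 0)
    (f : E → ℝ) :
    tangentialGrad ((fun y => s • y + b) ⁻¹' N) (fun y => c • f (s • y + b)) x =
      (c * s) • tangentialGrad N f (s • x + b) := by
  refine SLGeom.tangentialGrad_unique ?_ fun w hw => ?_
  · rw [tangentSpaceOf_preimage_similarity hs]
    exact Submodule.smul_mem _ _ (tangentialGrad_mem _ _)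
  · rw [tangentSpaceOf_preimage_similarity hs] at hw
    rw [fderivWithin_comp_similarity hs b x hc f hw, inner_smul_left, SLGeom.inner_tangentialGrad,
      tangentProj_of_mem hw]
    simp

theorem ChartGerm.gradCoord_st (h : ChartGerm N ψ π v₀) {f : ι → P → ℝ} {f₀ : P → ℝ}
    (hf : ST l v₀ (fun i => fderiv ℝ (f i)) (fderiv ℝ f₀)) :
    ST l v₀ (fun i => gradCoord ψ (f i)) (gradCoord ψ f₀) := by
  have h1 : SmoothNear (fun v => (gramOf (fderiv ℝ ψ v)).inverse) v₀ := by
    have a := h.smooth.fderiv.self.continuousAt.tendsto.eventually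
      (smoothNear_gramOf_inverse h.injective)
    filter_upwards [a, h.smooth.fderiv] with v hv hv'
    exact ContDiffAt.comp v hv hv'
  exact h1.ST.bilin (ContinuousLinearMap.id ℝ _) hf

end Gradients

/-! ### Cylinders over submanifolds of ℂⁿ -/

section Cylinder

variable {n : ℕ} {P : Type} [NormedAddCommGroup P] [NormedSpace ℝ P] [FiniteDimensional ℝ P]
  {N : Set (Cn n)} {ψ : P → Cn n} {π : Cn n → P} {v₀ : P}

/-- The point `(z, w)` as a real linear map. -/
def mkL (n : ℕ) : (Cn n × ℂ) →L[ℝ] CnC n :=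
  ((WithLp.prodContinuousLinearEquiv 2 ℝ (Cn n) ℂ).symm : (Cn n × ℂ) →L[ℝ] CnC n)

/-- The point `(z, u)`, with `u` real, as a real linear map. -/
def mkCyl (n : ℕ) : (Cn n × ℝ) →L[ℝ] CnC n :=
  (mkL n).comp ((ContinuousLinearMap.fst ℝ (Cn n) ℝ).prod
    (Complex.ofRealCLM.comp (ContinuousLinearMap.snd ℝ (Cn n) ℝ)))

/-- The first component as a real linear map. -/
def fstC (n : ℕ) : CnC n →L[ℝ] Cn n := WithLp.fstL 2 ℝ (Cn n) ℂ

/-- The last component as a real linear map. -/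
def sndC (n : ℕ) : CnC n →L[ℝ] ℂ := WithLp.sndL 2 ℝ (Cn n) ℂ

@[simp] theorem mkL_fst (p : Cn n × ℂ) : (mkL n p).fst = p.1 := rfl
@[simp] theorem mkL_snd (p : Cn n × ℂ) : (mkL n p).snd = p.2 := rfl
@[simp] theorem mkCyl_fst (p : Cn n × ℝ) : (mkCyl n p).fst = p.1 := rfl
@[simp] theorem mkCyl_snd (p : Cn n × ℝ) : (mkCyl n p).snd = (p.2 : ℂ) := rfl
@[simp] theorem fstC_apply (p : CnC n) : fstC n p = p.fst := rfl
@[simp] theorem sndC_apply (p : CnC n) : sndC n p = p.snd := rfl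

theorem CnC_ext {p q : CnC n} (h1 : p.fst = q.fst) (h2 : p.snd = q.snd) : p = q :=
  WithLp.ofLp_injective 2 (Prod.ext h1 h2)

theorem CnC_inner (p q : CnC n) : ⟪p, q⟫ = ⟪p.fst, q.fst⟫ + ⟪p.snd, q.snd⟫ :=
  WithLp.prod_inner_apply p q

theorem norm_fst_le (p : CnC n) : ‖p.fst‖ ≤ ‖p‖ := by
  have := WithLp.prod_norm_sq_eq_of_L2 p
  nlinarith [norm_nonneg p, norm_nonneg p.fst, sq_nonneg ‖p.snd‖]

theorem norm_snd_le (p : CnC n) : ‖p.snd‖ ≤ ‖p‖ := by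
  have := WithLp.prod_norm_sq_eq_of_L2 p
  nlinarith [norm_nonneg p, norm_nonneg p.snd, sq_nonneg ‖p.fst‖]

theorem norm_le_fst_add_snd (p : CnC n) : ‖p‖ ≤ ‖p.fst‖ + ‖p.snd‖ := by
  have := WithLp.prod_norm_sq_eq_of_L2 p
  nlinarith [norm_nonneg p, norm_nonneg p.snd, norm_nonneg p.fst]

/-- The parametrization of the cylinder over the image of `ψ`. -/
def cylParam (ψ : P → Cn n) (v : P × ℝ) : CnC n := mkCyl n (ψ v.1, v.2)

/-- The left inverse of `cylParam`. -/
def cylInv (π : Cn n → P) (p : CnC n) : P × ℝ := (π p.fst, p.snd.re)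

theorem ChartGerm.cylinder (h : ChartGerm N ψ π v₀) (τ : ℝ) :
    ChartGerm (cylinder N) (cylParam ψ) (cylInv π) (v₀, τ) := by
  have hfst : Tendsto (fun v : P × ℝ => v.1) (𝓝 (v₀, τ)) (𝓝 v₀) := continuous_fst.tendsto _
  have hf : Tendsto (fun p : CnC n => p.fst) (𝓝 (cylParam ψ (v₀, τ))) (𝓝 (ψ v₀)) :=
    (fstC n).continuous.tendsto _
  refine ⟨?_, ?_, ?_, ?_, ?_⟩
  · filter_upwards [hfst.eventually h.smooth] with v hv
    exact (mkCyl n).contDiff.contDiffAt.comp v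
      ((ContDiffAt.comp v hv contDiffAt_fst).prodMk contDiffAt_snd)
  · filter_upwards [hf.eventually h.smooth_inv] with p hp
    exact (ContDiffAt.comp p (g := π) hp (fstC n).contDiff.contDiffAt).prodMk
      (Complex.reCLM.contDiff.comp (sndC n).contDiff).contDiffAt
  · filter_upwards [hfst.eventually h.left_inv] with v hv
    simp [cylInv, cylParam, hv]
  · filter_upwards [hfst.eventually h.mem] with v hv
    exact ⟨hv, by simp [cylParam]⟩
  · filter_upwards [hf.eventually h.right_inv] with p hp hpN
    refine CnC_ext (hp hpN.1) ?_
    simp only [cylParam, cylInv, mkCyl_snd]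
    exact Complex.ext rfl (by simp [hpN.2])

theorem cylParam_hasFDerivAt {v : P × ℝ} (h : DifferentiableAt ℝ ψ v.1) :
    HasFDerivAt (cylParam ψ) ((mkCyl n).comp (((fderiv ℝ ψ v.1).comp
      (ContinuousLinearMap.fst ℝ P ℝ)).prod (ContinuousLinearMap.snd ℝ P ℝ))) v :=
  (mkCyl n).hasFDerivAt.comp v ((HasFDerivAt.comp v h.hasFDerivAt hasFDerivAt_fst).prodMk
    hasFDerivAt_snd)

theorem cylParam_fderiv_apply {v : P × ℝ} (h : DifferentiableAt ℝ ψ v.1) (w : P × ℝ) :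
    fderiv ℝ (cylParam ψ) v w = mkCyl n (fderiv ℝ ψ v.1 w.1, w.2) := by
  rw [(cylParam_hasFDerivAt h).fderiv]; rfl

/-- The translation by `u` along the line. -/
def shift (n : ℕ) (u : ℝ) : CnC n := mkCyl n (0, u)

theorem preimage_cylinder (s u : ℝ) (hs : s ≠ 0) :
    (fun q : CnC n => s • q + shift n u) ⁻¹' cylinder N = cylinder ((fun x => s • x) ⁻¹' N) := by
  ext q
  simp [cylinder, shift, hs]

end Cylinder

/-! ### The Lagrangian neighbourhood in a chart of the cone -/

section Graph

variable {n : ℕ} {C : Set (Cn n)} (Φ : ConeLagrangianNbhd C)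
variable {P : Type} [NormedAddCommGroup P] [NormedSpace ℝ P] [FiniteDimensional ℝ P]
  {ψ : P → Cn n} {π : Cn n → P} {v₀ : P}

/-- The Lagrangian neighbourhood in the coordinates of a chart of the cone. -/
def nbhdCoord (ψ : P → Cn n) (p : P × P) : Cn n := Φ.toFun (ψ p.1, fderiv ℝ ψ p.1 p.2)

theorem ChartGerm.eventually_mem_dom (h : ChartGerm C ψ π v₀) :
    ∀ᶠ p : P × P in 𝓝 (v₀, 0), (ψ p.1, fderiv ℝ ψ p.1 p.2) ∈ Φ.dom := by
  obtain ⟨O, hO, hdom⟩ := Φ.isOpen_dom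
  have hfst : Tendsto (fun p : P × P => p.1) (𝓝 (v₀, 0)) (𝓝 v₀) := continuous_fst.tendsto _
  have hc : Tendsto (fun p : P × P => (ψ p.1, fderiv ℝ ψ p.1 p.2)) (𝓝 (v₀, 0)) (𝓝 (ψ v₀, 0)) := by
    have a1 : Tendsto (fun p : P × P => ψ p.1) (𝓝 (v₀, 0)) (𝓝 (ψ v₀)) :=
      h.smooth.self.continuousAt.tendsto.comp hfst
    have a2 : Tendsto (fun p : P × P => fderiv ℝ ψ p.1) (𝓝 (v₀, 0)) (𝓝 (fderiv ℝ ψ v₀)) :=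
      h.smooth.fderiv.self.continuousAt.tendsto.comp hfst
    have a3 : Tendsto (fun p : P × P => fderiv ℝ ψ p.1 p.2) (𝓝 (v₀, 0))
        (𝓝 (fderiv ℝ ψ v₀ 0)) :=
      (isBoundedBilinearMap_apply (𝕜 := ℝ) (E := P) (F := Cn n)).continuous.tendsto
        (fderiv ℝ ψ v₀, 0) |>.comp (a2.prodMk_nhds (continuous_snd.tendsto ((v₀, 0) : P × P)))
    rw [map_zero] at a3
    exact a1.prodMk_nhds a3
  have h0 : (ψ v₀, (0 : Cn n)) ∈ O := by
    have := Φ.zero_mem _ h.mem_self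
    rw [hdom] at this
    exact this.2
  filter_upwards [hc.eventually (hO.mem_nhds h0), hfst.eventually h.eventually] with p h1 h2
  rw [hdom]
  exact ⟨⟨h2.mem_self, h2.fderiv_mem _⟩, h1⟩

theorem ChartGerm.nbhdCoord_smooth (h : ChartGerm C ψ π v₀) :
    SmoothNear (nbhdCoord Φ ψ) (v₀, 0) := by
  have hfst : Tendsto (fun p : P × P => p.1) (𝓝 (v₀, 0)) (𝓝 v₀) := continuous_fst.tendsto _
  have h1 : SmoothNear (fun p : P × P => (ψ p.1, fderiv ℝ ψ p.1 p.2)) (v₀, 0) := by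
    filter_upwards [hfst.eventually h.smooth, hfst.eventually h.smooth.fderiv] with p a1 a2
    exact (ContDiffAt.comp p a1 contDiffAt_fst).prodMk
      ((ContDiffAt.comp p a2 contDiffAt_fst).clm_apply contDiffAt_snd)
  filter_upwards [h1, eventually_eventually_nhds.2 (h.eventually_mem_dom Φ)] with p a1 a2
  have := (Φ.smooth _ a2.self_of_nhds).comp (t := Φ.dom) (s := (fun p : P × P =>
    (ψ p.1, fderiv ℝ ψ p.1 p.2)) ⁻¹' Φ.dom) p a1.contDiffWithinAt (mapsTo_preimage _ _)
  exact this.contDiffAt a2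

end Graph

end SLGeom

end

noncomputable section

namespace SLGeom

/-! ## From covariant derivatives to derivatives in charts -/

section Decay

variable {ι : Type} {E P : Type} [NormedAddCommGroup E] [InnerProductSpace ℝ E]
  [FiniteDimensional ℝ E] [NormedAddCommGroup P] [NormedSpace ℝ P] [FiniteDimensional ℝ P]
variable {l : Filter ι} {N : Set E} {ψ : P → E} {π : E → P} {v₀ : P}

/-- The derivative of `A ↦ T(A ·, …, A ·)` along the family of projections given by a chart. -/
def projDeriv (ψ : P → E) (j : ℕ) (q : (E [×j]→L[ℝ] ℝ) × P) : P →L[ℝ] E [×j]→L[ℝ] ℝ :=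
  (fderiv ℝ (fun A : (E [×j]→L[ℝ] ℝ) × (E →L[ℝ] E) => A.1.compContinuousLinearMap fun _ => A.2)
    (q.1, projOf (fderiv ℝ ψ q.2))).comp
    ((ContinuousLinearMap.inr ℝ (E [×j]→L[ℝ] ℝ) (E →L[ℝ] E)).comp
      (fderiv ℝ (fun v => projOf (fderiv ℝ ψ v)) q.2))

theorem ChartGerm.smoothNear_projOf (h : ChartGerm N ψ π v₀) :
    SmoothNear (fun v => projOf (fderiv ℝ ψ v)) v₀ := by
  filter_upwards [h.smooth.fderiv.self.continuousAt.tendsto.eventually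
    (SLGeom.smoothNear_projOf h.injective), h.smooth.fderiv] with v a1 a2
  exact ContDiffAt.comp v a1 a2

theorem ChartGerm.smoothNear_projDeriv (h : ChartGerm N ψ π v₀) (j : ℕ) (T : E [×j]→L[ℝ] ℝ) :
    SmoothNear (projDeriv ψ j) (T, v₀) := by
  have hsnd : Tendsto (fun q : (E [×j]→L[ℝ] ℝ) × P => q.2) (𝓝 (T, v₀)) (𝓝 v₀) :=
    continuous_snd.tendsto _
  filter_upwards [hsnd.eventually h.smoothNear_projOf, hsnd.eventually h.smoothNear_projOf.fderiv]
    with q h1 h2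
  refine ContDiffAt.clm_comp ?_ (contDiffAt_const.clm_comp (ContDiffAt.comp q h2 contDiffAt_snd))
  have h3 : ContDiff ℝ ∞ (fderiv ℝ (fun A : (E [×j]→L[ℝ] ℝ) × (E →L[ℝ] E) =>
      A.1.compContinuousLinearMap fun _ => A.2)) :=
    (contDiff_compCLM (E := E) (F := E) j).fderiv_right (by simp)
  exact h3.contDiffAt.comp q (contDiffAt_fst.prodMk (ContDiffAt.comp q h1 contDiffAt_snd))

/-- T ↦ T(A ·, …, A ·) is linear in T, hence constant in A at T = 0. This makes the lower-order term
of `ChartGerm.fderiv_tensor` vanish in the limit. -/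
theorem projDeriv_zero (j : ℕ) (v : P) : projDeriv ψ j (0, v) = 0 := by
  set M := fun A : (E [×j]→L[ℝ] ℝ) × (E →L[ℝ] E) => A.1.compContinuousLinearMap fun _ => A.2 with hM
  have hMd : HasFDerivAt M (fderiv ℝ M (0, projOf (fderiv ℝ ψ v))) (0, projOf (fderiv ℝ ψ v)) :=
    ((contDiff_compCLM (E := E) (F := E) j).differentiable (by simp) _).hasFDerivAt
  have h1 := hMd.comp (projOf (fderiv ℝ ψ v)) (f := fun A : E →L[ℝ] E => ((0 : E [×j]→L[ℝ] ℝ), A))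
    (hasFDerivAt_prodMk_right _ _)
  have h2 : M ∘ (fun A : E →L[ℝ] E => ((0 : E [×j]→L[ℝ] ℝ), A)) = fun _ => 0 := by
    funext A; ext m; simp [hM]
  rw [h2] at h1
  have h3 := h1.unique (hasFDerivAt_const _ _)
  simp only [projDeriv]
  rw [← ContinuousLinearMap.comp_assoc, h3, ContinuousLinearMap.zero_comp]

/-- `T` does not change when its arguments are projected to the tangent space. -/
def IsTangential (N : Set E) {j : ℕ} (x : E) (T : E [×j]→L[ℝ] ℝ) : Prop :=
  (T.compContinuousLinearMap fun _ => tangentProj N x) = T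

theorem covDeriv_isTangential {j : ℕ} (T : E → E [×j]→L[ℝ] ℝ) (x : E) :
    IsTangential N x (covDeriv N T x) := by
  ext m
  simp only [covDeriv, ContinuousMultilinearMap.compContinuousLinearMap_apply]
  congr 1
  funext i
  exact tangentProj_of_mem (tangentProj_mem _ _)

theorem ChartGerm.covDeriv_eq (h : ChartGerm N ψ π v₀) {j : ℕ} {T : E → E [×j]→L[ℝ] ℝ}
    (hT : DifferentiableAt ℝ (fun v => T (ψ v)) v₀) :
    covDeriv N T (ψ v₀) = uncurryComp j ((fderiv ℝ (fun v => T (ψ v)) v₀).comp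
      (fderiv ℝ π (ψ v₀)), projOf (fderiv ℝ ψ v₀)) := by
  rw [← h.tangentProj_eq]
  ext m
  simp only [covDeriv, uncurryComp, ContinuousMultilinearMap.compContinuousLinearMap_apply,
    ContinuousLinearMap.uncurryLeft_apply]
  congr 1
  have hm := tangentProj_mem (N := N) (ψ v₀) (m 0)
  have hm' := hm
  rw [h.tangentSpaceOf_eq] at hm'
  obtain ⟨a, ha⟩ := hm'
  have ha' : fderiv ℝ ψ v₀ a = tangentProj N (ψ v₀) (m 0) := ha
  rw [← ha', h.fderivWithin_apply hT, ContinuousLinearMap.comp_apply]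
  have := DFunLike.congr_fun h.fderiv_comp_fderiv a
  simp only [ContinuousLinearMap.comp_apply] at this
  rw [this]; rfl

/-- A tangential tensor equals T(A ·, …, A ·) with A the projection. Differentiating T gives the
covariant derivative, and differentiating A gives a term that is algebraic in T. Chart derivatives
are thus controlled by covariant ones. -/
theorem ChartGerm.fderiv_tensor (h : ChartGerm N ψ π v₀) {j : ℕ} {T : E → E [×j]→L[ℝ] ℝ}
    (hT : DifferentiableAt ℝ (fun v => T (ψ v)) v₀)
    (htan : ∀ᶠ v in 𝓝 v₀, IsTangential N (ψ v) (T (ψ v))) :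
    fderiv ℝ (fun v => T (ψ v)) v₀ =
      (covDeriv N T (ψ v₀)).curryLeft.comp (fderiv ℝ ψ v₀) + projDeriv ψ j (T (ψ v₀), v₀) := by
  set M := fun A : (E [×j]→L[ℝ] ℝ) × (E →L[ℝ] E) => A.1.compContinuousLinearMap fun _ => A.2 with hM
  set p := fun v => projOf (fderiv ℝ ψ v) with hp
  have heq : (fun v => T (ψ v)) =ᶠ[𝓝 v₀] fun v => M (T (ψ v), p v) := by
    filter_upwards [htan, h.eventually] with v h1 h2
    simp only [hM, hp]
    rw [← h2.tangentProj_eq]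
    exact h1.symm
  have hMd : HasFDerivAt M (fderiv ℝ M (T (ψ v₀), p v₀)) (T (ψ v₀), p v₀) :=
    ((contDiff_compCLM (E := E) (F := E) j).differentiable (by simp) _).hasFDerivAt
  have hpd : HasFDerivAt p (fderiv ℝ p v₀) v₀ :=
    (h.smoothNear_projOf.self.differentiableAt (by simp)).hasFDerivAt
  have hcomp := HasFDerivAt.comp v₀ (f := fun v => (T (ψ v), p v)) hMd
    (hT.hasFDerivAt.prodMk hpd)
  set D := fderiv ℝ (fun v => T (ψ v)) v₀ with hD
  have h1 : D = (fderiv ℝ M (T (ψ v₀), p v₀)).comp (D.prod (fderiv ℝ p v₀)) := by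
    exact heq.fderiv_eq.trans hcomp.fderiv
  have hleft : ∀ B : E [×j]→L[ℝ] ℝ, fderiv ℝ M (T (ψ v₀), p v₀) (B, 0) = M (B, p v₀) := by
    intro B
    have a1 := hMd.comp (T (ψ v₀)) (f := fun B : E [×j]→L[ℝ] ℝ => (B, p v₀))
      (hasFDerivAt_prodMk_left _ _)
    let Lc : (E [×j]→L[ℝ] ℝ) →L[ℝ] (E [×j]→L[ℝ] ℝ) :=
      ContinuousMultilinearMap.compContinuousLinearMapL fun _ => p v₀
    have a2 : M ∘ (fun B : E [×j]→L[ℝ] ℝ => (B, p v₀)) = Lc := rfl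
    rw [a2] at a1
    have := DFunLike.congr_fun (a1.unique Lc.hasFDerivAt) B
    exact this
  refine ContinuousLinearMap.ext fun a => ?_
  rw [h1, ContinuousLinearMap.comp_apply, ContinuousLinearMap.prod_apply,
    show (D a, fderiv ℝ p v₀ a) = (D a, 0) + (0, fderiv ℝ p v₀ a) by simp, map_add, hleft,
    add_apply]
  congr 1
  rw [h.covDeriv_eq hT]
  ext m
  simp only [hM, uncurryComp, ContinuousMultilinearMap.compContinuousLinearMap_apply,
    ContinuousLinearMap.comp_apply, ContinuousMultilinearMap.curryLeft_apply,
    ContinuousLinearMap.uncurryLeft_apply]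
  have e1 : projOf (fderiv ℝ ψ v₀) (fderiv ℝ ψ v₀ a) = fderiv ℝ ψ v₀ a := by
    rw [← h.tangentProj_eq]; exact tangentProj_of_mem (h.fderiv_mem a)
  have e2 := DFunLike.congr_fun h.fderiv_comp_fderiv a
  simp only [ContinuousLinearMap.comp_apply] at e2
  simp only [Fin.cons_zero, Fin.tail_def, Fin.cons_succ]
  rw [e1, e2]
  rfl

theorem ChartGerm.famSmooth_iterCovDeriv (h : ChartGerm N ψ π v₀) {j : ℕ}
    {T : ι → E → E [×j]→L[ℝ] ℝ} (hT : FamSmooth l (fun i v => T i (ψ v)) v₀) (k : ℕ) :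
    FamSmooth l (fun i v => iterCovDeriv N (T i) k (ψ v)) v₀ := by
  induction k with
  | zero => exact hT
  | succ k ih =>
    have hπ : SmoothNear (fun v => fderiv ℝ π (ψ v)) v₀ := by
      filter_upwards [h.smooth.self.continuousAt.tendsto.eventually h.smooth_inv.fderiv, h.smooth]
        with v h1 h2 using ContDiffAt.comp v h1 h2
    have heq : ∀ᶠ p in l ×ˢ 𝓝 v₀, iterCovDeriv N (T p.1) (k + 1) (ψ p.2) =
        uncurryComp (j + k) ((fderiv ℝ (fun v => iterCovDeriv N (T p.1) k (ψ v)) p.2).comp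
          (fderiv ℝ π (ψ p.2)), projOf (fderiv ℝ ψ p.2)) := by
      filter_upwards [ih, tendsto_snd.eventually h.eventually] with p h1 h2
      exact h2.covDeriv_eq (h1.differentiableAt (by simp))
    filter_upwards [eventually_prod_nhds heq, ih.fderiv, tendsto_snd.eventually hπ,
      tendsto_snd.eventually h.smoothNear_projOf] with p h1 h2 h3 h4
    refine ContDiffAt.congr_of_eventuallyEq ?_ h1
    exact (contDiff_uncurryComp (E := E) (j + k)).contDiffAt.comp p.2
      ((ContDiffAt.clm_comp h2 h3).prodMk h4)

/-- If all covariant derivatives of a family of tensor fields on `N` tend to zero uniformly near a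
point, then so do all derivatives in a chart. -/
theorem ChartGerm.st_of_iterCovDeriv (h : ChartGerm N ψ π v₀) {j : ℕ}
    {T : ι → E → E [×j]→L[ℝ] ℝ} (hT : FamSmooth l (fun i v => T i (ψ v)) v₀)
    (htan : ∀ i x, IsTangential N x (T i x))
    (h0 : ∀ k, Tendsto (fun p : ι × P => iterCovDeriv N (T p.1) k (ψ p.2)) (l ×ˢ 𝓝 v₀) (𝓝 0)) :
    ST l v₀ (fun i v => T i (ψ v)) (fun _ => 0) := by
  have htan' : ∀ k i x, IsTangential N x (iterCovDeriv N (T i) k x) := by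
    intro k i x
    cases k with
    | zero => exact htan i x
    | succ k => exact covDeriv_isTangential _ _
  have hz : ∀ k, SmoothNear (fun _ : P => (0 : E [×(j + k)]→L[ℝ] ℝ)) v₀ := fun k =>
    Eventually.of_forall fun _ => contDiffAt_const
  -- The induction on the order m treats all k at once, because the chart derivative of ∇^k T
  -- involves both ∇^{k+1} T and ∇^k T.
  suffices H : ∀ m k, STk l v₀ m (fun i v => iterCovDeriv N (T i) k (ψ v)) (fun _ => 0) from
    fun m => H m 0
  intro m
  induction m with
  | zero => exact fun k => ⟨h.famSmooth_iterCovDeriv hT k, hz k, h0 k⟩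
  | succ m ih =>
    intro k
    have hb : STk l v₀ 0 (fun i v => iterCovDeriv N (T i) k (ψ v)) (fun _ => 0) :=
      ⟨h.famSmooth_iterCovDeriv hT k, hz k, h0 k⟩
    refine hb.succ ?_
    have hcur : ContDiff ℝ ∞ (fun A : E [×(j + k + 1)]→L[ℝ] ℝ => A.curryLeft) := by
      refine IsBoundedLinearMap.contDiff (IsLinearMap.with_bound
        ⟨fun _ _ => ?_, fun _ _ => ?_⟩ 1 fun A => ?_)
      · ext m; simp
      · ext m; simp
      · rw [one_mul]
        refine ContinuousLinearMap.opNorm_le_bound _ (norm_nonneg A) fun x => ?_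
        refine ContinuousMultilinearMap.opNorm_le_bound (by positivity) fun m => ?_
        exact ContinuousMultilinearMap.norm_map_cons_le A x m
    have hΨ : ContDiff ℝ ∞ (fun q : (E [×(j + k + 1)]→L[ℝ] ℝ) × (P →L[ℝ] E) =>
        q.1.curryLeft.comp q.2) := (hcur.comp contDiff_fst).clm_comp contDiff_snd
    have t1 : STk l v₀ m (fun i v => ((iterCovDeriv N (T i) (k + 1) (ψ v)).curryLeft).comp
        (fderiv ℝ ψ v)) (fun v => (0 : E [×(j + k + 1)]→L[ℝ] ℝ).curryLeft.comp (fderiv ℝ ψ v)) :=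
      STk.map (f₀ := fun v => ((0 : E [×(j + k + 1)]→L[ℝ] ℝ), fderiv ℝ ψ v)) hΨ.smoothNear
        ((ih (k + 1)).prodMk h.smooth.fderiv.STk)
    have t2 : STk l v₀ m (fun i v => projDeriv ψ (j + k) (iterCovDeriv N (T i) k (ψ v), v))
        (fun v => projDeriv ψ (j + k) (0, v)) :=
      STk.map (f₀ := fun v => ((0 : E [×(j + k)]→L[ℝ] ℝ), v)) (h.smoothNear_projDeriv (j + k) 0)
        ((ih k).prodMk (SmoothNear.STk (f₀ := fun v : P => v) contDiff_id.smoothNear))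
    refine (t1.add t2).congr ?_ ?_
    · filter_upwards [hb.fam, tendsto_snd.eventually h.eventually] with p h1 h2
      exact h2.fderiv_tensor (h1.differentiableAt (by simp))
        (Eventually.of_forall fun v => htan' k p.1 (ψ v))
    · refine Eventually.of_forall fun v => ?_
      simp only [projDeriv_zero, fderiv_fun_const]
      ext a m
      simp

end Decay

end SLGeom

end

noncomputable section

namespace SLGeom

/-! ## The cone, its Lagrangian neighbourhood, and decaying functions -/

/-- The tube lemma in filter form: it turns what holds near each point of the link, or of a bounded
part of L, into one threshold. -/
theorem eventually_forall_of_isCompact {ι X : Type} [TopologicalSpace X] {l : Filter ι} {S : Set X}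
    (hS : IsCompact S) {p : ι × X → Prop} (h : ∀ x ∈ S, ∀ᶠ q in l ×ˢ 𝓝 x, p q) :
    ∀ᶠ i in l, ∀ x ∈ S, p (i, x) := by
  refine hS.induction_on (p := fun s => ∀ᶠ i in l, ∀ x ∈ s, p (i, x)) (by simp) ?_ ?_ ?_
  · intro s t hst ht
    filter_upwards [ht] with i hi x hx using hi x (hst hx)
  · intro s t hs ht
    filter_upwards [hs, ht] with i h1 h2 x hx using hx.elim (h1 x) (h2 x)
  · intro x hx
    obtain ⟨pa, ha, pb, hb, hab⟩ := eventually_prod_iff.1 (h x hx)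
    refine ⟨{y | pb y}, mem_nhdsWithin_of_mem_nhds hb, ?_⟩
    filter_upwards [ha] with i hi y hy using hab hi hy

section Cone

variable {n : ℕ} {S : Set (Cn n)}

theorem smul_mem_puncturedCone {t : ℝ} (ht : 0 < t) {x : Cn n} (hx : x ∈ puncturedCone S) :
    t • x ∈ puncturedCone S := by
  obtain ⟨s, hs, σ, hσ, rfl⟩ := hx
  exact ⟨t * s, mul_pos ht hs, σ, hσ, smul_smul _ _ _⟩

theorem smul_mem_puncturedCone_iff {t : ℝ} (ht : 0 < t) {x : Cn n} :
    t • x ∈ puncturedCone S ↔ x ∈ puncturedCone S := by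
  refine ⟨fun h => ?_, smul_mem_puncturedCone ht⟩
  have := smul_mem_puncturedCone (inv_pos.2 ht) h
  rwa [smul_smul, inv_mul_cancel₀ ht.ne', one_smul] at this

theorem preimage_puncturedCone {t : ℝ} (ht : 0 < t) :
    (fun y : Cn n => t • y + 0) ⁻¹' puncturedCone S = puncturedCone S := by
  ext x
  simp [smul_mem_puncturedCone_iff ht]

theorem subset_puncturedCone : S ⊆ puncturedCone S := fun σ hσ => ⟨1, one_pos, σ, hσ, by simp⟩

theorem tangentSpaceOf_puncturedCone {t : ℝ} (ht : 0 < t) (x : Cn n) :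
    tangentSpaceOf (puncturedCone S) (t • x) = tangentSpaceOf (puncturedCone S) x := by
  have := tangentSpaceOf_preimage_similarity (N := puncturedCone S) ht.ne' 0 x
  rw [preimage_puncturedCone ht, add_zero] at this
  exact this.symm

theorem IsSpecialLagrangianLink.norm_eq (hS : IsSpecialLagrangianLink S) {σ : Cn n} (h : σ ∈ S) :
    ‖σ‖ = 1 := by simpa using hS.subset_sphere h

theorem IsSpecialLagrangianLink.norm_pos (hS : IsSpecialLagrangianLink S) {x : Cn n}
    (hx : x ∈ puncturedCone S) : 0 < ‖x‖ := by
  obtain ⟨t, ht, σ, hσ, rfl⟩ := hx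
  rw [norm_smul, hS.norm_eq hσ, mul_one]
  simpa using ht.ne'

theorem IsSpecialLagrangianLink.normalize_mem (hS : IsSpecialLagrangianLink S) {x : Cn n}
    (hx : x ∈ puncturedCone S) : ‖x‖⁻¹ • x ∈ S := by
  obtain ⟨t, ht, σ, hσ, rfl⟩ := hx
  rw [norm_smul, hS.norm_eq hσ, mul_one, Real.norm_of_nonneg ht.le, smul_smul,
    inv_mul_cancel₀ ht.ne', one_smul]
  exact hσ

theorem IsSpecialLagrangianLink.isSmooth (hS : IsSpecialLagrangianLink S) :
    IsSmoothSubmanifold n (puncturedCone S) := hS.cone_sl.1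

/-- On the compact link this is openness of the domain and continuity of Φ along the zero section.
Equivariance spreads it over the cone with bounds proportional to ‖x‖. -/
theorem ConeLagrangianNbhd.exists_uniform (hS : IsSpecialLagrangianLink S)
    (Φ : ConeLagrangianNbhd (puncturedCone S)) {ε : ℝ} (hε : 0 < ε) :
    ∃ δ > 0, ∀ x ∈ puncturedCone S, ∀ ξ ∈ tangentSpaceOf (puncturedCone S) x, ‖ξ‖ ≤ δ * ‖x‖ →
      (x, ξ) ∈ Φ.dom ∧ ‖Φ.toFun (x, ξ) - x‖ ≤ ε * ‖x‖ := by
  obtain ⟨O, hO, hdom⟩ := Φ.isOpen_dom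
  have h1 : ∀ᶠ ξ in 𝓝 (0 : Cn n), ∀ σ ∈ S, ξ ∈ tangentSpaceOf (puncturedCone S) σ →
      (σ, ξ) ∈ Φ.dom ∧ ‖Φ.toFun (σ, ξ) - σ‖ ≤ ε := by
    have h2 : ∀ σ ∈ S, ∀ᶠ q in 𝓝 (0 : Cn n) ×ˢ 𝓝 σ, q.2 ∈ S →
        q.1 ∈ tangentSpaceOf (puncturedCone S) q.2 →
        (q.2, q.1) ∈ Φ.dom ∧ ‖Φ.toFun (q.2, q.1) - q.2‖ ≤ ε := by
      intro σ hσ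
      have h0 := Φ.zero_mem σ (subset_puncturedCone hσ)
      have h3 : Tendsto (fun q => Φ.toFun q - q.1) (𝓝[Φ.dom] (σ, 0)) (𝓝 (Φ.toFun (σ, 0) - σ)) :=
        ((Φ.smooth.continuousOn _ h0).tendsto).sub
          ((continuous_fst.tendsto _).mono_left nhdsWithin_le_nhds)
      rw [Φ.map_zero σ (subset_puncturedCone hσ), sub_self] at h3
      have h4 := eventually_nhdsWithin_iff.1 (h3.eventually (closedBall_mem_nhds 0 hε))
      have h5 : ∀ᶠ q in 𝓝 (σ, (0 : Cn n)), q ∈ O := hO.mem_nhds (hdom ▸ h0).2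
      have h6 : Tendsto (fun q : Cn n × Cn n => (q.2, q.1)) (𝓝 0 ×ˢ 𝓝 σ) (𝓝 (σ, 0)) := by
        rw [nhds_prod_eq]; exact tendsto_snd.prodMk tendsto_fst
      filter_upwards [h6.eventually h4, h6.eventually h5] with q a1 a2 a3 a4
      have a5 : (q.2, q.1) ∈ Φ.dom := hdom ▸ ⟨⟨subset_puncturedCone a3, a4⟩, a2⟩
      exact ⟨a5, by simpa using a1 a5⟩
    filter_upwards [eventually_forall_of_isCompact hS.isCompact h2] with ξ h σ hσ
      using h σ hσ hσ
  obtain ⟨δ, hδ, h⟩ := Metric.eventually_nhds_iff_ball.1 h1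
  refine ⟨δ / 2, by positivity, fun x hx ξ hξ hle => ?_⟩
  have hp := hS.norm_pos hx
  have e : ∀ y : Cn n, ‖x‖ • (‖x‖⁻¹ • y) = y := fun y => by
    rw [smul_smul, mul_inv_cancel₀ hp.ne', one_smul]
  obtain ⟨a1, a2⟩ := h (‖x‖⁻¹ • ξ) (by
    rw [mem_ball_zero_iff, norm_smul, norm_inv, norm_norm, inv_mul_lt_iff₀ hp]
    nlinarith) _ (hS.normalize_mem hx)
    (by rw [tangentSpaceOf_puncturedCone (inv_pos.2 hp)]; exact Submodule.smul_mem _ _ hξ)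
  have a3 := Φ.smul_mem _ hp _ _ a1
  have a4 := Φ.map_smul _ hp _ _ a1
  rw [e, e] at a3 a4
  refine ⟨a3, ?_⟩
  have : Φ.toFun (x, ξ) - x = ‖x‖ • (Φ.toFun (‖x‖⁻¹ • x, ‖x‖⁻¹ • ξ) - ‖x‖⁻¹ • x) := by
    rw [a4, smul_sub, e]
  rw [this, norm_smul, norm_norm, mul_comm]
  gcongr

theorem contDiff_scalar : ContDiff ℝ ∞
    (fun c : ℝ => ContinuousMultilinearMap.constOfIsEmpty ℝ (fun _ : Fin 0 => Cn n) c) := by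
  refine IsBoundedLinearMap.contDiff (IsLinearMap.with_bound
    ⟨fun _ _ => ?_, fun _ _ => ?_⟩ 1 fun A => ?_)
  · ext m; simp
  · ext m; simp
  · simp

variable {Φ : ConeLagrangianNbhd (puncturedCone S)} {L : Set (Cn n)} {Λ₀ μ : ℝ} {g : Cn n → ℝ}
variable {P : Type} [NormedAddCommGroup P] [NormedSpace ℝ P] [FiniteDimensional ℝ P]
  {ψ : P → Cn n} {π : Cn n → P} {v₀ : P}

theorem IsAsymptoticTo.contDiffAt_comp (hg : IsAsymptoticTo Φ L Λ₀ μ g)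
    (h : ChartGerm (puncturedCone S) ψ π v₀) {t : ℝ} (ht : 0 < t) (hr : Λ₀ < t * ‖ψ v₀‖) :
    ContDiffAt ℝ ∞ (fun v => g (t • ψ v)) v₀ := by
  have hc : Tendsto (fun v => t * ‖ψ v‖) (𝓝 v₀) (𝓝 (t * ‖ψ v₀‖)) :=
    (h.differentiableAt.continuousAt.tendsto.norm).const_mul t
  have hmem : ∀ᶠ v in 𝓝 v₀, t • ψ v ∈ {x | x ∈ puncturedCone S ∧ Λ₀ < ‖x‖} := by
    filter_upwards [h.mem, hc.eventually (lt_mem_nhds hr)] with v h1 h2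
    refine ⟨smul_mem_puncturedCone ht h1, ?_⟩
    rwa [norm_smul, Real.norm_of_nonneg ht.le]
  have h1 : ContDiffAt ℝ ∞ (fun v => t • ψ v) v₀ := h.smooth.self.const_smul t
  exact ((hg.smooth _ hmem.self_of_nhds).comp v₀ (s := (fun v => t • ψ v) ⁻¹' _)
    h1.contDiffWithinAt (mapsTo_preimage _ _)).contDiffAt hmem

/-- On dilations, the potential of an asymptotically conical end tends to zero smoothly. -/
theorem IsAsymptoticTo.st_zero (hS : IsSpecialLagrangianLink S) (hμ : μ < 0)
    (hg : IsAsymptoticTo Φ L Λ₀ μ g) (h : ChartGerm (puncturedCone S) ψ π v₀) :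
    ST atTop v₀ (fun (t : ℝ) v => g (t • ψ v)) (fun _ => 0) := by
  have hpos := hS.norm_pos h.mem_self
  have hbig : Tendsto (fun p : ℝ × P => p.1 * ‖ψ p.2‖) (atTop ×ˢ 𝓝 v₀) atTop :=
    tendsto_fst.atTop_mul_pos hpos
      ((h.differentiableAt.continuousAt.tendsto.norm).comp tendsto_snd)
  have hfam : FamSmooth atTop (fun (t : ℝ) v => scalarTensor (fun y => g (t • y)) (ψ v)) v₀ := by
    filter_upwards [hbig.eventually_gt_atTop Λ₀, tendsto_fst.eventually (eventually_gt_atTop 0),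
      tendsto_snd.eventually h.eventually] with p h1 h2 h3
    exact contDiff_scalar.contDiffAt.comp p.2 (hg.contDiffAt_comp h3 h2 h1)
  have key := h.st_of_iterCovDeriv (T := fun (t : ℝ) => scalarTensor (fun y => g (t • y))) hfam
    (fun t x => by ext m; simp [scalarTensor]) ?_
  · refine (key.clm (ContinuousMultilinearMap.apply ℝ (fun _ : Fin 0 => Cn n) ℝ 0)).congr ?_ ?_
    · exact Eventually.of_forall fun p => by simp [scalarTensor]
    · exact Eventually.of_forall fun p => by simp
  · intro k
    obtain ⟨Ck, hCk⟩ := hg.decay k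
    -- The dilation contributes t^k and the decay (t‖x‖)^{μ-k}, which leaves t^μ ‖x‖^{μ-k} → 0 for
    -- every k.
    have hlim : Tendsto (fun p : ℝ × P => Ck * (p.1 ^ μ * ‖ψ p.2‖ ^ (μ - k))) (atTop ×ˢ 𝓝 v₀)
        (𝓝 (Ck * (0 * ‖ψ v₀‖ ^ (μ - k)))) := by
      refine Tendsto.const_mul _ (Tendsto.mul ?_ ?_)
      · have := tendsto_rpow_neg_atTop (neg_pos.2 hμ)
        rw [neg_neg] at this
        exact this.comp tendsto_fst
      · exact (((h.differentiableAt.continuousAt.tendsto.norm).rpow_const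
          (Or.inl hpos.ne')).comp tendsto_snd)
    rw [zero_mul, mul_zero] at hlim
    refine squeeze_zero_norm' ?_ hlim
    filter_upwards [hbig.eventually_gt_atTop Λ₀, tendsto_fst.eventually (eventually_gt_atTop 0),
      tendsto_snd.eventually h.mem] with p h1 h2 h3
    have e := iterCovDeriv_comp_similarity (N := puncturedCone S) h2.ne' 0 (ψ p.2)
      (scalarTensor g) k
    rw [preimage_puncturedCone h2] at e
    simp only [add_zero] at e
    have e' : (scalarTensor fun y => g (p.1 • y)) = fun y => scalarTensor g (p.1 • y) := rfl
    rw [e', e, norm_smul, norm_pow, Real.norm_of_nonneg h2.le]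
    have hx := hS.norm_pos h3
    have h4 := hCk (p.1 • ψ p.2) (smul_mem_puncturedCone h2 h3)
      (by rwa [norm_smul, Real.norm_of_nonneg h2.le])
    rw [norm_smul, Real.norm_of_nonneg h2.le, Real.mul_rpow h2.le hx.le] at h4
    calc p.1 ^ k * _ ≤ p.1 ^ k * (Ck * (p.1 ^ (μ - k) * ‖ψ p.2‖ ^ (μ - k))) := by gcongr
      _ = Ck * ((p.1 ^ k * p.1 ^ (μ - k)) * ‖ψ p.2‖ ^ (μ - k)) := by ring
      _ = _ := by
        congr 3
        rw [← Real.rpow_natCast, ← Real.rpow_add h2]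
        congr 1; ring

theorem tangentialGrad_puncturedCone {t : ℝ} (ht : 0 < t) (x : Cn n) :
    tangentialGrad (puncturedCone S) (fun y => g (t • y)) x =
      t • tangentialGrad (puncturedCone S) g (t • x) := by
  have := tangentialGrad_comp_similarity (N := puncturedCone S) ht.ne' 0 x one_ne_zero g
  rw [preimage_puncturedCone ht] at this
  simpa using this

theorem IsAsymptoticTo.grad_eq (hg : IsAsymptoticTo Φ L Λ₀ μ g)
    (h : ChartGerm (puncturedCone S) ψ π v₀) {t : ℝ} (ht : 0 < t) (hr : Λ₀ < t * ‖ψ v₀‖) :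
    t • tangentialGrad (puncturedCone S) g (t • ψ v₀) =
      fderiv ℝ ψ v₀ (gradCoord ψ (fun v => g (t • ψ v)) v₀) := by
  rw [← tangentialGrad_puncturedCone ht]
  exact h.tangentialGrad_eq ((hg.contDiffAt_comp h ht hr).differentiableAt (by simp))

/-- With t = ‖x‖ the bound concerns the dilated function g(t ·) on the link, where
`IsAsymptoticTo.st_zero` and compactness apply. -/
theorem IsAsymptoticTo.exists_decay (hS : IsSpecialLagrangianLink S) (hμ : μ < 0)
    (hg : IsAsymptoticTo Φ L Λ₀ μ g) {ε : ℝ} (hε : 0 < ε) :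
    ∃ R > 0, ∀ x ∈ puncturedCone S, R ≤ ‖x‖ →
      ‖x‖ * ‖tangentialGrad (puncturedCone S) g x‖ ≤ ε ∧ |g x| ≤ ε := by
  have h1 : ∀ᶠ t in (atTop : Filter ℝ), ∀ σ ∈ S,
      ‖t • tangentialGrad (puncturedCone S) g (t • σ)‖ ≤ ε ∧ |g (t • σ)| ≤ ε := by
    have h2 : ∀ σ ∈ S, ∀ᶠ q in (atTop : Filter ℝ) ×ˢ 𝓝 σ, q.2 ∈ S →
        ‖q.1 • tangentialGrad (puncturedCone S) g (q.1 • q.2)‖ ≤ ε ∧ |g (q.1 • q.2)| ≤ ε := by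
      intro σ hσ
      obtain ⟨ψ, π, v₀, h, rfl⟩ := hS.isSmooth.exists_chartGerm (subset_puncturedCone hσ)
      have st := hg.st_zero hS hμ h
      have st2 : ST atTop v₀ (fun (t : ℝ) v => fderiv ℝ ψ v (gradCoord ψ (fun v => g (t • ψ v)) v))
          (fun v => fderiv ℝ ψ v (gradCoord ψ (fun _ => 0) v)) :=
        ST.bilin (ContinuousLinearMap.id ℝ _) h.smooth.fderiv.ST (h.gradCoord_st st.fderiv)
      have t1 := st.tendsto
      have t2 := st2.tendsto
      have z : gradCoord ψ (fun _ => 0) v₀ = 0 := by simp [gradCoord]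
      rw [z, map_zero] at t2
      have hπ : Tendsto (fun q : ℝ × Cn n => (q.1, π q.2)) (atTop ×ˢ 𝓝 (ψ v₀)) (atTop ×ˢ 𝓝 v₀) :=
        tendsto_fst.prodMk (h.inv_tendsto.comp tendsto_snd)
      filter_upwards [(hπ.eventually (t1.eventually (closedBall_mem_nhds 0 hε))),
        (hπ.eventually (t2.eventually (closedBall_mem_nhds 0 hε))),
        tendsto_snd.eventually h.eventually_chartGerm_inv,
        tendsto_fst.eventually (eventually_gt_atTop 0),
        tendsto_fst.eventually (eventually_gt_atTop Λ₀)] with q a1 a2 a3 a4 a5 a6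
      obtain ⟨a7, a8⟩ := a3 (subset_puncturedCone a6)
      have e := hg.grad_eq a7 a4 (by rw [a8, hS.norm_eq a6, mul_one]; exact a5)
      rw [a8] at e
      replace a1 := mem_closedBall_zero_iff.1 a1
      replace a2 := mem_closedBall_zero_iff.1 a2
      rw [← e] at a2
      rw [a8, Real.norm_eq_abs] at a1
      exact ⟨a2, a1⟩
    filter_upwards [eventually_forall_of_isCompact hS.isCompact h2] with t h σ hσ using h σ hσ hσ
  obtain ⟨R, hR⟩ := eventually_atTop.1 h1
  refine ⟨max R 1, by positivity, fun x hx hxR => ?_⟩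
  have := hR ‖x‖ ((le_max_left _ _).trans hxR) _ (hS.normalize_mem hx)
  rw [smul_smul, mul_inv_cancel₀ (hS.norm_pos hx).ne', one_smul, norm_smul, norm_norm] at this
  exact this

end Cone

end SLGeom

end

noncomputable section

namespace SLGeom

/-! ## The Liouville potential along the ends -/

section Liouville

variable {n : ℕ} {S : Set (Cn n)}
variable {Φ : ConeLagrangianNbhd (puncturedCone S)} {L : Set (Cn n)} {Λ₀ μ : ℝ} {g β : Cn n → ℝ}

theorem mem_tangentConeAt_of_hasFDerivAt {P E : Type} [NormedAddCommGroup P] [NormedSpace ℝ P]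
    [NormedAddCommGroup E] [NormedSpace ℝ E] {N : Set E} {f : P → E} {f' : P →L[ℝ] E} {v₀ : P}
    (hf : HasFDerivAt f f' v₀) (hN : ∀ᶠ v in 𝓝 v₀, f v ∈ N) (w : P) :
    f' w ∈ tangentConeAt ℝ N (f v₀) := by
  obtain ⟨s, hs, hso, hv⟩ := _root_.eventually_nhds_iff.1 hN
  have h1 : w ∈ tangentConeAt ℝ s v₀ := by
    rw [tangentConeAt_of_mem_nhds (hso.mem_nhds hv)]; trivial
  refine tangentConeAt_mono ?_ (hf.hasFDerivWithinAt.mapsTo_tangent_cone h1)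
  rintro _ ⟨x, hx, rfl⟩
  exact hs x hx

/-- Differentiating Φ(t p) = t Φ(p) at t = 1 shows that the position vector Φ(p) is the image of p
under dΦ. Symplecticity then evaluates ω(Φ(p), ·), twice the Liouville form, in T^*C. -/
theorem ConeLagrangianNbhd.omega_apply (Φ : ConeLagrangianNbhd (puncturedCone S)) {P : Type}
    [NormedAddCommGroup P] [NormedSpace ℝ P] {c : P → Cn n × Cn n} {c' : P →L[ℝ] Cn n × Cn n}
    {F' : P →L[ℝ] Cn n} {v₀ : P} (hc : HasFDerivAt c c' v₀) (hdom : ∀ᶠ v in 𝓝 v₀, c v ∈ Φ.dom)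
    (hF : HasFDerivAt (fun v => Φ.toFun (c v)) F' v₀) (w : P) :
    omega (Φ.toFun (c v₀)) (F' w) = ⟪(c v₀).1, (c' w).2⟫ - ⟪(c' w).1, (c v₀).2⟫ := by
  have h0 := hdom.self_of_nhds
  have hd := ((Φ.smooth _ h0).differentiableWithinAt (by simp)).hasFDerivWithinAt
  have comp : ∀ {Q : Type} [NormedAddCommGroup Q] [NormedSpace ℝ Q] {e : Q → Cn n × Cn n}
      {e' : Q →L[ℝ] Cn n × Cn n} {q : Q}, HasFDerivAt e e' q → (∀ᶠ v in 𝓝 q, e v ∈ Φ.dom) →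
      e q = c v₀ → HasFDerivAt (fun v => Φ.toFun (e v))
        ((fderivWithin ℝ Φ.toFun Φ.dom (c v₀)).comp e') q := by
    intro Q _ _ e e' q he hedom heq
    rw [← heq] at hd ⊢
    exact (hd.comp q (s := e ⁻¹' Φ.dom) he.hasFDerivWithinAt (mapsTo_preimage _ _)).hasFDerivAt
      hedom
  have h1 := hF.unique (comp hc hdom rfl)
  have hray : HasFDerivAt (fun t : ℝ => t • c v₀)
      ((ContinuousLinearMap.id ℝ ℝ).smulRight (c v₀)) 1 := (hasFDerivAt_id (1 : ℝ)).smul_const _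
  have hraydom : ∀ᶠ t in 𝓝 (1 : ℝ), t • c v₀ ∈ Φ.dom := by
    filter_upwards [lt_mem_nhds one_pos] with t ht
    exact Φ.smul_mem t ht (c v₀).1 (c v₀).2 h0
  have h2 := comp hray hraydom (one_smul _ _)
  have h3 : HasFDerivAt (fun t : ℝ => Φ.toFun (t • c v₀))
      ((ContinuousLinearMap.id ℝ ℝ).smulRight (Φ.toFun (c v₀))) 1 := by
    refine ((hasFDerivAt_id (1 : ℝ)).smul_const (Φ.toFun (c v₀))).congr_of_eventuallyEq ?_
    filter_upwards [lt_mem_nhds one_pos] with t ht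
    exact Φ.map_smul t ht (c v₀).1 (c v₀).2 h0
  have h4 := DFunLike.congr_fun (h3.unique h2) 1
  simp only [ContinuousLinearMap.smulRight_apply, ContinuousLinearMap.comp_apply, one_smul,
    ContinuousLinearMap.id_apply] at h4
  rw [h1, ContinuousLinearMap.comp_apply]
  conv_lhs => rw [h4]
  have t1 := mem_tangentConeAt_of_hasFDerivAt hray hraydom 1
  simp only [ContinuousLinearMap.smulRight_apply, one_smul, ContinuousLinearMap.id_apply] at t1
  exact Φ.symplectic _ h0 _ t1 _ (mem_tangentConeAt_of_hasFDerivAt hc hdom w)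

/-- The difference between the Liouville potential at a point of the graph of `dg` and the terms
determined by `g`. -/
def endPart (Φ : ConeLagrangianNbhd (puncturedCone S)) (g β : Cn n → ℝ) (y : Cn n) : ℝ :=
  β (coneGraphPoint Φ g y) - 1 / 2 * ⟪tangentialGrad (puncturedCone S) g y, y⟫ + g y

/-- By `ConeLagrangianNbhd.omega_apply`, dβ(w) = ½(⟪ψ, dξ w⟫ - ⟪dψ w, ξ⟫) along the graph of ξ = ∇g.
With dg(w) = ⟪ξ, dψ w⟫ the derivative of `endPart` cancels completely. -/
theorem endPart_eventually_eq (hS : IsSpecialLagrangianLink S)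
    (hg : IsAsymptoticTo Φ L Λ₀ μ g) (hβ : IsLiouvillePotential L β) {y : Cn n}
    (hy : y ∈ puncturedCone S) (hr : Λ₀ < ‖y‖) :
    ∀ᶠ x in 𝓝 y, x ∈ puncturedCone S → endPart Φ g β x = endPart Φ g β y := by
  obtain ⟨ψ, π, v₀, h, rfl⟩ := hS.isSmooth.exists_chartGerm hy
  have hev : ∀ᶠ v in 𝓝 v₀, ChartGerm (puncturedCone S) ψ π v ∧ Λ₀ < ‖ψ v‖ :=
    h.eventually.and (h.differentiableAt.continuousAt.norm.eventually (lt_mem_nhds hr))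
  have hgs : ∀ᶠ v in 𝓝 v₀, ContDiffAt ℝ ∞ (fun v => g (ψ v)) v := by
    filter_upwards [hev] with v hv
    have := hg.contDiffAt_comp hv.1 one_pos (by rw [one_mul]; exact hv.2)
    simpa using this
  set ξ : EuclideanSpace ℝ (Fin n) → Cn n := fun v => tangentialGrad (puncturedCone S) g (ψ v)
    with hξ
  have hξs : ∀ᶠ v in 𝓝 v₀, ContDiffAt ℝ ∞ ξ v := by
    have st : ST (pure () : Filter Unit) v₀ (fun _ v => fderiv ℝ ψ v (gradCoord ψ (fun v => g (ψ v)) v))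
        (fun v => fderiv ℝ ψ v (gradCoord ψ (fun v => g (ψ v)) v)) :=
      ST.bilin (ContinuousLinearMap.id ℝ _) h.smooth.fderiv.ST
        (h.gradCoord_st (SmoothNear.ST (f₀ := fun v => g (ψ v)) hgs).fderiv)
    filter_upwards [(st 0).lim.eventually_nhds, hev.eventually_nhds, hgs.eventually_nhds]
      with v h1 h2 h3
    refine h1.self_of_nhds.congr_of_eventuallyEq ?_
    filter_upwards [h2, h3] with w h4 h5
    exact h4.1.tangentialGrad_eq (h5.differentiableAt (by simp))
  have hdom : ∀ᶠ v in 𝓝 v₀, (ψ v, ξ v) ∈ Φ.dom := by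
    filter_upwards [hev] with v hv using hg.mem_dom _ hv.1.mem_self hv.2
  have hPL : ∀ᶠ v in 𝓝 v₀, Φ.toFun (ψ v, ξ v) ∈ L := by
    filter_upwards [hev] with v hv
    exact hg.graph_subset ⟨ψ v, ⟨hv.1.mem_self, hv.2⟩, rfl⟩
  have hder : ∀ᶠ v in 𝓝 v₀, HasFDerivAt (fun v => endPart Φ g β (ψ v))
      (0 : EuclideanSpace ℝ (Fin n) →L[ℝ] ℝ) v := by
    filter_upwards [hev, hgs, hξs, hdom.eventually_nhds, hPL.eventually_nhds]
      with v h1 h2 h3 h4 h5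
    have d1 := h1.1.differentiableAt.hasFDerivAt
    have d2 := (h3.differentiableAt (by simp)).hasFDerivAt
    have d3 := (h2.differentiableAt (by simp)).hasFDerivAt
    have d4 := d1.prodMk d2
    have d5 := (((Φ.smooth _ h4.self_of_nhds).differentiableWithinAt
      (by simp)).hasFDerivWithinAt.comp v (s := (fun v => (ψ v, ξ v)) ⁻¹' Φ.dom)
      d4.hasFDerivWithinAt (mapsTo_preimage _ _)).hasFDerivAt h4
    have d6 := (((hβ.1 _ h5.self_of_nhds).differentiableWithinAt
      (by simp)).hasFDerivWithinAt.comp v (s := (fun v => Φ.toFun (ψ v, ξ v)) ⁻¹' L)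
      d5.hasFDerivWithinAt (mapsTo_preimage _ _)).hasFDerivAt h5
    have d7 := (d6.sub ((d2.inner ℝ d1).const_mul (1 / 2))).add d3
    refine d7.congr_fderiv ?_
    ext w
    have o := Φ.omega_apply d4 h4 d5 w
    have bt := hβ.2 _ h5.self_of_nhds _ (Submodule.subset_span
      (mem_tangentConeAt_of_hasFDerivAt d5 h5 w))
    have gr := h1.1.inner_tangentialGrad (h2.differentiableAt (by simp)) w
    have bt' : fderivWithin ℝ β L (Φ.toFun (ψ v, ξ v)) (((fderivWithin ℝ Φ.toFun Φ.dom
      (ψ v, ξ v)).comp ((fderiv ℝ ψ v).prod (fderiv ℝ ξ v))) w) = _ := bt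
    simp only [add_apply, sub_apply, ContinuousLinearMap.comp_apply,
      smul_apply, ContinuousLinearMap.prod_apply, fderivInnerCLM_apply,
      zero_apply, smul_eq_mul] at o bt' ⊢
    rw [bt', o, ← gr, real_inner_comm (ψ v), real_inner_comm (ξ v) (fderiv ℝ ψ v w)]
    ring
  obtain ⟨ρ, hρ, hb⟩ := Metric.eventually_nhds_iff_ball.1 hder
  have hconst : ∀ v ∈ ball v₀ ρ, endPart Φ g β (ψ v) = endPart Φ g β (ψ v₀) := fun v hv =>
    isOpen_ball.is_const_of_fderiv_eq_zero (convex_ball v₀ ρ).isPreconnected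
      (fun x hx => (hb x hx).differentiableAt.differentiableWithinAt)
      (fun x hx => (hb x hx).fderiv) hv (mem_ball_self hρ)
  filter_upwards [h.inv_tendsto.eventually (ball_mem_nhds v₀ hρ), h.right_inv] with x h1 h2 hx
  rw [← hconst _ h1, h2 hx]

theorem endPart_smul (hS : IsSpecialLagrangianLink S) (hΛ₀ : 0 < Λ₀)
    (hg : IsAsymptoticTo Φ L Λ₀ μ g) (hβ : IsLiouvillePotential L β) {y : Cn n}
    (hy : y ∈ puncturedCone S) {s t : ℝ} (hs : Λ₀ < s * ‖y‖) (ht : Λ₀ < t * ‖y‖) :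
    endPart Φ g β (s • y) = endPart Φ g β (t • y) := by
  have hp := hS.norm_pos hy
  have hder : ∀ t ∈ Ioi (Λ₀ / ‖y‖), HasDerivAt (fun t : ℝ => endPart Φ g β (t • y)) 0 t := by
    intro t ht
    have ht' : 0 < t := (by positivity : 0 < Λ₀ / ‖y‖).trans ht
    have h1 := endPart_eventually_eq hS hg hβ (smul_mem_puncturedCone ht' hy)
      (by rw [norm_smul, Real.norm_of_nonneg ht'.le]; exact (div_lt_iff₀ hp).1 ht)
    have h2 : Tendsto (fun s : ℝ => s • y) (𝓝 t) (𝓝 (t • y)) :=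
      (continuous_id.smul continuous_const).tendsto _
    refine (hasDerivAt_const t (endPart Φ g β (t • y))).congr_of_eventuallyEq ?_
    filter_upwards [h2.eventually h1, lt_mem_nhds ht'] with s a1 a2
    exact a1 (smul_mem_puncturedCone a2 hy)
  refine isOpen_Ioi.is_const_of_deriv_eq_zero isPreconnected_Ioi
    (fun t ht => (hder t ht).differentiableAt.differentiableWithinAt)
    (fun t ht => (hder t ht).deriv) ((div_lt_iff₀ hp).2 hs) ((div_lt_iff₀ hp).2 ht)

/-- `endPart` is constant along the ray while its terms ⟪∇g, y⟫ and g tend to zero, so β converges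
and its limit is that constant. -/
theorem endConst_eq (hS : IsSpecialLagrangianLink S) (hΛ₀ : 0 < Λ₀) (hμ : μ < 0)
    (hg : IsAsymptoticTo Φ L Λ₀ μ g) (hβ : IsLiouvillePotential L β) {y : Cn n}
    (hy : y ∈ puncturedCone S) {t : ℝ} (ht : Λ₀ < t * ‖y‖) :
    endConst Φ g β y = endPart Φ g β (t • y) := by
  have hp := hS.norm_pos hy
  refine Tendsto.limUnder_eq ?_
  rw [Metric.tendsto_atTop]
  intro ε hε
  obtain ⟨R, hR, hdec⟩ := hg.exists_decay hS hμ (ε := ε / 3) (by positivity)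
  refine ⟨max (R / ‖y‖) ((Λ₀ + 1) / ‖y‖), fun s hs => ?_⟩
  have hs1 : R ≤ s * ‖y‖ := (div_le_iff₀ hp).1 ((le_max_left _ _).trans hs)
  have hs2 : Λ₀ < s * ‖y‖ := by
    have := (div_le_iff₀ hp).1 ((le_max_right _ _).trans hs); linarith
  have hs0 : 0 < s := by
    by_contra hcon
    have : s * ‖y‖ ≤ 0 := mul_nonpos_of_nonpos_of_nonneg (not_lt.1 hcon) hp.le
    linarith
  obtain ⟨d1, d2⟩ := hdec (s • y) (smul_mem_puncturedCone hs0 hy)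
    (by rwa [norm_smul, Real.norm_of_nonneg hs0.le])
  rw [← endPart_smul hS hΛ₀ hg hβ hy hs2 ht, Real.dist_eq, endPart]
  have d3 := abs_real_inner_le_norm (tangentialGrad (puncturedCone S) g (s • y)) (s • y)
  rw [mul_comm] at d3
  have e : β (coneGraphPoint Φ g (s • y)) - (β (coneGraphPoint Φ g (s • y)) -
      1 / 2 * ⟪tangentialGrad (puncturedCone S) g (s • y), s • y⟫ + g (s • y)) =
      1 / 2 * ⟪tangentialGrad (puncturedCone S) g (s • y), s • y⟫ - g (s • y) := by ring
  rw [e, abs_lt]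
  have := abs_le.1 d2
  have := abs_le.1 (d3.trans d1)
  constructor <;> linarith

/-- The identity that matches the graph of dG with the embedding of L × (ℝ ∖ 0): its right side
appears when G is differentiated in u. -/
theorem liouville_coneGraphPoint (hS : IsSpecialLagrangianLink S) (hΛ₀ : 0 < Λ₀) (hμ : μ < 0)
    (hg : IsAsymptoticTo Φ L Λ₀ μ g) (hβ : IsLiouvillePotential L β) {y : Cn n}
    (hy : y ∈ puncturedCone S) (hr : Λ₀ < ‖y‖) :
    β (coneGraphPoint Φ g y) = endConst Φ g β y +
      1 / 2 * ⟪tangentialGrad (puncturedCone S) g y, y⟫ - g y := by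
  have := endConst_eq hS hΛ₀ hμ hg hβ hy (t := 1) (by rwa [one_mul])
  rw [this, one_smul, endPart]
  ring

theorem endConst_smul (hS : IsSpecialLagrangianLink S) (hΛ₀ : 0 < Λ₀) (hμ : μ < 0)
    (hg : IsAsymptoticTo Φ L Λ₀ μ g) (hβ : IsLiouvillePotential L β) {y : Cn n}
    (hy : y ∈ puncturedCone S) {t : ℝ} (ht : 0 < t) :
    endConst Φ g β (t • y) = endConst Φ g β y := by
  have hp := hS.norm_pos hy
  have hΛ : Λ₀ < (2 * Λ₀ / ‖y‖) * ‖y‖ := by rw [div_mul_cancel₀ _ hp.ne']; linarith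
  rw [endConst_eq hS hΛ₀ hμ hg hβ hy hΛ, endConst_eq hS hΛ₀ hμ hg hβ (smul_mem_puncturedCone ht hy)
    (t := (2 * Λ₀ / ‖y‖) * t⁻¹) ?_, smul_smul, inv_mul_cancel_right₀ ht.ne']
  rw [norm_smul, Real.norm_of_nonneg ht.le]
  field_simp
  linarith

theorem endConst_eventually_eq (hS : IsSpecialLagrangianLink S) (hΛ₀ : 0 < Λ₀) (hμ : μ < 0)
    (hg : IsAsymptoticTo Φ L Λ₀ μ g) (hβ : IsLiouvillePotential L β) {y : Cn n}
    (hy : y ∈ puncturedCone S) :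
    ∀ᶠ x in 𝓝 y, x ∈ puncturedCone S → endConst Φ g β x = endConst Φ g β y := by
  have hp := hS.norm_pos hy
  set t := 2 * Λ₀ / ‖y‖
  have ht : 0 < t := by positivity
  have hΛ : Λ₀ < t * ‖y‖ := by
    simp only [t]; rw [div_mul_cancel₀ _ hp.ne']; linarith
  have h1 := endPart_eventually_eq hS hg hβ (smul_mem_puncturedCone ht hy)
    (by rwa [norm_smul, Real.norm_of_nonneg ht.le])
  have h2 : Tendsto (fun x : Cn n => t • x) (𝓝 y) (𝓝 (t • y)) :=
    (continuous_const_smul t).tendsto _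
  have h3 : Tendsto (fun x : Cn n => t * ‖x‖) (𝓝 y) (𝓝 (t * ‖y‖)) :=
    (continuous_const.mul continuous_norm).tendsto _
  filter_upwards [h2.eventually h1, h3.eventually (lt_mem_nhds hΛ)] with x a1 a2 hx
  rw [endConst_eq hS hΛ₀ hμ hg hβ hx a2, endConst_eq hS hΛ₀ hμ hg hβ hy hΛ]
  exact a1 (smul_mem_puncturedCone ht hx)

end Liouville

end SLGeom

end

noncomputable section

namespace SLGeom

/-! ## The rescaled potential -/

theorem ST.comp_tendsto {ι ι' : Type} {E F : Type} [NormedAddCommGroup E] [NormedSpace ℝ E]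
    [NormedAddCommGroup F] [NormedSpace ℝ F] {l : Filter ι} {l' : Filter ι'} {x₀ : E}
    {f : ι' → E → F} {f₀ : E → F} (h : ST l' x₀ f f₀) {φ : ι → ι'} (hφ : Tendsto φ l l') :
    ST l x₀ (fun i => f (φ i)) f₀ := by
  have ht : Tendsto (fun p : ι × E => (φ p.1, p.2)) (l ×ˢ 𝓝 x₀) (l' ×ˢ 𝓝 x₀) :=
    (hφ.comp tendsto_fst).prodMk tendsto_snd
  intro k
  induction k generalizing F with
  | zero => exact ⟨ht.eventually (h 0).fam, (h 0).lim, h.tendsto.comp ht⟩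
  | succ k ih => exact STk.succ ⟨ht.eventually (h 0).fam, (h 0).lim, h.tendsto.comp ht⟩ (ih h.fderiv)

/-- The quadratic remainder of `(u + y)^(m+1)`. -/
def sqRem : ℕ → ℝ × ℝ → ℝ
  | 0, _ => 0
  | m + 1, q => sqRem m q * (q.1 + q.2) + (m + 1) * q.1 ^ m

theorem add_pow_eq_sqRem (m : ℕ) (u y : ℝ) :
    (u + y) ^ (m + 1) = u ^ (m + 1) + (m + 1) * u ^ m * y + y ^ 2 * sqRem m (u, y) := by
  induction m with
  | zero => simp [sqRem]
  | succ m ih =>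
    rw [pow_succ, ih, sqRem]
    push_cast
    ring

theorem contDiff_sqRem (m : ℕ) : ContDiff ℝ ∞ (sqRem m) := by
  induction m with
  | zero => exact contDiff_const
  | succ m ih =>
    exact (ih.mul (contDiff_fst.add contDiff_snd)).add (contDiff_const.mul (contDiff_fst.pow m))

theorem sqRem_zero {m : ℕ} (hm : 2 ≤ m) : sqRem m (0, 0) = 0 := by
  obtain ⟨k, rfl⟩ := Nat.exists_eq_add_of_le' hm
  simp [sqRem]

/-- The terms of `φ_a` that contain `r`, rescaled. -/
def phiRest (n a : ℕ) (q : ℝ × ℝ × ℝ) : ℝ :=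
  ∑ j ∈ Finset.range a, harmonicCoeff n a (j + 1) * q.1 ^ (2 * a - 2 * (j + 1)) *
    q.2.1 ^ (2 * j) * q.2.2 ^ (j + 1)

theorem contDiff_phiRest (n a : ℕ) : ContDiff ℝ ∞ (phiRest n a) := by
  unfold phiRest
  refine ContDiff.sum fun j _ => ?_
  fun_prop

/-- Every term has a positive power of the first variable, except the last one (j = a - 1), which
has s^{2a-2}, positive because a > 1. -/
theorem phiRest_zero {n a : ℕ} (ha : 1 < a) (ϱ : ℝ) : phiRest n a (0, 0, ϱ) = 0 := by
  refine Finset.sum_eq_zero fun j hj => ?_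
  rw [Finset.mem_range] at hj
  by_cases h : 2 * a - 2 * (j + 1) = 0
  · have : 2 * j ≠ 0 := by omega
    simp [this]
  · simp [h]

/-- A family of points `u` on the line and of scales `s` with `|u|^a ≪ s → 0`. -/
structure ConicalScale {ι : Type} (l : Filter ι) (a : ℕ) (u s : ι → ℝ) : Prop where
  tendsto_u : Tendsto u l (𝓝 0)
  tendsto_s : Tendsto s l (𝓝 0)
  pos : ∀ᶠ i in l, 0 < s i
  tendsto_ratio : Tendsto (fun i => |u i| ^ a / s i) l (𝓝 0)

theorem ConicalScale.mono {ι : Type} {l l' : Filter ι} {a : ℕ} {u s : ι → ℝ}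
    (h : ConicalScale l a u s) (hl : l' ≤ l) : ConicalScale l' a u s :=
  ⟨h.1.mono_left hl, h.2.mono_left hl, h.3.filter_mono hl, h.4.mono_left hl⟩

section Potential

variable {n : ℕ} {S : Set (Cn n)}
variable {Φ : ConeLagrangianNbhd (puncturedCone S)} {L : Set (Cn n)} {Λ₀ μ : ℝ} {g β : Cn n → ℝ}
variable {a : ℕ} {b : ℝ} {χ : ℝ → ℝ}
variable {P : Type} [NormedAddCommGroup P] [NormedSpace ℝ P] [FiniteDimensional ℝ P]
  {ψ : P → Cn n} {π : Cn n → P} {v₀ : P}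

@[simp] theorem similarity_fst (s u : ℝ) (p : CnC n) : (s • p + shift n u).fst = s • p.fst := by
  simp [shift]

@[simp] theorem similarity_snd (s u : ℝ) (p : CnC n) : (s • p + shift n u).snd = s • p.snd + u := by
  simp [shift]

theorem similarity_uCoord (s u : ℝ) (p : CnC n) :
    uCoord (s • p + shift n u) = s * uCoord p + u := by
  simp [uCoord, shift]

theorem similarity_rad {s : ℝ} (hs : 0 ≤ s) (u : ℝ) (p : CnC n) :
    rad (s • p + shift n u) = s * rad p := by
  rw [rad, similarity_fst, norm_smul, Real.norm_of_nonneg hs, rad]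

@[simp] theorem cylParam_fst (w : P × ℝ) : (cylParam ψ w).fst = ψ w.1 := rfl
@[simp] theorem cylParam_uCoord (w : P × ℝ) : uCoord (cylParam ψ w) = w.2 := rfl
@[simp] theorem cylParam_rad (w : P × ℝ) : rad (cylParam ψ w) = ‖ψ w.1‖ := rfl

/-- The potential `I` in a chart of the cylinder, rescaled by `s` about `(0, u)`. -/
def rescaledPot (I : CnC n → ℝ) (ψ : P → Cn n) (u s : ℝ) (w : P × ℝ) : ℝ :=
  (s⁻¹ ^ 2) • I (s • cylParam ψ w + shift n u)

/-- Isolates the constant s⁻² u^{2a}, which may be unbounded but does not affect the gradient. The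
linear coefficient u^{2a-1}/s tends to zero at conical scales. -/
theorem rescaled_pow {s : ℝ} (hs : 0 < s) (u τ : ℝ) (ha : 0 < a) :
    s⁻¹ ^ 2 * (s * τ + u) ^ (2 * a) = s⁻¹ ^ 2 * u ^ (2 * a) +
      ((2 * a * u ^ (2 * a - 1) / s) * τ + τ ^ 2 * sqRem (2 * a - 1) (u, s * τ)) := by
  have := add_pow_eq_sqRem (2 * a - 1) u (s * τ)
  have e : 2 * a - 1 + 1 = 2 * a := by omega
  rw [e] at this
  have e' : ((2 * a - 1 : ℕ) : ℝ) + 1 = 2 * a := by exact_mod_cast congrArg (Nat.cast (R := ℝ)) e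
  rw [e'] at this
  rw [add_comm (s * τ) u, this]
  field_simp
  ring

theorem rescaled_phiA {s : ℝ} (hs : 0 < s) (u : ℝ) (w : P × ℝ) (ha : 1 < a)
    {c : ℝ} (hc : endConst Φ g β (s • ψ w.1) = c) :
    s⁻¹ ^ 2 * phiA Φ g β a (s • cylParam ψ w + shift n u) = -c * (s⁻¹ ^ 2 * u ^ (2 * a)) -
      c * ((2 * a * u ^ (2 * a - 1) / s) * w.2 + w.2 ^ 2 * sqRem (2 * a - 1) (u, s * w.2) +
        phiRest n a (s * w.2 + u, s, ‖ψ w.1‖ ^ 2)) := by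
  have e2 : s⁻¹ ^ 2 * ∑ j ∈ Finset.range a, harmonicCoeff n a (j + 1) *
      (s * w.2 + u) ^ (2 * a - 2 * (j + 1)) * (s * ‖ψ w.1‖) ^ (2 * (j + 1)) =
      phiRest n a (s * w.2 + u, s, ‖ψ w.1‖ ^ 2) := by
    rw [phiRest, Finset.mul_sum]
    refine Finset.sum_congr rfl fun j _ => ?_
    rw [mul_pow, show 2 * (j + 1) = 2 * j + 2 by ring, pow_add s, ← pow_mul ‖ψ w.1‖]
    rw [show 2 * (j + 1) = 2 * j + 2 by ring]
    field_simp
  rw [phiA, similarity_uCoord, similarity_rad hs.le, similarity_fst, cylParam_fst, hc,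
    Finset.sum_range_succ']
  simp only [cylParam_uCoord, cylParam_rad, harmonicCoeff, mul_zero, Nat.sub_zero, pow_zero,
    mul_one, one_mul]
  have e3 : ∀ x y : ℝ, s⁻¹ ^ 2 * (-(x + y) * c) = -c * (s⁻¹ ^ 2 * x + s⁻¹ ^ 2 * y) := by
    intro x y; ring
  rw [e3, rescaled_pow hs u w.2 (by omega)]
  have e4 := e2
  simp only [harmonicCoeff] at e4
  rw [e4]
  ring

/-- The difference of `I` and `φ_a`, rescaled. -/
def cutPart (n a : ℕ) (b : ℝ) (χ : ℝ → ℝ) (g : Cn n → ℝ) (c u s : ℝ) (x : Cn n) (τ : ℝ) : ℝ :=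
  if s * τ + u = 0 then 0 else χ (s * ‖x‖ / |s * τ + u| ^ b) *
    (c * phiRest n a (s * τ + u, s, ‖x‖ ^ 2) +
      s⁻¹ ^ 2 * (s * τ + u) ^ (2 * a) * g ((|s * τ + u| ^ a)⁻¹ • s • x))

/-- I - φ_a = χ (G - φ_a), and G and φ_a share the leading term -c u^{2a}. The cut-off therefore
multiplies only the small terms collected in `cutPart`. -/
theorem rescaledPot_eq {s : ℝ} (hs : 0 < s) (u : ℝ) (w : P × ℝ) (ha : 1 < a)
    {c : ℝ} (hc : endConst Φ g β (s • ψ w.1) = c) :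
    rescaledPot (potI Φ g β a b χ) ψ u s w = -c * (s⁻¹ ^ 2 * u ^ (2 * a)) -
      c * ((2 * a * u ^ (2 * a - 1) / s) * w.2 + w.2 ^ 2 * sqRem (2 * a - 1) (u, s * w.2) +
        phiRest n a (s * w.2 + u, s, ‖ψ w.1‖ ^ 2)) + cutPart n a b χ g c u s (ψ w.1) w.2 := by
  have h1 := rescaled_phiA hs u w ha hc
  rw [← h1, rescaledPot, smul_eq_mul, potI, cutPart, similarity_uCoord, cylParam_uCoord]
  split_ifs with h0
  · rw [add_zero]
  · have h2 : s⁻¹ ^ 2 * potG Φ g β a (s • cylParam ψ w + shift n u) -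
        s⁻¹ ^ 2 * phiA Φ g β a (s • cylParam ψ w + shift n u) =
        c * phiRest n a (s * w.2 + u, s, ‖ψ w.1‖ ^ 2) +
        s⁻¹ ^ 2 * (s * w.2 + u) ^ (2 * a) * g ((|s * w.2 + u| ^ a)⁻¹ • s • ψ w.1) := by
      rw [h1, potG, similarity_uCoord, cylParam_uCoord, if_neg h0, similarity_fst, cylParam_fst, hc]
      linear_combination -c * rescaled_pow hs u w.2 (by omega : 0 < a)
    rw [similarity_rad hs.le, cylParam_rad, ← h2]
    ring

variable {ι : Type} {l : Filter ι} {u s : ι → ℝ}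

theorem ConicalScale.tendsto_pow_div (h : ConicalScale l a u s) (ha : 1 < a) :
    Tendsto (fun i => 2 * a * u i ^ (2 * a - 1) / s i) l (𝓝 0) := by
  have h1 : Tendsto (fun i => |2 * (a : ℝ)| * (|u i| ^ (a - 1) * (|u i| ^ a / s i))) l
      (𝓝 (|2 * (a : ℝ)| * (0 * 0))) := by
    refine Tendsto.const_mul _ (Tendsto.mul ?_ h.tendsto_ratio)
    have := (h.tendsto_u.abs.pow (a - 1))
    rwa [abs_zero, zero_pow (by omega)] at this
  rw [mul_zero, mul_zero] at h1
  refine squeeze_zero_norm' ?_ h1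
  filter_upwards [h.pos] with i hi
  rw [norm_div, norm_mul, norm_pow, Real.norm_eq_abs, Real.norm_eq_abs, Real.norm_of_nonneg hi.le,
    show 2 * a - 1 = (a - 1) + a by omega, pow_add]
  apply le_of_eq; ring

/-- For U = sτ + u with |τ| ≤ 1 one has |U| ≤ 2 max(s, |u|), so 4|U|^b ≤ s: by assumption if |u| ≥
s, and since b > 1 and s → 0 otherwise. As ‖ψ‖ ≥ 1/2, the argument of χ is at least 2. -/
theorem ConicalScale.eventually_cut_zero (h : ConicalScale l a u s) (hb : 1 < b)
    (hχ2 : ∀ t, 2 ≤ t → χ t = 0) (hcase : ∀ᶠ i in l, 4 * 2 ^ b * |u i| ^ b ≤ s i)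
    (hr : Tendsto (fun v => ‖ψ v‖) (𝓝 v₀) (𝓝 ‖ψ v₀‖)) (h1 : ‖ψ v₀‖ = 1) (c : ℝ) :
    ∀ᶠ p in l ×ˢ 𝓝 ((v₀, 0) : P × ℝ),
      cutPart n a b χ g c (u p.1) (s p.1) (ψ p.2.1) p.2.2 = 0 := by
  have hτ : Tendsto (fun w : P × ℝ => |w.2|) (𝓝 ((v₀, 0) : P × ℝ)) (𝓝 |(0 : ℝ)|) :=
    (continuous_snd.abs).tendsto _
  have hr' : Tendsto (fun w : P × ℝ => ‖ψ w.1‖) (𝓝 ((v₀, 0) : P × ℝ)) (𝓝 1) := by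
    rw [← h1]; exact hr.comp (continuous_fst.tendsto _)
  have hsmall : Tendsto (fun i => 4 * 2 ^ b * s i ^ (b - 1)) l (𝓝 0) := by
    have := (h.tendsto_s.rpow_const (p := b - 1) (Or.inr (by linarith))).const_mul (4 * 2 ^ b)
    rwa [Real.zero_rpow (by linarith), mul_zero] at this
  rw [abs_zero] at hτ
  filter_upwards [tendsto_fst.eventually hcase, tendsto_fst.eventually h.pos,
    tendsto_fst.eventually (hsmall.eventually (ge_mem_nhds one_pos)),
    tendsto_snd.eventually (hτ.eventually (ge_mem_nhds one_pos)),
    tendsto_snd.eventually (hr'.eventually (le_mem_nhds (by norm_num : (1 / 2 : ℝ) < 1)))]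
    with p a1 a2 a3 a4 a5
  rw [cutPart]
  split_ifs with h0
  · rfl
  · rw [hχ2, zero_mul]
    have hU : 0 < |s p.1 * p.2.2 + u p.1| := abs_pos.2 h0
    rw [le_div_iff₀ (Real.rpow_pos_of_pos hU _)]
    have hle : |s p.1 * p.2.2 + u p.1| ≤ s p.1 + |u p.1| := by
      refine (abs_add_le _ _).trans ?_
      rw [abs_mul, abs_of_pos a2]
      nlinarith
    have hmax : 4 * |s p.1 * p.2.2 + u p.1| ^ b ≤ s p.1 := by
      rcases le_total (s p.1) |u p.1| with hc | hc
      · calc 4 * |s p.1 * p.2.2 + u p.1| ^ b ≤ 4 * (2 * |u p.1|) ^ b := by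
              gcongr; linarith
          _ = 4 * 2 ^ b * |u p.1| ^ b := by
              rw [Real.mul_rpow (by norm_num) (abs_nonneg _)]; ring
          _ ≤ _ := a1
      · calc 4 * |s p.1 * p.2.2 + u p.1| ^ b ≤ 4 * (2 * s p.1) ^ b := by
              gcongr; linarith
          _ = 4 * 2 ^ b * s p.1 ^ (b - 1) * s p.1 := by
              rw [Real.mul_rpow (by norm_num) a2.le, mul_assoc _ (s p.1 ^ (b - 1)),
                ← Real.rpow_add_one a2.ne', sub_add_cancel]; ring
          _ ≤ 1 * s p.1 := by gcongr
          _ = _ := one_mul _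
    nlinarith

/-- Factoring sτ + u = u(1 + (s/u)τ) shows that the whole expression depends smoothly on the ratios
s/u, s/|u|^b and |u|^a/s, apart from the dilated g. -/
theorem cutPart_eq {u s τ : ℝ} {x : Cn n} {c : ℝ} (hu : u ≠ 0) (hs : 0 < s)
    (hτ : 0 < 1 + s / u * τ) :
    cutPart n a b χ g c u s x τ = χ (s / |u| ^ b * ‖x‖ * (1 + s / u * τ) ^ (-b)) *
      (c * phiRest n a (s * τ + u, s, ‖x‖ ^ 2) + (|u| ^ a / s) ^ 2 * (1 + s / u * τ) ^ (2 * a) *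
        g ((s / |u| ^ a) • ((1 + s / u * τ) ^ a)⁻¹ • x)) := by
  have e : s * τ + u = u * (1 + s / u * τ) := by field_simp; ring
  have e' : |s * τ + u| = |u| * (1 + s / u * τ) := by rw [e, abs_mul, abs_of_pos hτ]
  have hua := abs_pos.2 hu
  rw [cutPart, if_neg (by rw [e]; exact mul_ne_zero hu hτ.ne'), e',
    Real.mul_rpow hua.le hτ.le, Real.rpow_neg hτ.le]
  congr 1
  · congr 1
    have := Real.rpow_pos_of_pos hua b
    have := Real.rpow_pos_of_pos hτ b
    field_simp
  · congr 2
    · have : u ^ (2 * a) = (|u| ^ a) ^ 2 := by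
        rw [← pow_mul, mul_comm a 2, pow_mul, pow_mul, sq_abs]
      rw [e, mul_pow, this]
      field_simp
    · congr 1
      rw [smul_smul, smul_smul]
      congr 1
      rw [mul_pow]
      field_simp

/-- The cut-off factor converges smoothly to one with parameter m₀, while the bracket tends to zero:
`phiRest` vanishes in the limit, |u|^a/s → 0, and g is evaluated on dilations by s/|u|^a → ∞. -/
theorem ConicalScale.st_cutPart (hS : IsSpecialLagrangianLink S) (hμ : μ < 0)
    (hg : IsAsymptoticTo Φ L Λ₀ μ g) (ha : 1 < a) (hχ : ContDiff ℝ ∞ χ)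
    (h : ConicalScale l a u s) (hψ : ChartGerm (puncturedCone S) ψ π v₀) {m₀ : ℝ}
    (hm : Tendsto (fun i => s i / |u i| ^ b) l (𝓝 m₀)) (hu : ∀ᶠ i in l, u i ≠ 0)
    (hκ : Tendsto (fun i => s i / u i) l (𝓝 0)) (c : ℝ) :
    ST l ((v₀, 0) : P × ℝ) (fun i w => cutPart n a b χ g c (u i) (s i) (ψ w.1) w.2)
      (fun _ => 0) := by
  have hpos := hS.norm_pos hψ.mem_self
  have hκτ : Tendsto (fun p : ι × (P × ℝ) => 1 + s p.1 / u p.1 * p.2.2) (l ×ˢ 𝓝 (v₀, 0))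
      (𝓝 (1 + 0 * 0)) :=
    ((hκ.comp tendsto_fst).mul ((continuous_snd.tendsto ((v₀, 0) : P × ℝ)).comp
      tendsto_snd)).const_add 1
  rw [mul_zero, add_zero] at hκτ
  -- the argument of `g`
  have hsm : ∀ᶠ q : ℝ × (P × ℝ) in 𝓝 (0, (v₀, 0)), ContDiffAt ℝ ∞ ψ q.2.1 ∧ 0 < ‖ψ q.2.1‖ ∧
      0 < 1 + q.1 * q.2.2 := by
    have t1 : Tendsto (fun q : ℝ × (P × ℝ) => q.2.1) (𝓝 (0, (v₀, 0))) (𝓝 v₀) :=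
      (continuous_fst.comp continuous_snd).tendsto _
    have t2 : Tendsto (fun q : ℝ × (P × ℝ) => 1 + q.1 * q.2.2) (𝓝 (0, (v₀, 0)))
        (𝓝 (1 + 0 * 0)) :=
      (continuous_const.add (continuous_fst.mul (continuous_snd.comp continuous_snd))).tendsto _
    filter_upwards [t1.eventually hψ.smooth, t1.eventually
      (hψ.differentiableAt.continuousAt.norm.eventually (lt_mem_nhds hpos)),
      t2.eventually (lt_mem_nhds (show (0 : ℝ) < 1 + 0 * 0 by norm_num))] with q a1 a2 a3 using ⟨a1, a2, a3⟩
  have hin : ∀ q : ℝ × (P × ℝ), ContDiffAt ℝ ∞ ψ q.2.1 → ContDiffAt ℝ ∞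
      (fun q : ℝ × (P × ℝ) => ψ q.2.1) q := fun q hq =>
    ContDiffAt.comp q hq (contDiff_fst.comp contDiff_snd).contDiffAt
  have hone : ContDiff ℝ ∞ (fun q : ℝ × (P × ℝ) => 1 + q.1 * q.2.2) :=
    contDiff_const.add (contDiff_fst.mul (contDiff_snd.comp contDiff_snd))
  have st1 : ST l ((v₀, 0) : P × ℝ) (fun i w => ((1 + s i / u i * w.2) ^ a)⁻¹ • ψ w.1)
      (fun w => ((1 + 0 * w.2) ^ a)⁻¹ • ψ w.1) := by
    refine ST.param (Ψ := fun q : ℝ × (P × ℝ) => ((1 + q.1 * q.2.2) ^ a)⁻¹ • ψ q.2.1) hκ ?_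
    filter_upwards [hsm] with q hq
    exact ((hone.pow a).contDiffAt.inv (pow_pos hq.2.2 a).ne').smul (hin q hq.1)
  have hval : ((1 + 0 * ((v₀, (0 : ℝ)) : P × ℝ).2) ^ a)⁻¹ • ψ ((v₀, (0 : ℝ)) : P × ℝ).1 = ψ v₀ := by
    simp
  have st2 : ST l ((v₀, 0) : P × ℝ) (fun i w => π (((1 + s i / u i * w.2) ^ a)⁻¹ • ψ w.1))
      (fun w => π (((1 + 0 * w.2) ^ a)⁻¹ • ψ w.1)) := by
    refine ST.map (f₀ := fun w : P × ℝ => ((1 + 0 * w.2) ^ a)⁻¹ • ψ w.1) ?_ st1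
    rw [hval]; exact hψ.smooth_inv
  have ht : Tendsto (fun i => s i / |u i| ^ a) l atTop := by
    have h1 : Tendsto (fun i => |u i| ^ a / s i) l (𝓝[>] 0) := by
      refine tendsto_nhdsWithin_iff.2 ⟨h.tendsto_ratio, ?_⟩
      filter_upwards [h.pos, hu] with i a1 a2
      exact div_pos (pow_pos (abs_pos.2 a2) a) a1
    exact h1.inv_tendsto_nhdsGT_zero.congr fun i => by simp
  -- The decay of g is known in the chart only, so the argument is first passed through ψ ∘ π. It
  -- lies on the cone, hence this changes nothing.
  have st3 : ST l ((v₀, 0) : P × ℝ) (fun i w => g ((s i / |u i| ^ a) •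
      ψ (π (((1 + s i / u i * w.2) ^ a)⁻¹ • ψ w.1)))) (fun _ => 0) := by
    refine ST.comp (f₀ := fun w : P × ℝ => π (((1 + 0 * w.2) ^ a)⁻¹ • ψ w.1))
      (h := fun i v => g ((s i / |u i| ^ a) • ψ v)) (h₀ := fun _ => 0) ?_ st2
    dsimp only
    rw [hval, hψ.inv_apply]
    exact (hg.st_zero hS hμ hψ).comp_tendsto ht
  have st4 : ST l ((v₀, 0) : P × ℝ) (fun i w => g ((s i / |u i| ^ a) •
      ((1 + s i / u i * w.2) ^ a)⁻¹ • ψ w.1)) (fun _ => 0) := by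
    refine st3.congr ?_ (Eventually.of_forall fun _ => rfl)
    have t1 := st1.tendsto
    rw [hval] at t1
    filter_upwards [t1.eventually hψ.right_inv, hκτ.eventually (lt_mem_nhds one_pos),
      ((continuous_fst.tendsto ((v₀, 0) : P × ℝ)).comp tendsto_snd).eventually hψ.mem]
      with p a1 a2 a3
    rw [a1 (smul_mem_puncturedCone (inv_pos.2 (pow_pos a2 a)) a3)]
  have st5 : ST l ((v₀, 0) : P × ℝ) (fun i w => (|u i| ^ a / s i) ^ 2 *
      (1 + s i / u i * w.2) ^ (2 * a)) (fun w => (0 : ℝ) ^ 2 * (1 + 0 * w.2) ^ (2 * a)) := by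
    refine ST.param (Ψ := fun q : (ℝ × ℝ) × (P × ℝ) => q.1.1 ^ 2 * (1 + q.1.2 * q.2.2) ^ (2 * a))
      (c := fun i => (|u i| ^ a / s i, s i / u i)) (c₀ := (0, 0))
      (h.tendsto_ratio.prodMk_nhds hκ) ?_
    exact ContDiff.smoothNear (by fun_prop)
  have st6 : ST l ((v₀, 0) : P × ℝ) (fun i w => c * phiRest n a (s i * w.2 + u i, s i, ‖ψ w.1‖ ^ 2))
      (fun w => c * phiRest n a (0 * w.2 + 0, 0, ‖ψ w.1‖ ^ 2)) := by
    refine ST.param (Ψ := fun q : (ℝ × ℝ) × (P × ℝ) => c * phiRest n a (q.1.2 * q.2.2 + q.1.1, q.1.2,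
      ‖ψ q.2.1‖ ^ 2)) (c := fun i => (u i, s i)) (c₀ := (0, 0))
      (h.tendsto_u.prodMk_nhds h.tendsto_s) ?_
    have t1 : Tendsto (fun q : (ℝ × ℝ) × (P × ℝ) => q.2.1) (𝓝 ((0, 0), (v₀, 0))) (𝓝 v₀) :=
      (continuous_fst.comp continuous_snd).tendsto _
    filter_upwards [t1.eventually hψ.smooth] with q hq
    refine contDiffAt_const.mul ((contDiff_phiRest n a).contDiffAt.comp q (ContDiffAt.prodMk
      (by fun_prop) (ContDiffAt.prodMk (by fun_prop) (ContDiffAt.norm_sq ℝ ?_))))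
    exact ContDiffAt.comp q hq (contDiff_fst.comp contDiff_snd).contDiffAt
  have st7 : ST l ((v₀, 0) : P × ℝ) (fun i w => χ (s i / |u i| ^ b * ‖ψ w.1‖ *
      (1 + s i / u i * w.2) ^ (-b))) (fun w => χ (m₀ * ‖ψ w.1‖ * (1 + 0 * w.2) ^ (-b))) := by
    refine ST.param (Ψ := fun q : (ℝ × ℝ) × (P × ℝ) => χ (q.1.1 * ‖ψ q.2.1‖ *
      (1 + q.1.2 * q.2.2) ^ (-b))) (c := fun i => (s i / |u i| ^ b, s i / u i)) (c₀ := (m₀, 0))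
      (hm.prodMk_nhds hκ) ?_
    have t1 : Tendsto (fun q : (ℝ × ℝ) × (P × ℝ) => (q.1.2, q.2)) (𝓝 ((m₀, 0), (v₀, 0)))
        (𝓝 (0, (v₀, 0))) := (Continuous.prodMk (by fun_prop) (by fun_prop)).tendsto _
    filter_upwards [t1.eventually hsm] with q hq
    refine hχ.contDiffAt.comp q (ContDiffAt.mul (ContDiffAt.mul (by fun_prop)
      (ContDiffAt.norm ℝ ?_ (norm_pos_iff.1 hq.2.1))) (ContDiffAt.rpow_const_of_ne ?_ hq.2.2.ne'))
    · exact ContDiffAt.comp q hq.1 (contDiff_fst.comp contDiff_snd).contDiffAt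
    · fun_prop
  have st8 := st7.mul (st6.add (st5.mul st4))
  refine st8.congr ?_ ?_
  · filter_upwards [tendsto_fst.eventually hu, tendsto_fst.eventually h.pos,
      hκτ.eventually (lt_mem_nhds one_pos)] with p a1 a2 a3
    exact cutPart_eq a1 a2 a3
  · refine Eventually.of_forall fun w => ?_
    simp [phiRest_zero ha]

/-- Along an ultrafilter either s ≥ 4·2^b |u|^b and the cut-off term is zero, or s/|u|^b is bounded,
hence convergent, and s/|u| ≤ 4·2^b |u|^{b-1} → 0. -/
theorem ConicalScale.st_cutPart_zero (hS : IsSpecialLagrangianLink S) (hμ : μ < 0)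
    (hg : IsAsymptoticTo Φ L Λ₀ μ g) (ha : 1 < a) (hb : 1 < b) (hχ : ContDiff ℝ ∞ χ)
    (hχ2 : ∀ t, 2 ≤ t → χ t = 0) (h : ConicalScale l a u s)
    (hψ : ChartGerm (puncturedCone S) ψ π v₀) (h1 : ‖ψ v₀‖ = 1) (c : ℝ) :
    ST l ((v₀, 0) : P × ℝ) (fun i w => cutPart n a b χ g c (u i) (s i) (ψ w.1) w.2)
      (fun _ => 0) := by
  refine ST.of_ultrafilter (fun V hV => ?_) (Eventually.of_forall fun _ => contDiffAt_const)
  have hV' := h.mono hV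
  by_cases hcase : ∀ᶠ i in (V : Filter ι), 4 * 2 ^ b * |u i| ^ b ≤ s i
  · refine (SmoothNear.ST (f₀ := fun _ : P × ℝ => (0 : ℝ))
      (Eventually.of_forall fun _ => contDiffAt_const)).congr ?_ (Eventually.of_forall fun _ => rfl)
    exact hV'.eventually_cut_zero hb hχ2 hcase hψ.differentiableAt.continuousAt.norm h1 c
  · have hcase' : ∀ᶠ i in (V : Filter ι), s i < 4 * 2 ^ b * |u i| ^ b := by
      simpa only [not_le] using Ultrafilter.eventually_not.2 hcase
    have hu : ∀ᶠ i in (V : Filter ι), u i ≠ 0 := by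
      filter_upwards [hcase', hV'.pos] with i a1 a2 h0
      rw [h0, abs_zero, Real.zero_rpow (by linarith), mul_zero] at a1
      linarith
    have hmem : ∀ᶠ i in (V : Filter ι), s i / |u i| ^ b ∈ Icc 0 (4 * 2 ^ b) := by
      filter_upwards [hcase', hV'.pos, hu] with i a1 a2 a3
      have := Real.rpow_pos_of_pos (abs_pos.2 a3) b
      exact ⟨by positivity, (div_le_iff₀ this).2 a1.le⟩
    obtain ⟨m₀, -, hm⟩ := isCompact_Icc.ultrafilter_le_nhds (V.map fun i => s i / |u i| ^ b)
      (le_principal_iff.2 hmem)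
    refine hV'.st_cutPart hS hμ hg ha hχ hψ (m₀ := m₀) hm hu ?_ c
    have hz : Tendsto (fun i => 4 * 2 ^ b * |u i| ^ (b - 1)) (V : Filter ι) (𝓝 0) := by
      have := (hV'.tendsto_u.abs.rpow_const (p := b - 1)
        (Or.inr (by linarith))).const_mul (4 * 2 ^ b)
      rwa [abs_zero, Real.zero_rpow (by linarith), mul_zero] at this
    refine squeeze_zero_norm' ?_ hz
    filter_upwards [hcase', hV'.pos, hu] with i a1 a2 a3
    have hp := abs_pos.2 a3
    rw [norm_div, Real.norm_of_nonneg a2.le, Real.norm_eq_abs, div_le_iff₀ hp, mul_assoc,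
      ← Real.rpow_add_one hp.ne', sub_add_cancel]
    exact a1.le

/-- Up to constants, the rescaled potentials tend to zero. -/
theorem ConicalScale.st_rescaledPot (hS : IsSpecialLagrangianLink S) (hΛ₀ : 0 < Λ₀) (hμ : μ < 0)
    (hg : IsAsymptoticTo Φ L Λ₀ μ g) (hβ : IsLiouvillePotential L β) (ha : 1 < a) (hb : 1 < b)
    (hχ : ContDiff ℝ ∞ χ) (hχ2 : ∀ t, 2 ≤ t → χ t = 0) (h : ConicalScale l a u s)
    (hψ : ChartGerm (puncturedCone S) ψ π v₀) (h1 : ‖ψ v₀‖ = 1) :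
    ∃ k : ι → ℝ, ST l ((v₀, 0) : P × ℝ)
      (fun i w => rescaledPot (potI Φ g β a b χ) ψ (u i) (s i) w + k i) (fun _ => 0) := by
  set c := endConst Φ g β (ψ v₀)
  -- Cancels the one term of the rescaled potential that need not converge.
  refine ⟨fun i => c * ((s i)⁻¹ ^ 2 * u i ^ (2 * a)), ?_⟩
  have st1 : ST l ((v₀, 0) : P × ℝ) (fun i w => - c *
      ((2 * a * u i ^ (2 * a - 1) / s i) * w.2 + w.2 ^ 2 * sqRem (2 * a - 1) (u i, s i * w.2) +
        phiRest n a (s i * w.2 + u i, s i, ‖ψ w.1‖ ^ 2)))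
      (fun w => - c * (0 * w.2 + w.2 ^ 2 * sqRem (2 * a - 1) (0, 0 * w.2) +
        phiRest n a (0 * w.2 + 0, 0, ‖ψ w.1‖ ^ 2))) := by
    refine ST.param (Ψ := fun q : (ℝ × ℝ × ℝ) × (P × ℝ) => - c * (q.1.2.2 * q.2.2 +
      q.2.2 ^ 2 * sqRem (2 * a - 1) (q.1.1, q.1.2.1 * q.2.2) +
        phiRest n a (q.1.2.1 * q.2.2 + q.1.1, q.1.2.1, ‖ψ q.2.1‖ ^ 2)))
      (c := fun i => (u i, s i, 2 * a * u i ^ (2 * a - 1) / s i)) (c₀ := (0, 0, 0))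
      (h.tendsto_u.prodMk_nhds (h.tendsto_s.prodMk_nhds (h.tendsto_pow_div ha))) ?_
    have t1 : Tendsto (fun q : (ℝ × ℝ × ℝ) × (P × ℝ) => q.2.1) (𝓝 ((0, 0, 0), (v₀, 0)))
        (𝓝 v₀) := (continuous_fst.comp continuous_snd).tendsto _
    filter_upwards [t1.eventually hψ.smooth] with q hq
    refine contDiffAt_const.mul (ContDiffAt.add (ContDiffAt.add (by fun_prop) (ContDiffAt.mul
      (by fun_prop) ((contDiff_sqRem _).contDiffAt.comp q (by fun_prop))))
      ((contDiff_phiRest n a).contDiffAt.comp q (ContDiffAt.prodMk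
      (by fun_prop) (ContDiffAt.prodMk (by fun_prop) (ContDiffAt.norm_sq ℝ ?_)))))
    exact ContDiffAt.comp q hq (contDiff_fst.comp contDiff_snd).contDiffAt
  refine (st1.add (h.st_cutPart_zero hS hμ hg ha hb hχ hχ2 hψ h1 c)).congr ?_ ?_
  · have hc : ∀ᶠ v in 𝓝 v₀, endConst Φ g β (ψ v) = c := by
      filter_upwards [hψ.differentiableAt.continuousAt.eventually
        (endConst_eventually_eq hS hΛ₀ hμ hg hβ hψ.mem_self), hψ.mem] with v a1 a2 using a1 a2
    have t1 : Tendsto (fun q : ι × (P × ℝ) => q.2.1) (l ×ˢ 𝓝 (v₀, 0)) (𝓝 v₀) :=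
      (continuous_fst.tendsto ((v₀, 0) : P × ℝ)).comp tendsto_snd
    filter_upwards [t1.eventually hc, t1.eventually hψ.mem, tendsto_fst.eventually h.pos]
      with p a1 a2 a3
    rw [rescaledPot_eq a3 (u p.1) p.2 ha
      ((endConst_smul hS hΛ₀ hμ hg hβ a2 a3).trans a1)]
    ring
  · refine Eventually.of_forall fun w => ?_
    simp [phiRest_zero ha, sqRem_zero (show 2 ≤ 2 * a - 1 by omega)]

end Potential

end SLGeom

end

noncomputable section

namespace SLGeom

/-! ## The gradient of the potential -/

/-- The pairs `(u, s)` with `u → 0`, `s → 0+` and `|u|^a / s → 0`. -/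
def conicalFilter (a : ℕ) : Filter (ℝ × ℝ) :=
  comap (fun p => (p.1, p.2, |p.1| ^ a / p.2)) (𝓝 0 ×ˢ 𝓝[>] 0 ×ˢ 𝓝 0)

theorem conicalScale_conicalFilter (a : ℕ) :
    ConicalScale (conicalFilter a) a Prod.fst Prod.snd := by
  have h : Tendsto (fun p : ℝ × ℝ => (p.1, p.2, |p.1| ^ a / p.2)) (conicalFilter a)
      (𝓝 0 ×ˢ 𝓝[>] 0 ×ˢ 𝓝 0) := tendsto_comap
  have h2 : Tendsto (fun p : ℝ × ℝ => p.2) (conicalFilter a) (𝓝[>] 0) :=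
    tendsto_fst.comp (tendsto_snd.comp h)
  have h1 : Tendsto (fun p : ℝ × ℝ => p.1) (conicalFilter a) (𝓝 0) :=
    (tendsto_fst (f := 𝓝 (0 : ℝ)) (g := 𝓝[>] (0 : ℝ) ×ˢ 𝓝 (0 : ℝ))).comp h
  exact ⟨h1, h2.mono_right nhdsWithin_le_nhds, h2.eventually self_mem_nhdsWithin,
    tendsto_snd.comp (tendsto_snd.comp h)⟩

theorem exists_of_eventually_conicalFilter {a : ℕ} {P : ℝ × ℝ → Prop}
    (h : ∀ᶠ p in conicalFilter a, P p) :
    ∃ η > 0, ∀ u s, |u| < η → 0 < s → s < η → |u| ^ a < η * s → P (u, s) := by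
  rw [conicalFilter, eventually_comap] at h
  obtain ⟨p₁, h₁, p₂, h₂, H⟩ := eventually_prod_iff.1 h
  obtain ⟨p₃, h₃, p₄, h₄, H'⟩ := eventually_prod_iff.1 h₂
  obtain ⟨η₁, hη₁, H₁⟩ := Metric.eventually_nhds_iff_ball.1 h₁
  obtain ⟨η₃, hη₃, H₃⟩ := (mem_nhdsGT_iff_exists_Ioo_subset).1 h₃
  obtain ⟨η₄, hη₄, H₄⟩ := Metric.eventually_nhds_iff_ball.1 h₄
  replace hη₃ : 0 < η₃ := hη₃
  refine ⟨min η₁ (min η₃ η₄), by positivity, fun u s hu hs hsη hus => ?_⟩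
  refine H (H₁ u ?_) (H' (H₃ ⟨hs, ?_⟩) (H₄ (|u| ^ a / s) ?_)) (u, s) rfl
  · rw [mem_ball_zero_iff]
    exact hu.trans_le (min_le_left _ _)
  · exact hsη.trans_le ((min_le_right _ _).trans (min_le_left _ _))
  · rw [mem_ball_zero_iff, Real.norm_of_nonneg (by positivity), div_lt_iff₀ hs]
    refine hus.trans_le ?_
    gcongr
    exact (min_le_right _ _).trans (min_le_right _ _)

theorem IsSmoothSubmanifold.tangentSpaceOf_cylinder {n m : ℕ} {N : Set (Cn n)}
    (hN : IsSmoothSubmanifold m N) {p ξ : CnC n} (hp : p ∈ cylinder N)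
    (hξ : ξ ∈ tangentSpaceOf (cylinder N) p) :
    ξ.fst ∈ tangentSpaceOf N p.fst ∧ ξ.snd = (ξ.snd.re : ℂ) := by
  obtain ⟨ψ, π, v₀, h, hψ⟩ := hN.exists_chartGerm hp.1
  have e : p = cylParam ψ (v₀, uCoord p) :=
    CnC_ext hψ.symm (Complex.ext (by simp [cylParam, uCoord]) (by simp [cylParam, hp.2]))
  rw [e, (h.cylinder _).tangentSpaceOf_eq] at hξ
  obtain ⟨w, rfl⟩ := hξ
  simp only [ContinuousLinearMap.coe_coe]
  rw [cylParam_fderiv_apply h.differentiableAt, ← hψ]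
  exact ⟨h.fderiv_mem _, by simp⟩

section Potential

variable {n : ℕ} {S : Set (Cn n)}
variable {Φ : ConeLagrangianNbhd (puncturedCone S)} {L : Set (Cn n)} {Λ₀ μ : ℝ} {g β : Cn n → ℝ}
variable {a : ℕ} {b : ℝ} {χ : ℝ → ℝ}
variable {P : Type} [NormedAddCommGroup P] [NormedSpace ℝ P] [FiniteDimensional ℝ P]
  {ψ : P → Cn n} {π : Cn n → P} {v₀ : P}

/-- The normalization s⁻² makes gradients scale like positions, which is the scaling under which Φ
is equivariant. -/
theorem ChartGerm.tangentialGrad_similarity (hψ : ChartGerm (puncturedCone S) ψ π v₀)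
    {I : CnC n → ℝ} {u s τ : ℝ} (hs : 0 < s)
    (hd : DifferentiableAt ℝ (rescaledPot I ψ u s) (v₀, τ)) :
    tangentialGrad (SLGeom.cylinder (puncturedCone S)) I (s • cylParam ψ (v₀, τ) + shift n u) =
      s • fderiv ℝ (cylParam ψ) (v₀, τ) (gradCoord (cylParam ψ) (rescaledPot I ψ u s) (v₀, τ)) := by
  have h1 := tangentialGrad_comp_similarity (N := SLGeom.cylinder (puncturedCone S)) hs.ne' (shift n u)
    (cylParam ψ (v₀, τ)) (pow_ne_zero 2 (inv_ne_zero hs.ne')) I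
  have e1 : (fun x : Cn n => s • x) ⁻¹' puncturedCone S = puncturedCone S := by
    simpa using preimage_puncturedCone (S := S) hs
  rw [preimage_cylinder s u hs.ne', e1, (hψ.cylinder τ).tangentialGrad_eq hd] at h1
  have e : s⁻¹ ^ 2 * s = s⁻¹ := by field_simp
  change fderiv ℝ (cylParam ψ) (v₀, τ) (gradCoord (cylParam ψ) (rescaledPot I ψ u s) (v₀, τ)) = _
    at h1
  rw [h1, e, smul_smul, mul_inv_cancel₀ hs.ne', one_smul]

variable {ι : Type} {l : Filter ι} {u s : ι → ℝ}

theorem ConicalScale.st_fderiv_rescaledPot (hS : IsSpecialLagrangianLink S) (hΛ₀ : 0 < Λ₀)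
    (hμ : μ < 0) (hg : IsAsymptoticTo Φ L Λ₀ μ g) (hβ : IsLiouvillePotential L β) (ha : 1 < a)
    (hb : 1 < b) (hχ : ContDiff ℝ ∞ χ) (hχ2 : ∀ t, 2 ≤ t → χ t = 0) (h : ConicalScale l a u s)
    (hψ : ChartGerm (puncturedCone S) ψ π v₀) (h1 : ‖ψ v₀‖ = 1) :
    FamSmooth l (fun i => rescaledPot (potI Φ g β a b χ) ψ (u i) (s i)) ((v₀, 0) : P × ℝ) ∧
    ST l ((v₀, 0) : P × ℝ) (fun i => fderiv ℝ (rescaledPot (potI Φ g β a b χ) ψ (u i) (s i)))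
      (fun _ => 0) := by
  obtain ⟨k, hk⟩ := h.st_rescaledPot hS hΛ₀ hμ hg hβ ha hb hχ hχ2 hψ h1
  refine ⟨?_, hk.fderiv.congr ?_ ?_⟩
  · filter_upwards [(hk 0).fam] with p hp
    have := hp.sub (contDiffAt_const (c := k p.1))
    simpa only [add_sub_cancel_right] using this
  · exact Eventually.of_forall fun p => by rw [fderiv_add_const]
  · exact Eventually.of_forall fun p => by simp

theorem ConicalScale.st_gradCoord (hS : IsSpecialLagrangianLink S) (hΛ₀ : 0 < Λ₀)
    (hμ : μ < 0) (hg : IsAsymptoticTo Φ L Λ₀ μ g) (hβ : IsLiouvillePotential L β) (ha : 1 < a)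
    (hb : 1 < b) (hχ : ContDiff ℝ ∞ χ) (hχ2 : ∀ t, 2 ≤ t → χ t = 0) (h : ConicalScale l a u s)
    (hψ : ChartGerm (puncturedCone S) ψ π v₀) (h1 : ‖ψ v₀‖ = 1) :
    ST l ((v₀, 0) : P × ℝ)
      (fun i => gradCoord (cylParam ψ) (rescaledPot (potI Φ g β a b χ) ψ (u i) (s i)))
      (fun _ => 0) := by
  have h2 := (h.st_fderiv_rescaledPot hS hΛ₀ hμ hg hβ ha hb hχ hχ2 hψ h1).2
  refine ((hψ.cylinder 0).gradCoord_st
    (f := fun i => rescaledPot (potI Φ g β a b χ) ψ (u i) (s i)) (f₀ := fun _ => (0 : ℝ)) ?_).congr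
    (Eventually.of_forall fun _ => rfl) (Eventually.of_forall fun _ => by simp [gradCoord])
  refine h2.congr (Eventually.of_forall fun _ => rfl) (Eventually.of_forall fun _ => by simp)

/-- The gradient of the potential is small compared with the radius where `|u|^a ≪ r`. -/
theorem exists_norm_tangentialGrad_le (hS : IsSpecialLagrangianLink S) (hΛ₀ : 0 < Λ₀)
    (hμ : μ < 0) (hg : IsAsymptoticTo Φ L Λ₀ μ g) (hβ : IsLiouvillePotential L β) (ha : 1 < a)
    (hb : 1 < b) (hχ : ContDiff ℝ ∞ χ) (hχ2 : ∀ t, 2 ≤ t → χ t = 0) {δ : ℝ} (hδ : 0 < δ) :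
    ∃ η > 0, ∀ p ∈ cylinder (puncturedCone S), |uCoord p| < η → rad p < η →
      |uCoord p| ^ a < η * rad p →
      ‖tangentialGrad (cylinder (puncturedCone S)) (potI Φ g β a b χ) p‖ ≤ δ * rad p := by
  have hseq : ∀ᶠ j in conicalFilter a, ∀ σ ∈ S,
      ‖tangentialGrad (cylinder (puncturedCone S)) (potI Φ g β a b χ)
        (mkCyl n (j.2 • σ, j.1))‖ ≤ δ * j.2 := by
    have h := conicalScale_conicalFilter a
    have key : ∀ σ ∈ S, ∀ᶠ q in conicalFilter a ×ˢ 𝓝 σ, q.2 ∈ S → ‖tangentialGrad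
        (cylinder (puncturedCone S)) (potI Φ g β a b χ) (mkCyl n (q.1.2 • q.2, q.1.1))‖ ≤
        δ * q.1.2 := by
      intro σ hσ
      obtain ⟨ψ, π, v₀, hψ, rfl⟩ := hS.isSmooth.exists_chartGerm (subset_puncturedCone hσ)
      have h1 := hS.norm_eq hσ
      have st := h.st_gradCoord hS hΛ₀ hμ hg hβ ha hb hχ hχ2 hψ h1
      have fam := (h.st_fderiv_rescaledPot hS hΛ₀ hμ hg hβ ha hb hχ hχ2 hψ h1).1
      have st2 : ST (conicalFilter a) ((v₀, 0) : EuclideanSpace ℝ (Fin n) × ℝ)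
          (fun j w => fderiv ℝ (cylParam ψ) w
            (gradCoord (cylParam ψ) (rescaledPot (potI Φ g β a b χ) ψ j.1 j.2) w))
          (fun w => fderiv ℝ (cylParam ψ) w 0) :=
        ST.bilin (ContinuousLinearMap.id ℝ _) (hψ.cylinder 0).smooth.fderiv.ST st
      have t2 := st2.tendsto
      rw [map_zero] at t2
      have hπ : Tendsto (fun q : (ℝ × ℝ) × Cn n => (q.1, (π q.2, (0 : ℝ)))) (conicalFilter a ×ˢ 𝓝 (ψ v₀))
          (conicalFilter a ×ˢ 𝓝 (v₀, 0)) :=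
        tendsto_fst.prodMk ((hψ.inv_tendsto.comp tendsto_snd).prodMk_nhds tendsto_const_nhds)
      filter_upwards [hπ.eventually (t2.eventually (closedBall_mem_nhds 0 hδ)),
        hπ.eventually fam, tendsto_fst.eventually h.pos,
        tendsto_snd.eventually hψ.eventually_chartGerm_inv] with q a1 a2 a3 a4 a5
      obtain ⟨a6, a7⟩ := a4 (subset_puncturedCone a5)
      have e : mkCyl n (q.1.2 • q.2, q.1.1) = q.1.2 • cylParam ψ (π q.2, 0) + shift n (q.1.1) :=
        CnC_ext (by simp [a7, shift]) (by simp [cylParam, shift])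
      replace a1 := mem_closedBall_zero_iff.1 a1
      rw [e, a6.tangentialGrad_similarity a3 (a2.differentiableAt (by simp)), norm_smul,
        Real.norm_of_nonneg a3.le, mul_comm]
      gcongr
    filter_upwards [eventually_forall_of_isCompact hS.isCompact key] with j hj σ hσ using hj σ hσ hσ
  obtain ⟨η, hη, H⟩ := exists_of_eventually_conicalFilter hseq
  refine ⟨η, hη, fun p hp h1 h2 h3 => ?_⟩
  have := H _ _ h1 (hS.norm_pos hp.1) h2 h3 _ (hS.normalize_mem hp.1)
  have e : mkCyl n (‖p.fst‖ • ‖p.fst‖⁻¹ • p.fst, uCoord p) = p := by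
    refine CnC_ext ?_ (Complex.ext (by simp [uCoord]) (by simp [hp.2]))
    rw [mkCyl_fst, smul_smul, mul_inv_cancel₀ (hS.norm_pos hp.1).ne', one_smul]
  rw [e] at this
  exact this

/-- The point of the graph of `dI` over `p`. -/
def potGraph (Φ : ConeLagrangianNbhd (puncturedCone S)) (g β : Cn n → ℝ) (a : ℕ) (b : ℝ)
    (χ : ℝ → ℝ) (p : CnC n) : CnC n :=
  cylGraphMap Φ p (tangentialGrad (cylinder (puncturedCone S)) (potI Φ g β a b χ) p)

theorem exists_potGraph_close (hS : IsSpecialLagrangianLink S) (hΛ₀ : 0 < Λ₀)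
    (hμ : μ < 0) (hg : IsAsymptoticTo Φ L Λ₀ μ g) (hβ : IsLiouvillePotential L β) (ha : 1 < a)
    (hb : 1 < b) (hχ : ContDiff ℝ ∞ χ) (hχ2 : ∀ t, 2 ≤ t → χ t = 0) {ε : ℝ} (hε : 0 < ε) :
    ∃ η > 0, ∀ p ∈ cylinder (puncturedCone S), |uCoord p| < η → rad p < η →
      |uCoord p| ^ a < η * rad p →
      (p.fst, (tangentialGrad (cylinder (puncturedCone S)) (potI Φ g β a b χ) p).fst) ∈ Φ.dom ∧
      ‖(potGraph Φ g β a b χ p).fst - p.fst‖ ≤ ε * rad p := by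
  obtain ⟨δ, hδ, hΦ⟩ := Φ.exists_uniform hS hε
  obtain ⟨η, hη, H⟩ := exists_norm_tangentialGrad_le (Φ := Φ) (b := b) hS hΛ₀ hμ hg hβ ha hb hχ
    hχ2 hδ
  exact ⟨η, hη, fun p hp h1 h2 h3 => hΦ p.fst hp.1 _
    (hS.isSmooth.tangentSpaceOf_cylinder hp (tangentialGrad_mem _ _)).1
    ((norm_fst_le _).trans (H p hp h1 h2 h3))⟩

/-- |u|^a = |u|^{a-b} |u|^b with a - b > 0: the region r ≥ |u|^b near the origin lies in the conical
regime. -/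
theorem exists_pow_lt (ha : 0 < a) (hba : b < a) {η : ℝ} (hη : 0 < η) :
    ∃ ρ > 0, ∀ u r : ℝ, |u| < ρ → 0 < r → |u| ^ b ≤ r → |u| ^ a < η * r := by
  have hz : Tendsto (fun x : ℝ => x ^ (a - b)) (𝓝 0) (𝓝 0) := by
    have h0 : (0 : ℝ) < a - b := by linarith
    have := (continuous_id.tendsto (0 : ℝ)).rpow_const (p := a - b) (Or.inr h0.le)
    simpa [Real.zero_rpow h0.ne'] using this
  obtain ⟨ρ, hρ, hzρ⟩ := Metric.eventually_nhds_iff_ball.1 (hz.eventually (gt_mem_nhds hη))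
  refine ⟨ρ, hρ, fun u r hu hr hur => ?_⟩
  rcases eq_or_ne u 0 with h0 | h0
  · rw [h0, abs_zero, zero_pow (by omega)]; positivity
  · have hup := abs_pos.2 h0
    have h4 := hzρ |u| (by rwa [mem_ball_zero_iff, norm_abs_eq_norm])
    calc |u| ^ a = |u| ^ ((a : ℝ) - b) * |u| ^ b := by
          rw [← Real.rpow_add hup, sub_add_cancel, Real.rpow_natCast]
      _ < η * |u| ^ b := by
          have := Real.rpow_pos_of_pos hup b
          gcongr
      _ ≤ η * r := by gcongr

theorem abs_uCoord_le (p : CnC n) : |uCoord p| ≤ ‖p‖ :=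
  (Complex.abs_re_le_norm _).trans (norm_snd_le p)

/-- The source of the threshold for A₁. The bound ½ r allows the radius of a point of X to be
compared with that of its foot point on the cone throughout the graph region. -/
theorem exists_graphRegion_close (hS : IsSpecialLagrangianLink S) (hΛ₀ : 0 < Λ₀)
    (hμ : μ < 0) (hg : IsAsymptoticTo Φ L Λ₀ μ g) (hβ : IsLiouvillePotential L β) (ha : 1 < a)
    (hb : 1 < b) (hba : b < a) (hχ : ContDiff ℝ ∞ χ) (hχ2 : ∀ t, 2 ≤ t → χ t = 0) :
    ∃ A' > (0 : ℝ), ∀ A₁ ≥ A', ∀ p ∈ graphRegion (puncturedCone S) b A₁,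
      (p.fst, (tangentialGrad (cylinder (puncturedCone S)) (potI Φ g β a b χ) p).fst) ∈ Φ.dom ∧
      ‖(potGraph Φ g β a b χ p).fst - p.fst‖ ≤ 1 / 2 * rad p := by
  obtain ⟨η, hη, H⟩ := exists_potGraph_close (Φ := Φ) (b := b) hS hΛ₀ hμ hg hβ ha hb hχ
    hχ2 one_half_pos
  obtain ⟨ρ, hρ, hpow⟩ := exists_pow_lt (a := a) (by omega) hba hη
  refine ⟨(min η ρ)⁻¹, by positivity, fun A₁ hA₁ p hp => ?_⟩
  obtain ⟨hp1, hp2, hp3⟩ := hp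
  have hA₁' : A₁⁻¹ ≤ min η ρ := inv_le_of_inv_le₀ (by positivity) hA₁
  have h1 : ‖p‖ < min η ρ := hp3.trans_le hA₁'
  have h2 := h1.trans_le (min_le_left _ _)
  have h3 := h1.trans_le (min_le_right _ _)
  exact H p hp1 ((abs_uCoord_le p).trans_lt h2) ((norm_fst_le p).trans_lt h2)
    (hpow _ _ ((abs_uCoord_le p).trans_lt h3) (hS.norm_pos hp1.1) hp2)

theorem IsAsymptoticTo.hasFDerivAt_comp (hg : IsAsymptoticTo Φ L Λ₀ μ g) {Q : Type}
    [NormedAddCommGroup Q] [NormedSpace ℝ Q] {m : Q → Cn n} {m' : Q →L[ℝ] Cn n} {q : Q}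
    (hm : HasFDerivAt m m' q) (hC : ∀ᶠ x in 𝓝 q, m x ∈ puncturedCone S) (hr : Λ₀ < ‖m q‖) :
    HasFDerivAt (fun x => g (m x))
      ((innerSL ℝ (tangentialGrad (puncturedCone S) g (m q))).comp m') q := by
  have hd : DifferentiableWithinAt ℝ g (puncturedCone S) (m q) := by
    refine ((hg.smooth _ ⟨hC.self_of_nhds, hr⟩).differentiableWithinAt
      (by simp)).mono_of_mem_nhdsWithin ?_
    exact inter_mem self_mem_nhdsWithin (mem_nhdsWithin_of_mem_nhds
      (continuous_norm.continuousAt.eventually (lt_mem_nhds hr)))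
  have h1 := (hd.hasFDerivWithinAt.comp q (s := m ⁻¹' puncturedCone S) hm.hasFDerivWithinAt
    (mapsTo_preimage _ _)).hasFDerivAt hC
  refine h1.congr_fderiv ?_
  ext w
  have := inner_tangentialGrad (N := puncturedCone S) g (m q) (m' w)
  rw [tangentProj_of_mem (Submodule.subset_span (mem_tangentConeAt_of_hasFDerivAt hm hC w))] at this
  exact this.symm

theorem inner_ofReal (x y : ℝ) : ⟪(x : ℂ), (y : ℂ)⟫ = x * y := by
  simp [Complex.inner, mul_comm]

/-- With x₁ = |u|^{-a} x, the u-derivative of G is -2a u^{2a-1}(c + ½⟪∇g, x₁⟫ - g(x₁)), and the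
bracket is β at the graph point over x₁ by `liouville_coneGraphPoint`. -/
theorem hasFDerivAt_potG (hS : IsSpecialLagrangianLink S) (hΛ₀ : 0 < Λ₀)
    (hμ : μ < 0) (hg : IsAsymptoticTo Φ L Λ₀ μ g) (hβ : IsLiouvillePotential L β)
    (hψ : ChartGerm (puncturedCone S) ψ π v₀) {u : ℝ} (hu : u ≠ 0) (ha : 0 < a)
    (hr : Λ₀ < (|u| ^ a)⁻¹ * ‖ψ v₀‖) :
    ∃ D : P × ℝ →L[ℝ] ℝ, HasFDerivAt (fun w => potG Φ g β a (cylParam ψ w)) D (v₀, u) ∧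
      ∀ w, ⟪mkCyl n (|u| ^ a • tangentialGrad (puncturedCone S) g ((|u| ^ a)⁻¹ • ψ v₀),
        -2 * a * u ^ (2 * a - 1) * β (coneGraphPoint Φ g ((|u| ^ a)⁻¹ • ψ v₀))),
        fderiv ℝ (cylParam ψ) (v₀, u) w⟫ = D w := by
  have hua := abs_pos.2 hu
  have hk : (0 : ℝ) < |u| ^ a := pow_pos hua a
  set x₁ := (|u| ^ a)⁻¹ • ψ v₀ with hx₁
  have hx₁C : x₁ ∈ puncturedCone S := smul_mem_puncturedCone (inv_pos.2 hk) hψ.mem_self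
  have hx₁r : Λ₀ < ‖x₁‖ := by rwa [hx₁, norm_smul, Real.norm_of_nonneg (inv_pos.2 hk).le]
  set G := tangentialGrad (puncturedCone S) g x₁
  set c := endConst Φ g β (ψ v₀) with hc
  have hfst : HasFDerivAt (fun w : P × ℝ => ψ w.1)
      ((fderiv ℝ ψ v₀).comp (ContinuousLinearMap.fst ℝ P ℝ)) (v₀, u) :=
    HasFDerivAt.comp (v₀, u) (f := Prod.fst) hψ.differentiableAt.hasFDerivAt hasFDerivAt_fst
  have hsnd : HasFDerivAt (fun w : P × ℝ => w.2) (ContinuousLinearMap.snd ℝ P ℝ) (v₀, u) :=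
    hasFDerivAt_snd
  have hkd : HasDerivAt (fun τ : ℝ => (|τ| ^ a)⁻¹) (-(a * (|u| ^ a)⁻¹ / u)) u := by
    have h1 := ((hasDerivAt_abs hu).pow a).inv hk.ne'
    refine h1.congr_deriv ?_
    have hsgn : (SignType.sign u : ℝ) * u = |u| := sign_mul_self u
    have hpow : |u| ^ a = |u| ^ (a - 1) * |u| := by
      rw [← pow_succ, Nat.sub_add_cancel ha]
    change -(a * |u| ^ (a - 1) * (SignType.sign u : ℝ)) / (|u| ^ a) ^ 2 = _
    have hsgn' : (SignType.sign u : ℝ) = |u| / u := by rw [← hsgn]; field_simp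
    rw [hsgn', hpow]
    field_simp
  have hkd' := hkd.hasFDerivAt.comp (v₀, u) (f := fun w : P × ℝ => w.2) hsnd
  have hm := hkd'.smul hfst
  have htfst : Tendsto (fun w : P × ℝ => w.1) (𝓝 (v₀, u)) (𝓝 v₀) := continuous_fst.tendsto _
  have htsnd : Tendsto (fun w : P × ℝ => w.2) (𝓝 (v₀, u)) (𝓝 u) := continuous_snd.tendsto _
  have hmC : ∀ᶠ w : P × ℝ in 𝓝 (v₀, u), (|w.2| ^ a)⁻¹ • ψ w.1 ∈ puncturedCone S := by
    filter_upwards [htfst.eventually hψ.mem, htsnd.eventually (isOpen_ne.mem_nhds hu)] with w h1 h2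
    exact smul_mem_puncturedCone (inv_pos.2 (pow_pos (abs_pos.2 h2) a)) h1
  have hgd := hg.hasFDerivAt_comp hm hmC hx₁r
  have hpw := ((hasDerivAt_pow (2 * a) u).hasFDerivAt.comp (v₀, u) (f := fun w : P × ℝ => w.2) hsnd)
  have htot := (hpw.neg.mul_const c).add (hpw.mul hgd)
  refine ⟨_, htot.congr_of_eventuallyEq ?_, fun w => ?_⟩
  · have hce : ∀ᶠ v in 𝓝 v₀, endConst Φ g β (ψ v) = c := by
      filter_upwards [hψ.differentiableAt.continuousAt.eventually
        (endConst_eventually_eq hS hΛ₀ hμ hg hβ hψ.mem_self), hψ.mem] with v a1 a2 using a1 a2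
    filter_upwards [htfst.eventually hce, htsnd.eventually (isOpen_ne.mem_nhds hu)] with w h1 h2
    rw [potG, cylParam_uCoord, if_neg h2, cylParam_fst, h1]
    rfl
  · have hβ' := liouville_coneGraphPoint hS hΛ₀ hμ hg hβ hx₁C hx₁r
    rw [hx₁, endConst_smul hS hΛ₀ hμ hg hβ hψ.mem_self (inv_pos.2 hk), ← hx₁, ← hc] at hβ'
    have e1 : ⟪G, x₁⟫ = (|u| ^ a)⁻¹ * ⟪G, ψ v₀⟫ := by rw [hx₁, inner_smul_right]
    have e2 : u ^ (2 * a) = u ^ (2 * a - 1) * u := by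
      rw [← pow_succ, Nat.sub_add_cancel (by omega)]
    have e3 : u ^ (2 * a) = |u| ^ a * |u| ^ a := by
      rw [← pow_add, ← two_mul, pow_mul, pow_mul, sq_abs]
    rw [cylParam_fderiv_apply hψ.differentiableAt, CnC_inner, hβ']
    simp only [mkCyl_fst, mkCyl_snd, inner_smul_left, inner_ofReal]
    have key : |u| ^ a * ⟪G, fderiv ℝ ψ v₀ w.1⟫ +
        -2 * a * u ^ (2 * a - 1) * (c + 1 / 2 * ⟪G, x₁⟫ - g x₁) * w.2 =
        c * -(w.2 * ((2 * a : ℕ) * u ^ (2 * a - 1))) +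
        (u ^ (2 * a) * ⟪G, (|u| ^ a)⁻¹ • fderiv ℝ ψ v₀ w.1 + (w.2 * -(a * (|u| ^ a)⁻¹ / u)) • ψ v₀⟫ +
          g x₁ * (w.2 * ((2 * a : ℕ) * u ^ (2 * a - 1)))) := by
      have e4 : u ^ (2 * a) * (|u| ^ a)⁻¹ = |u| ^ a := by rw [e3]; field_simp
      have e5 : u ^ (2 * a) * (a * (|u| ^ a)⁻¹ / u) = a * u ^ (2 * a - 1) * (|u| ^ a)⁻¹ := by
        rw [e2]; field_simp
      rw [e1, inner_add_right, inner_smul_right, inner_smul_right]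
      push_cast
      linear_combination (-⟪G, fderiv ℝ ψ v₀ w.1⟫) * e4 + (w.2 * ⟪G, ψ v₀⟫) * e5
    exact key

end Potential

end SLGeom

end

noncomputable section

namespace SLGeom

/-! ## The two descriptions of the approximate solution -/

/-- At t = 1 only the values to the left are known, but a one-sided derivative determines the
derivative. The gradient of I can thus be computed up to and including r = |u|^b. -/
theorem deriv_eq_zero_of_eq_one {χ : ℝ → ℝ} (hχ : ContDiff ℝ ∞ χ) (hχ1 : ∀ t ≤ 1, χ t = 1) {t : ℝ}
    (ht : t ≤ 1) : HasDerivAt χ 0 t := by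
  have h1 := (hχ.differentiable (by simp) t).hasDerivAt
  have h2 : HasDerivWithinAt χ 0 (Iic 1) t :=
    (hasDerivWithinAt_const t (Iic 1) (1 : ℝ)).congr (fun x hx => hχ1 x hx) (hχ1 t ht)
  have h3 := (uniqueDiffOn_Iic (1 : ℝ) t ht).eq_deriv _ h1.hasDerivWithinAt h2
  rwa [h3] at h1

section Potential

variable {n : ℕ} {S : Set (Cn n)}
variable {Φ : ConeLagrangianNbhd (puncturedCone S)} {L : Set (Cn n)} {Λ₀ μ : ℝ} {g β : Cn n → ℝ}
variable {a : ℕ} {b : ℝ} {χ : ℝ → ℝ}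
variable {P : Type} [NormedAddCommGroup P] [NormedSpace ℝ P] [FiniteDimensional ℝ P]
  {ψ : P → Cn n} {π : Cn n → P} {v₀ : P}

theorem differentiableAt_phiA (hS : IsSpecialLagrangianLink S) (hΛ₀ : 0 < Λ₀)
    (hμ : μ < 0) (hg : IsAsymptoticTo Φ L Λ₀ μ g) (hβ : IsLiouvillePotential L β)
    (hψ : ChartGerm (puncturedCone S) ψ π v₀) (u : ℝ) :
    DifferentiableAt ℝ (fun w => phiA Φ g β a (cylParam ψ w)) (v₀, u) := by
  have htfst : Tendsto (fun w : P × ℝ => w.1) (𝓝 (v₀, u)) (𝓝 v₀) := continuous_fst.tendsto _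
  have hce : ∀ᶠ v in 𝓝 v₀, endConst Φ g β (ψ v) = endConst Φ g β (ψ v₀) := by
    filter_upwards [hψ.differentiableAt.continuousAt.eventually
      (endConst_eventually_eq hS hΛ₀ hμ hg hβ hψ.mem_self), hψ.mem] with v a1 a2 using a1 a2
  have hfst : DifferentiableAt ℝ (fun w : P × ℝ => ψ w.1) (v₀, u) :=
    DifferentiableAt.comp (v₀, u) (f := Prod.fst) hψ.differentiableAt differentiableAt_fst
  have hn : DifferentiableAt ℝ (fun w : P × ℝ => ‖ψ w.1‖) (v₀, u) :=
    hfst.norm ℝ (norm_pos_iff.1 (hS.norm_pos hψ.mem_self))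
  have hd : DifferentiableAt ℝ (fun w : P × ℝ => -(∑ j ∈ Finset.range (a + 1),
      harmonicCoeff n a j * w.2 ^ (2 * a - 2 * j) * ‖ψ w.1‖ ^ (2 * j)) * endConst Φ g β (ψ v₀))
      (v₀, u) := by
    refine DifferentiableAt.mul_const (DifferentiableAt.neg (DifferentiableAt.fun_sum
      fun j _ => ?_)) _
    exact ((differentiableAt_const _).mul (differentiableAt_snd.pow _)).mul (hn.pow _)
  refine hd.congr_of_eventuallyEq ?_
  filter_upwards [htfst.eventually hce] with w hw
  rw [phiA, cylParam_uCoord, cylParam_rad, cylParam_fst, hw]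

/-- Where `r ≤ |u|^b` the gradient of the potential is the one of the asymptotically conical
end. -/
theorem tangentialGrad_potI (hS : IsSpecialLagrangianLink S) (hΛ₀ : 0 < Λ₀)
    (hμ : μ < 0) (hg : IsAsymptoticTo Φ L Λ₀ μ g) (hβ : IsLiouvillePotential L β) (ha : 0 < a)
    (hχ : ContDiff ℝ ∞ χ) (hχ1 : ∀ t ≤ 1, χ t = 1) {x : Cn n} (hx : x ∈ puncturedCone S) {u : ℝ}
    (hu : u ≠ 0) (hr : Λ₀ < (|u| ^ a)⁻¹ * ‖x‖) (hxu : ‖x‖ ≤ |u| ^ b) :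
    tangentialGrad (cylinder (puncturedCone S)) (potI Φ g β a b χ) (mkCyl n (x, u)) =
      mkCyl n (|u| ^ a • tangentialGrad (puncturedCone S) g ((|u| ^ a)⁻¹ • x),
        -2 * a * u ^ (2 * a - 1) * β (coneGraphPoint Φ g ((|u| ^ a)⁻¹ • x))) := by
  obtain ⟨ψ, π, v₀, hψ, rfl⟩ := hS.isSmooth.exists_chartGerm hx
  obtain ⟨D, hD, hDi⟩ := hasFDerivAt_potG hS hΛ₀ hμ hg hβ hψ hu ha hr
  have hua := abs_pos.2 hu
  have hub := Real.rpow_pos_of_pos hua b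
  have hfst : DifferentiableAt ℝ (fun w : EuclideanSpace ℝ (Fin n) × ℝ => ψ w.1) (v₀, u) :=
    DifferentiableAt.comp (v₀, u) (f := Prod.fst) hψ.differentiableAt differentiableAt_fst
  have hn : DifferentiableAt ℝ (fun w : EuclideanSpace ℝ (Fin n) × ℝ => ‖ψ w.1‖ / |w.2| ^ b)
      (v₀, u) := by
    simp only [div_eq_mul_inv]
    refine (hfst.norm ℝ (norm_pos_iff.1 (hS.norm_pos hψ.mem_self))).mul
      (DifferentiableAt.fun_inv ?_ hub.ne')
    exact ((differentiableAt_abs hu).comp (v₀, u) (f := Prod.snd)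
      differentiableAt_snd).rpow_const (Or.inl hua.ne')
  have hle : ‖ψ v₀‖ / |u| ^ b ≤ 1 := (div_le_one hub).2 hxu
  have hχd : HasFDerivAt (fun w : EuclideanSpace ℝ (Fin n) × ℝ => χ (‖ψ w.1‖ / |w.2| ^ b))
      (0 : EuclideanSpace ℝ (Fin n) × ℝ →L[ℝ] ℝ) (v₀, u) := by
    have := (deriv_eq_zero_of_eq_one hχ hχ1 hle).hasFDerivAt.comp (v₀, u)
      (f := fun w : EuclideanSpace ℝ (Fin n) × ℝ => ‖ψ w.1‖ / |w.2| ^ b) hn.hasFDerivAt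
    refine this.congr_fderiv ?_
    ext w <;> simp
  have htot := (hχd.mul hD).add ((hχd.const_sub 1).mul
    (differentiableAt_phiA (a := a) hS hΛ₀ hμ hg hβ hψ u).hasFDerivAt)
  have hI : HasFDerivAt (fun w => potI Φ g β a b χ (cylParam ψ w)) D (v₀, u) := by
    refine (htot.congr_fderiv ?_).congr_of_eventuallyEq ?_
    · simp only [hχ1 _ hle]
      simp
    · have htsnd : Tendsto (fun w : EuclideanSpace ℝ (Fin n) × ℝ => w.2) (𝓝 (v₀, u)) (𝓝 u) :=
        continuous_snd.tendsto _
      filter_upwards [htsnd.eventually (isOpen_ne.mem_nhds hu)] with w hw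
      rw [potI, cylParam_uCoord, if_neg hw]
      rfl
  refine (hψ.cylinder u).tangentialGrad_unique hI.differentiableAt ?_ fun w => ?_
  · rw [(hψ.cylinder u).tangentSpaceOf_eq]
    have h1 := tangentialGrad_mem (N := puncturedCone S) g ((|u| ^ a)⁻¹ • ψ v₀)
    rw [tangentSpaceOf_puncturedCone (inv_pos.2 (pow_pos hua a)), hψ.tangentSpaceOf_eq] at h1
    obtain ⟨y, hy⟩ := h1
    refine ⟨(|u| ^ a • y, -2 * a * u ^ (2 * a - 1) *
      β (coneGraphPoint Φ g ((|u| ^ a)⁻¹ • ψ v₀))), ?_⟩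
    rw [ContinuousLinearMap.coe_coe] at hy
    rw [ContinuousLinearMap.coe_coe, cylParam_fderiv_apply hψ.differentiableAt, map_smul, hy]
  · rw [hDi, hI.fderiv]

/-- Equivariance of Φ takes the factor |u|^a out of the fibre and the base point together, while the
last gradient component already carries β. -/
theorem cylGraphMap_eq_embX2 (hS : IsSpecialLagrangianLink S) (hΛ₀ : 0 < Λ₀)
    (hμ : μ < 0) (hg : IsAsymptoticTo Φ L Λ₀ μ g) (hβ : IsLiouvillePotential L β) (ha : 0 < a)
    (hχ : ContDiff ℝ ∞ χ) (hχ1 : ∀ t ≤ 1, χ t = 1) {x₁ : Cn n} (hx : x₁ ∈ puncturedCone S) {u : ℝ}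
    (hu : u ≠ 0) (hr : Λ₀ < ‖x₁‖) (hxu : |u| ^ a * ‖x₁‖ ≤ |u| ^ b) :
    cylGraphMap Φ (mkCyl n (|u| ^ a • x₁, u)) (tangentialGrad (cylinder (puncturedCone S))
      (potI Φ g β a b χ) (mkCyl n (|u| ^ a • x₁, u))) = embX2 β a (coneGraphPoint Φ g x₁) u := by
  have hk := pow_pos (abs_pos.2 hu) a
  have e : (|u| ^ a)⁻¹ • |u| ^ a • x₁ = x₁ := by rw [smul_smul, inv_mul_cancel₀ hk.ne', one_smul]
  have e1 : ‖|u| ^ a • x₁‖ = |u| ^ a * ‖x₁‖ := by rw [norm_smul, Real.norm_of_nonneg hk.le]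
  rw [tangentialGrad_potI hS hΛ₀ hμ hg hβ ha hχ hχ1 (smul_mem_puncturedCone hk hx) hu
    (by rwa [e1, inv_mul_cancel_left₀ hk.ne']) (by rwa [e1]), e, cylGraphMap, embX2]
  simp only [mkCyl_fst, mkCyl_snd]
  rw [Φ.map_smul _ hk _ _ (hg.mem_dom _ hx hr)]
  rfl

theorem IsAsymptoticTo.eq_of_coneGraphPoint_eq (hg : IsAsymptoticTo Φ L Λ₀ μ g) {x x' : Cn n}
    (hx : x ∈ puncturedCone S) (hr : Λ₀ < ‖x‖) (hx' : x' ∈ puncturedCone S) (hr' : Λ₀ < ‖x'‖)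
    (h : coneGraphPoint Φ g x = coneGraphPoint Φ g x') : x = x' :=
  congrArg Prod.fst (Φ.injOn (hg.mem_dom x hx hr) (hg.mem_dom x' hx' hr') h)

theorem eq_mkCyl {p : CnC n} {N : Set (Cn n)} (hp : p ∈ cylinder N) :
    p = mkCyl n (p.fst, uCoord p) :=
  CnC_ext rfl (Complex.ext (by simp [uCoord]) (by simp [hp.2]))

/-- Below r = |u|^b, where X is defined through L, the graph point is rewritten with `embX2`. The
graph of dI can therefore be used in the whole region r > Λ₀|u|^a. -/
theorem potGraph_mem_approxSol (hS : IsSpecialLagrangianLink S) (hΛ₀ : 0 < Λ₀)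
    (hμ : μ < 0) (hg : IsAsymptoticTo Φ L Λ₀ μ g) (hβ : IsLiouvillePotential L β) (ha : 0 < a)
    (hχ : ContDiff ℝ ∞ χ) (hχ1 : ∀ t ≤ 1, χ t = 1) (hb : 0 < b) {A : ℝ} {p : CnC n}
    (hp : p ∈ cylinder (puncturedCone S))
    (hpA : ‖p‖ < A⁻¹) (hr : Λ₀ * |uCoord p| ^ a < rad p) :
    potGraph Φ g β a b χ p ∈ approxSol Φ L Λ₀ g β a b χ A := by
  by_cases hc : |uCoord p| ^ b ≤ rad p
  · exact Or.inl ⟨p, ⟨hp, hc, hpA⟩, rfl⟩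
  · rw [not_le] at hc
    have hu : uCoord p ≠ 0 := by
      intro h0
      rw [h0, abs_zero, Real.zero_rpow hb.ne'] at hc
      exact absurd hc (not_lt.2 (norm_nonneg _))
    have hk := pow_pos (abs_pos.2 hu) a
    set x₁ := (|uCoord p| ^ a)⁻¹ • p.fst with hx₁
    have hx₁C : x₁ ∈ puncturedCone S := smul_mem_puncturedCone (inv_pos.2 hk) hp.1
    have e : |uCoord p| ^ a • x₁ = p.fst := by
      rw [hx₁, smul_smul, mul_inv_cancel₀ hk.ne', one_smul]
    have er : rad p = |uCoord p| ^ a * ‖x₁‖ := by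
      rw [rad, ← e, norm_smul, Real.norm_of_nonneg hk.le]
    have hr₁ : Λ₀ < ‖x₁‖ := by
      rw [er, mul_comm] at hr; exact lt_of_mul_lt_mul_left hr hk.le
    have hG := cylGraphMap_eq_embX2 (b := b) hS hΛ₀ hμ hg hβ ha hχ hχ1 hx₁C hu hr₁
      (er ▸ hc.le)
    rw [e, ← eq_mkCyl hp] at hG
    refine Or.inr ⟨coneGraphPoint Φ g x₁, uCoord p, hu, ?_, ⟨hg.graph_subset ⟨x₁, ⟨hx₁C, hr₁⟩, rfl⟩,
      ?_⟩, hG⟩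
    · exact (abs_uCoord_le p).trans_lt hpA
    -- Injectivity of Φ: the point of L determines its radius in the cone, so it is not among the
    -- points left out for this u.
    · rintro ⟨x', ⟨hx'C, hx'r⟩, hx'⟩
      have hr' := (le_max_left _ _).trans_lt hx'r
      rw [hg.eq_of_coneGraphPoint_eq hx'C hr' hx₁C hr₁ hx'] at hx'r
      have h3 := (le_max_right _ _).trans_lt hx'r
      rw [Real.rpow_sub (abs_pos.2 hu), Real.rpow_natCast, div_lt_iff₀ hk, mul_comm, ← er] at h3
      exact absurd hc (not_lt.2 h3.le)

/-- The converse direction, with a free radius R: whatever is not a graph point of dI comes from a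
compact part of L. Taking R large puts the additional graph points in the conical regime. -/
theorem approxSol_cases (hS : IsSpecialLagrangianLink S) (hΛ₀ : 0 < Λ₀)
    (hμ : μ < 0) (hg : IsAsymptoticTo Φ L Λ₀ μ g) (hβ : IsLiouvillePotential L β) (ha : 0 < a)
    (hχ : ContDiff ℝ ∞ χ) (hχ1 : ∀ t ≤ 1, χ t = 1) {A R : ℝ} (hR : Λ₀ ≤ R) {q : CnC n}
    (hq : q ∈ approxSol Φ L Λ₀ g β a b χ A) :
    (∃ p ∈ cylinder (puncturedCone S), (p ∈ graphRegion (puncturedCone S) b A ∨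
      R * |uCoord p| ^ a < rad p ∧ rad p ≤ |uCoord p| ^ b) ∧
      q = potGraph Φ g β a b χ p) ∨
    ∃ y ∈ L \ coneGraph Φ g R, ∃ u : ℝ, u ≠ 0 ∧ |u| < A⁻¹ ∧ q = embX2 β a y u := by
  rcases hq with ⟨p, hp, hq⟩ | ⟨y, u, hu, huA, ⟨hyL, hy⟩, hq⟩
  · exact Or.inl ⟨p, hp.1, Or.inl hp, hq⟩
  · by_cases hyR : y ∈ coneGraph Φ g R
    · obtain ⟨x₁, ⟨hx₁C, hx₁r⟩, rfl⟩ := hyR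
      have hk := pow_pos (abs_pos.2 hu) a
      have hr₁ := hR.trans_lt hx₁r
      have hle : ‖x₁‖ ≤ |u| ^ ((b : ℝ) - a) := by
        by_contra hcon
        exact hy ⟨x₁, ⟨hx₁C, max_lt hr₁ (not_le.1 hcon)⟩, rfl⟩
      rw [Real.rpow_sub (abs_pos.2 hu), Real.rpow_natCast, le_div_iff₀ hk, mul_comm] at hle
      refine Or.inl ⟨mkCyl n (|u| ^ a • x₁, u), ⟨smul_mem_puncturedCone hk hx₁C, by simp⟩,
        Or.inr ?_, ?_⟩
      · simp only [uCoord, rad, mkCyl_fst, mkCyl_snd, Complex.ofReal_re, norm_smul,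
          Real.norm_of_nonneg hk.le]
        refine ⟨?_, hle⟩
        rw [mul_comm]
        gcongr
      · rw [hq, potGraph, cylGraphMap_eq_embX2 hS hΛ₀ hμ hg hβ ha hχ hχ1 hx₁C hu hr₁ hle]
    · exact Or.inr ⟨y, ⟨hyL, hyR⟩, u, hu, huA, hq⟩

end Potential

end SLGeom

end

noncomputable section

namespace SLGeom

/-! ## Convergence to the cylinder over the cone -/

section Conical

variable {n : ℕ} {S : Set (Cn n)}
variable {Φ : ConeLagrangianNbhd (puncturedCone S)} {L : Set (Cn n)} {Λ₀ μ : ℝ} {g β : Cn n → ℝ}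
variable {a : ℕ} {b : ℝ} {χ : ℝ → ℝ}
variable {P : Type} [NormedAddCommGroup P] [NormedSpace ℝ P] [FiniteDimensional ℝ P]
  {ψ : P → Cn n} {π : Cn n → P} {v₀ : P}
variable {ι : Type} {l : Filter ι} {u s : ι → ℝ}

theorem embX2_uCoord (y : Cn n) (u : ℝ) : uCoord (embX2 β a y u) = u := by
  change ((u : ℂ) + Complex.I * ((-2 * a * u ^ (2 * a - 1) * β y : ℝ) : ℂ)).re = u
  rw [Complex.add_re, Complex.ofReal_re, Complex.I_mul_re, Complex.ofReal_im, neg_zero, add_zero]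

theorem embX2_fst (y : Cn n) (u : ℝ) : (embX2 β a y u).fst = |u| ^ a • y := rfl

theorem embX2_rad (y : Cn n) (u : ℝ) : rad (embX2 β a y u) = |u| ^ a * ‖y‖ := by
  rw [rad, embX2_fst, norm_smul, Real.norm_of_nonneg (by positivity)]

theorem potGraph_uCoord (hS : IsSpecialLagrangianLink S) {p : CnC n}
    (hp : p ∈ cylinder (puncturedCone S)) : uCoord (potGraph Φ g β a b χ p) = uCoord p := by
  have hreal := (hS.isSmooth.tangentSpaceOf_cylinder hp
    (tangentialGrad_mem (potI Φ g β a b χ) p)).2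
  change (p.snd + Complex.I * (tangentialGrad (cylinder (puncturedCone S))
    (potI Φ g β a b χ) p).snd).re = p.snd.re
  rw [hreal, Complex.add_re, Complex.I_mul_re, Complex.ofReal_im, neg_zero, add_zero]

/-- A rescaled neighbourhood moves u by at most s, and (|u| + s)^a ≤ 2^{a-1}(|u|^a + s^a) is still
small compared with s because a > 1. -/
theorem ConicalScale.eventually_pow_lt (h : ConicalScale l a u s) (ha : 1 < a) {c : ℝ}
    (hc : 0 < c) : ∀ᶠ i in l, ∀ U, |U - u i| ≤ s i → |U| ^ a < c * s i := by
  have h1 : Tendsto (fun i => 2 ^ (a - 1) * (|u i| ^ a / s i + s i ^ (a - 1))) l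
      (𝓝 (2 ^ (a - 1) * (0 + 0))) := by
    refine Tendsto.const_mul _ (h.tendsto_ratio.add ?_)
    have := h.tendsto_s.pow (a - 1)
    rwa [zero_pow (by omega)] at this
  rw [add_zero, mul_zero] at h1
  filter_upwards [h1.eventually (gt_mem_nhds hc), h.pos] with i a1 a2 U hU
  have h3 : |U| ≤ |u i| + s i := by
    have := abs_sub_abs_le_abs_sub U (u i); linarith
  calc |U| ^ a ≤ (|u i| + s i) ^ a := by gcongr
    _ ≤ 2 ^ (a - 1) * (|u i| ^ a + s i ^ a) := add_pow_le (abs_nonneg _) a2.le a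
    _ = 2 ^ (a - 1) * (|u i| ^ a / s i + s i ^ (a - 1)) * s i := by
        have : s i ^ a = s i ^ (a - 1) * s i := by rw [← pow_succ, Nat.sub_add_cancel (by omega)]
        rw [this]; field_simp
    _ < c * s i := by gcongr

/-- The graph over the cylinder with gradient coordinates `q.2`. -/
def cylNbhdCoord (Φ : ConeLagrangianNbhd (puncturedCone S)) (ψ : P → Cn n)
    (q : (P × ℝ) × (P × ℝ)) : CnC n :=
  mkL n (nbhdCoord Φ ψ (q.1.1, q.2.1), (q.1.2 : ℂ) + Complex.I * q.2.2)

/-- The rescaled graph of `dI` in a chart. -/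
def rescaledGraph (Φ : ConeLagrangianNbhd (puncturedCone S)) (ψ : P → Cn n) (I : CnC n → ℝ)
    (u s : ℝ) (w : P × ℝ) : CnC n :=
  cylNbhdCoord Φ ψ (w, gradCoord (cylParam ψ) (rescaledPot I ψ u s) w)

theorem ChartGerm.smoothNear_cylNbhdCoord (hψ : ChartGerm (puncturedCone S) ψ π v₀) :
    SmoothNear (cylNbhdCoord Φ ψ) ((v₀, 0), 0) := by
  have t : Tendsto (fun q : (P × ℝ) × (P × ℝ) => (q.1.1, q.2.1)) (𝓝 ((v₀, 0), 0))
      (𝓝 (v₀, 0)) := (Continuous.prodMk (by fun_prop) (by fun_prop)).tendsto _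
  filter_upwards [t.eventually (hψ.nbhdCoord_smooth Φ)] with q hq
  refine (mkL n).contDiff.contDiffAt.comp q (ContDiffAt.prodMk ?_ ?_)
  · exact ContDiffAt.comp (g := nbhdCoord Φ ψ) (f := fun q : (P × ℝ) × (P × ℝ) => (q.1.1, q.2.1)) q
      hq (ContDiffAt.prodMk (by fun_prop) (by fun_prop))
  · have h1 : ContDiff ℝ ∞ (fun q : (P × ℝ) × (P × ℝ) => Complex.ofRealCLM q.1.2) := by fun_prop
    have h2 : ContDiff ℝ ∞ (fun q : (P × ℝ) × (P × ℝ) => Complex.ofRealCLM q.2.2) := by fun_prop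
    exact (h1.add (contDiff_const.mul h2)).contDiffAt

theorem ChartGerm.potGraph_similarity (hψ : ChartGerm (puncturedCone S) ψ π v₀) {u s τ : ℝ}
    (hs : 0 < s)
    (hd : DifferentiableAt ℝ (rescaledPot (potI Φ g β a b χ) ψ u s) (v₀, τ))
    (hdom : (ψ v₀, fderiv ℝ ψ v₀ (gradCoord (cylParam ψ)
      (rescaledPot (potI Φ g β a b χ) ψ u s) (v₀, τ)).1) ∈ Φ.dom) :
    potGraph Φ g β a b χ (s • cylParam ψ (v₀, τ) + shift n u) =
      s • rescaledGraph Φ ψ (potI Φ g β a b χ) u s (v₀, τ) + shift n u := by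
  set ζ := gradCoord (cylParam ψ) (rescaledPot (potI Φ g β a b χ) ψ u s) (v₀, τ) with hζ
  rw [potGraph, hψ.tangentialGrad_similarity hs hd, ← hζ,
    cylParam_fderiv_apply hψ.differentiableAt, rescaledGraph, ← hζ]
  refine CnC_ext ?_ ?_
  · rw [similarity_fst]
    simp only [cylGraphMap, similarity_fst, cylParam_fst]
    exact Φ.map_smul s hs _ _ hdom
  · rw [similarity_snd]
    simp only [cylGraphMap, similarity_snd, cylNbhdCoord, mkL_snd]
    change s • (τ : ℂ) + u + Complex.I * (s • (ζ.2 : ℂ)) =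
      s • ((τ : ℂ) + Complex.I * ζ.2) + u
    simp only [Complex.real_smul]
    ring

/-- The gradient coordinates tend to zero and Φ is the identity on the zero section. -/
theorem ConicalScale.st_rescaledGraph (hS : IsSpecialLagrangianLink S) (hΛ₀ : 0 < Λ₀)
    (hμ : μ < 0) (hg : IsAsymptoticTo Φ L Λ₀ μ g) (hβ : IsLiouvillePotential L β) (ha : 1 < a)
    (hb : 1 < b) (hχ : ContDiff ℝ ∞ χ) (hχ2 : ∀ t, 2 ≤ t → χ t = 0) (h : ConicalScale l a u s)
    (hψ : ChartGerm (puncturedCone S) ψ π v₀) (h1 : ‖ψ v₀‖ = 1) :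
    ST l ((v₀, 0) : P × ℝ)
      (fun i => rescaledGraph Φ ψ (potI Φ g β a b χ) (u i) (s i)) (cylParam ψ) := by
  have st := h.st_gradCoord hS hΛ₀ hμ hg hβ ha hb hχ hχ2 hψ h1
  have st1 : ST l ((v₀, 0) : P × ℝ)
      (fun i w => (w, gradCoord (cylParam ψ) (rescaledPot (potI Φ g β a b χ) ψ (u i) (s i)) w))
      (fun w => (w, 0)) :=
    (SmoothNear.ST (f₀ := fun w : P × ℝ => w) contDiff_id.smoothNear).prodMk st
  have st2 : ST l ((v₀, 0) : P × ℝ)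
      (fun i => rescaledGraph Φ ψ (potI Φ g β a b χ) (u i) (s i))
      (fun w => cylNbhdCoord Φ ψ (w, 0)) :=
    ST.map (h₀ := cylNbhdCoord Φ ψ) (f := fun i w => (w, gradCoord (cylParam ψ)
      (rescaledPot (potI Φ g β a b χ) ψ (u i) (s i)) w)) hψ.smoothNear_cylNbhdCoord st1
  refine st2.congr (Eventually.of_forall fun _ => rfl) ?_
  have t : Tendsto (fun w : P × ℝ => w.1) (𝓝 (v₀, 0)) (𝓝 v₀) := continuous_fst.tendsto _
  filter_upwards [t.eventually hψ.mem] with w hw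
  refine CnC_ext ?_ ?_
  · simp [cylNbhdCoord, nbhdCoord, Φ.map_zero _ hw]
  · simp [cylNbhdCoord, cylParam]

theorem ConicalScale.eventually_similarity (hS : IsSpecialLagrangianLink S) (hΛ₀ : 0 < Λ₀)
    (hμ : μ < 0) (hg : IsAsymptoticTo Φ L Λ₀ μ g) (hβ : IsLiouvillePotential L β) (ha : 1 < a)
    (hb : 1 < b) (hχ : ContDiff ℝ ∞ χ) (hχ2 : ∀ t, 2 ≤ t → χ t = 0) (h : ConicalScale l a u s)
    (hψ : ChartGerm (puncturedCone S) ψ π v₀) (h1 : ‖ψ v₀‖ = 1) :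
    ∀ᶠ p in l ×ˢ 𝓝 ((v₀, 0) : P × ℝ),
      potGraph Φ g β a b χ (s p.1 • cylParam ψ p.2 + shift n (u p.1)) =
      s p.1 • rescaledGraph Φ ψ (potI Φ g β a b χ) (u p.1) (s p.1) p.2 + shift n (u p.1) := by
  have st := h.st_gradCoord hS hΛ₀ hμ hg hβ ha hb hχ hχ2 hψ h1
  have t : Tendsto (fun p : ι × (P × ℝ) => p.2.1) (l ×ˢ 𝓝 ((v₀, 0) : P × ℝ)) (𝓝 v₀) :=
    (continuous_fst.tendsto ((v₀, 0) : P × ℝ)).comp tendsto_snd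
  have t2 : Tendsto (fun p : ι × (P × ℝ) => (p.2.1, (gradCoord (cylParam ψ)
      (rescaledPot (potI Φ g β a b χ) ψ (u p.1) (s p.1)) p.2).1))
      (l ×ˢ 𝓝 ((v₀, 0) : P × ℝ)) (𝓝 (v₀, 0)) :=
    t.prodMk_nhds ((continuous_fst.tendsto (0 : P × ℝ)).comp st.tendsto)
  filter_upwards [t.eventually hψ.eventually, tendsto_fst.eventually h.pos,
    (h.st_fderiv_rescaledPot hS hΛ₀ hμ hg hβ ha hb hχ hχ2 hψ h1).1,
    t2.eventually (hψ.eventually_mem_dom Φ)] with p a1 a2 a3 a4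
  exact a1.potGraph_similarity a2 (a3.differentiableAt (by simp)) a4

/-- At conical scales the approximate solution converges to the cylinder over the cone. -/
theorem ConicalScale.smoothlyConverges (hS : IsSpecialLagrangianLink S) (hΛ₀ : 0 < Λ₀)
    (hμ : μ < 0) (hg : IsAsymptoticTo Φ L Λ₀ μ g) (hβ : IsLiouvillePotential L β) (ha : 1 < a)
    (hb : 1 < b) (hba : b < a) (hχ : ContDiff ℝ ∞ χ) (hχ1 : ∀ t ≤ 1, χ t = 1)
    (hχ2 : ∀ t, 2 ≤ t → χ t = 0) (h : ConicalScale l a u s)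
    (hψ : ChartGerm (puncturedCone S) ψ π v₀) (h1 : ‖ψ v₀‖ = 1) {A : ℝ} (hA : 0 < A)
    (hgr : ∀ p ∈ graphRegion (puncturedCone S) b A,
      ‖(potGraph Φ g β a b χ p).fst - p.fst‖ ≤ 1 / 2 * rad p) :
    SmoothlyConverges l
      (fun i => (fun q => s i • q + shift n (u i)) ⁻¹' approxSol Φ L Λ₀ g β a b χ A)
      (cylinder (puncturedCone S)) (cylParam ψ) (cylInv π) (v₀, 0)
      (fun i => rescaledGraph Φ ψ (potI Φ g β a b χ) (u i) (s i)) := by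
  have hsim := h.eventually_similarity hS hΛ₀ hμ hg hβ ha hb hχ hχ2 hψ h1
  refine ⟨hψ.cylinder 0, h.st_rescaledGraph hS hΛ₀ hμ hg hβ ha hb hχ hχ2 hψ h1, ?_, ?_⟩
  · have t : Tendsto (fun p : ι × (P × ℝ) => p.2.1) (l ×ˢ 𝓝 ((v₀, 0) : P × ℝ)) (𝓝 v₀) :=
      (continuous_fst.tendsto ((v₀, 0) : P × ℝ)).comp tendsto_snd
    have t2 : Tendsto (fun p : ι × (P × ℝ) => |p.2.2|) (l ×ˢ 𝓝 ((v₀, 0) : P × ℝ)) (𝓝 |(0 : ℝ)|) :=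
      ((continuous_snd.abs).tendsto ((v₀, 0) : P × ℝ)).comp tendsto_snd
    rw [abs_zero] at t2
    have t3 : Tendsto (fun p : ι × (P × ℝ) => s p.1 • cylParam ψ p.2 + shift n (u p.1))
        (l ×ˢ 𝓝 ((v₀, 0) : P × ℝ)) (𝓝 ((0 : ℝ) • cylParam ψ (v₀, 0) + shift n 0)) := by
      refine ((h.tendsto_s.comp tendsto_fst).smul
        ((hψ.cylinder 0).differentiableAt.continuousAt.tendsto.comp tendsto_snd)).add ?_
      have : Continuous (shift n) := (mkCyl n).continuous.comp (by fun_prop)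
      exact (this.tendsto 0).comp (h.tendsto_u.comp tendsto_fst)
    have e0 : (0 : ℝ) • cylParam ψ (v₀, 0) + shift n 0 = 0 := by
      rw [zero_smul, zero_add, shift]
      exact map_zero (mkCyl n)
    rw [e0] at t3
    filter_upwards [hsim, t.eventually hψ.mem, tendsto_fst.eventually h.pos,
      t.eventually (hψ.differentiableAt.continuousAt.norm.eventually
        (lt_mem_nhds (by rw [h1]; exact one_half_lt_one : (1 / 2 : ℝ) < ‖ψ v₀‖))),
      t2.eventually (ge_mem_nhds one_pos), t3.eventually (ball_mem_nhds 0 (inv_pos.2 hA)),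
      tendsto_fst.eventually (h.eventually_pow_lt ha (c := 1 / (2 * Λ₀)) (by positivity))]
      with p a1 a2 a3 a4 a5 a6 a7
    rw [mem_preimage, ← a1]
    refine potGraph_mem_approxSol hS hΛ₀ hμ hg hβ (by omega) hχ hχ1 (by linarith) ?_
      (mem_ball_zero_iff.1 a6) ?_
    · exact ⟨by simpa [shift] using smul_mem_puncturedCone a3 a2, by simp [cylParam, shift]⟩
    · rw [similarity_uCoord, similarity_rad a3.le, cylParam_uCoord, cylParam_rad]
      have := a7 (s p.1 * p.2.2 + u p.1) (by
        rw [add_sub_cancel_right, abs_mul, abs_of_pos a3]; nlinarith)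
      calc Λ₀ * |s p.1 * p.2.2 + u p.1| ^ a < Λ₀ * (1 / (2 * Λ₀) * s p.1) := by gcongr
        _ = s p.1 * (1 / 2) := by field_simp
        _ < s p.1 * ‖ψ p.2.1‖ := by gcongr
  · intro V hV
    set c₀ := cylParam ψ (v₀, (0 : ℝ)) with hc₀
    have hinv := (hψ.cylinder 0).inv_tendsto
    have tinv : Tendsto (fun p : ι × CnC n => (p.1, cylInv π p.2)) (l ×ˢ 𝓝 c₀)
        (l ×ˢ 𝓝 (v₀, 0)) := tendsto_fst.prodMk (hinv.comp tendsto_snd)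
    obtain ⟨ρ, hρ, hball⟩ := eventually_prod_uniform ((tinv.eventually hsim).and
      ((tendsto_snd.eventually (hψ.cylinder 0).right_inv).and
        (tendsto_snd.eventually (hinv.eventually hV))))
    obtain ⟨η, hη, hclose⟩ := exists_potGraph_close (Φ := Φ) (b := b) hS hΛ₀ hμ hg hβ ha hb hχ
      hχ2 (ε := min (1 / 2) (ρ / 16)) (by positivity)
    obtain ⟨ρ', hρ', hpow⟩ := exists_pow_lt (a := a) (by omega) hba hη
    -- For graph points with r > R|u|^a this gives |u|^a < η r, as needed for
    -- `exists_potGraph_close`.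
    set R := max Λ₀ (1 / η)
    obtain ⟨M, hM⟩ := (hg.isCompact_diff R (le_max_left _ _)).isBounded.exists_norm_le
    have hzb : Tendsto (fun i => (|u i| + s i) ^ b) l (𝓝 0) := by
      have := (h.tendsto_u.abs.add h.tendsto_s).rpow_const (p := b) (Or.inr (by linarith))
      rwa [abs_zero, add_zero, Real.zero_rpow (by linarith)] at this
    have hus : Tendsto (fun i => |u i| + s i) l (𝓝 0) := by
      simpa using h.tendsto_u.abs.add h.tendsto_s
    filter_upwards [tendsto_fst.eventually hball, tendsto_fst.eventually h.pos,
      tendsto_snd.eventually (ball_mem_nhds c₀ (by positivity : 0 < min (1 / 2) (ρ / 8))),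
      tendsto_fst.eventually (h.eventually_pow_lt ha (c := 1 / (2 * (|M| + 1))) (by positivity)),
      tendsto_fst.eventually (hus.eventually (gt_mem_nhds hη)),
      tendsto_fst.eventually (hus.eventually (gt_mem_nhds hρ')),
      tendsto_fst.eventually (hzb.eventually (gt_mem_nhds hη)),
      tendsto_fst.eventually (h.tendsto_s.eventually (gt_mem_nhds (by positivity : 0 < η / 4)))]
      with p b1 b2 b3 b4 b5 b6 b7 b8 hpX
    obtain ⟨i, q⟩ := p
    dsimp only at b1 b2 b3 b4 b5 b6 b7 b8 hpX ⊢
    rw [dist_eq_norm] at b3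
    have c1 : ‖q - c₀‖ < 1 / 2 := b3.trans_le (min_le_left _ _)
    have c2 : ‖q - c₀‖ < ρ / 8 := b3.trans_le (min_le_right _ _)
    have c3 : ‖q.fst - ψ v₀‖ ≤ ‖q - c₀‖ := norm_fst_le (q - c₀)
    have c4 : |uCoord q| ≤ ‖q - c₀‖ := by
      have := abs_uCoord_le (q - c₀)
      simpa [uCoord, hc₀, cylParam] using this
    have hfst : 1 / 2 < ‖q.fst‖ ∧ ‖q.fst‖ < 3 / 2 := by
      have k1 := norm_sub_norm_le q.fst (ψ v₀)
      have k2 := norm_sub_norm_le (ψ v₀) q.fst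
      rw [norm_sub_rev] at k2
      constructor <;> linarith
    have hU : |s i * uCoord q + u i - u i| ≤ s i := by
      rw [add_sub_cancel_right, abs_mul, abs_of_pos b2]; nlinarith
    have hU' : |s i * uCoord q + u i| ≤ |u i| + s i := by
      have := abs_sub_abs_le_abs_sub (s i * uCoord q + u i) (u i); linarith
    rcases approxSol_cases hS hΛ₀ hμ hg hβ (by omega) hχ hχ1 (le_max_left Λ₀ (1 / η)) hpX with
      ⟨p, hp, hcase, hq⟩ | ⟨y, hy, U, hU0, -, hq⟩
    · have hup : uCoord p = s i * uCoord q + u i := by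
        rw [← similarity_uCoord, ← potGraph_uCoord hS hp, ← hq]
      have hrad : s i • q.fst = (potGraph Φ g β a b χ p).fst := by
        rw [← similarity_fst (s i) (u i) q]; exact congrArg WithLp.fst hq
      have hrp : 0 < rad p := hS.norm_pos hp.1
      have hsmall : rad p < η ∧ |uCoord p| ^ a < η * rad p := by
        rcases hcase with hreg | ⟨k1, k2⟩
        · refine ⟨?_, hpow _ _ (by rw [hup]; exact hU'.trans_lt b6) hrp hreg.2.1⟩
          have k3 := hgr p hreg
          rw [← hrad] at k3
          have k4 := norm_sub_norm_le p.fst (s i • q.fst)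
          rw [norm_sub_rev, norm_smul, Real.norm_of_nonneg b2.le] at k4
          change rad p - _ ≤ _ at k4
          nlinarith
        · refine ⟨k2.trans_lt ?_, ?_⟩
          · rw [hup]
            refine lt_of_le_of_lt ?_ b7
            gcongr
          · have : 1 / η * |uCoord p| ^ a < rad p := lt_of_le_of_lt (by
              gcongr; exact le_max_right _ _) k1
            rw [one_div, inv_mul_lt_iff₀ hη] at this
            exact this
      have k5 := (hclose p hp (by rw [hup]; exact hU'.trans_lt b5) hsmall.1 hsmall.2).2
      set x := (s i)⁻¹ • p.fst with hx
      have hsx : s i • x = p.fst := by rw [hx, smul_smul, mul_inv_cancel₀ b2.ne', one_smul]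
      have hxC : x ∈ puncturedCone S := smul_mem_puncturedCone (inv_pos.2 b2) hp.1
      have k6 : ‖q.fst - x‖ ≤ min (1 / 2) (ρ / 16) * ‖x‖ := by
        rw [← hrad, rad, ← hsx, ← smul_sub, norm_smul, norm_smul, Real.norm_of_nonneg b2.le] at k5
        have : s i * ‖q.fst - x‖ ≤ s i * (min (1 / 2) (ρ / 16) * ‖x‖) := by linarith
        exact le_of_mul_le_mul_left this b2
      have k7 : ‖x‖ ≤ 3 := by
        have k8 := norm_sub_norm_le x q.fst
        rw [norm_sub_rev] at k8
        have : min (1 / 2) (ρ / 16) * ‖x‖ ≤ 1 / 2 * ‖x‖ := by gcongr; exact min_le_left _ _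
        linarith [hfst.2]
      have k8 : ‖q.fst - x‖ ≤ ρ / 16 * 3 :=
        k6.trans (mul_le_mul (min_le_right _ _) k7 (norm_nonneg _) (by positivity))
      -- The rescaled foot point of q; it is close to q, so it lies in the chart and supplies the
      -- parameter.
      set z := mkCyl n (x, uCoord q) with hz
      have hzC : z ∈ cylinder (puncturedCone S) := ⟨hxC, by simp [hz]⟩
      have hzc : z ∈ ball c₀ ρ := by
        rw [mem_ball_iff_norm]
        have k9 : ‖z - c₀‖ ≤ ‖x - ψ v₀‖ + |uCoord q| := by
          refine (norm_le_fst_add_snd _).trans (le_of_eq ?_)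
          simp [hz, hc₀, cylParam]
        have k10 : ‖x - ψ v₀‖ ≤ ‖q.fst - x‖ + ‖q.fst - ψ v₀‖ := by
          have := norm_sub_le (q.fst - ψ v₀) (q.fst - x)
          rw [sub_sub_sub_cancel_left] at this
          linarith
        linarith
      obtain ⟨m1, m2, m3⟩ := b1 z hzc
      refine ⟨cylInv π z, m3, ?_⟩
      have m4 : s i • z + shift n (u i) = p := by
        rw [eq_mkCyl hp, hup]
        refine CnC_ext ?_ ?_
        · simp [hz, hsx, shift]
        · simp [hz, shift]
      rw [m2 hzC, m4, ← hq] at m1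
      exact (smul_right_injective _ b2.ne' (add_right_cancel m1)).symm
    -- Points from the compact part of L have r = |U|^a ‖y‖, which is much smaller than s, whereas q
    -- was chosen with r about s.
    · exfalso
      have hUq : U = s i * uCoord q + u i := by
        rw [← similarity_uCoord, ← embX2_uCoord (β := β) (a := a) y U, ← hq]
      have k1 : s i * ‖q.fst‖ = |U| ^ a * ‖y‖ := by
        rw [← embX2_rad (β := β) y U, ← hq]
        exact (similarity_rad b2.le _ _).symm
      have k2 := b4 U (by rw [hUq]; exact hU)
      have k3 : ‖y‖ ≤ |M| + 1 := (hM y hy).trans (by linarith [le_abs_self M])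
      have k4 : |U| ^ a * ‖y‖ ≤ 1 / (2 * (|M| + 1)) * s i * (|M| + 1) := by gcongr
      have k5 : 1 / (2 * (|M| + 1)) * s i * (|M| + 1) = s i * (1 / 2) := by
        have : |M| + 1 ≠ 0 := by positivity
        field_simp
      nlinarith [hfst.1]

end Conical

end SLGeom

end

noncomputable section

namespace SLGeom

/-! ## Convergence to the cylinder over `L` -/

/-- The pairs `(u, u₀)` with `u₀ → 0` and `||u| - u₀| ≤ u₀^a`. -/
def neckFilter (a : ℕ) : Filter (ℝ × ℝ) :=
  comap Prod.snd (𝓝[>] 0) ⊓ 𝓟 {p | |(|p.1| - p.2)| ≤ p.2 ^ a}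

/-- The coefficients of the affine function `τ ↦ |u + u₀^a τ| / u₀`. -/
def neckParam (a : ℕ) (p : ℝ × ℝ) : ℝ × ℝ := (|p.1| / p.2, (SignType.sign p.1 : ℝ) * p.2 ^ (a - 1))

/-- The embedding of `L × ℝ`, rescaled by `u₀^a` about `(0, u)`, as a function of the coefficients
`neckParam` and of the point of a chart of `L × ℝ`. -/
def neckGerm {n : ℕ} {P : Type} (β : Cn n → ℝ) (ψ : P → Cn n) (a : ℕ)
    (q : (ℝ × ℝ) × (P × ℝ)) : CnC n :=
  mkL n ((q.1.1 + q.1.2 * q.2.2) ^ a • ψ q.2.1, (q.2.2 : ℂ) + Complex.I *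
    ((-2 * a * (q.1.2 * (q.1.1 + q.1.2 * q.2.2) ^ (2 * a - 1)) * β (ψ q.2.1) : ℝ) : ℂ))

theorem eventually_neckFilter_iff {a : ℕ} {P : ℝ × ℝ → Prop} :
    (∀ᶠ p in neckFilter a, P p) ↔
      ∃ η > 0, ∀ u u₀ : ℝ, 0 < u₀ → u₀ < η → |(|u| - u₀)| ≤ u₀ ^ a → P (u, u₀) := by
  rw [neckFilter, eventually_inf_principal, eventually_comap]
  constructor
  · intro h
    obtain ⟨η, hη, H⟩ := (mem_nhdsGT_iff_exists_Ioo_subset).1 h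
    exact ⟨η, hη, fun u u₀ h0 h1 h2 => H ⟨h0, h1⟩ (u, u₀) rfl h2⟩
  · rintro ⟨η, hη, H⟩
    filter_upwards [Ioo_mem_nhdsGT (show (0 : ℝ) < η from hη)] with x hx q hq h2
    subst hq
    exact H q.1 q.2 hx.1 hx.2 h2

theorem tendsto_snd_neckFilter (a : ℕ) : Tendsto Prod.snd (neckFilter a) (𝓝[>] 0) :=
  tendsto_comap.mono_left inf_le_left

theorem neckFilter_small {a : ℕ} (ha : 1 < a) : ∀ᶠ p in neckFilter a,
    0 < p.2 ∧ p.2 < 1 ∧ p.2 ^ (a - 1) ≤ 1 / 4 ∧ |(|p.1| - p.2)| ≤ p.2 ^ a := by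
  refine eventually_neckFilter_iff.2 ⟨1 / 4, by norm_num, fun u u₀ h0 h1 h2 =>
    ⟨h0, by linarith, ?_, h2⟩⟩
  calc u₀ ^ (a - 1) ≤ u₀ ^ 1 := pow_le_pow_of_le_one h0.le (by linarith) (by omega)
    _ ≤ 1 / 4 := by rw [pow_one]; exact h1.le

theorem abs_neckParam_fst_sub_one_le {a : ℕ} (ha : 1 < a) {p : ℝ × ℝ} (h0 : 0 < p.2)
    (h : |(|p.1| - p.2)| ≤ p.2 ^ a) : |(neckParam a p).1 - 1| ≤ p.2 ^ (a - 1) := by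
  have e : p.2 ^ a = p.2 ^ (a - 1) * p.2 := by rw [← pow_succ, Nat.sub_add_cancel (by omega)]
  rw [neckParam, div_sub_one h0.ne', abs_div, abs_of_pos h0, div_le_iff₀ h0, ← e]
  exact h

theorem abs_neckParam_snd_le {a : ℕ} {p : ℝ × ℝ} (h0 : 0 < p.2) :
    |(neckParam a p).2| ≤ p.2 ^ (a - 1) := by
  have h1 : |(SignType.sign p.1 : ℝ)| ≤ 1 := by
    rcases lt_trichotomy p.1 0 with h | h | h <;> simp [h]
  rw [neckParam, abs_mul, abs_of_pos (pow_pos h0 _)]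
  exact mul_le_of_le_one_left (pow_pos h0 _).le h1

theorem tendsto_neckParam {a : ℕ} (ha : 1 < a) :
    Tendsto (neckParam a) (neckFilter a) (𝓝 (1, 0)) := by
  have h0 : Tendsto (fun p : ℝ × ℝ => p.2 ^ (a - 1)) (neckFilter a) (𝓝 0) := by
    have := ((tendsto_snd_neckFilter a).mono_right nhdsWithin_le_nhds).pow (a - 1)
    rwa [zero_pow (by omega)] at this
  refine Tendsto.prodMk_nhds ?_ ?_
  · rw [tendsto_iff_norm_sub_tendsto_zero]
    refine squeeze_zero' (Eventually.of_forall fun _ => norm_nonneg _) ?_ h0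
    filter_upwards [neckFilter_small ha] with p h
    exact abs_neckParam_fst_sub_one_le ha h.1 h.2.2.2
  · refine squeeze_zero_norm' ?_ h0
    filter_upwards [neckFilter_small ha] with p h
    exact abs_neckParam_snd_le h.1

theorem abs_neckParam_le {a : ℕ} (ha : 1 < a) {p : ℝ × ℝ} (h0 : 0 < p.2)
    (h1 : p.2 ^ (a - 1) ≤ 1 / 4) (h : |(|p.1| - p.2)| ≤ p.2 ^ a) {τ : ℝ} (hτ : |τ| ≤ 1) :
    |(neckParam a p).1 + (neckParam a p).2 * τ - 1| ≤ 1 / 2 := by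
  have k1 := abs_neckParam_fst_sub_one_le ha h0 h
  have k2 := abs_neckParam_snd_le (a := a) h0
  have k3 : |(neckParam a p).2 * τ| ≤ 1 / 4 * 1 := by
    rw [abs_mul]; exact mul_le_mul (k2.trans h1) hτ (abs_nonneg _) (by norm_num)
  have k4 := abs_add_le ((neckParam a p).1 - 1) ((neckParam a p).2 * τ)
  rw [show (neckParam a p).1 + (neckParam a p).2 * τ - 1 =
    (neckParam a p).1 - 1 + (neckParam a p).2 * τ by ring]
  linarith

/-- Since u₀^a is much smaller than u₀, the sign of u + u₀^a τ is that of u, and the modulus is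
affine in τ. The odd power 2a - 1 keeps the sign, which is stored in the second coefficient; the
latter tends to zero, so the imaginary part disappears in the limit. -/
theorem abs_eq_neckParam {a : ℕ} (ha : 1 < a) {p : ℝ × ℝ} (h0 : 0 < p.2)
    (h1 : p.2 ^ (a - 1) ≤ 1 / 4) (h : |(|p.1| - p.2)| ≤ p.2 ^ a) {τ : ℝ} (hτ : |τ| ≤ 1) :
    |p.2 ^ a * τ + p.1| = p.2 * ((neckParam a p).1 + (neckParam a p).2 * τ) ∧
    (p.2 ^ a * τ + p.1) ^ (2 * a - 1) = p.2 ^ a * ((neckParam a p).2 *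
      ((neckParam a p).1 + (neckParam a p).2 * τ) ^ (2 * a - 1)) := by
  have k := abs_neckParam_le ha h0 h1 h hτ
  obtain ⟨u, x⟩ := p
  dsimp only at *
  have e : x ^ a = x ^ (a - 1) * x := by rw [← pow_succ, Nat.sub_add_cancel (by omega)]
  set c := neckParam a (u, x) with hc
  have hpos : 0 < x * (c.1 + c.2 * τ) := mul_pos h0 (by have := abs_le.1 k; linarith)
  have hodd : Odd (2 * a - 1) := ⟨a - 1, by omega⟩
  have e2 : x ^ (2 * a - 1) = x ^ a * x ^ (a - 1) := by rw [← pow_add]; congr 1; omega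
  have hu0 : u ≠ 0 := by
    rintro rfl
    rw [abs_zero, zero_sub, abs_neg, abs_of_pos h0, e] at h
    nlinarith
  rcases lt_or_gt_of_ne hu0 with hu | hu
  · have h1 : c.1 = -u / x := by rw [hc, neckParam, abs_of_neg hu]
    have h2 : c.2 = -x ^ (a - 1) := by rw [hc, neckParam]; simp [hu]
    have h3 : x ^ a * τ + u = -(x * (c.1 + c.2 * τ)) := by rw [h1, h2, e]; field_simp; ring
    refine ⟨by rw [h3, abs_neg, abs_of_pos hpos], ?_⟩
    rw [h3, hodd.neg_pow, mul_pow, e2]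
    generalize (c.1 + c.2 * τ) ^ (2 * a - 1) = k'
    rw [h2]
    ring
  · have h1 : c.1 = u / x := by rw [hc, neckParam, abs_of_pos hu]
    have h2 : c.2 = x ^ (a - 1) := by rw [hc, neckParam]; simp [hu]
    have h3 : x ^ a * τ + u = x * (c.1 + c.2 * τ) := by rw [h1, h2, e]; field_simp; ring
    refine ⟨by rw [h3, abs_of_pos hpos], ?_⟩
    rw [h3, mul_pow, e2]
    generalize (c.1 + c.2 * τ) ^ (2 * a - 1) = k'
    rw [h2]
    ring

section Neck

variable {n : ℕ} {S : Set (Cn n)}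
variable {Φ : ConeLagrangianNbhd (puncturedCone S)} {L : Set (Cn n)} {Λ₀ μ : ℝ} {g β : Cn n → ℝ}
variable {a : ℕ} {b : ℝ} {χ : ℝ → ℝ}
variable {P : Type} [NormedAddCommGroup P] [NormedSpace ℝ P] [FiniteDimensional ℝ P]
  {ψ : P → Cn n} {π : Cn n → P} {v₀ : P}

theorem neckGerm_similarity (ha : 1 < a) {p : ℝ × ℝ} (h0 : 0 < p.2)
    (h1 : p.2 ^ (a - 1) ≤ 1 / 4) (h : |(|p.1| - p.2)| ≤ p.2 ^ a) {w : P × ℝ} (hτ : |w.2| ≤ 1) :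
    p.2 ^ a • neckGerm β ψ a (neckParam a p, w) + shift n p.1 =
      embX2 β a (ψ w.1) (p.2 ^ a * w.2 + p.1) := by
  obtain ⟨e1, e2⟩ := abs_eq_neckParam ha h0 h1 h hτ
  refine CnC_ext ?_ ?_
  · rw [similarity_fst, embX2_fst, e1, mul_pow, ← smul_smul]
    rfl
  · rw [similarity_snd]
    change (p.2 ^ a) • ((w.2 : ℂ) + Complex.I * ((-2 * a * ((neckParam a p).2 *
      ((neckParam a p).1 + (neckParam a p).2 * w.2) ^ (2 * a - 1)) * β (ψ w.1) : ℝ) : ℂ)) + p.1 =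
      ((p.2 ^ a * w.2 + p.1 : ℝ) : ℂ) + Complex.I *
        ((-2 * a * (p.2 ^ a * w.2 + p.1) ^ (2 * a - 1) * β (ψ w.1) : ℝ) : ℂ)
    rw [e2, Complex.real_smul]
    push_cast
    ring

theorem ChartGerm.smoothNear_neckGerm (hψ : ChartGerm L ψ π v₀) (hβ : ContDiffOn ℝ ∞ β L)
    (a : ℕ) : SmoothNear (neckGerm β ψ a) (((1, 0), (v₀, 0)) : (ℝ × ℝ) × (P × ℝ)) := by
  have t : Tendsto (fun q : (ℝ × ℝ) × (P × ℝ) => q.2.1) (𝓝 ((1, 0), (v₀, 0))) (𝓝 v₀) :=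
    Continuous.tendsto (by fun_prop) _
  filter_upwards [t.eventually hψ.eventually] with q hq
  have h1 : ContDiffAt ℝ ∞ (fun v => β (ψ v)) q.2.1 := by
    have := (hβ _ hq.mem_self).comp q.2.1 (s := ψ ⁻¹' L) hq.smooth.self_of_nhds.contDiffWithinAt
      (mapsTo_preimage _ _)
    exact this.contDiffAt hq.mem
  have hβ' : ContDiffAt ℝ ∞ (fun q : (ℝ × ℝ) × (P × ℝ) => β (ψ q.2.1)) q :=
    ContDiffAt.comp (g := fun v => β (ψ v)) (f := fun q : (ℝ × ℝ) × (P × ℝ) => q.2.1) q h1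
      (by fun_prop)
  have hψ' : ContDiffAt ℝ ∞ (fun q : (ℝ × ℝ) × (P × ℝ) => ψ q.2.1) q :=
    ContDiffAt.comp (g := ψ) (f := fun q : (ℝ × ℝ) × (P × ℝ) => q.2.1) q hq.smooth.self_of_nhds
      (by fun_prop)
  have hk : ContDiffAt ℝ ∞ (fun q : (ℝ × ℝ) × (P × ℝ) => q.1.1 + q.1.2 * q.2.2) q := by fun_prop
  have hk2 : ContDiffAt ℝ ∞ (fun q : (ℝ × ℝ) × (P × ℝ) => q.1.2) q := by fun_prop
  refine (mkL n).contDiff.contDiffAt.comp q (ContDiffAt.prodMk ((hk.pow a).smul hψ') ?_)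
  have h2 : ContDiff ℝ ∞ (fun q : (ℝ × ℝ) × (P × ℝ) => Complex.ofRealCLM q.2.2) := by fun_prop
  have h3 : ContDiffAt ℝ ∞ (fun q : (ℝ × ℝ) × (P × ℝ) => Complex.ofRealCLM
    (-2 * a * (q.1.2 * (q.1.1 + q.1.2 * q.2.2) ^ (2 * a - 1)) * β (ψ q.2.1))) q :=
    Complex.ofRealCLM.contDiff.contDiffAt.comp q
      ((contDiffAt_const.mul (hk2.mul (hk.pow _))).mul hβ')
  exact h2.contDiffAt.add (contDiffAt_const.mul h3)

/-- Far out Φ moves points by at most half their norm. Hence a bounded part of L can only come from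
a bounded part of the cone. -/
theorem IsAsymptoticTo.exists_norm_le (hS : IsSpecialLagrangianLink S) (hμ : μ < 0)
    (hg : IsAsymptoticTo Φ L Λ₀ μ g) :
    ∃ R > 0, ∀ x ∈ puncturedCone S, R ≤ ‖x‖ → ‖x‖ ≤ 2 * ‖coneGraphPoint Φ g x‖ := by
  obtain ⟨δ, hδ, H⟩ := Φ.exists_uniform hS one_half_pos
  obtain ⟨R, hR, H'⟩ := hg.exists_decay hS hμ hδ
  refine ⟨max R 1, by positivity, fun x hx hxR => ?_⟩
  have h1 : 1 ≤ ‖x‖ := (le_max_right _ _).trans hxR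
  have h2 := (H' x hx ((le_max_left _ _).trans hxR)).1
  have h3 := (H x hx (tangentialGrad (puncturedCone S) g x) (tangentialGrad_mem _ _) (by
    have := norm_nonneg (tangentialGrad (puncturedCone S) g x); nlinarith)).2
  have h4 := norm_sub_norm_le x (coneGraphPoint Φ g x)
  rw [norm_sub_rev] at h4
  change ‖coneGraphPoint Φ g x - x‖ ≤ _ at h3
  linarith

/-- Equivalently |U|^{b-a} > M: the radius beyond which points of L are left out tends to infinity
at the neck scale. -/
theorem neckFilter_pow_lt (ha : 1 < a) (hba : b < a) {M : ℝ} (hM : 0 < M) :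
    ∀ᶠ p in neckFilter a, ∀ τ : ℝ, |τ| ≤ 1 →
      M * |p.2 ^ a * τ + p.1| ^ a < |p.2 ^ a * τ + p.1| ^ b := by
  obtain ⟨ρ, hρ, H⟩ := exists_pow_lt (a := a) (by omega) hba (inv_pos.2 hM)
  have hs := (tendsto_snd_neckFilter a).mono_right nhdsWithin_le_nhds
  filter_upwards [neckFilter_small ha, hs.eventually (gt_mem_nhds (half_pos hρ))]
    with p ⟨h0, _, h1, h2⟩ h3 τ hτ
  have e := (abs_eq_neckParam ha h0 h1 h2 hτ).1
  have k := abs_le.1 (abs_neckParam_le ha h0 h1 h2 hτ)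
  set U := p.2 ^ a * τ + p.1
  have hU : 0 < |U| := by rw [e]; exact mul_pos h0 (by linarith)
  have := H U (|U| ^ b) (by rw [e]; nlinarith) (Real.rpow_pos_of_pos hU b) le_rfl
  rwa [lt_inv_mul_iff₀ hM] at this

/-- At the scale of the neck the approximate solution converges to the cylinder over `L`. -/
theorem smoothlyConverges_neck (hS : IsSpecialLagrangianLink S)
    (hμ : μ < 0) (hg : IsAsymptoticTo Φ L Λ₀ μ g) (hβ : IsLiouvillePotential L β) (ha : 1 < a)
    (hba : b < a) (hψ : ChartGerm L ψ π v₀) {A : ℝ} (hA : 0 < A)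
    (hgr : ∀ p ∈ graphRegion (puncturedCone S) b A,
      ‖(potGraph Φ g β a b χ p).fst - p.fst‖ ≤ 1 / 2 * rad p) :
    SmoothlyConverges (neckFilter a)
      (fun p => (fun q => p.2 ^ a • q + shift n p.1) ⁻¹' approxSol Φ L Λ₀ g β a b χ A)
      (cylinder L) (cylParam ψ) (cylInv π) (v₀, 0)
      (fun p w => neckGerm β ψ a (neckParam a p, w)) := by
  have hs := (tendsto_snd_neckFilter a).mono_right nhdsWithin_le_nhds
  refine ⟨hψ.cylinder 0, ?_, ?_, ?_⟩
  · refine ST.congr (ST.param (tendsto_neckParam ha) (hψ.smoothNear_neckGerm hβ.1 a))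
      (Eventually.of_forall fun _ => rfl) (Eventually.of_forall fun w => ?_)
    refine CnC_ext ?_ ?_
    · simp [neckGerm]
    · simp [neckGerm, cylParam]
  · obtain ⟨R, hR, hRle⟩ := hg.exists_norm_le hS hμ
    have t : Tendsto (fun p : (ℝ × ℝ) × (P × ℝ) => p.2.1)
        (neckFilter a ×ˢ 𝓝 ((v₀, 0) : P × ℝ)) (𝓝 v₀) :=
      (continuous_fst.tendsto ((v₀, 0) : P × ℝ)).comp tendsto_snd
    have t2 : Tendsto (fun p : (ℝ × ℝ) × (P × ℝ) => |p.2.2|)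
        (neckFilter a ×ˢ 𝓝 ((v₀, 0) : P × ℝ)) (𝓝 |(0 : ℝ)|) :=
      ((continuous_snd.abs).tendsto ((v₀, 0) : P × ℝ)).comp tendsto_snd
    rw [abs_zero] at t2
    -- A graph point of L over a cone point of norm above M has norm above ‖ψ v₀‖ + 1, so the points
    -- considered are not left out.
    set M := max R (2 * (‖ψ v₀‖ + 1))
    filter_upwards [tendsto_fst.eventually (neckFilter_small ha), t.eventually hψ.mem,
      t.eventually (hψ.differentiableAt.continuousAt.norm.eventually (gt_mem_nhds (lt_add_one ‖ψ v₀‖))),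
      t2.eventually (ge_mem_nhds one_pos),
      tendsto_fst.eventually (hs.eventually (gt_mem_nhds (half_pos (inv_pos.2 hA)))),
      tendsto_fst.eventually (neckFilter_pow_lt (M := M) ha hba (by positivity))]
      with p ⟨h0, _, h1, h2⟩ a2 a3 a4 a5 a6
    rw [mem_preimage, neckGerm_similarity ha h0 h1 h2 a4]
    have e := (abs_eq_neckParam ha h0 h1 h2 a4).1
    have k := abs_le.1 (abs_neckParam_le ha h0 h1 h2 a4)
    set U := p.1.2 ^ a * p.2.2 + p.1.1
    have hU : 0 < |U| := by rw [e]; exact mul_pos h0 (by linarith)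
    refine Or.inr ⟨_, _, abs_pos.1 hU, by rw [e]; nlinarith, ⟨a2, ?_⟩, rfl⟩
    rintro ⟨x, ⟨hx, hxr⟩, hxe⟩
    have k1 : M < ‖x‖ := by
      refine lt_trans ?_ ((le_max_right _ _).trans_lt hxr)
      rw [Real.rpow_sub hU, Real.rpow_natCast, lt_div_iff₀ (by positivity)]
      exact a6 _ a4
    have k2 := hRle x hx ((le_max_left _ _).trans k1.le)
    rw [hxe] at k2
    have k3 := (le_max_right R (2 * (‖ψ v₀‖ + 1))).trans_lt k1
    linarith
  · intro V hV
    set c₀ := cylParam ψ (v₀, (0 : ℝ)) with hc₀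
    have tq : Tendsto (fun p : (ℝ × ℝ) × CnC n => uCoord p.2) (neckFilter a ×ˢ 𝓝 c₀) (𝓝 0) := by
      have h1 : Continuous (fun q : CnC n => uCoord q) :=
        Complex.continuous_re.comp (sndC n).continuous
      have := (h1.tendsto c₀).comp (tendsto_snd (f := neckFilter a))
      rwa [hc₀, cylParam_uCoord] at this
    have tf : Tendsto (fun p : (ℝ × ℝ) × CnC n => p.2.fst) (neckFilter a ×ˢ 𝓝 c₀) (𝓝 (ψ v₀)) :=
      ((fstC n).continuous.tendsto c₀).comp (tendsto_snd (f := neckFilter a))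
    have tc := (tendsto_neckParam ha).comp (tendsto_fst (f := neckFilter a) (g := 𝓝 c₀))
    have tY : Tendsto (fun p : (ℝ × ℝ) × CnC n =>
        (((neckParam a p.1).1 + (neckParam a p.1).2 * uCoord p.2) ^ a)⁻¹ • p.2.fst)
        (neckFilter a ×ˢ 𝓝 c₀) (𝓝 (ψ v₀)) := by
      have h1 := (((continuous_fst.tendsto _).comp tc).add
        (((continuous_snd.tendsto _).comp tc).mul tq)).pow a
      have h2 := (h1.inv₀ (by simp)).smul tf
      simpa using h2
    have tV : Tendsto (fun p : (ℝ × ℝ) × CnC n =>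
        (π ((((neckParam a p.1).1 + (neckParam a p.1).2 * uCoord p.2) ^ a)⁻¹ • p.2.fst),
          uCoord p.2)) (neckFilter a ×ˢ 𝓝 c₀) (𝓝 (v₀, 0)) :=
      (hψ.inv_tendsto.comp tY).prodMk_nhds tq
    -- Chosen to exclude the graph region: there r ≥ |U|^b > M|U|^a on the cone, while the points
    -- near c₀ have r at most a smaller multiple of u₀^a ≤ 2^a |U|^a.
    set M := 2 ^ a * (2 * (‖ψ v₀‖ + 1))
    have tq' := tq.abs
    rw [abs_zero] at tq'
    filter_upwards [tendsto_fst.eventually (neckFilter_small ha),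
      tq'.eventually (ge_mem_nhds one_pos), tV.eventually hV, tY.eventually hψ.right_inv,
      tf.norm.eventually (gt_mem_nhds (lt_add_one ‖ψ v₀‖)),
      tendsto_fst.eventually (neckFilter_pow_lt (M := M) ha hba (by positivity))]
      with p ⟨h0, _, h1, h2⟩ a4 a5 a6 a7 a8 hpX
    obtain ⟨p, q⟩ := p
    dsimp only at *
    have e := (abs_eq_neckParam ha h0 h1 h2 a4).1
    have k := abs_le.1 (abs_neckParam_le ha h0 h1 h2 a4)
    replace a8 := a8 _ a4
    have hsp : 0 < p.2 ^ a := pow_pos h0 a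
    rcases hpX with ⟨p', hp', hq⟩ | ⟨y, U, -, -, hy, hq⟩
    · exfalso
      change p.2 ^ a • q + shift n p.1 = potGraph Φ g β a b χ p' at hq
      have k1 := hgr p' hp'
      have k2 : uCoord p' = p.2 ^ a * uCoord q + p.1 := by
        rw [← similarity_uCoord, ← potGraph_uCoord (Φ := Φ) (g := g) (β := β) (a := a) (b := b)
          (χ := χ) hS hp'.1, ← hq]
      have k3 := hp'.2.1
      rw [k2] at k3
      rw [← hq, similarity_fst] at k1
      have k4 := norm_sub_norm_le p'.fst (p.2 ^ a • q.fst)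
      rw [norm_sub_rev, norm_smul, Real.norm_of_nonneg hsp.le] at k4
      change rad p' - _ ≤ _ at k4
      have k5 : p.2 ^ a ≤ 2 ^ a * |p.2 ^ a * uCoord q + p.1| ^ a := by
        rw [← mul_pow]
        gcongr
        rw [e]; nlinarith
      have k6 : p.2 ^ a * ‖q.fst‖ ≤ 2 ^ a * |p.2 ^ a * uCoord q + p.1| ^ a * (‖ψ v₀‖ + 1) := by
        gcongr
      have k7 : M * |p.2 ^ a * uCoord q + p.1| ^ a =
        2 * (2 ^ a * |p.2 ^ a * uCoord q + p.1| ^ a * (‖ψ v₀‖ + 1)) := by ring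
      linarith
    · change p.2 ^ a • q + shift n p.1 = embX2 β a y U at hq
      have k1 : U = p.2 ^ a * uCoord q + p.1 := by
        rw [← similarity_uCoord, ← embX2_uCoord (β := β) (a := a) y U, ← hq]
      have k2 : p.2 ^ a • q.fst = |U| ^ a • y := by
        rw [← similarity_fst (p.2 ^ a) p.1 q, hq, embX2_fst]
      set c := (neckParam a p).1 + (neckParam a p).2 * uCoord q
      have hc : 0 < c := by linarith
      have k3 : (c ^ a)⁻¹ • q.fst = y := by
        rw [k1, e, mul_pow, ← smul_smul] at k2
        have k4 := smul_right_injective _ hsp.ne' k2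
        rw [k4, smul_smul, inv_mul_cancel₀ (pow_pos hc a).ne', one_smul]
      rw [k3] at a5 a6
      refine ⟨_, a5, ?_⟩
      have k5 := neckGerm_similarity (β := β) (ψ := ψ) (w := (π y, uCoord q)) ha h0 h1 h2 a4
      rw [a6 hy.1, ← k1, ← hq] at k5
      exact smul_right_injective _ hsp.ne' (add_right_cancel k5)

end Neck

end SLGeom

end

noncomputable section

namespace SLGeom

/-! ## The metric estimates -/

/-- The points of X i are near the compact model set T but not on it, so a uniform thickening of T
is needed in addition to uniform constants. -/
theorem exists_uniform_boundedChart {ι E : Type} [NormedAddCommGroup E] [InnerProductSpace ℝ E]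
    [FiniteDimensional ℝ E] {l : Filter ι} {X : ι → Set E} {m K : ℕ} {T : Set E}
    (hT : IsCompact T)
    (h : ∀ x ∈ T, ∃ δ > 0, ∃ B > 0, ∀ᶠ p in l ×ˢ 𝓝 x, p.2 ∈ X p.1 →
      HasBoundedChartAt m K (X p.1) 1 δ B p.2) :
    ∃ δ > 0, ∃ B > 0, ∃ ρ > 0, ∀ᶠ i in l, ∀ t ∈ T, ∀ x, dist x t < ρ → x ∈ X i →
      HasBoundedChartAt m K (X i) 1 δ B x := by
  have key : ∃ δ > 0, ∃ B > 0, ∃ O : Set E, IsOpen O ∧ T ⊆ O ∧ ∀ᶠ i in l, ∀ x ∈ O, x ∈ X i →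
      HasBoundedChartAt m K (X i) 1 δ B x := by
    refine hT.induction_on (p := fun T => ∃ δ > 0, ∃ B > 0, ∃ O : Set E, IsOpen O ∧ T ⊆ O ∧
      ∀ᶠ i in l, ∀ x ∈ O, x ∈ X i → HasBoundedChartAt m K (X i) 1 δ B x) ?_ ?_ ?_ ?_
    · exact ⟨1, one_pos, 1, one_pos, ∅, isOpen_empty, subset_rfl, by simp⟩
    · rintro s t hst ⟨δ, hδ, B, hB, O, hO, htO, H⟩
      exact ⟨δ, hδ, B, hB, O, hO, hst.trans htO, H⟩
    · rintro s t ⟨δ, hδ, B, hB, O, hO, hsO, H⟩ ⟨δ', hδ', B', hB', O', hO', htO', H'⟩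
      refine ⟨min δ δ', lt_min hδ hδ', max B B', lt_max_of_lt_left hB, O ∪ O', hO.union hO',
        union_subset_union hsO htO', ?_⟩
      filter_upwards [H, H'] with i h1 h2 x hx hxX
      rcases hx with hx | hx
      · exact (h1 x hx hxX).mono (min_le_left _ _) hB (le_max_left _ _)
      · exact (h2 x hx hxX).mono (min_le_right _ _) hB' (le_max_right _ _)
    · intro x hx
      obtain ⟨δ, hδ, B, hB, H⟩ := h x hx
      obtain ⟨ρ, hρ, H⟩ := eventually_prod_uniform H
      exact ⟨ball x ρ, mem_nhdsWithin_of_mem_nhds (ball_mem_nhds x hρ), δ, hδ, B, hB, ball x ρ,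
        isOpen_ball, subset_rfl, H⟩
  obtain ⟨δ, hδ, B, hB, O, hO, hTO, H⟩ := key
  obtain ⟨ρ, hρ, hρO⟩ := hT.exists_thickening_subset_open hO hTO
  refine ⟨δ, hδ, B, hB, ρ, hρ, ?_⟩
  filter_upwards [H] with i hi t ht x hx hxX
  exact hi x (hρO (mem_thickening_iff.2 ⟨t, ht, hx⟩)) hxX

/-- A linear chart of the product with a line. -/
def prodRealEquiv (n : ℕ) :
    EuclideanSpace ℝ (Fin (n + 1)) ≃L[ℝ] EuclideanSpace ℝ (Fin n) × ℝ :=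
  ContinuousLinearEquiv.ofFinrankEq (by simp)

section Estimates

variable {n : ℕ} {S : Set (Cn n)}
variable {Φ : ConeLagrangianNbhd (puncturedCone S)} {L : Set (Cn n)} {Λ₀ μ : ℝ} {g β : Cn n → ℝ}
variable {a : ℕ} {b : ℝ} {χ : ℝ → ℝ} {K : ℕ}

theorem tendsto_mkCyl_zero {ι : Type} {l : Filter ι} (x : Cn n) :
    Tendsto (fun p : ι × Cn n => (p.1, mkCyl n (p.2, 0))) (l ×ˢ 𝓝 x)
      (l ×ˢ 𝓝 (mkCyl n (x, 0))) := by
  have h : Continuous (fun x : Cn n => mkCyl n (x, 0)) := (mkCyl n).continuous.comp (by fun_prop)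
  exact tendsto_fst.prodMk ((h.tendsto x).comp tendsto_snd)

/-- Rescaling by r(p) about (0, u(p)) moves p to Σ × {0}, so one η works for all p by compactness of
Σ; scaling back turns ε into ε r^{-k}. -/
theorem exists_nearGood_conical (hS : IsSpecialLagrangianLink S) (hΛ₀ : 0 < Λ₀)
    (hμ : μ < 0) (hg : IsAsymptoticTo Φ L Λ₀ μ g) (hβ : IsLiouvillePotential L β) (ha : 1 < a)
    (hb : 1 < b) (hba : b < a) (hχ : ContDiff ℝ ∞ χ) (hχ1 : ∀ t ≤ 1, χ t = 1)
    (hχ2 : ∀ t, 2 ≤ t → χ t = 0) {A : ℝ} (hA : 0 < A)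
    (hgr : ∀ p ∈ graphRegion (puncturedCone S) b A,
      ‖(potGraph Φ g β a b χ p).fst - p.fst‖ ≤ 1 / 2 * rad p) (K : ℕ) {ε : ℝ} (hε : 0 < ε) :
    ∃ η > 0, ∀ p ∈ cylinder (puncturedCone S), |uCoord p| < η → rad p < η →
      |uCoord p| ^ a < η * rad p →
      NearGood (cylinder (puncturedCone S)) (approxSol Φ L Λ₀ g β a b χ A) K
        (fun k => ε / rad p ^ k) p := by
  have h := conicalScale_conicalFilter a
  have key : ∀ σ ∈ S, ∀ᶠ q in conicalFilter a ×ˢ 𝓝 σ, q.2 ∈ S →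
      NearGood (cylinder (puncturedCone S))
        ((fun x => q.1.2 • x + shift n q.1.1) ⁻¹' approxSol Φ L Λ₀ g β a b χ A) K (fun _ => ε)
        (mkCyl n (q.2, 0)) := by
    intro σ hσ
    obtain ⟨ψ, π, v₀, hψ, rfl⟩ := hS.isSmooth.exists_chartGerm (subset_puncturedCone hσ)
    have hsc := (h.smoothlyConverges hS hΛ₀ hμ hg hβ ha hb hba hχ hχ1 hχ2 hψ (hS.norm_eq hσ) hA
      hgr).nearGood K hε
    filter_upwards [(tendsto_mkCyl_zero (ψ v₀)).eventually hsc] with q hq hqS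
    exact hq ⟨subset_puncturedCone hqS, by simp⟩
  obtain ⟨η, hη, H⟩ := exists_of_eventually_conicalFilter
    (eventually_forall_of_isCompact hS.isCompact key)
  refine ⟨η, hη, fun p hp h1 h2 h3 => ?_⟩
  have hr : 0 < rad p := hS.norm_pos hp.1
  have hσ : (rad p)⁻¹ • p.fst ∈ S := hS.normalize_mem hp.1
  have h4 := H _ _ h1 hr h2 h3 _ hσ hσ
  have e : rad p • mkCyl n ((rad p)⁻¹ • p.fst, 0) + shift n (uCoord p) = p := by
    conv_rhs => rw [eq_mkCyl hp]
    exact CnC_ext (by simp [shift, smul_smul, hr.ne']) (by simp [shift])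
  have hN : (fun x => rad p • x + shift n (uCoord p)) ⁻¹' cylinder (puncturedCone S) =
      cylinder (puncturedCone S) := by
    rw [preimage_cylinder _ _ hr.ne']
    congr 1
    simpa using preimage_puncturedCone (S := S) hr
  dsimp only at h4
  rw [← hN] at h4
  have h5 := h4.similarity hr
  rwa [e] at h5

theorem eventually_nearGood_neck (hS : IsSpecialLagrangianLink S)
    (hL : IsSpecialLagrangian L) (hLc : IsClosed L)
    (hμ : μ < 0) (hg : IsAsymptoticTo Φ L Λ₀ μ g) (hβ : IsLiouvillePotential L β) (ha : 1 < a)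
    (hba : b < a) {A : ℝ} (hA : 0 < A)
    (hgr : ∀ p ∈ graphRegion (puncturedCone S) b A,
      ‖(potGraph Φ g β a b χ p).fst - p.fst‖ ≤ 1 / 2 * rad p) (K : ℕ) {ε : ℝ} (hε : 0 < ε)
    (M : ℝ) :
    ∀ᶠ q in neckFilter a, ∀ y ∈ L ∩ closedBall 0 M,
      NearGood (cylinder L)
        ((fun x => q.2 ^ a • x + shift n q.1) ⁻¹' approxSol Φ L Λ₀ g β a b χ A) K (fun _ => ε)
        (mkCyl n (y, 0)) := by
  have hY : IsCompact (L ∩ closedBall 0 M) := (isCompact_closedBall _ _).inter_left hLc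
  have key : ∀ y ∈ L ∩ closedBall 0 M, ∀ᶠ q in neckFilter a ×ˢ 𝓝 y, q.2 ∈ L →
      NearGood (cylinder L)
        ((fun x => q.1.2 ^ a • x + shift n q.1.1) ⁻¹' approxSol Φ L Λ₀ g β a b χ A) K (fun _ => ε)
        (mkCyl n (q.2, 0)) := by
    rintro y ⟨hy, -⟩
    obtain ⟨ψ, π, v₀, hψ, rfl⟩ := hL.1.exists_chartGerm hy
    have hsc := (smoothlyConverges_neck hS hμ hg hβ ha hba hψ hA hgr).nearGood K hε
    filter_upwards [(tendsto_mkCyl_zero (ψ v₀)).eventually hsc] with q hq hqS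
    exact hq ⟨hqS, by simp⟩
  filter_upwards [eventually_forall_of_isCompact hY key] with q hq y hy using hq y hy hy.1

theorem exists_nearGood_neck (hS : IsSpecialLagrangianLink S)
    (hL : IsSpecialLagrangian L) (hLc : IsClosed L) (hL0 : (0 : Cn n) ∉ L)
    (hμ : μ < 0) (hg : IsAsymptoticTo Φ L Λ₀ μ g) (hβ : IsLiouvillePotential L β) (ha : 1 < a)
    (hba : b < a) {A : ℝ} (hA : 0 < A)
    (hgr : ∀ p ∈ graphRegion (puncturedCone S) b A,
      ‖(potGraph Φ g β a b χ p).fst - p.fst‖ ≤ 1 / 2 * rad p) (K : ℕ) {ε Λ : ℝ} (hε : 0 < ε) :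
    ∃ η > 0, ∀ u₀, 0 < u₀ → u₀ < η → ∀ p ∈ modelS L a u₀, rad p < 2 * Λ * |uCoord p| ^ a →
      |(|uCoord p| - u₀)| ≤ u₀ ^ a →
      NearGood (modelS L a u₀) (approxSol Φ L Λ₀ g β a b χ A) K (fun k => ε / rad p ^ k) p := by
  -- In this region |u| ≤ 2u₀, so r = u₀^a ‖y‖ < 2Λ|u|^a bounds ‖y‖. Since the rescaling is by u₀^a
  -- and not by r, a factor ‖y‖^k ≤ M^K is lost; hence ε / M^K below.
  set M := max (2 * |Λ| * 2 ^ a) 1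
  have hM : 1 ≤ M := le_max_right _ _
  obtain ⟨η, hη, H⟩ := eventually_neckFilter_iff.1 (eventually_nearGood_neck (ε := ε / M ^ K) hS hL
    hLc hμ hg hβ ha hba hA hgr K (by positivity) M)
  refine ⟨min η 1, by positivity, fun u₀ h0 h1 p hp h2 h3 => ?_⟩
  obtain ⟨⟨y, hy, hpy⟩, hp2⟩ := hp
  dsimp only at hpy
  have hs : 0 < u₀ ^ a := pow_pos h0 a
  have hy0 : 0 < ‖y‖ := norm_pos_iff.2 fun h => hL0 (h ▸ hy)
  have hr : rad p = u₀ ^ a * ‖y‖ := by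
    rw [rad, ← hpy, norm_smul, Real.norm_of_nonneg hs.le]
  have hle : u₀ ^ a ≤ u₀ := by
    calc u₀ ^ a ≤ u₀ ^ 1 := pow_le_pow_of_le_one h0.le (h1.trans_le (min_le_right _ _)).le (by omega)
      _ = u₀ := pow_one _
  have hu : |uCoord p| ≤ 2 * u₀ := by have := abs_le.1 h3; linarith
  have hyM : ‖y‖ ≤ M := by
    refine le_trans ?_ (le_max_left _ _)
    have : u₀ ^ a * ‖y‖ ≤ u₀ ^ a * (2 * |Λ| * 2 ^ a) := by
      rw [← hr]
      calc rad p ≤ 2 * Λ * |uCoord p| ^ a := h2.le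
        _ ≤ 2 * |Λ| * (2 * u₀) ^ a := by gcongr; exact le_abs_self _
        _ = u₀ ^ a * (2 * |Λ| * 2 ^ a) := by rw [mul_pow]; ring
    exact le_of_mul_le_mul_left this hs
  have h4 := H (uCoord p) u₀ h0 (h1.trans_le (min_le_left _ _)) h3 y
    ⟨hy, mem_closedBall_zero_iff.2 hyM⟩
  have hN : (fun x => u₀ ^ a • x + shift n (uCoord p)) ⁻¹' modelS L a u₀ = cylinder L := by
    rw [modelS, preimage_cylinder _ _ hs.ne', preimage_image_eq _ (smul_right_injective _ hs.ne')]
  have e : u₀ ^ a • mkCyl n (y, 0) + shift n (uCoord p) = p := by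
    refine CnC_ext (by simp [shift, hpy]) (Complex.ext ?_ ?_)
    · simp [shift, uCoord]
    · simp [shift, hp2]
  dsimp only at h4
  rw [← hN] at h4
  have h5 := h4.similarity hs
  rw [e] at h5
  refine h5.mono fun k hk => ?_
  rw [div_div, hr]
  refine div_le_div_of_nonneg_left hε.le (by positivity) ?_
  rw [mul_pow, mul_comm]
  gcongr
  calc ‖y‖ ^ k ≤ M ^ k := by gcongr
    _ ≤ M ^ K := pow_le_pow_right₀ hM hk

/-! ## Bounded geometry -/

/-- Where `|u|^a ≪ r` the approximate solution is close to the cylinder over the cone. -/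
theorem exists_approxSol_near_cone (hS : IsSpecialLagrangianLink S) (hΛ₀ : 0 < Λ₀)
    (hμ : μ < 0) (hg : IsAsymptoticTo Φ L Λ₀ μ g) (hβ : IsLiouvillePotential L β) (ha : 1 < a)
    (hb : 1 < b) (hba : b < a) (hχ : ContDiff ℝ ∞ χ) (hχ1 : ∀ t ≤ 1, χ t = 1)
    (hχ2 : ∀ t, 2 ≤ t → χ t = 0) {A : ℝ}
    (hgr : ∀ p ∈ graphRegion (puncturedCone S) b A,
      ‖(potGraph Φ g β a b χ p).fst - p.fst‖ ≤ 1 / 2 * rad p) {ε : ℝ} (hε : 0 < ε) :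
    ∃ η > 0, ∀ q ∈ approxSol Φ L Λ₀ g β a b χ A, |uCoord q| < η → rad q < η →
      |uCoord q| ^ a < η * rad q →
      ∃ p ∈ cylinder (puncturedCone S), uCoord p = uCoord q ∧ ‖q - p‖ ≤ ε * rad p := by
  obtain ⟨η₁, hη₁, h₁⟩ := exists_potGraph_close (Φ := Φ) (b := b) hS hΛ₀ hμ hg hβ ha hb hχ
    hχ2 (half_pos hε)
  obtain ⟨η₂, hη₂, h₂⟩ := exists_norm_tangentialGrad_le (Φ := Φ) (b := b) hS hΛ₀ hμ hg hβ ha hb hχ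
    hχ2 (half_pos hε)
  set η := min η₁ η₂
  have hη : 0 < η := lt_min hη₁ hη₂
  obtain ⟨ρ, hρ, hpow⟩ := exists_pow_lt (a := a) (by omega) hba hη
  obtain ⟨M, hM⟩ := (hg.isCompact_diff (max Λ₀ (1 / η)) (le_max_left _ _)).isBounded.exists_norm_le
  obtain ⟨ρ', hρ', hpow'⟩ : ∃ ρ' > 0, ∀ u : ℝ, |u| < ρ' → |u| ^ b < η := by
    have h0 : Tendsto (fun u : ℝ => |u| ^ b) (𝓝 0) (𝓝 0) := by
      have := (continuous_abs.tendsto (0 : ℝ)).rpow_const (p := b) (Or.inr (by linarith))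
      rwa [abs_zero, Real.zero_rpow (by linarith)] at this
    obtain ⟨ρ', hρ', H⟩ := Metric.eventually_nhds_iff_ball.1 (h0.eventually (gt_mem_nhds hη))
    exact ⟨ρ', hρ', fun u hu => H u (by rwa [mem_ball_zero_iff])⟩
  -- The factor 1/(|M| + 1) rules out the compact part of L, where r ≤ |M||u|^a; η / 2 allows for
  -- the change of radius between X and the cone.
  refine ⟨min (min (η / 2) (1 / (|M| + 1))) (min ρ ρ'), by positivity, fun q hq hu hr hur => ?_⟩
  have hη2 : min (min (η / 2) (1 / (|M| + 1))) (min ρ ρ') ≤ η / 2 :=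
    (min_le_left _ _).trans (min_le_left _ _)
  rcases approxSol_cases hS hΛ₀ hμ hg hβ (by omega) hχ hχ1 (le_max_left Λ₀ (1 / η)) hq with
    ⟨p, hp, hcase, rfl⟩ | ⟨y, hy, U, -, -, rfl⟩
  · have hup : uCoord p = uCoord (potGraph Φ g β a b χ p) := (potGraph_uCoord hS hp).symm
    have hrp : 0 < rad p := hS.norm_pos hp.1
    rw [← hup] at hu hur
    have hsmall : rad p < η ∧ |uCoord p| ^ a < η * rad p := by
      rcases hcase with hreg | ⟨k1, k2⟩
      · refine ⟨?_, hpow _ _ (hu.trans_le ((min_le_right _ _).trans (min_le_left _ _))) hrp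
          hreg.2.1⟩
        have k3 := hgr p hreg
        have k4 := norm_sub_norm_le p.fst (potGraph Φ g β a b χ p).fst
        rw [norm_sub_rev] at k4
        change rad p - rad (potGraph Φ g β a b χ p) ≤ _ at k4
        linarith
      · refine ⟨k2.trans_lt (hpow' _ (hu.trans_le ((min_le_right _ _).trans (min_le_right _ _)))),
          ?_⟩
        have : 1 / η * |uCoord p| ^ a < rad p := lt_of_le_of_lt (by
          gcongr; exact le_max_right _ _) k1
        rwa [one_div, inv_mul_lt_iff₀ hη] at this
    have hu' : |uCoord p| < η := by linarith
    have k5 := (h₁ p hp (hu'.trans_le (min_le_left _ _)) (hsmall.1.trans_le (min_le_left _ _))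
      (hsmall.2.trans_le (by gcongr; exact min_le_left _ _))).2
    have k6 := h₂ p hp (hu'.trans_le (min_le_right _ _)) (hsmall.1.trans_le (min_le_right _ _))
      (hsmall.2.trans_le (by gcongr; exact min_le_right _ _))
    refine ⟨p, hp, hup, (norm_le_fst_add_snd _).trans ?_⟩
    have k7 : ‖(potGraph Φ g β a b χ p - p).snd‖ ≤ ε / 2 * rad p := by
      refine le_trans (le_of_eq ?_) ((norm_snd_le _).trans k6)
      rw [WithLp.sub_snd, potGraph]
      simp [cylGraphMap]
    rw [WithLp.sub_fst]
    linarith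
  · exfalso
    rw [embX2_uCoord, embX2_rad] at hur
    have k1 : ‖y‖ ≤ |M| := (hM y hy).trans (le_abs_self M)
    have k2 : |U| ^ a < 1 / (|M| + 1) * (|U| ^ a * |M|) := by
      refine hur.trans_le ?_
      gcongr
      exact (min_le_left _ _).trans (min_le_right _ _)
    rw [one_div, inv_mul_eq_div, lt_div_iff₀ (by positivity)] at k2
    have : 0 ≤ |U| ^ a := by positivity
    nlinarith

theorem exists_boundedChart_conical (hS : IsSpecialLagrangianLink S) (hΛ₀ : 0 < Λ₀)
    (hμ : μ < 0) (hg : IsAsymptoticTo Φ L Λ₀ μ g) (hβ : IsLiouvillePotential L β) (ha : 1 < a)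
    (hb : 1 < b) (hba : b < a) (hχ : ContDiff ℝ ∞ χ) (hχ1 : ∀ t ≤ 1, χ t = 1)
    (hχ2 : ∀ t, 2 ≤ t → χ t = 0) {A : ℝ} (hA : 0 < A)
    (hgr : ∀ p ∈ graphRegion (puncturedCone S) b A,
      ‖(potGraph Φ g β a b χ p).fst - p.fst‖ ≤ 1 / 2 * rad p) (K : ℕ) :
    ∃ δ > 0, ∃ B > 0, ∃ η > 0, ∀ q ∈ approxSol Φ L Λ₀ g β a b χ A, |uCoord q| < η → rad q < η →
      |uCoord q| ^ a < η * rad q → ∀ R, 0 < R → R < rad q → rad q < 2 * R →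
      HasBoundedChartAt (n + 1) K (approxSol Φ L Λ₀ g β a b χ A) R δ B q := by
  have h := conicalScale_conicalFilter a
  have hc : Continuous (fun x : Cn n => mkCyl n (x, 0)) := (mkCyl n).continuous.comp (by fun_prop)
  obtain ⟨δ, hδ, B, hB, ρ, hρ, H⟩ := exists_uniform_boundedChart (l := conicalFilter a)
    (m := n + 1) (K := K) (T := (fun x : Cn n => mkCyl n (x, 0)) '' S)
    (X := fun q => (fun x => q.2 • x + shift n q.1) ⁻¹' approxSol Φ L Λ₀ g β a b χ A)
    (hS.isCompact.image hc) (by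
      rintro _ ⟨σ, hσ, rfl⟩
      obtain ⟨ψ, π, v₀, hψ, rfl⟩ := hS.isSmooth.exists_chartGerm (subset_puncturedCone hσ)
      have := ((h.smoothlyConverges hS hΛ₀ hμ hg hβ ha hb hba hχ hχ1 hχ2 hψ (hS.norm_eq hσ) hA
        hgr).reparam (prodRealEquiv n)).exists_boundedChart K
      rw [ContinuousLinearEquiv.apply_symm_apply] at this
      exact this)
  obtain ⟨η, hη, H⟩ := exists_of_eventually_conicalFilter H
  obtain ⟨η', hη', hcone⟩ := exists_approxSol_near_cone (Φ := Φ) hS hΛ₀ hμ hg hβ ha hb hba hχ hχ1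
    hχ2 hgr (ε := min (1 / 2) (ρ / 8)) (by positivity)
  -- Rescaling is by r(q), and 1 < r(q)/R < 2 bounds the square of the ratio by 4.
  refine ⟨δ, hδ, 4 * B, by positivity, min η η', by positivity,
    fun q hq hu hr hur R hR hR1 hR2 => ?_⟩
  have hq0 : 0 < rad q := hR.trans hR1
  obtain ⟨p, hp, hup, hpq⟩ := hcone q hq (hu.trans_le (min_le_right _ _))
    (hr.trans_le (min_le_right _ _)) (hur.trans_le (by gcongr; exact min_le_right _ _))
  have hrp : 0 < rad p := hS.norm_pos hp.1
  have hσ : (rad p)⁻¹ • p.fst ∈ S := hS.normalize_mem hp.1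
  set c := mkCyl n ((rad p)⁻¹ • p.fst, 0) with hcdef
  set q' := (rad q)⁻¹ • (q - shift n (uCoord q)) with hq'
  have eq' : rad q • q' + shift n (uCoord q) = q := by
    rw [hq', smul_smul, mul_inv_cancel₀ hq0.ne', one_smul, sub_add_cancel]
  have ep : rad p • c + shift n (uCoord q) = p := by
    conv_rhs => rw [eq_mkCyl hp, hup]
    exact CnC_ext (by simp [hcdef, shift, smul_smul, hrp.ne']) (by simp [hcdef, shift])
  have k1 : |rad p - rad q| ≤ ‖q - p‖ := by
    rw [abs_sub_comm]
    exact (abs_norm_sub_norm_le q.fst p.fst).trans (norm_fst_le (q - p))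
  have hc1 : ‖c‖ = 1 := by
    have h1 := WithLp.prod_norm_sq_eq_of_L2 c
    have h2 : ‖c.fst‖ = 1 := hS.norm_eq hσ
    have h3 : c.snd = 0 := by simp [hcdef]
    rw [h2, h3, norm_zero] at h1
    nlinarith [norm_nonneg c]
  have k2 : rad q • (q' - c) = (q - p) + (rad p - rad q) • c := by
    have e1 : rad q • q' = q - shift n (uCoord q) := eq_sub_of_add_eq eq'
    have e2 : rad p • c = p - shift n (uCoord q) := eq_sub_of_add_eq ep
    rw [smul_sub, sub_smul, e1, e2]
    abel
  have hdist : dist q' c < ρ := by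
    rw [dist_eq_norm]
    have k3 : rad q * ‖q' - c‖ ≤ 2 * ‖q - p‖ := by
      rw [← Real.norm_of_nonneg hq0.le, ← norm_smul, k2]
      refine (norm_add_le _ _).trans ?_
      rw [norm_smul, hc1, mul_one, Real.norm_eq_abs]
      linarith
    have k4 : ‖q - p‖ ≤ 1 / 2 * rad p := hpq.trans (by gcongr; exact min_le_left _ _)
    have k5 : ‖q - p‖ ≤ ρ / 8 * rad p := hpq.trans (by gcongr; exact min_le_right _ _)
    have k6 := (abs_le.1 k1).2
    have k7 : rad p ≤ 2 * rad q := by linarith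
    have k8 : rad q * ‖q' - c‖ ≤ rad q * (ρ / 2) := by nlinarith
    linarith [le_of_mul_le_mul_left k8 hq0]
  have h4 := H (uCoord q) (rad q) (hu.trans_le (min_le_left _ _)) hq0
    (hr.trans_le (min_le_left _ _)) (hur.trans_le (by gcongr; exact min_le_left _ _)) c
    ⟨_, hσ, rfl⟩ q' hdist (by rw [mem_preimage]; dsimp only; rwa [eq'])
  have h5 : 1 < rad q / R := (one_lt_div hR).2 hR1
  have h6 : rad q / R < 2 := (div_lt_iff₀ hR).2 hR2
  have h7 := h4.similarity hq0 hR (M := 4) (by norm_num) (by nlinarith) (by nlinarith) hB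
  rwa [eq'] at h7

theorem exists_boundedChart_neck (hS : IsSpecialLagrangianLink S)
    (hL : IsSpecialLagrangian L) (hLc : IsClosed L) (hL0 : (0 : Cn n) ∉ L)
    (hμ : μ < 0) (hg : IsAsymptoticTo Φ L Λ₀ μ g) (hβ : IsLiouvillePotential L β) (ha : 1 < a)
    (hba : b < a) {A : ℝ} (hA : 0 < A)
    (hgr : ∀ p ∈ graphRegion (puncturedCone S) b A,
      ‖(potGraph Φ g β a b χ p).fst - p.fst‖ ≤ 1 / 2 * rad p) (K : ℕ) (M : ℝ) :
    ∃ δ > 0, ∃ B > 0, ∃ η > 0, ∀ y ∈ L, ‖y‖ ≤ M → ∀ u, u ≠ 0 → |u| < η →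
      embX2 β a y u ∈ approxSol Φ L Λ₀ g β a b χ A → ∀ R, 0 < R → R < rad (embX2 β a y u) →
      rad (embX2 β a y u) < 2 * R →
      HasBoundedChartAt (n + 1) K (approxSol Φ L Λ₀ g β a b χ A) R δ B (embX2 β a y u) := by
  have hY : IsCompact (L ∩ closedBall 0 M) := (isCompact_closedBall _ _).inter_left hLc
  have hc : Continuous (fun x : Cn n => mkCyl n (x, 0)) := (mkCyl n).continuous.comp (by fun_prop)
  obtain ⟨d, hd, hdL⟩ : ∃ d > 0, ∀ y ∈ L, d ≤ ‖y‖ := by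
    obtain ⟨d, hd, H⟩ := Metric.eventually_nhds_iff_ball.1 (hLc.isOpen_compl.mem_nhds hL0)
    exact ⟨d, hd, fun y hy => not_lt.1 fun h => H y (mem_ball_zero_iff.2 h) hy⟩
  obtain ⟨D, hD⟩ := hY.exists_bound_of_continuousOn (hβ.1.continuousOn.mono inter_subset_left)
  obtain ⟨δ, hδ, B, hB, ρ, hρ, H⟩ := exists_uniform_boundedChart (l := neckFilter a)
    (m := n + 1) (K := K) (T := (fun x : Cn n => mkCyl n (x, 0)) '' (L ∩ closedBall 0 M))
    (X := fun q => (fun x => q.2 ^ a • x + shift n q.1) ⁻¹' approxSol Φ L Λ₀ g β a b χ A)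
    (hY.image hc) (by
      rintro _ ⟨y, ⟨hy, -⟩, rfl⟩
      obtain ⟨ψ, π, v₀, hψ, rfl⟩ := hL.1.exists_chartGerm hy
      have := ((smoothlyConverges_neck hS hμ hg hβ ha hba hψ hA hgr).reparam
        (prodRealEquiv n)).exists_boundedChart K
      rw [ContinuousLinearEquiv.apply_symm_apply] at this
      exact this)
  obtain ⟨η, hη, H⟩ := eventually_neckFilter_iff.1 H
  -- Rescaling is by |u|^a while R is comparable with r = |u|^a ‖y‖; the bounds d ≤ ‖y‖ ≤ M give M⁻¹
  -- ≤ |u|^a/R ≤ 2/d.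
  set N := max (M ^ 2) ((2 / d) ^ 2)
  have hN : 0 < N := lt_max_of_lt_right (by positivity)
  refine ⟨δ, hδ, N * B, by positivity, min η (min 1 (ρ / (2 * a * (|D| + 1)))), by positivity,
    fun y hy hyM u hu huη hX R hR hR1 hR2 => ?_⟩
  have hua : 0 < |u| := abs_pos.2 hu
  have hs : 0 < |u| ^ a := pow_pos hua a
  -- The rescaled point differs from (y, 0) only by an imaginary part of size 2a|u|^{a-1}|β(y)|,
  -- small because β is bounded on the compact part of L.
  set q' : CnC n := mkL n (y, Complex.I *
    ((-2 * a * (u ^ (2 * a - 1) / |u| ^ a) * β y : ℝ) : ℂ)) with hq'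
  have eq' : |u| ^ a • q' + shift n u = embX2 β a y u := by
    refine CnC_ext ?_ ?_
    · rw [similarity_fst, embX2_fst]; rfl
    · rw [similarity_snd]
      change (|u| ^ a) • (Complex.I * ((-2 * a * (u ^ (2 * a - 1) / |u| ^ a) * β y : ℝ) : ℂ)) + u =
        (u : ℂ) + Complex.I * ((-2 * a * u ^ (2 * a - 1) * β y : ℝ) : ℂ)
      have e : -2 * a * u ^ (2 * a - 1) * β y =
        |u| ^ a * (-2 * a * (u ^ (2 * a - 1) / |u| ^ a) * β y) := by field_simp
      rw [e, Complex.real_smul]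
      push_cast
      ring
  have hdist : dist q' (mkCyl n (y, 0)) < ρ := by
    rw [dist_eq_norm]
    refine (norm_le_fst_add_snd _).trans_lt ?_
    have e1 : (q' - mkCyl n (y, 0)).fst = 0 := by simp [hq']
    have e2 : ‖(q' - mkCyl n (y, 0)).snd‖ = 2 * a * |u| ^ (a - 1) * |β y| := by
      have e3 : |u| ^ (2 * a - 1) = |u| ^ (a - 1) * |u| ^ a := by rw [← pow_add]; congr 1; omega
      rw [WithLp.sub_snd, mkCyl_snd, hq', mkL_snd]
      simp only [Complex.ofReal_zero, sub_zero, norm_mul, Complex.norm_I, one_mul,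
        Complex.norm_real, Real.norm_eq_abs, abs_div, abs_pow, abs_abs, e3, abs_neg,
        Nat.abs_cast, abs_two]
      field_simp
    rw [e1, e2, norm_zero, zero_add]
    have k1 : |u| ^ (a - 1) ≤ |u| := by
      calc |u| ^ (a - 1) ≤ |u| ^ 1 := pow_le_pow_of_le_one hua.le
            (huη.trans_le ((min_le_right _ _).trans (min_le_left _ _))).le (by omega)
        _ = |u| := pow_one _
    have k2 : |u| < ρ / (2 * a * (|D| + 1)) :=
      huη.trans_le ((min_le_right _ _).trans (min_le_right _ _))
    have k3 : |β y| ≤ |D| + 1 := by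
      have := hD y ⟨hy, mem_closedBall_zero_iff.2 hyM⟩
      rw [Real.norm_eq_abs] at this
      linarith [le_abs_self D]
    have ha0 : (0 : ℝ) < a := by positivity
    rw [lt_div_iff₀ (by positivity)] at k2
    calc 2 * a * |u| ^ (a - 1) * |β y| ≤ 2 * a * |u| * (|D| + 1) := by gcongr
      _ = |u| * (2 * a * (|D| + 1)) := by ring
      _ < ρ := k2
  have h4 := H u |u| hua (huη.trans_le (min_le_left _ _)) (by rw [sub_self, abs_zero]; exact hs.le)
    (mkCyl n (y, 0)) ⟨y, ⟨hy, mem_closedBall_zero_iff.2 hyM⟩, rfl⟩ q' hdist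
    (by rw [mem_preimage]; dsimp only; rwa [eq'])
  rw [embX2_rad] at hR1 hR2
  have hdy := hdL y hy
  have h5 : M⁻¹ ≤ |u| ^ a / R := by
    rw [le_div_iff₀ hR, inv_mul_le_iff₀ (by linarith)]
    nlinarith
  have h6 : |u| ^ a / R ≤ 2 / d := by
    rw [div_le_div_iff₀ hR hd]
    nlinarith
  have hMp : 0 < M := by linarith
  have h7 := h4.similarity hs hR hN (by
      calc N⁻¹ ≤ (M ^ 2)⁻¹ := inv_anti₀ (by positivity) (le_max_left _ _)
        _ = M⁻¹ ^ 2 := (inv_pow M 2).symm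
        _ ≤ _ := by gcongr) (by
      calc (|u| ^ a / R) ^ 2 ≤ (2 / d) ^ 2 := by gcongr
        _ ≤ N := le_max_right _ _) hB
  rwa [eq'] at h7

/-- Near the origin the approximate solution has bounded geometry. -/
theorem exists_boundedGeometry (hS : IsSpecialLagrangianLink S) (hΛ₀ : 0 < Λ₀)
    (hL : IsSpecialLagrangian L) (hLc : IsClosed L) (hL0 : (0 : Cn n) ∉ L)
    (hμ : μ < 0) (hg : IsAsymptoticTo Φ L Λ₀ μ g) (hβ : IsLiouvillePotential L β) (ha : 1 < a)
    (hb : 1 < b) (hba : b < a) (hχ : ContDiff ℝ ∞ χ) (hχ1 : ∀ t ≤ 1, χ t = 1)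
    (hχ2 : ∀ t, 2 ≤ t → χ t = 0) {A : ℝ} (hA : 0 < A)
    (hgr : ∀ p ∈ graphRegion (puncturedCone S) b A,
      ‖(potGraph Φ g β a b χ p).fst - p.fst‖ ≤ 1 / 2 * rad p) (K : ℕ) :
    ∃ η > 0, HasBoundedGeometryOn rad (fun q => ‖q‖) (n + 1) K (approxSol Φ L Λ₀ g β a b χ A)
      {q | ‖q‖ < η} := by
  obtain ⟨δ₁, hδ₁, B₁, hB₁, η₁, hη₁, H₁⟩ := exists_boundedChart_conical hS hΛ₀ hμ hg hβ ha hb hba hχ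
    hχ1 hχ2 hA hgr K
  obtain ⟨δ₂, hδ₂, B₂, hB₂, η₂, hη₂, H₂⟩ := exists_boundedChart_neck hS hL hLc hL0 hμ hg hβ ha hba
    hA hgr K (1 / η₁)
  obtain ⟨ρ, hρ, hpow⟩ := exists_pow_lt (a := a) (by omega) hba (half_pos hη₁)
  refine ⟨min η₁ (min η₂ ρ), by positivity, min δ₁ δ₂, by positivity, max B₁ B₂,
    lt_max_of_lt_left hB₁, fun R hR _ _ q hq hR1 hR2 _ _ => ?_⟩
  obtain ⟨hqX, hqη⟩ := hq
  change ‖q‖ < _ at hqη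
  have hu := (abs_uCoord_le q).trans_lt hqη
  have hr : rad q < _ := (norm_fst_le q).trans_lt hqη
  have hq0 : 0 < rad q := hR.trans hR1
  -- Otherwise q is at the neck. Points over the graph region are excluded, since |u|^a < (η₁/2)
  -- r(p) and r(p) ≤ 2 r(q); for the others r = |u|^a ‖y‖ forces ‖y‖ ≤ 1/η₁.
  by_cases hcase : |uCoord q| ^ a < η₁ * rad q
  · exact (H₁ q hqX (hu.trans_le (min_le_left _ _)) (hr.trans_le (min_le_left _ _)) hcase R hR hR1
      hR2).mono (min_le_left _ _) hB₁ (le_max_left _ _)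
  · rw [not_lt] at hcase
    rcases id hqX with ⟨p, hp, hqp⟩ | ⟨y, u, hu0, -, hy, rfl⟩
    · exfalso
      change q = potGraph Φ g β a b χ p at hqp
      subst hqp
      have k1 := hgr p hp
      have k2 := norm_sub_norm_le p.fst (potGraph Φ g β a b χ p).fst
      rw [norm_sub_rev] at k2
      change rad p - rad (potGraph Φ g β a b χ p) ≤ _ at k2
      rw [potGraph_uCoord hS hp.1] at hu hcase
      have k3 := hpow _ _ (hu.trans_le ((min_le_right _ _).trans (min_le_right _ _)))
        (hS.norm_pos hp.1.1) hp.2.1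
      change _ < η₁ / 2 * rad p at k3
      nlinarith
    · rw [embX2_uCoord] at hu hcase
      have hs : 0 < |u| ^ a := pow_pos (abs_pos.2 hu0) a
      refine (H₂ y hy.1 ?_ u hu0 (hu.trans_le ((min_le_right _ _).trans (min_le_left _ _))) hqX R hR
        hR1 hR2).mono (min_le_right _ _) hB₂ (le_max_right _ _)
      rw [embX2_rad] at hcase
      rw [le_div_iff₀ hη₁]
      have : |u| ^ a * (‖y‖ * η₁) ≤ |u| ^ a * 1 := by linarith
      exact le_of_mul_le_mul_left this hs

end Estimates

end SLGeom

end

/-! ### Choice of the thresholds and conclusion -/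

theorem proposition4p13 {n : ℕ} (hn : 3 ≤ n)
    (S : Set (SLGeom.Cn n)) (hS : SLGeom.IsSpecialLagrangianLink S)
    (Φ : SLGeom.ConeLagrangianNbhd (SLGeom.puncturedCone S))
    (L : Set (SLGeom.Cn n)) (hL : SLGeom.IsSpecialLagrangian L) (hLclosed : IsClosed L)
    (hLconn : IsConnected L) (hL0 : (0 : SLGeom.Cn n) ∉ L)
    (Λ₀ μ : ℝ) (hΛ₀ : 0 < Λ₀) (hμ : μ < 0)
    (g : SLGeom.Cn n → ℝ) (hg : SLGeom.IsAsymptoticTo Φ L Λ₀ μ g)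
    (β : SLGeom.Cn n → ℝ) (hβ : SLGeom.IsLiouvillePotential L β)
    (a : ℕ) (ha : 1 < a) (b : ℝ) (hb : 1 < b) (hba : b < a)
    (χ : ℝ → ℝ) (hχ : ContDiff ℝ ∞ χ) (hχ1 : ∀ t ≤ 1, χ t = 1) (hχ2 : ∀ t, 2 ≤ t → χ t = 0)
    (K : ℕ) :
    ∃ A' > (0 : ℝ), ∀ A₁ ≥ A',
      SLGeom.GraphWellDefined Φ g β a b χ A₁ ∧
      ∀ ε > (0 : ℝ), ∃ A₀ ≥ A₁, ∀ A ≥ A₀,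
        (∃ Λ > (0 : ℝ),
          SLGeom.MetricCloseOn SLGeom.rad
            (SLGeom.cylinder (SLGeom.puncturedCone S))
            (SLGeom.approxSol Φ L Λ₀ g β a b χ A₁)
            (SLGeom.regionU (SLGeom.puncturedCone S) a Λ A) K ε ∧
          ∀ u₀ : ℝ, 0 < u₀ → u₀ < 1 →
            SLGeom.MetricCloseOn SLGeom.rad
              (SLGeom.modelS L a u₀)
              (SLGeom.approxSol Φ L Λ₀ g β a b χ A₁)
              (SLGeom.regionV L a u₀ Λ A) K ε) ∧
        SLGeom.HasBoundedGeometryOn SLGeom.rad (fun q => ‖q‖) (n + 1) K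
          (SLGeom.approxSol Φ L Λ₀ g β a b χ A₁) {q | ‖q‖ ∈ Set.Ioo 0 A⁻¹} := by
  obtain ⟨A', hA', H⟩ := SLGeom.exists_graphRegion_close (Φ := Φ) hS hΛ₀ hμ hg hβ ha hb hba hχ hχ2
  refine ⟨A', hA', fun A₁ hA₁ => ⟨fun p hp => (H A₁ hA₁ p hp).1, fun ε hε => ?_⟩⟩
  have hA₁' : 0 < A₁ := hA'.trans_le hA₁
  have hgr := fun p hp => (H A₁ hA₁ p hp).2
  obtain ⟨η₁, hη₁, H₁⟩ := SLGeom.exists_nearGood_conical hS hΛ₀ hμ hg hβ ha hb hba hχ hχ1 hχ2 hA₁'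
    hgr K hε
  -- With Λ = 1/η₁ the first region is exactly where |u|^a < η₁ r. The neck estimate holds for any
  -- Λ, so it can be taken for this one.
  obtain ⟨η₂, hη₂, H₂⟩ := SLGeom.exists_nearGood_neck (Λ := 1 / η₁) hS hL hLclosed hL0 hμ hg hβ ha
    hba hA₁' hgr K hε
  obtain ⟨η₃, hη₃, H₃⟩ := SLGeom.exists_boundedGeometry hS hΛ₀ hL hLclosed hL0 hμ hg hβ ha hb hba
    hχ hχ1 hχ2 hA₁' hgr K
  obtain ⟨d, hd, hdL⟩ : ∃ d > 0, ∀ y ∈ L, d ≤ ‖y‖ := by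
    obtain ⟨d, hd, h⟩ := Metric.eventually_nhds_iff_ball.1 (hLclosed.isOpen_compl.mem_nhds hL0)
    exact ⟨d, hd, fun y hy => not_lt.1 fun h' => h y (mem_ball_zero_iff.2 h') hy⟩
  -- The last entry controls u₀: points of u₀^a L × ℝ have r ≥ u₀^a d, so ρ < A⁻¹ forces u₀ < η₂,
  -- and for larger u₀ the region is empty.
  set η := min (min η₁ η₃) (η₂ ^ a * d)
  have hη : 0 < η := by positivity
  refine ⟨max A₁ η⁻¹, le_max_left _ _, fun A hA => ?_⟩
  have hAη : A⁻¹ ≤ η := inv_le_of_inv_le₀ hη ((le_max_right _ _).trans hA)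
  have hAη₁ : A⁻¹ ≤ η₁ := hAη.trans ((min_le_left _ _).trans (min_le_left _ _))
  have hAη₃ : A⁻¹ ≤ η₃ := hAη.trans ((min_le_left _ _).trans (min_le_right _ _))
  refine ⟨⟨1 / η₁, by positivity, ?_, fun u₀ h0 _ => ?_⟩, ?_⟩
  · refine SLGeom.metricCloseOn_of_nearGood fun p ⟨hp, hpΛ, hpA⟩ => ⟨hp, H₁ p hp ?_ ?_ ?_⟩
    · exact (SLGeom.abs_uCoord_le p).trans_lt (hpA.2.trans_le hAη₁)
    · exact (SLGeom.norm_fst_le p).trans_lt (hpA.2.trans_le hAη₁)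
    · rwa [one_div, inv_mul_lt_iff₀ hη₁] at hpΛ
  · refine SLGeom.metricCloseOn_of_nearGood fun p ⟨hp, hpΛ, hpu, hpA⟩ =>
      ⟨hp, H₂ u₀ h0 ?_ p hp hpΛ hpu⟩
    obtain ⟨⟨y, hy, hpy⟩, -⟩ := hp
    dsimp only at hpy
    have hs : 0 < u₀ ^ a := pow_pos h0 a
    have h1 : u₀ ^ a * d < η₂ ^ a * d :=
      calc u₀ ^ a * d ≤ u₀ ^ a * ‖y‖ := by gcongr; exact hdL y hy
        _ = ‖p.fst‖ := by rw [← hpy, norm_smul, Real.norm_of_nonneg hs.le]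
        _ ≤ ‖p‖ := SLGeom.norm_fst_le p
        _ < η₂ ^ a * d := hpA.2.trans_le (hAη.trans (min_le_right _ _))
    exact lt_of_pow_lt_pow_left₀ a hη₂.le (lt_of_mul_lt_mul_right h1 hd.le)
  · obtain ⟨δ, hδ, B, hB, h⟩ := H₃
    exact ⟨δ, hδ, B, hB, fun R hR S' hS' q hq => h R hR S' hS' q ⟨hq.1, hq.2.2.trans_le hAη₃⟩⟩
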